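/- A CNF formula $\varphi$ is a finite set of clauses, a clause being a finite set of literals that contains no complementary pair; $|\varphi|=\sum_{c\in\varphi}|\mathrm{var}(c)|$. The incidence graph of $\varphi$ has the variables and the clauses of $\varphi$ as vertices, a variable being adjacent to the clauses in which it occurs. For a variable $x$ and a value $\star\in\{+,-\}$, the formula $\varphi[x_\star]$ arises by deleting the clauses that contain the literal $x_\star$ and deleting the opposite literal from the others. Let $\mathscr C_0$ be the class of formulas all of whose clauses are empty. A strong recursive backdoor of $\varphi$ to $\mathscr C_0$ is a finite-depth rooted tree with root labelled $\varphi$, in which every leaf is labelled with a formula from $\mathscr C_0$; an inner node labelled with a formula $\psi$ with connected incidence graph branches over a variable $x$ of $\psi$ into $\psi[x_+]$ and $\psi[x_-]$; and an inner node labelled with a formula with disconnected incidence graph has one child for each connected component, labelled with the formula formed by the clauses in that component. Its depth is the maximal number of branching variables on a path from the root to a leaf, and $\mathrm{srbd}_{\mathscr C_0}(\varphi)$ is the minimal depth of a strong recursive backdoor of $\varphi$ to $\mathscr C_0$. **Corollary 5.11.** There is an algorithm that, given a formula $\varphi$ and a parameter $k\in\mathbb N$, in time $2^{2^{O(k)}}\cdot(|\varphi|+1)$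 either correctly decides whether $\varphi$ is satisfiable or correctly concludes that $\mathrm{srbd}_{\mathscr C_0}(\varphi)>k$. In particular, the permissive backdoor detection problem $\mathrm{SAT}(\mathrm{srbd}_{\mathscr C_0})$, which asks for exactly such an answer, is fixed-parameter tractable: it is solvable in time $f(k)\cdot(|\varphi|+1)^{c}$ for a computable function $f$ and a constant $c$. Here variables are natural numbers, $k$ and $\varphi$ are given as $k$ followed by the list of clauses (in any order) in an array, and the algorithm is one fixed program for a random access machine with unit-cost addition, subtraction, indirect addressing and comparison. In the first claim the numbers occurring in a run are at most $2^{2^{O(k)}}\cdot(|\varphi|+M+1)$, where $M$ is the largest variable name in $\varphi$ ($0$ if $\varphi$ has no variables); in the second they are at most $f(k)\cdot(|\varphi|+M+1)^c$. -/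

import Mathlib

namespace RecBackdoor

/-! ### Propositional formulas in conjunctive normal form -/

/-- A literal: a variable (a natural number) with a polarity (`true` for positive). -/
abbrev Literal := ℕ × Bool

/-- A clause is a finite set of literals. -/
abbrev Clause := Finset Literal

/-- A CNF formula is a finite set of clauses. -/
abbrev Formula := Finset Clause

/-- The variables of a clause. -/
def Clause.vars (c : Clause) : Finset ℕ := c.image Prod.fst

/-- The variables of a formula. -/
def Formula.vars (φ : Formula) : Finset ℕ := φ.biUnion Clause.vars

/-- The standing convention on formulas: no clause contains a complementary pair of literals. -/
def Formula.Proper (φ : Formula) : Prop :=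
  ∀ c ∈ φ, ∀ x : ℕ, ¬ ((x, true) ∈ c ∧ (x, false) ∈ c)

/-- The length `|φ|`: the sum of the widths of the clauses of `φ`. -/
def Formula.length (φ : Formula) : ℕ := ∑ c ∈ φ, (Clause.vars c).card

/-- The largest variable name that occurs in `φ` (`0` if there is none). -/
def Formula.maxVar (φ : Formula) : ℕ := (Formula.vars φ).sup id

/-- Some truth assignment satisfies every clause. -/
def Formula.Satisfiable (φ : Formula) : Prop :=
  ∃ τ : ℕ → Bool, ∀ c ∈ φ, ∃ l ∈ c, τ l.1 = l.2

/-- The formula `φ[x_b]`: assign the value `b` to `x`, that is, remove the clauses that contain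
the literal `(x, b)`, and remove the opposite literal from the remaining clauses. -/
def Formula.assign (φ : Formula) (x : ℕ) (b : Bool) : Formula :=
  (φ.filter (fun c => (x, b) ∉ c)).image (fun c => c.erase (x, !b))

/-- The class of formulas all of whose clauses have width at most `d`.  For `d = 0` these are the
formulas without variables: no clause at all, or just the empty clause. -/
def widthAtMost (d : ℕ) : Set Formula := {φ | ∀ c ∈ φ, (Clause.vars c).card ≤ d}

/-! ### Incidence graphs -/

/-- The vertices of the incidence graph of `φ`: its variables and its clauses. -/
def Formula.IsVertex (φ : Formula) : ℕ ⊕ Clause → Prop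
  | Sum.inl x => x ∈ Formula.vars φ
  | Sum.inr c => c ∈ φ

/-- The incidence graph of `φ`: a variable is adjacent to the clauses in which it occurs,
positively or negatively. -/
def Formula.incidenceGraph (φ : Formula) :
    SimpleGraph {v : ℕ ⊕ Clause // Formula.IsVertex φ v} :=
  SimpleGraph.fromRel (fun u v =>
    ∃ (x : ℕ) (c : Clause), u.1 = Sum.inl x ∧ v.1 = Sum.inr c ∧ x ∈ Clause.vars c)

open Classical in
/-- The formula formed by the clauses in a connected component `K` of the incidence graph. Its
incidence graph is the graph induced by `K`, since every variable of `φ` occurs in a clause. -/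
noncomputable def Formula.component (φ : Formula)
    (K : (Formula.incidenceGraph φ).ConnectedComponent) : Formula :=
  φ.filter (fun c => ∃ h : Formula.IsVertex φ (Sum.inr c),
    (Formula.incidenceGraph φ).connectedComponentMk ⟨Sum.inr c, h⟩ = K)

/-! ### Strong recursive backdoors -/

/-- Strong recursive backdoors of a formula to a class `𝒞`.  A leaf is labelled with a formula
from `𝒞`; an inner node labelled with a connected formula branches over the two values of one of
its variables; an inner node labelled with a disconnected formula has one child for every
connected component. -/
inductive SRB (𝒞 : Set Formula) : Formula → Type
  | leaf {φ : Formula} (h : φ ∈ 𝒞) : SRB 𝒞 φ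
  | branch {φ : Formula} (h : (Formula.incidenceGraph φ).Connected)
      (x : ℕ) (hx : x ∈ Formula.vars φ)
      (T : ∀ b : Bool, SRB 𝒞 (Formula.assign φ x b)) : SRB 𝒞 φ
  | split {φ : Formula} (h : ¬ (Formula.incidenceGraph φ).Connected)
      (T : ∀ K : (Formula.incidenceGraph φ).ConnectedComponent,
        SRB 𝒞 (Formula.component φ K)) : SRB 𝒞 φ

/-- The depth of a strong recursive backdoor: the maximal number of variable nodes on a path from
the root to a leaf. -/
noncomputable def SRB.depth {𝒞 : Set Formula} : {φ : Formula} → SRB 𝒞 φ → ℕ∞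
  | _, .leaf _ => 0
  | _, .branch _ _ _ T => 1 + ⨆ b : Bool, (T b).depth
  | _, .split _ T => ⨆ K, (T K).depth

/-- The strong recursive backdoor depth of `φ` to `𝒞`: the minimal depth of a strong recursive
backdoor of `φ` to `𝒞`. -/
noncomputable def srbd (𝒞 : Set Formula) (φ : Formula) : ℕ∞ := ⨅ T : SRB 𝒞 φ, T.depth

/-! ### Random access machines -/

/-- Tests on the contents of two registers. -/
inductive Test
  | lt (a b : ℕ)
  | eq (a b : ℕ)

/-- Programs of a random access machine with registers and an addressable memory, in structured
form.  Addition and truncated subtraction are the only arithmetical instructions. -/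
inductive Program
  | skip
  | const (r n : ℕ)             -- register `r` := the constant `n`
  | copy (r a : ℕ)              -- register `r` := register `a`
  | add (r a b : ℕ)             -- register `r` := register `a` + register `b`
  | sub (r a b : ℕ)             -- register `r` := register `a` - register `b`, or 0 if negative
  | load (r a : ℕ)              -- register `r` := the memory cell addressed by register `a`
  | store (a r : ℕ)             -- the memory cell addressed by register `a` := register `r`
  | seq (P Q : Program)
  | cond (c : Test) (P Q : Program)
  | loop (c : Test) (P : Program)  -- while `c` holds, do `P`

/-- The configuration of the machine: the contents of the registers and of the memory cells. -/
structure State where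
  reg : ℕ → ℕ
  mem : ℕ → ℕ

/-- Write `v` into register `r`. -/
def State.setReg (s : State) (r v : ℕ) : State := { s with reg := Function.update s.reg r v }

/-- Write `v` into the memory cell with address `a`. -/
def State.setMem (s : State) (a v : ℕ) : State := { s with mem := Function.update s.mem a v }

/-- The value of a test. -/
def Test.Holds (s : State) : Test → Prop
  | .lt a b => s.reg a < s.reg b
  | .eq a b => s.reg a = s.reg b

/-- `Exec W P s s' t`: on a machine whose words hold the numbers `0, …, W`, the program `P`, started
in the configuration `s`, halts in the configuration `s'` after exactly `t` steps.  Every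
instruction and every evaluation of a test is one step.  A computation that would produce a number
above `W` is not a legal run. -/
inductive Exec (W : ℕ) : Program → State → State → ℕ → Prop
  | skip (s : State) : Exec W .skip s s 1
  | const (s : State) (r n : ℕ) (h : n ≤ W) : Exec W (.const r n) s (s.setReg r n) 1
  | copy (s : State) (r a : ℕ) : Exec W (.copy r a) s (s.setReg r (s.reg a)) 1
  | add (s : State) (r a b : ℕ) (h : s.reg a + s.reg b ≤ W) :
      Exec W (.add r a b) s (s.setReg r (s.reg a + s.reg b)) 1
  | sub (s : State) (r a b : ℕ) : Exec W (.sub r a b) s (s.setReg r (s.reg a - s.reg b)) 1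
  | load (s : State) (r a : ℕ) : Exec W (.load r a) s (s.setReg r (s.mem (s.reg a))) 1
  | store (s : State) (a r : ℕ) : Exec W (.store a r) s (s.setMem (s.reg a) (s.reg r)) 1
  | seq {P Q : Program} {s s' s'' : State} {t t' : ℕ} (hP : Exec W P s s' t)
      (hQ : Exec W Q s' s'' t') : Exec W (.seq P Q) s s'' (t + t')
  | condTrue {c : Test} {P Q : Program} {s s' : State} {t : ℕ} (hc : c.Holds s)
      (hP : Exec W P s s' t) : Exec W (.cond c P Q) s s' (1 + t)
  | condFalse {c : Test} {P Q : Program} {s s' : State} {t : ℕ} (hc : ¬ c.Holds s)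
      (hQ : Exec W Q s s' t) : Exec W (.cond c P Q) s s' (1 + t)
  | loopDone {c : Test} {P : Program} {s : State} (hc : ¬ c.Holds s) :
      Exec W (.loop c P) s s 1
  | loopStep {c : Test} {P : Program} {s s' s'' : State} {t t' : ℕ} (hc : c.Holds s)
      (hP : Exec W P s s' t) (hL : Exec W (.loop c P) s' s'' t') :
      Exec W (.loop c P) s s'' (1 + t + t')

/-! ### Inputs and outputs -/

/-- `L` lists the clauses of `φ`, each as a list of its literals, in any order and without
repetitions. -/
def Lists (L : List (List Literal)) (φ : Formula) : Prop :=
  (∀ C ∈ L, C.Nodup) ∧ (L.map List.toFinset).Nodup ∧ (L.map List.toFinset).toFinset = φ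

/-- The input words for the parameter `k` and the formula listed by `L`: `k`, the number of
clauses, and then for every clause its number of literals followed by the literals, two words each
(the variable; `1` for positive and `0` for negative). -/
def inputWords (k : ℕ) (L : List (List Literal)) : List ℕ :=
  k :: L.length ::
    L.flatMap (fun C => C.length :: C.flatMap (fun l => [l.1, l.2.toNat]))

/-- The initial configuration: the input is in the memory from address `0` on, and everything else
is `0`. -/
def initialState (w : List ℕ) : State where
  reg := fun _ => 0
  mem := fun i => w.getD i 0

/-- The possible answers of an algorithm for permissive backdoor detection. -/
inductive Answer
  | unsat
  | sat
  | exceeds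

/-- The number by which an answer is returned. -/
def Answer.code : Answer → ℕ
  | .unsat => 0
  | .sat => 1
  | .exceeds => 2

/-- The answers that are true for `φ` and `k` in the permissive backdoor detection problem of the
measure `μ`: decide the satisfiability of `φ`, or conclude `μ(φ) > k`. -/
def Answer.IsCorrect (μ : Formula → ℕ∞) (φ : Formula) (k : ℕ) : Answer → Prop
  | .unsat => ¬ Formula.Satisfiable φ
  | .sat => Formula.Satisfiable φ
  | .exceeds => (k : ℕ∞) < μ φ

/-- On all inputs `φ`, `k`, the program `P` solves the permissive backdoor detection problem of
the measure `μ` in at most `time φ k` steps on words that hold the numbers up to `word φ k`.  The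
answer is in register `0` at the end. -/
def SolvesPermissive (P : Program) (μ : Formula → ℕ∞) (time word : Formula → ℕ → ℕ) : Prop :=
  ∀ (φ : Formula) (k : ℕ) (L : List (List Literal)), Formula.Proper φ → Lists L φ →
    (∀ v ∈ inputWords k L, v ≤ word φ k) ∧
    ∃ (s : State) (t : ℕ) (a : Answer),
      Exec (word φ k) P (initialState (inputWords k L)) s t ∧
      t ≤ time φ k ∧ s.reg 0 = a.code ∧ a.IsCorrect μ φ k

/-- The permissive backdoor detection problem of `μ` is fixed-parameter tractable: it is solved in
time `f(k) · n ^ c` for a computable function `f` and a constant `c`, on words of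
`O(log n) + log f(k)` bits that can hold the names of the variables. -/
def PermissiveIsFPT (μ : Formula → ℕ∞) : Prop :=
  ∃ (f : ℕ → ℕ) (c : ℕ) (P : Program), Computable f ∧
    SolvesPermissive P μ
      (fun φ k => f k * (Formula.length φ + 1) ^ c)
      (fun φ k => f k * (Formula.length φ + Formula.maxVar φ + 1) ^ c)

end RecBackdoor

/-! Lower bounds come from certificates. Under a partial assignment `τ` (value `2` for a free
variable), a set of clauses is `Hard (n + 1)` if it contains a nonempty connected set of unsatisfied
clauses such that every variable occurring freely in that subset has a value after which the subset
is still `Hard n`. A certificate survives in every backdoor: a branching over one of its variables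
follows the bad value and costs one level, any other branching leaves the clauses alone, and a split
keeps them inside one component (`SRB.le_depth`). Two sources are direct: a clause of width `n`
(`Hard.of_wide`), and two linked variables at distance more than `2 ^ (n + 1) - 2`
(`Hard.of_far_part`). So a clause wider than `k` or a component of too large diameter allows the
answer "exceeds" at once.

The algorithm is a recursion over levels. A call at level `j` declares every component of the
unsatisfied clauses satisfiable, unsatisfiable or open; for an open one it returns an obstruction, a
set of clauses that is `Hard j` and whose size depends on `k` only. At level `0` everything is open.
At level `j + 1` a component starts with a single candidate variable, its root, and the values of
the candidates are handed to level `j`. One satisfiable value or two unsatisfiable ones decide the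
component; otherwise the candidate has a value with an obstruction. The variables of the
obstructions found for the root become candidates too. When the candidates are exhausted, the
collected obstructions, closed under the parent clauses of a search forest of depth at most `D` and
thereby connected, are `Hard (j + 1)`: a candidate has its own bad value, and a variable that is not
a candidate does not occur in the obstruction of the root, which therefore stays hard when that
variable is assigned and the root is freed again (`Hard.mono`, `Dyn.spec`). A component that is open
at level `k + 1` shows that the depth exceeds `k`.

In each round one variable is selected in every component simultaneously, followed by a single call.
Hence the number of steps (`iters`) does not depend on the number of components, and a step takes at
most about `D = 2 ^ (k + 2)` times constantly many passes over the input. The size of the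
obstructions roughly squares from level to level, starting from `(k + 1) ^ D`, which gives the
doubly exponential factor (`obsSize_le`, `dexp_iters`).

For the machine, the algorithm is written in an array language without arithmetic, compiled with a
proof of simulation. The rows have an entry for every variable name up to the largest one, but they
are filled along the occurrences in the input and never swept; so the largest name affects the word
size and not the time. -/

namespace RecBackdoor

/-! ### A small array language -/

/-- The state of the array language: a recursion level, registers, and arrays of rows, one row for
every level. -/
@[ext] structure HS where
  lev : ℕ
  reg : ℕ → ℕ
  arr : Fin 32 → ℕ → ℕ → ℕ

/-- An event of a pass over the input: the index of a clause, and two further numbers. -/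
abbrev Ev := ℕ × ℕ × ℕ

/-- Expressions.  An access to an array goes to the row of the current level, or (if `ch`) to the
row of the level below. -/
inductive E
  | c (n : Fin 8)
  | ci
  | cv
  | cs
  | reg (r : ℕ)
  | arr (a : Fin 32) (ch : Bool) (x : E)
  | eq (a b : E)
  | lt (a b : E)
  | and (a b : E)
  | top
  | bot

/-- The level addressed by an array access. -/
def HS.lv (σ : HS) (ch : Bool) : ℕ := if ch then σ.lev - 1 else σ.lev

/-- The value of an expression, for rows of size `S` and the highest level `LM`. -/
def E.eval (S LM : ℕ) (e : Ev) (σ : HS) : E → ℕ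
  | c n => n
  | ci => e.1
  | cv => e.2.1
  | cs => e.2.2
  | reg r => σ.reg r
  | arr a ch x => if x.eval S LM e σ < S then σ.arr a (σ.lv ch) (x.eval S LM e σ) else 0
  | eq a b => if a.eval S LM e σ = b.eval S LM e σ then 1 else 0
  | lt a b => if a.eval S LM e σ < b.eval S LM e σ then 1 else 0
  | and a b => if a.eval S LM e σ ≠ 0 ∧ b.eval S LM e σ ≠ 0 then 1 else 0
  | top => if σ.lev = LM then 1 else 0
  | bot => if σ.lev = 0 then 1 else 0

/-- Replace a row. -/
def HS.setA (σ : HS) (a : Fin 32) (l : ℕ) (f : ℕ → ℕ) : HS :=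
  { σ with arr := Function.update σ.arr a (Function.update (σ.arr a) l f) }

/-- Replace the contents of a register. -/
def HS.setR (σ : HS) (r v : ℕ) : HS := { σ with reg := Function.update σ.reg r v }

/-- Loop-free commands. -/
inductive C
  | skip
  | put (a : Fin 32) (ch : Bool) (x v : E)
  | set (r : ℕ) (v : E)
  | seq (P Q : C)
  | ite (g : E) (P Q : C)

/-- The effect of a loop-free command; writing outside of a row has no effect. -/
def C.run (S LM : ℕ) (e : Ev) : C → HS → HS
  | skip, σ => σ
  | put a ch x v, σ =>
      if x.eval S LM e σ < S then
        σ.setA a (σ.lv ch)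
          (Function.update (σ.arr a (σ.lv ch)) (x.eval S LM e σ) (v.eval S LM e σ))
      else σ
  | set r v, σ => σ.setR r (v.eval S LM e σ)
  | seq P Q, σ => Q.run S LM e (P.run S LM e σ)
  | ite g P Q, σ => if g.eval S LM e σ ≠ 0 then P.run S LM e σ else Q.run S LM e σ

-- Compilation of the array language to the machine.

infixr:60 " ;; " => Program.seq

/-- The code that turns the index in register `2 * d + 1` into the address of the row entry. -/
def addrCode (a : Fin 32) (ch : Bool) (d : ℕ) : Program :=
  .add (2 * d + 1) (2 * d + 1) (if ch then 8 else 6) ;;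
    .add (2 * d + 1) (2 * d + 1) (2 * d + 1) ;; .add (2 * d + 1) (2 * d + 1) (2 * d + 1) ;;
    .add (2 * d + 1) (2 * d + 1) (2 * d + 1) ;; .add (2 * d + 1) (2 * d + 1) (2 * d + 1) ;;
    .add (2 * d + 1) (2 * d + 1) (2 * d + 1) ;; .const (2 * (d + 1) + 1) a ;;
    .add (2 * d + 1) (2 * d + 1) (2 * (d + 1) + 1) ;; .add (2 * d + 1) (2 * d + 1) 2

/-- The code that evaluates an expression into the scratch register `2 * d + 1`. -/
def E.code : E → ℕ → Program
  | c n, d => .const (2 * d + 1) n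
  | ci, d => .copy (2 * d + 1) 30
  | cv, d => .copy (2 * d + 1) 32
  | cs, d => .copy (2 * d + 1) 34
  | reg r, d => .copy (2 * d + 1) (40 + 2 * r)
  | arr a ch x, d =>
      x.code d ;; .cond (.lt (2 * d + 1) 4)
        (addrCode a ch d ;; .load (2 * d + 1) (2 * d + 1))
        (.const (2 * d + 1) 0)
  | eq a b, d => a.code d ;; b.code (d + 1) ;;
      .cond (.eq (2 * d + 1) (2 * (d + 1) + 1)) (.const (2 * d + 1) 1) (.const (2 * d + 1) 0)
  | lt a b, d => a.code d ;; b.code (d + 1) ;;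
      .cond (.lt (2 * d + 1) (2 * (d + 1) + 1)) (.const (2 * d + 1) 1) (.const (2 * d + 1) 0)
  | and a b, d => a.code d ;; b.code (d + 1) ;;
      .cond (.eq (2 * d + 1) 26) (.const (2 * d + 1) 0)
        (.cond (.eq (2 * (d + 1) + 1) 26) (.const (2 * d + 1) 0) (.const (2 * d + 1) 1))
  | top, d => .cond (.eq 10 28) (.const (2 * d + 1) 1) (.const (2 * d + 1) 0)
  | bot, d => .cond (.eq 10 26) (.const (2 * d + 1) 1) (.const (2 * d + 1) 0)

/-- A bound on the number of steps of the evaluation. -/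
def E.cost : E → ℕ
  | c _ | ci | cv | cs | reg _ => 1
  | arr _ _ x => x.cost + 11
  | eq a b | lt a b | and a b => a.cost + b.cost + 3
  | top | bot => 2

/-- The code of a loop-free command. -/
def C.code : C → Program
  | skip => .skip
  | put a ch x v =>
      v.code 0 ;; x.code 1 ;; .cond (.lt 3 4)
        (addrCode a ch 1 ;; .store 3 1)
        .skip
  | set r v => v.code 0 ;; .copy (40 + 2 * r) 1
  | seq P Q => P.code ;; Q.code
  | ite g P Q => g.code 0 ;; .cond (.eq 1 26) Q.code P.code

/-- A bound on the number of steps of a loop-free command. -/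
def C.cost : C → ℕ
  | skip => 1
  | put _ _ x v => v.cost + x.cost + 11
  | set _ v => v.cost + 1
  | seq P Q => P.cost + Q.cost
  | ite g P Q => g.cost + 1 + P.cost + Q.cost

/-- The parameters of the layout of the memory. -/
structure Layout where
  /-- the input -/
  w : List ℕ
  /-- the first address behind the input -/
  N0 : ℕ
  /-- the size of the rows -/
  S : ℕ
  /-- a bound on all values -/
  B : ℕ
  /-- the number of rounds of a repetition -/
  D : ℕ
  /-- the highest level -/
  LM : ℕ
  /-- the largest number in a word -/
  W : ℕ
  hB : 8 ≤ B
  hW : N0 + 32 * B + 32 ≤ W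
  hS : (LM + 1) * S ≤ B
  hN : S = 0 ∨ w.length ≤ N0
  hw : ∀ x ∈ w, x ≤ B
  hlen : w.length ≤ W
  hLM : LM ≤ B

/-- The address of an entry of a row. -/
def Layout.addr (X : Layout) (a : Fin 32) (l x : ℕ) : ℕ := X.N0 + (32 * (l * X.S + x) + a)

/-- The machine configuration `s` represents the state `σ`. -/
structure Rep (X : Layout) (σ : HS) (s : State) : Prop where
  n0 : s.reg 2 = X.N0
  sz : s.reg 4 = X.S
  cur : s.reg 6 = σ.lev * X.S
  chi : s.reg 8 = (σ.lev - 1) * X.S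
  lev : s.reg 10 = σ.lev
  num : s.reg 12 = X.w.getD 1 0
  one : s.reg 20 = 1
  rnd : s.reg 22 = X.D
  zero : s.reg 26 = 0
  lm : s.reg 28 = X.LM
  reg : ∀ r, s.reg (40 + 2 * r) = σ.reg r
  inp : ∀ i < X.w.length, s.mem i = X.w.getD i 0
  arr : ∀ a l x, x < X.S → s.mem (X.addr a l x) = σ.arr a l x
  levle : σ.lev ≤ X.LM
  regle : ∀ r, σ.reg r ≤ X.B
  arrle : ∀ a l x, x < X.S → σ.arr a l x ≤ X.B

/-- The machine holds the event `e`. -/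
structure RepE (X : Layout) (e : Ev) (σ : HS) (s : State) : Prop extends Rep X σ s where
  ei : s.reg 30 = e.1
  ev : s.reg 32 = e.2.1
  es : s.reg 34 = e.2.2
  eile : e.1 ≤ X.B
  evle : e.2.1 ≤ X.B
  esle : e.2.2 ≤ X.B

/-- The language has no arithmetic: a value is a small constant, a part of the event, or something
stored before. Hence a bound `B` fixed in advance covers the whole run, and only addresses need
larger words. -/
theorem RepE.eval_le {X : Layout} {e : Ev} {σ : HS} {s : State} (h : RepE X e σ s) (x : E) :
    x.eval X.S X.LM e σ ≤ X.B := by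
  have := X.hB
  cases x <;> simp only [E.eval]
  case c n => omega
  case ci => exact h.eile
  case cv => exact h.evle
  case cs => exact h.esle
  case reg r => exact h.regle r
  case arr a ch x =>
    split_ifs with hx
    · exact h.arrle _ _ _ hx
    · omega
  all_goals split_ifs <;> omega

theorem Layout.row_le (X : Layout) {l x : ℕ} (hl : l ≤ X.LM) (hx : x < X.S) :
    l * X.S + x ≤ X.B := by
  have := X.hS
  have : l * X.S ≤ X.LM * X.S := Nat.mul_le_mul_right _ hl
  nlinarith

/-- The arrays are interleaved with stride `32`: the remainder of an address gives the array and the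
quotient gives `l * S + x`, from which `x < S` recovers level and index. -/
theorem Layout.addr_inj (X : Layout) {a b : Fin 32} {l m x y : ℕ} (hx : x < X.S) (hy : y < X.S)
    (h : X.addr a l x = X.addr b m y) : a = b ∧ l = m ∧ x = y := by
  unfold Layout.addr at h
  have h1 : (a : ℕ) = b ∧ l * X.S + x = m * X.S + y := by omega
  obtain ⟨h1, h2⟩ := h1
  refine ⟨Fin.ext h1, ?_⟩
  have e1 : (l * X.S + x) / X.S = l := by
    rw [mul_comm, Nat.mul_add_div (by omega), Nat.div_eq_of_lt hx, add_zero]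
  have e2 : (m * X.S + y) / X.S = m := by
    rw [mul_comm, Nat.mul_add_div (by omega), Nat.div_eq_of_lt hy, add_zero]
  have : l = m := by rw [← e1, ← e2, h2]
  subst this
  exact ⟨rfl, by omega⟩

/-- The registers that an evaluation into scratch register `2 * d + 1` may not touch agree. -/
def SameBelow (d : ℕ) (s s' : State) : Prop :=
  s'.mem = s.mem ∧ (∀ r, s'.reg (2 * r) = s.reg (2 * r)) ∧
    ∀ d' < d, s'.reg (2 * d' + 1) = s.reg (2 * d' + 1)

theorem SameBelow.refl (d : ℕ) (s : State) : SameBelow d s s := ⟨rfl, fun _ => rfl, fun _ _ => rfl⟩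

theorem SameBelow.trans {d : ℕ} {s s' s'' : State} (h : SameBelow d s s')
    (h' : SameBelow d s' s'') : SameBelow d s s'' :=
  ⟨h'.1.trans h.1, fun r => (h'.2.1 r).trans (h.2.1 r),
    fun d' hd => (h'.2.2 d' hd).trans (h.2.2 d' hd)⟩

theorem SameBelow.mono {d d' : ℕ} {s s' : State} (hd : d' ≤ d) (h : SameBelow d s s') :
    SameBelow d' s s' := ⟨h.1, h.2.1, fun x hx => h.2.2 x (by omega)⟩

theorem SameBelow.setReg {d d' : ℕ} (hd : d ≤ d') (s : State) (v : ℕ) :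
    SameBelow d s (s.setReg (2 * d' + 1) v) := by
  refine ⟨rfl, fun r => ?_, fun r hr => ?_⟩ <;>
    exact Function.update_of_ne (by omega) _ _

theorem SameBelow.even {d : ℕ} {s s' : State} (h : SameBelow d s s') {r : ℕ} (hr : Even r) :
    s'.reg r = s.reg r := by
  obtain ⟨m, rfl⟩ := hr
  have := h.2.1 m
  rwa [two_mul] at this

/-- The represented state occupies the memory and even registers only, so scratch work in odd
registers cannot disturb it. -/
theorem Rep.same {X : Layout} {σ : HS} {s s' : State} {d : ℕ} (h : Rep X σ s)
    (h' : SameBelow d s s') : Rep X σ s' where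
  n0 := (h'.even (by decide)).trans h.n0
  sz := (h'.even (by decide)).trans h.sz
  cur := (h'.even (by decide)).trans h.cur
  chi := (h'.even (by decide)).trans h.chi
  lev := (h'.even (by decide)).trans h.lev
  num := (h'.even (by decide)).trans h.num
  one := (h'.even (by decide)).trans h.one
  rnd := (h'.even (by decide)).trans h.rnd
  zero := (h'.even (by decide)).trans h.zero
  lm := (h'.even (by decide)).trans h.lm
  reg r := (h'.even ⟨20 + r, by ring⟩).trans (h.reg r)
  inp i hi := by rw [h'.1]; exact h.inp i hi
  arr a l x hx := by rw [h'.1]; exact h.arr a l x hx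
  levle := h.levle
  regle := h.regle
  arrle := h.arrle

theorem RepE.same {X : Layout} {e : Ev} {σ : HS} {s s' : State} {d : ℕ} (h : RepE X e σ s)
    (h' : SameBelow d s s') : RepE X e σ s' where
  toRep := h.toRep.same h'
  ei := (h'.even (by decide)).trans h.ei
  ev := (h'.even (by decide)).trans h.ev
  es := (h'.even (by decide)).trans h.es
  eile := h.eile
  evle := h.evle
  esle := h.esle

@[simp] theorem State.reg_setReg (s : State) (r v r' : ℕ) :
    (s.setReg r v).reg r' = if r' = r then v else s.reg r' := by
  simp [State.setReg, Function.update_apply]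

@[simp] theorem State.mem_setReg (s : State) (r v : ℕ) : (s.setReg r v).mem = s.mem := rfl

@[simp] theorem State.reg_setMem (s : State) (a v : ℕ) : (s.setMem a v).reg = s.reg := rfl

@[simp] theorem State.mem_setMem (s : State) (a v x : ℕ) :
    (s.setMem a v).mem x = if x = a then v else s.mem x := by
  simp [State.setMem, Function.update_apply]

theorem Exec.seq' {W : ℕ} {P Q : Program} {s s' s'' : State} {t t' u : ℕ} (hP : Exec W P s s' t)
    (hQ : Exec W Q s' s'' t') (hu : u = t + t') : Exec W (P ;; Q) s s'' u := by
  subst hu; exact .seq hP hQ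

/-- Without multiplication, the factor `32` is made by five doublings. All intermediate values stay
below `N0 + 32 * B + 32`, which is what `hW` provides. -/
theorem exec_addrCode (X : Layout) (d : ℕ) (a : Fin 32) (ch : Bool) (s : State) (σ : HS)
    (h : Rep X σ s) (hx : s.reg (2 * d + 1) < X.S) :
    ∃ s', Exec X.W (addrCode a ch d) s s' 9 ∧ SameBelow d s s' ∧
      s'.reg (2 * d + 1) = X.addr a (σ.lv ch) (s.reg (2 * d + 1)) := by
  set x := s.reg (2 * d + 1) with hxd
  set y := σ.lv ch * X.S + x with hy
  have hl : σ.lv ch ≤ X.LM := by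
    have := h.levle
    unfold HS.lv; split_ifs <;> omega
  have hyB : y ≤ X.B := X.row_le hl hx
  have hW := X.hW
  have ha := a.2
  have hbase : s.reg (if ch then 8 else 6) = σ.lv ch * X.S := by
    unfold HS.lv; split_ifs
    · exact h.chi
    · exact h.cur
  have key : ∀ (u : State) (v : ℕ), SameBelow d s u → SameBelow d s (u.setReg (2 * d + 1) v) :=
    fun u v hu => hu.trans (SameBelow.setReg le_rfl u v)
  have dbl : ∀ (u : State) (n : ℕ), SameBelow d s u → u.reg (2 * d + 1) = n → n + n ≤ X.W →
      ∃ u', Exec X.W (.add (2 * d + 1) (2 * d + 1) (2 * d + 1)) u u' 1 ∧ SameBelow d s u' ∧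
        u'.reg (2 * d + 1) = n + n := by
    intro u n hu hn hW
    exact ⟨_, .add u _ _ _ (by rw [hn]; exact hW), key u _ hu, by simp [hn]⟩
  have h1 : Exec X.W (.add (2 * d + 1) (2 * d + 1) (if ch then 8 else 6)) s
      (s.setReg (2 * d + 1) y) 1 := by
    have : s.reg (2 * d + 1) + s.reg (if ch then 8 else 6) = y := by rw [hbase, ← hxd, hy]; ring
    rw [← this]
    exact .add s _ _ _ (by rw [this]; omega)
  obtain ⟨u1, e1, k1, v1⟩ := dbl _ y (key s y (.refl d s)) (by simp) (by omega)
  obtain ⟨u2, e2, k2, v2⟩ := dbl _ _ k1 v1 (by omega)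
  obtain ⟨u3, e3, k3, v3⟩ := dbl _ _ k2 v2 (by omega)
  obtain ⟨u4, e4, k4, v4⟩ := dbl _ _ k3 v3 (by omega)
  obtain ⟨u5, e5, k5, v5⟩ := dbl _ _ k4 v4 (by omega)
  have k6 : SameBelow d s (u5.setReg (2 * (d + 1) + 1) a) :=
    k5.trans (SameBelow.setReg (by omega) _ _)
  have n0 : s.reg 2 = X.N0 := h.n0
  have k7 := key _ (32 * y + a) k6
  refine ⟨(((u5.setReg (2 * (d + 1) + 1) a).setReg (2 * d + 1) (32 * y + a)).setReg (2 * d + 1)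
    (32 * y + a + X.N0)), ?_, key _ _ k7, ?_⟩
  · refine (h1.seq' (e1.seq' (e2.seq' (e3.seq' (e4.seq' (e5.seq' (Exec.seq' (t := 1) (t' := 2)
      (.const _ _ _ (by omega)) (Exec.seq' (t := 1) (t' := 1)
      (s' := (u5.setReg (2 * (d + 1) + 1) a).setReg (2 * d + 1) (32 * y + a)) ?_ ?_ rfl) rfl) rfl) rfl) rfl) rfl)
      rfl) rfl)
    · have : (u5.setReg (2 * (d + 1) + 1) a).reg (2 * d + 1) +
          (u5.setReg (2 * (d + 1) + 1) a).reg (2 * (d + 1) + 1) = 32 * y + a := by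
        simp [v5]; ring
      rw [← this]
      exact .add _ _ _ _ (by rw [this]; omega)
    · have : ((u5.setReg (2 * (d + 1) + 1) a).setReg (2 * d + 1) (32 * y + a)).reg (2 * d + 1) +
          ((u5.setReg (2 * (d + 1) + 1) a).setReg (2 * d + 1) (32 * y + a)).reg 2
            = 32 * y + a + X.N0 := by
        rw [k7.even (r := 2) (by decide), n0]; simp
      rw [← this]
      exact .add _ _ _ _ (by rw [this]; omega)
  · simp [Layout.addr, hy]; ring

theorem exec_bool {W : ℕ} (hW : 1 ≤ W) (r n m : ℕ) (c : Test) (s : State)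
    (hn : n ≤ 1) (hm : m ≤ 1) [Decidable (c.Holds s)] :
    Exec W (.cond c (.const r n) (.const r m)) s (s.setReg r (if c.Holds s then n else m)) 2 := by
  split_ifs with h
  · exact .condTrue (t := 1) h (.const _ _ _ (by omega))
  · exact .condFalse (t := 1) h (.const _ _ _ (by omega))

/-- The odd registers form an evaluation stack: an evaluation at depth `d` leaves all scratch
registers below `2 * d + 1` alone, so the second operand, evaluated at depth `d + 1`, preserves the
first. -/
theorem exec_E (X : Layout) (e : Ev) (σ : HS) (x : E) : ∀ (d : ℕ) (s : State), RepE X e σ s →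
    ∃ s' t, Exec X.W (x.code d) s s' t ∧ t ≤ x.cost ∧ SameBelow d s s' ∧
      s'.reg (2 * d + 1) = x.eval X.S X.LM e σ := by
  have hW := X.hW
  have hB := X.hB
  have h1W : 1 ≤ X.W := by omega
  classical
  -- The common part of the three binary operators: `Q` combines the two operands within three
  -- steps.
  have two : ∀ (a b : E) (d : ℕ) (s : State),
      (∀ (d : ℕ) (s : State), RepE X e σ s →
        ∃ s' t, Exec X.W (a.code d) s s' t ∧ t ≤ a.cost ∧ SameBelow d s s' ∧
          s'.reg (2 * d + 1) = a.eval X.S X.LM e σ) →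
      (∀ (d : ℕ) (s : State), RepE X e σ s →
        ∃ s' t, Exec X.W (b.code d) s s' t ∧ t ≤ b.cost ∧ SameBelow d s s' ∧
          s'.reg (2 * d + 1) = b.eval X.S X.LM e σ) → RepE X e σ s → ∀ (Q : Program) (v : ℕ),
      (∀ u : State, u.reg (2 * d + 1) = a.eval X.S X.LM e σ →
        u.reg (2 * (d + 1) + 1) = b.eval X.S X.LM e σ → RepE X e σ u →
        ∃ t, t ≤ 3 ∧ Exec X.W Q u (u.setReg (2 * d + 1) v) t) →
      ∃ s' t, Exec X.W (a.code d ;; b.code (d + 1) ;; Q) s s' t ∧ t ≤ a.cost + b.cost + 3 ∧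
        SameBelow d s s' ∧ s'.reg (2 * d + 1) = v := by
    intro a b d s iha ihb hs Q v hQ
    obtain ⟨s1, t1, x1, l1, k1, v1⟩ := iha d s hs
    have hs1 := hs.same k1
    obtain ⟨s2, t2, x2, l2, k2, v2⟩ := ihb (d + 1) s1 hs1
    have hs2 := hs1.same k2
    obtain ⟨t3, l3, x3⟩ := hQ s2 ((k2.2.2 d (by omega)).trans v1) v2 hs2
    refine ⟨_, _, x1.seq (x2.seq x3), by omega, (k1.trans (k2.mono (by omega))).trans
      (SameBelow.setReg le_rfl _ _), by simp⟩
  induction x with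
  | c n =>
    intro d s hs
    exact ⟨_, 1, .const _ _ _ (by omega), le_rfl, SameBelow.setReg le_rfl _ _, by simp [E.eval]⟩
  | ci =>
    intro d s hs
    exact ⟨_, 1, .copy _ _ _, le_rfl, SameBelow.setReg le_rfl _ _, by simp [E.eval, hs.ei]⟩
  | cv =>
    intro d s hs
    exact ⟨_, 1, .copy _ _ _, le_rfl, SameBelow.setReg le_rfl _ _, by simp [E.eval, hs.ev]⟩
  | cs =>
    intro d s hs
    exact ⟨_, 1, .copy _ _ _, le_rfl, SameBelow.setReg le_rfl _ _, by simp [E.eval, hs.es]⟩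
  | reg r =>
    intro d s hs
    exact ⟨_, 1, .copy _ _ _, le_rfl, SameBelow.setReg le_rfl _ _, by simp [E.eval, hs.reg]⟩
  | arr a ch x ih =>
    intro d s hs
    obtain ⟨s1, t1, x1, l1, k1, v1⟩ := ih d s hs
    have hs1 := hs.same k1
    by_cases hlt : x.eval X.S X.LM e σ < X.S
    · obtain ⟨s2, x2, k2, v2⟩ := exec_addrCode X d a ch s1 σ hs1.toRep (by rw [v1]; exact hlt)
      have hs2 := hs1.same k2
      refine ⟨s2.setReg (2 * d + 1) (s2.mem (s2.reg (2 * d + 1))), _,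
        x1.seq (.condTrue (by simp only [Test.Holds]; rw [v1, hs1.sz]; exact hlt)
          (x2.seq (.load _ _ _))), by simp only [E.cost]; omega,
        (k1.trans k2).trans (SameBelow.setReg le_rfl _ _), ?_⟩
      simp only [State.reg_setReg, if_true, E.eval, if_pos hlt]
      rw [v2, v1, hs2.arr _ _ _ hlt]
    · refine ⟨_, _, x1.seq (.condFalse (by simp only [Test.Holds]; rw [v1, hs1.sz]; exact hlt)
          (.const _ _ _ (by omega))), by simp only [E.cost]; omega,
        k1.trans (SameBelow.setReg le_rfl _ _), ?_⟩
      simp [E.eval, if_neg hlt]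
  | eq a b iha ihb =>
    intro d s hs
    refine two a b d s iha ihb hs _ _ fun u h1 h2 hu => ⟨2, by omega, ?_⟩
    have := exec_bool h1W (2 * d + 1) 1 0 (.eq (2 * d + 1) (2 * (d + 1) + 1)) u le_rfl (by omega)
    convert this using 2
    simp only [Test.Holds, h1, h2, E.eval]
  | lt a b iha ihb =>
    intro d s hs
    refine two a b d s iha ihb hs _ _ fun u h1 h2 hu => ⟨2, by omega, ?_⟩
    have := exec_bool h1W (2 * d + 1) 1 0 (.lt (2 * d + 1) (2 * (d + 1) + 1)) u le_rfl (by omega)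
    convert this using 2
    simp only [Test.Holds, h1, h2, E.eval]
  | and a b iha ihb =>
    intro d s hs
    refine two a b d s iha ihb hs _ _ fun u h1 h2 hu => ?_
    by_cases ha : a.eval X.S X.LM e σ = 0
    · refine ⟨2, by omega, .condTrue (t := 1) (by simp only [Test.Holds, h1, hu.zero, ha]) ?_⟩
      simp only [E.eval, ha, ne_eq, not_true, false_and, if_false]
      exact .const _ _ _ (by omega)
    · refine ⟨3, by omega, .condFalse (t := 2) (by simp only [Test.Holds, h1, hu.zero, ha,
        not_false_iff]) ?_⟩
      have := exec_bool h1W (2 * d + 1) 0 1 (.eq (2 * (d + 1) + 1) 26) u (by omega) le_rfl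
      convert this using 2
      simp only [Test.Holds, h2, hu.zero, E.eval, ne_eq, ha, not_false_iff, true_and, ite_not]
  | top =>
    intro d s hs
    refine ⟨_, 2, exec_bool h1W (2 * d + 1) 1 0 (.eq 10 28) s le_rfl (by omega), le_rfl,
      SameBelow.setReg le_rfl _ _, ?_⟩
    simp only [State.reg_setReg, if_true, Test.Holds, hs.lev, hs.lm, E.eval]
  | bot =>
    intro d s hs
    refine ⟨_, 2, exec_bool h1W (2 * d + 1) 1 0 (.eq 10 26) s le_rfl (by omega), le_rfl,
      SameBelow.setReg le_rfl _ _, ?_⟩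
    simp only [State.reg_setReg, if_true, Test.Holds, hs.lev, hs.zero, E.eval]

end RecBackdoor

/-! ### Simulation of loop-free commands. -/

namespace RecBackdoor

theorem HS.setA_arr (σ : HS) (a b : Fin 32) (l m : ℕ) (f : ℕ → ℕ) :
    (σ.setA a l f).arr b m = if b = a ∧ m = l then f else σ.arr b m := by
  unfold HS.setA
  by_cases h : b = a
  · subst h
    by_cases h' : m = l
    · subst h'; simp
    · simp [h']
  · simp [h]

theorem exec_C (X : Layout) (e : Ev) (P : C) : ∀ (σ : HS) (s : State), RepE X e σ s →
    ∃ s' t, Exec X.W P.code s s' t ∧ t ≤ P.cost ∧ RepE X e (P.run X.S X.LM e σ) s' ∧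
      ∀ r < 20, s'.reg (2 * r) = s.reg (2 * r) := by
  induction P with
  | skip => exact fun σ s hs => ⟨s, 1, .skip s, le_rfl, hs, fun _ _ => rfl⟩
  | put a ch x v =>
    intro σ s hs
    obtain ⟨s1, t1, x1, l1, k1, v1⟩ := exec_E X e σ v 0 s hs
    have hs1 := hs.same k1
    obtain ⟨s2, t2, x2, l2, k2, v2⟩ := exec_E X e σ x 1 s1 hs1
    have hs2 := hs1.same k2
    have v1' : s2.reg 1 = v.eval X.S X.LM e σ := (k2.2.2 0 (by omega)).trans v1
    by_cases hlt : x.eval X.S X.LM e σ < X.S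
    · obtain ⟨s3, x3, k3, v3⟩ := exec_addrCode X 1 a ch s2 σ hs2.toRep (by rw [v2]; exact hlt)
      have hs3 := hs2.same k3
      have v1'' : s3.reg 1 = v.eval X.S X.LM e σ := (k3.2.2 0 (by omega)).trans v1'
      rw [v2] at v3
      simp only [mul_one, Nat.reduceAdd] at v3
      have hl : σ.lv ch ≤ X.LM := by
        have := hs.levle
        unfold HS.lv; split_ifs <;> omega
      refine ⟨s3.setMem (s3.reg 3) (s3.reg 1), _, x1.seq (x2.seq (.condTrue ?_ (x3.seq
        (.store _ _ _)))), by simp only [C.cost]; omega, ?_, fun r _ => ?_⟩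
      · simp only [Test.Holds]; rw [hs2.sz]; simp only [mul_one, Nat.reduceAdd] at v2; omega
      · simp only [C.run, if_pos hlt]
        -- A write takes place only if rows are nonempty, and then they lie behind the input, which
        -- is therefore never overwritten.
        have hlen : X.w.length ≤ X.N0 := by
          rcases X.hN with h | h
          · omega
          · exact h
        refine { hs3 with reg := hs3.reg, regle := hs3.regle, inp := ?_, arr := ?_, arrle := ?_ }
        · intro i hi
          rw [State.mem_setMem, if_neg, hs3.inp i hi]
          rw [v3]; unfold Layout.addr; omega
        · intro b m y hy
          rw [State.mem_setMem, v3, v1'', HS.setA_arr]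
          by_cases hb : X.addr b m y = X.addr a (σ.lv ch) (x.eval X.S X.LM e σ)
          · obtain ⟨h1, h2, h3⟩ := X.addr_inj hy hlt hb
            rw [if_pos hb, if_pos ⟨h1, h2⟩, h3]; simp
          · rw [if_neg hb, hs3.arr _ _ _ hy]
            split_ifs with h
            · obtain ⟨rfl, rfl⟩ := h
              rw [Function.update_of_ne]
              rintro rfl
              exact hb rfl
            · rfl
        · intro b m y hy
          rw [HS.setA_arr]
          split_ifs with h
          · obtain ⟨rfl, rfl⟩ := h
            rw [Function.update_apply]
            split_ifs
            · exact hs.eval_le v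
            · exact hs.arrle _ _ _ hy
          · exact hs.arrle _ _ _ hy
      · rw [State.reg_setMem, k3.2.1, k2.2.1, k1.2.1]
    · refine ⟨s2, _, x1.seq (x2.seq (.condFalse ?_ (.skip _))), by simp only [C.cost]; omega, ?_,
        fun r _ => ?_⟩
      · simp only [Test.Holds]; rw [hs2.sz]; simp only [mul_one, Nat.reduceAdd] at v2; omega
      · simp only [C.run, if_neg hlt]; exact hs2
      · rw [k2.2.1, k1.2.1]
  | set r v =>
    intro σ s hs
    obtain ⟨s1, t1, x1, l1, k1, v1⟩ := exec_E X e σ v 0 s hs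
    have hs1 := hs.same k1
    have hv := hs.eval_le v
    simp only [mul_zero, zero_add] at v1
    refine ⟨_, _, x1.seq (.copy _ _ _), by simp only [C.cost]; omega, ?_, fun r' hr' => ?_⟩
    · simp only [C.run, v1]
      have := hs1
      constructor
      · constructor <;> try simp only [State.reg_setReg, State.mem_setReg, HS.setR]
        · rw [if_neg (by omega)]; exact hs1.n0
        · rw [if_neg (by omega)]; exact hs1.sz
        · rw [if_neg (by omega)]; exact hs1.cur
        · rw [if_neg (by omega)]; exact hs1.chi
        · rw [if_neg (by omega)]; exact hs1.lev
        · rw [if_neg (by omega)]; exact hs1.num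
        · rw [if_neg (by omega)]; exact hs1.one
        · rw [if_neg (by omega)]; exact hs1.rnd
        · rw [if_neg (by omega)]; exact hs1.zero
        · rw [if_neg (by omega)]; exact hs1.lm
        · intro r'
          rw [Function.update_apply, hs1.reg]
          congr 1
          simp
        · exact hs1.inp
        · exact hs1.arr
        · exact hs1.levle
        · intro r'
          rw [Function.update_apply]
          split_ifs
          · exact hv
          · exact hs1.regle r'
        · exact hs1.arrle
      · rw [State.reg_setReg, if_neg (by omega)]; exact hs1.ei
      · rw [State.reg_setReg, if_neg (by omega)]; exact hs1.ev
      · rw [State.reg_setReg, if_neg (by omega)]; exact hs1.es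
      · exact hs1.eile
      · exact hs1.evle
      · exact hs1.esle
    · rw [State.reg_setReg, if_neg (by omega), k1.2.1]
  | seq P Q ihP ihQ =>
    intro σ s hs
    obtain ⟨s1, t1, x1, l1, h1, k1⟩ := ihP σ s hs
    obtain ⟨s2, t2, x2, l2, h2, k2⟩ := ihQ _ s1 h1
    exact ⟨s2, _, x1.seq x2, by simp only [C.cost]; omega, h2,
      fun r hr => (k2 r hr).trans (k1 r hr)⟩
  | ite g P Q ihP ihQ =>
    intro σ s hs
    obtain ⟨s1, t1, x1, l1, k1, v1⟩ := exec_E X e σ g 0 s hs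
    have hs1 := hs.same k1
    simp only [mul_zero, zero_add] at v1
    by_cases hg : g.eval X.S X.LM e σ = 0
    · obtain ⟨s2, t2, x2, l2, h2, k2⟩ := ihQ _ s1 hs1
      refine ⟨s2, _, x1.seq (.condTrue (by simp only [Test.Holds, v1, hs1.zero, hg]) x2),
        by simp only [C.cost]; omega, ?_, fun r hr => by rw [k2 r hr, k1.2.1]⟩
      simpa only [C.run, hg, ne_eq, not_true, if_false] using h2
    · obtain ⟨s2, t2, x2, l2, h2, k2⟩ := ihP _ s1 hs1
      refine ⟨s2, _, x1.seq (.condFalse (by simp only [Test.Holds, v1, hs1.zero, hg, not_false_iff])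
        x2), by simp only [C.cost]; omega, ?_, fun r hr => by rw [k2 r hr, k1.2.1]⟩
      simpa only [C.run, hg, ne_eq, not_false_iff, if_true] using h2

/-- The registers that are not part of the representation of a state. -/
def Spare (r : ℕ) : Prop :=
  r = 0 ∨ r = 14 ∨ r = 16 ∨ r = 18 ∨ r = 24 ∨ r = 30 ∨ r = 32 ∨ r = 34 ∨ r = 36 ∨ r = 38 ∨
    r % 2 = 1

theorem Rep.setReg {X : Layout} {σ : HS} {s : State} (h : Rep X σ s) {r : ℕ} (hr : Spare r)
    (v : ℕ) : Rep X σ (s.setReg r v) := by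
  unfold Spare at hr
  constructor <;> try simp only [State.reg_setReg, State.mem_setReg]
  · rw [if_neg (by omega)]; exact h.n0
  · rw [if_neg (by omega)]; exact h.sz
  · rw [if_neg (by omega)]; exact h.cur
  · rw [if_neg (by omega)]; exact h.chi
  · rw [if_neg (by omega)]; exact h.lev
  · rw [if_neg (by omega)]; exact h.num
  · rw [if_neg (by omega)]; exact h.one
  · rw [if_neg (by omega)]; exact h.rnd
  · rw [if_neg (by omega)]; exact h.zero
  · rw [if_neg (by omega)]; exact h.lm
  · intro r'
    rw [if_neg (by omega), h.reg]
  · exact h.inp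
  · exact h.arr
  · exact h.levle
  · exact h.regle
  · exact h.arrle

/-! ### Passes over the input -/

/-- The code of a pass that does `A` for every clause (with its index and its number of literals)
and then `B` for each of its literals. -/
def passCode (A B : C) : Program :=
  .const 14 2 ;; .const 16 0 ;; .loop (.lt 16 12)
    (.load 18 14 ;; .copy 30 16 ;; .copy 32 18 ;; .const 34 0 ;; A.code ;; .add 14 14 20 ;;
      .add 18 18 18 ;; .add 18 14 18 ;;
      .loop (.lt 14 18)
        (.load 32 14 ;; .add 14 14 20 ;; .load 34 14 ;; .add 14 14 20 ;; .copy 30 16 ;; B.code) ;;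
      .add 16 16 20)

/-- The effect of a pass. -/
def passSem (S LM : ℕ) (L : List (List Literal)) (A B : C) (σ : HS) : HS :=
  L.zipIdx.foldl (fun σ p => p.1.foldl (fun σ l => B.run S LM (p.2, l.1, l.2.toNat) σ)
    (A.run S LM (p.2, p.1.length, 0) σ)) σ

theorem drop_succ_of_drop_eq_cons {α : Type*} {w r : List α} {x : α} {p : ℕ} (d : α)
    (h : w.drop p = x :: r) : p < w.length ∧ w.getD p d = x ∧ x ∈ w ∧ w.drop (p + 1) = r := by
  have hp : p < w.length := by
    by_contra hp
    rw [List.drop_eq_nil_of_le (by omega)] at h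
    exact absurd h (by simp)
  rw [List.drop_eq_getElem_cons hp] at h
  injection h with h1 h2
  exact ⟨hp, by simp [hp, h1], h1 ▸ List.getElem_mem hp, h2⟩

/-- The loop invariant: from the pointer `p` on, the input consists of the remaining literals of the
clause followed by `rest`. A turn consumes two words, and at the end `rest` is left for the next
clause. -/
theorem exec_pass_inner (X : Layout) (B : C) (i : ℕ) (hi : i ≤ X.B)
    (c : List Literal) :
    ∀ (σ : HS) (s : State) (p : ℕ) (rest : List ℕ), Rep X σ s → s.reg 14 = p → s.reg 16 = i →
      s.reg 18 = p + 2 * c.length →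
      X.w.drop p = c.flatMap (fun l => [l.1, l.2.toNat]) ++ rest →
      ∃ s' t, Exec X.W (.loop (.lt 14 18)
          (.load 32 14 ;; .add 14 14 20 ;; .load 34 14 ;; .add 14 14 20 ;; .copy 30 16 ;; B.code))
          s s' t ∧ t ≤ c.length * (B.cost + 6) + 1 ∧
        Rep X (c.foldl (fun σ l => B.run X.S X.LM (i, l.1, l.2.toNat) σ) σ) s' ∧
        s'.reg 14 = p + 2 * c.length ∧ s'.reg 16 = i ∧ s'.reg 24 = s.reg 24 ∧
        X.w.drop (p + 2 * c.length) = rest := by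
  induction c with
  | nil =>
    intro σ s p rest h hp hi he hd
    refine ⟨s, 1, .loopDone ?_, by simp, h, by simpa using hp, hi, rfl, by simpa using hd⟩
    simp only [Test.Holds, he, hp]; simp
  | cons l c ih =>
    intro σ s p rest h hp hi' he hd
    simp only [List.flatMap_cons, List.cons_append, List.nil_append] at hd
    obtain ⟨p1, g1, m1, d1⟩ := drop_succ_of_drop_eq_cons 0 hd
    obtain ⟨p2, g2, m2, d2⟩ := drop_succ_of_drop_eq_cons 0 d1
    have hlen := X.hlen
    have hone := h.one
    set u1 := s.setReg 32 l.1 with hu1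
    set u2 := u1.setReg 14 (p + 1) with hu2
    set u3 := u2.setReg 34 l.2.toNat with hu3
    set u4 := u3.setReg 14 (p + 2) with hu4
    set u5 := u4.setReg 30 i with hu5
    have r5 : Rep X σ u5 := by
      refine ((((h.setReg ?_ _).setReg ?_ _).setReg ?_ _).setReg ?_ _).setReg ?_ _ <;>
        simp [Spare]
    have x1 : Exec X.W (.load 32 14) s u1 1 := by
      have := Exec.load (W := X.W) s 32 14
      rwa [hp, h.inp p p1, g1] at this
    have x2 : Exec X.W (.add 14 14 20) u1 u2 1 := by
      have := Exec.add (W := X.W) u1 14 14 20 (by simp [hu1, hp, hone]; omega)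
      simpa [hu1, hp, hone, hu2] using this
    have x3 : Exec X.W (.load 34 14) u2 u3 1 := by
      have := Exec.load (W := X.W) u2 34 14
      simp only [hu2, hu1, State.reg_setReg, State.mem_setReg, if_true] at this
      rwa [h.inp (p + 1) p2, g2] at this
    have x4 : Exec X.W (.add 14 14 20) u3 u4 1 := by
      have := Exec.add (W := X.W) u3 14 14 20 (by simp [hu3, hu2, hu1, hone]; omega)
      simpa [hu1, hu2, hu3, hone, hu4] using this
    have x5 : Exec X.W (.copy 30 16) u4 u5 1 := by
      have := Exec.copy (W := X.W) u4 30 16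
      simpa [hu1, hu2, hu3, hu4, hi'] using this
    have e5 : RepE X (i, l.1, l.2.toNat) σ u5 :=
      { r5 with
        reg := r5.reg
        regle := r5.regle
        ei := by simp [hu5]
        ev := by simp [hu5, hu4, hu3, hu2, hu1]
        es := by simp [hu5, hu4, hu3]
        eile := hi
        evle := X.hw _ m1
        esle := X.hw _ m2 }
    obtain ⟨s6, t6, x6, l6, h6, k6⟩ := exec_C X _ B σ u5 e5
    have b14 : s6.reg 14 = p + 2 := (k6 7 (by omega)).trans (by simp [hu5, hu4])
    have b16 : s6.reg 16 = i := (k6 8 (by omega)).trans (by simp [hu5, hu4, hu3, hu2, hu1, hi'])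
    have b18 : s6.reg 18 = p + 2 + 2 * c.length :=
      (k6 9 (by omega)).trans (by simp [hu5, hu4, hu3, hu2, hu1, he]; ring)
    have b24 : s6.reg 24 = s.reg 24 :=
      (k6 12 (by omega)).trans (by simp [hu5, hu4, hu3, hu2, hu1])
    obtain ⟨s7, t7, x7, l7, h7, c14, c16, c24, cd⟩ :=
      ih _ s6 (p + 2) rest h6.toRep b14 b16 b18 d2
    refine ⟨s7, _, .loopStep (by simp [Test.Holds, he, hp])
      (x1.seq (x2.seq (x3.seq (x4.seq (x5.seq x6))))) x7, ?_, h7, ?_, c16, c24.trans b24, ?_⟩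
    · simp only [List.length_cons]; ring_nf; ring_nf at l7; omega
    · rw [c14]; simp; ring
    · rw [← cd]; congr 1; simp; ring

end RecBackdoor

namespace RecBackdoor

/-- The number of clauses plus the number of occurrences of literals. -/
def inputSize (L : List (List Literal)) : ℕ := (L.map fun c => c.length + 1).sum

/-- A clause with `m` literals is charged `m + 1` times, which adds up to `inputSize`. The pointer
in register `14` ends at the length of the input; the program later uses it as the start of its own
memory. -/
theorem exec_pass_outer (X : Layout) (A B : C) (hm : X.w.getD 1 0 ≤ X.B) (L : List (List Literal)) :
    ∀ (σ : HS) (s : State) (p i : ℕ), Rep X σ s → s.reg 14 = p → s.reg 16 = i →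
      p ≤ X.w.length → i + L.length = X.w.getD 1 0 →
      X.w.drop p = L.flatMap (fun C => C.length :: C.flatMap (fun l => [l.1, l.2.toNat])) →
      ∃ s' t, Exec X.W (.loop (.lt 16 12)
          (.load 18 14 ;; .copy 30 16 ;; .copy 32 18 ;; .const 34 0 ;; A.code ;; .add 14 14 20 ;;
            .add 18 18 18 ;; .add 18 14 18 ;;
            .loop (.lt 14 18)
              (.load 32 14 ;; .add 14 14 20 ;; .load 34 14 ;; .add 14 14 20 ;; .copy 30 16 ;;
                B.code) ;;
            .add 16 16 20))
          s s' t ∧ t ≤ inputSize L * (A.cost + B.cost + 10) + 1 ∧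
        Rep X ((L.zipIdx i).foldl (fun σ p => p.1.foldl
          (fun σ l => B.run X.S X.LM (p.2, l.1, l.2.toNat) σ)
          (A.run X.S X.LM (p.2, p.1.length, 0) σ)) σ) s' ∧
        s'.reg 14 = X.w.length ∧ s'.reg 24 = s.reg 24 := by
  induction L with
  | nil =>
    intro σ s p i h hp hi hpl hm hd
    refine ⟨s, 1, .loopDone ?_, by simp, h, ?_, rfl⟩
    · simp only [Test.Holds, hi, h.num, ← hm]; simp
    · simp only [List.flatMap_nil, List.drop_eq_nil_iff] at hd
      omega
  | cons c L ih =>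
    intro σ s p i h hp hi _ hm' hd
    simp only [List.flatMap_cons, List.cons_append] at hd
    obtain ⟨p1, g1, m1, d1⟩ := drop_succ_of_drop_eq_cons 0 hd
    have hlen := X.hlen
    have hone := h.one
    have hiB : i ≤ X.B := by rw [List.length_cons] at hm'; omega
    have hcl : p + 1 + 2 * c.length ≤ X.w.length := by
      have := congrArg List.length d1
      simp only [List.length_drop, List.length_append, List.length_flatMap] at this
      simp at this
      omega
    set u1 := s.setReg 18 c.length with hu1
    set u2 := u1.setReg 30 i with hu2
    set u3 := u2.setReg 32 c.length with hu3
    set u4 := u3.setReg 34 0 with hu4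
    have r4 : Rep X σ u4 := by
      refine ((((h.setReg ?_ _).setReg ?_ _).setReg ?_ _).setReg ?_ _) <;>
        simp [Spare]
    have x1 : Exec X.W (.load 18 14) s u1 1 := by
      have := Exec.load (W := X.W) s 18 14
      rwa [hp, h.inp p p1, g1] at this
    have x2 : Exec X.W (.copy 30 16) u1 u2 1 := by
      have := Exec.copy (W := X.W) u1 30 16
      simpa [hu1, hi] using this
    have x3 : Exec X.W (.copy 32 18) u2 u3 1 := by
      have := Exec.copy (W := X.W) u2 32 18
      simpa [hu1, hu2] using this
    have x4 : Exec X.W (.const 34 0) u3 u4 1 := .const _ _ _ (by omega)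
    have e4 : RepE X (i, c.length, 0) σ u4 :=
      { r4 with
        reg := r4.reg
        regle := r4.regle
        ei := by simp [hu4, hu3, hu2]
        ev := by simp [hu4, hu3]
        es := by simp [hu4]
        eile := hiB
        evle := X.hw _ m1
        esle := by simp }
    obtain ⟨s5, t5, x5, l5, h5, k5⟩ := exec_C X _ A σ u4 e4
    have a14 : s5.reg 14 = p := (k5 7 (by omega)).trans (by simp [hu4, hu3, hu2, hu1, hp])
    have a16 : s5.reg 16 = i := (k5 8 (by omega)).trans (by simp [hu4, hu3, hu2, hu1, hi])
    have a18 : s5.reg 18 = c.length := (k5 9 (by omega)).trans (by simp [hu4, hu3, hu2, hu1])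
    have a24 : s5.reg 24 = s.reg 24 := (k5 12 (by omega)).trans (by simp [hu4, hu3, hu2, hu1])
    have hone5 := h5.one
    set u6 := s5.setReg 14 (p + 1) with hu6
    set u7 := u6.setReg 18 (c.length + c.length) with hu7
    set u8 := u7.setReg 18 (p + 1 + 2 * c.length) with hu8
    have x6 : Exec X.W (.add 14 14 20) s5 u6 1 := by
      have := Exec.add (W := X.W) s5 14 14 20 (by simp [a14, hone5]; omega)
      simpa [a14, hone5, hu6] using this
    have x7 : Exec X.W (.add 18 18 18) u6 u7 1 := by
      have := Exec.add (W := X.W) u6 18 18 18 (by simp [hu6, a18]; omega)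
      simpa [hu6, a18, hu7] using this
    have x8 : Exec X.W (.add 18 14 18) u7 u8 1 := by
      have := Exec.add (W := X.W) u7 18 14 18 (by simp [hu7, hu6]; omega)
      simp only [hu7, hu6, State.reg_setReg, if_true] at this
      simpa [hu7, hu6, hu8, two_mul] using this
    have r8 : Rep X (A.run X.S X.LM (i, c.length, 0) σ) u8 := by
      refine (((h5.toRep.setReg ?_ _).setReg ?_ _).setReg ?_ _) <;> simp [Spare]
    obtain ⟨s9, t9, x9, l9, h9, c14, c16, c24, cd⟩ := exec_pass_inner X B i hiB c _ u8 (p + 1) _ r8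
      (by simp [hu8, hu7, hu6]) (by simp [hu8, hu7, hu6, a16]) (by simp [hu8]) d1
    have hone9 := h9.one
    have x10 : Exec X.W (.add 16 16 20) s9 (s9.setReg 16 (i + 1)) 1 := by
      have := Exec.add (W := X.W) s9 16 16 20 (by have := X.hW; rw [c16, hone9]; omega)
      simpa [c16, hone9] using this
    obtain ⟨s11, t11, x11, l11, h11, d1, d3⟩ :=
      ih _ (s9.setReg 16 (i + 1)) (p + 1 + 2 * c.length) (i + 1) (h9.setReg (by simp [Spare]) _)
        (by simp [c14]) (by simp) hcl (by rw [List.length_cons] at hm'; omega) cd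
    refine ⟨s11, _, .loopStep ?_ (x1.seq (x2.seq (x3.seq (x4.seq (x5.seq (x6.seq (x7.seq
      (x8.seq (x9.seq x10))))))))) x11, ?_, h11, d1, ?_⟩
    · simp only [Test.Holds, hi, h.num, ← hm']; simp
    · simp only [inputSize, List.map_cons, List.sum_cons] at l11 ⊢
      have : c.length * (B.cost + 6) ≤ c.length * (A.cost + B.cost + 10) :=
        Nat.mul_le_mul_left _ (by omega)
      rw [add_mul, add_mul]
      omega
    · rw [d3]; simp [c24, hu8, hu7, hu6, a24]

/-- The simulation statement: started in a representation of `σ`, the program halts within `T`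
steps in a representation of `σ'`; if `q` is set, then the counter is preserved. -/
def Sim (X : Layout) (q : Bool) (P : Program) (σ σ' : HS) (T : ℕ) : Prop :=
  ∀ s, Rep X σ s → ∃ s' t, Exec X.W P s s' t ∧ t ≤ T ∧ Rep X σ' s' ∧
    (q = true → s'.reg 24 = s.reg 24)

theorem Sim.seq {X : Layout} {q : Bool} {P Q : Program} {σ σ' σ'' : HS} {T U : ℕ}
    (h : Sim X q P σ σ' T) (h' : Sim X q Q σ' σ'' U) : Sim X q (P ;; Q) σ σ'' (T + U) := by
  intro s hs
  obtain ⟨s1, t1, x1, l1, h1, k1⟩ := h s hs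
  obtain ⟨s2, t2, x2, l2, h2, k2⟩ := h' s1 h1
  exact ⟨s2, _, x1.seq x2, by omega, h2, fun hq => (k2 hq).trans (k1 hq)⟩

theorem Sim.weaken {X : Layout} {q : Bool} {P : Program} {σ σ' : HS} {T U : ℕ}
    (h : Sim X q P σ σ' T) (hT : T ≤ U) : Sim X false P σ σ' U := by
  intro s hs
  obtain ⟨s1, t1, x1, l1, h1, k1⟩ := h s hs
  exact ⟨s1, _, x1, by omega, h1, by simp⟩

theorem exec_pass (X : Layout) (A B : C) (k : ℕ) (L : List (List Literal))
    (hw : X.w = inputWords k L) (σ : HS) (s : State) (hs : Rep X σ s) :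
    ∃ s' t, Exec X.W (passCode A B) s s' t ∧ t ≤ inputSize L * (A.cost + B.cost + 10) + 3 ∧
      Rep X (passSem X.S X.LM L A B σ) s' ∧ s'.reg 14 = X.w.length ∧ s'.reg 24 = s.reg 24 := by
  have hW := X.hW
  have h2 : X.w.drop 2 = L.flatMap (fun C => C.length :: C.flatMap (fun l => [l.1, l.2.toNat])) := by
    rw [hw]; rfl
  have h1 : X.w.getD 1 0 = L.length := by rw [hw]; rfl
  have hlen : 2 ≤ X.w.length := by rw [hw]; simp [inputWords]
  obtain ⟨s', t, x, l, h, d1, d3⟩ := exec_pass_outer X A B (X.hw _ (by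
      rw [h1, hw]; simp [inputWords])) L σ ((s.setReg 14 2).setReg 16 0) 2 0
    ((hs.setReg (by simp [Spare]) _).setReg (by simp [Spare]) _) (by simp) (by simp) hlen
    (by rw [h1]; simp) h2
  exact ⟨s', _, (Exec.const _ _ _ (by omega)).seq ((Exec.const _ _ _ (by omega)).seq x), by omega, h,
    d1, by rw [d3]; simp⟩

/-! ### Structured commands -/

/-- Commands without repetitions. -/
inductive Flat
  | once (P : C)
  | pass (A B : C)
  | seq (P Q : Flat)

/-- Commands. -/
inductive Cmd
  | flat (P : Flat)
  | rep (P : Flat)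
  | seq (P Q : Cmd)
  | ite (g : E) (P Q : Cmd)
  | up
  | down

/-- A repetition keeps its counter in the single register `24`. Therefore repetitions are not
nested, and their bodies are `Flat` commands, which preserve that register. -/
def Flat.sem (S LM : ℕ) (L : List (List Literal)) : Flat → HS → HS
  | once P, σ => P.run S LM (0, 0, 0) σ
  | pass A B, σ => passSem S LM L A B σ
  | seq P Q, σ => Q.sem S LM L (P.sem S LM L σ)

def Cmd.sem (S LM D : ℕ) (L : List (List Literal)) : Cmd → HS → HS
  | flat P, σ => P.sem S LM L σ
  | rep P, σ => (P.sem S LM L)^[D] σ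
  | seq P Q, σ => Q.sem S LM D L (P.sem S LM D L σ)
  | ite g P Q, σ =>
      if g.eval S LM (0, 0, 0) σ ≠ 0 then P.sem S LM D L σ else Q.sem S LM D L σ
  | up, σ => { σ with lev := if σ.lev < LM then σ.lev + 1 else σ.lev }
  | down, σ => { σ with lev := σ.lev - 1 }

/-- Clear the event. -/
def clearCode : Program := .const 30 0 ;; .const 32 0 ;; .const 34 0

def Flat.code : Flat → Program
  | once P => clearCode ;; P.code
  | pass A B => passCode A B
  | seq P Q => P.code ;; Q.code

def Cmd.code : Cmd → Program
  | flat P => P.code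
  | rep P => .copy 24 22 ;; .loop (.lt 26 24) (P.code ;; .sub 24 24 20)
  | seq P Q => P.code ;; Q.code
  | ite g P Q => clearCode ;; g.code 0 ;; .cond (.eq 1 26) Q.code P.code
  | up => .cond (.lt 10 28) (.copy 8 6 ;; .add 6 6 4 ;; .add 10 10 20) .skip
  | down => .copy 6 8 ;; .sub 8 8 4 ;; .sub 10 10 20

/-- A bound on the number of steps of a command, for an input of size `n`. -/
def Flat.cost (n : ℕ) : Flat → ℕ
  | once P => P.cost + 3
  | pass A B => n * (A.cost + B.cost + 10) + 3
  | seq P Q => P.cost n + Q.cost n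

def Cmd.cost (n D : ℕ) : Cmd → ℕ
  | flat P => P.cost n
  | rep P => D * (P.cost n + 2) + 2
  | seq P Q => P.cost n D + Q.cost n D
  | ite g P Q => g.cost + 4 + P.cost n D + Q.cost n D
  | up => 4
  | down => 3

theorem Flat.cost_le (P : Flat) : ∃ c, ∀ n, P.cost n ≤ c * (n + 1) := by
  induction P with
  | once P => exact ⟨P.cost + 3, fun n => by simp only [cost]; nlinarith⟩
  | pass A B => exact ⟨A.cost + B.cost + 10, fun n => by simp only [cost]; nlinarith⟩
  | seq P Q ihP ihQ =>
    obtain ⟨c, hc⟩ := ihP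
    obtain ⟨d, hd⟩ := ihQ
    exact ⟨c + d, fun n => by simp only [cost]; nlinarith [hc n, hd n]⟩

theorem Cmd.cost_le (P : Cmd) : ∃ c, ∀ n D, P.cost n D ≤ c * ((n + 1) * (D + 1)) := by
  have hone : ∀ n D : ℕ, 1 ≤ (n + 1) * (D + 1) := fun n D =>
    Nat.one_le_iff_ne_zero.mpr (by positivity)
  induction P with
  | flat P =>
    obtain ⟨c, hc⟩ := P.cost_le
    exact ⟨c, fun n D => (hc n).trans (Nat.mul_le_mul_left _ (by nlinarith))⟩
  | rep P =>
    obtain ⟨c, hc⟩ := P.cost_le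
    refine ⟨c + 2, fun n D => ?_⟩
    simp only [cost]
    have := hc n
    have : D * (P.cost n + 2) ≤ D * (c * (n + 1) + 2) := Nat.mul_le_mul_left _ (by omega)
    nlinarith [Nat.zero_le (n * D)]
  | seq P Q ihP ihQ =>
    obtain ⟨c, hc⟩ := ihP
    obtain ⟨d, hd⟩ := ihQ
    exact ⟨c + d, fun n D => by simp only [cost]; nlinarith [hc n D, hd n D]⟩
  | ite g P Q ihP ihQ =>
    obtain ⟨c, hc⟩ := ihP
    obtain ⟨d, hd⟩ := ihQ
    refine ⟨g.cost + 4 + c + d, fun n D => ?_⟩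
    simp only [cost]
    have := Nat.mul_le_mul_left (g.cost + 4) (hone n D)
    nlinarith [hc n D, hd n D]
  | up => exact ⟨4, fun n D => by simp only [cost]; linarith [hone n D]⟩
  | down => exact ⟨3, fun n D => by simp only [cost]; linarith [hone n D]⟩

/-- Outside of passes the event registers hold leftovers; they are reset so that expressions are
evaluated at the event `(0, 0, 0)`. -/
theorem exec_clear (X : Layout) (σ : HS) (s : State) (hs : Rep X σ s) :
    ∃ s', Exec X.W clearCode s s' 3 ∧ RepE X (0, 0, 0) σ s' ∧ s'.reg 24 = s.reg 24 := by
  have h3 := ((hs.setReg (r := 30) (by simp [Spare]) 0).setReg (r := 32) (by simp [Spare]) 0).setReg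
    (r := 34) (by simp [Spare]) 0
  refine ⟨_, ((Exec.const _ _ _ (by omega)).seq' ((Exec.const _ _ _ (by omega)).seq
    (Exec.const _ _ _ (by omega))) rfl), { h3 with
      reg := h3.reg, regle := h3.regle, ei := ?_, ev := ?_, es := ?_, eile := ?_, evle := ?_,
      esle := ?_ }, ?_⟩ <;> simp

theorem Flat.sim (X : Layout) (k : ℕ) (L : List (List Literal)) (hw : X.w = inputWords k L)
    (P : Flat) : ∀ σ, Sim X true P.code σ (P.sem X.S X.LM L σ) (P.cost (inputSize L)) := by
  induction P with
  | once P =>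
    intro σ s hs
    obtain ⟨s1, x1, h1, k1⟩ := exec_clear X σ s hs
    obtain ⟨s2, t2, x2, l2, h2, k2⟩ := exec_C X _ P σ s1 h1
    exact ⟨s2, _, x1.seq x2, by simp only [cost]; omega, h2.toRep,
      fun _ => (k2 12 (by omega)).trans k1⟩
  | pass A B =>
    intro σ s hs
    obtain ⟨s1, t1, x1, l1, h1, _, k1⟩ := exec_pass X A B k L hw σ s hs
    exact ⟨s1, t1, x1, l1, h1, fun _ => k1⟩
  | seq P Q ihP ihQ => exact fun σ => (ihP σ).seq (ihQ _)

theorem sim_rep (X : Layout) (P : Program) (f : HS → HS) (T : ℕ)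
    (h : ∀ σ, Sim X true P σ (f σ) T) (σ : HS) :
    Sim X false (.copy 24 22 ;; .loop (.lt 26 24) (P ;; .sub 24 24 20)) σ (f^[X.D] σ)
      (X.D * (T + 2) + 2) := by
  have loop : ∀ (d : ℕ) (σ : HS) (s : State), Rep X σ s → s.reg 24 = d →
      ∃ s' t, Exec X.W (.loop (.lt 26 24) (P ;; .sub 24 24 20)) s s' t ∧ t ≤ d * (T + 2) + 1 ∧
        Rep X (f^[d] σ) s' := by
    intro d
    induction d with
    | zero =>
      intro σ s hs hd
      exact ⟨s, 1, .loopDone (by simp [Test.Holds, hd]), by simp, hs⟩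
    | succ d ih =>
      intro σ s hs hd
      obtain ⟨s1, t1, x1, l1, h1, k1⟩ := h σ s hs
      have k1 := k1 rfl
      have x2 : Exec X.W (.sub 24 24 20) s1 (s1.setReg 24 d) 1 := by
        have := Exec.sub (W := X.W) s1 24 24 20
        rwa [k1, hd, h1.one, Nat.add_sub_cancel] at this
      obtain ⟨s3, t3, x3, l3, h3⟩ := ih (f σ) (s1.setReg 24 d) (h1.setReg (by simp [Spare]) _)
        (by simp)
      refine ⟨s3, _, .loopStep (by simp [Test.Holds, hd, hs.zero]) (x1.seq x2) x3, ?_, h3⟩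
      rw [add_mul, one_mul]; omega
  intro s hs
  obtain ⟨s', t, x, l, h'⟩ := loop X.D σ (s.setReg 24 X.D) (hs.setReg (by simp [Spare]) _) (by simp)
  have x0 : Exec X.W (.copy 24 22) s (s.setReg 24 X.D) 1 := by
    have := Exec.copy (W := X.W) s 24 22
    rwa [hs.rnd] at this
  exact ⟨s', _, x0.seq x, by omega, h', by simp⟩

theorem Cmd.sim (X : Layout) (k : ℕ) (L : List (List Literal)) (hw : X.w = inputWords k L)
    (P : Cmd) :
    ∀ σ, Sim X false P.code σ (P.sem X.S X.LM X.D L σ) (P.cost (inputSize L) X.D) := by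
  induction P with
  | flat P => exact fun σ => (P.sim X k L hw σ).weaken le_rfl
  | rep P => exact fun σ => sim_rep X _ _ _ (P.sim X k L hw) σ
  | seq P Q ihP ihQ => exact fun σ => (ihP σ).seq (ihQ _)
  | ite g P Q ihP ihQ =>
    intro σ s hs
    obtain ⟨s0, x0, h0, k0⟩ := exec_clear X σ s hs
    obtain ⟨s1, t1, x1, l1, k1, v1⟩ := exec_E X _ σ g 0 s0 h0
    have hs1 := h0.same k1
    simp only [mul_zero, zero_add] at v1
    by_cases hg : g.eval X.S X.LM (0, 0, 0) σ = 0
    · obtain ⟨s2, t2, x2, l2, h2, k2⟩ := ihQ σ s1 hs1.toRep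
      refine ⟨s2, _, x0.seq (x1.seq (.condTrue (by simp only [Test.Holds, v1, hs1.zero, hg]) x2)),
        by simp only [cost]; omega, ?_, by simp⟩
      simpa only [sem, hg, ne_eq, not_true, if_false] using h2
    · obtain ⟨s2, t2, x2, l2, h2, k2⟩ := ihP σ s1 hs1.toRep
      refine ⟨s2, _, x0.seq (x1.seq (.condFalse (by simp only [Test.Holds, v1, hs1.zero, hg,
        not_false_iff]) x2)), by simp only [cost]; omega, ?_, by simp⟩
      simpa only [sem, hg, ne_eq, not_false_iff, if_true] using h2
  | up =>
    intro σ s hs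
    by_cases hl : σ.lev < X.LM
    · have hle : σ.lev * X.S + X.S ≤ X.W := by
        have h1 := X.hS
        have h2 := X.hW
        have : (σ.lev + 1) * X.S ≤ (X.LM + 1) * X.S := Nat.mul_le_mul_right _ (by omega)
        rw [add_mul, one_mul] at this
        omega
      have hLM := X.hLM
      have hW := X.hW
      have hcur := hs.cur
      have hsz := hs.sz
      have hlev := hs.lev
      have hone := hs.one
      have x1 := Exec.copy (W := X.W) s 8 6
      have x2 := Exec.add (W := X.W) (s.setReg 8 (s.reg 6)) 6 6 4 (by simpa [hcur, hsz] using hle)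
      have x3 := Exec.add (W := X.W) ((s.setReg 8 (s.reg 6)).setReg 6
        ((s.setReg 8 (s.reg 6)).reg 6 + (s.setReg 8 (s.reg 6)).reg 4)) 10 10 20
        (by simp [hlev, hone]; omega)
      refine ⟨_, _, .condTrue (by simpa only [Test.Holds, hs.lev, hs.lm] using hl)
        (x1.seq (x2.seq x3)), by simp only [cost]; omega, ?_, by simp⟩
      simp only [sem, if_pos hl]
      constructor <;> try simp only [State.reg_setReg, State.mem_setReg]
      · simpa using hs.n0
      · simpa using hs.sz
      · simp [hcur, hsz, add_mul]
      · simp [hcur]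
      · simp [hlev, hone]
      · simpa using hs.num
      · simpa using hs.one
      · simpa using hs.rnd
      · simpa using hs.zero
      · simpa using hs.lm
      · intro r
        rw [if_neg (by omega), if_neg (by omega), if_neg (by omega), hs.reg]
      · exact hs.inp
      · exact hs.arr
      · exact hl
      · exact hs.regle
      · exact hs.arrle
    · refine ⟨s, _, .condFalse (by simpa only [Test.Holds, hs.lev, hs.lm] using hl) (.skip _),
        by simp only [cost]; omega, ?_, by simp⟩
      simpa only [sem, if_neg hl] using hs
  | down =>
    intro σ s hs
    have x1 := Exec.copy (W := X.W) s 6 8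
    have x2 := Exec.sub (W := X.W) (s.setReg 6 (s.reg 8)) 8 8 4
    have x3 := Exec.sub (W := X.W) ((s.setReg 6 (s.reg 8)).setReg 8
      ((s.setReg 6 (s.reg 8)).reg 8 - (s.setReg 6 (s.reg 8)).reg 4)) 10 10 20
    refine ⟨_, _, x1.seq (x2.seq x3), by simp only [cost]; omega, ?_, by simp⟩
    simp only [sem]
    constructor <;> try simp only [State.reg_setReg, State.mem_setReg]
    · simpa using hs.n0
    · simpa using hs.sz
    · simpa using hs.chi
    · simp [hs.chi, hs.sz, Nat.sub_mul]
    · simp [hs.lev, hs.one]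
    · simpa using hs.num
    · simpa using hs.one
    · simpa using hs.rnd
    · simpa using hs.zero
    · simpa using hs.lm
    · intro r
      rw [if_neg (by omega), if_neg (by omega), if_neg (by omega), hs.reg]
    · exact hs.inp
    · exact hs.arr
    · have := hs.levle; omega
    · exact hs.regle
    · exact hs.arrle

end RecBackdoor

namespace RecBackdoor

/-! ### Hardness certificates

A family of clauses is given by the list `es` of its occurrences `(i, v, s)`: the clause `i` contains
the variable `v` with sign `s`.  In an assignment `τ` the value `2` means that the variable is
free. -/

variable (es : List Ev)

def Occ (i v : ℕ) : Prop := ∃ s, (i, v, s) ∈ es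

/-- The clause `i` is not satisfied by `τ`. -/
def Live (τ : ℕ → ℕ) (i : ℕ) : Prop := ∀ v s, (i, v, s) ∈ es → τ v ≠ s

/-- The clause `i` is not satisfied, and contains the free variable `v`. -/
def LF (τ : ℕ → ℕ) (i v : ℕ) : Prop := Live es τ i ∧ Occ es i v ∧ τ v = 2

def Adj (τ : ℕ → ℕ) (O : Set ℕ) (u v : ℕ) : Prop := ∃ i ∈ O, LF es τ i u ∧ LF es τ i v

def Link (τ : ℕ → ℕ) (O : Set ℕ) : ℕ → ℕ → Prop := Relation.ReflTransGen (Adj es τ O)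

/-- A certificate for the fact that the clauses in `O` under the assignment `τ` have strong
recursive backdoor depth at least `n`. -/
def Hard : ℕ → (ℕ → ℕ) → Set ℕ → Prop
  | 0, _, _ => True
  | n + 1, τ, O => ∃ O' ⊆ O, O'.Nonempty ∧ ∃ r, (∀ i ∈ O', ∃ v, LF es τ i v ∧ Link es τ O' r v) ∧
      ∀ i ∈ O', ∀ x, LF es τ i x → ∃ b < 2, Hard n (Function.update τ x b) O'

variable {es}

theorem Adj.symm {τ : ℕ → ℕ} {O : Set ℕ} {u v : ℕ} (h : Adj es τ O u v) : Adj es τ O v u := by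
  obtain ⟨i, hi, h1, h2⟩ := h
  exact ⟨i, hi, h2, h1⟩

theorem Link.symm {τ : ℕ → ℕ} {O : Set ℕ} {u v : ℕ} (h : Link es τ O u v) : Link es τ O v u := by
  induction h with
  | refl => exact .refl
  | tail _ h2 ih => exact .head h2.symm ih

theorem Link.mono {τ τ' : ℕ → ℕ} {O O' : Set ℕ} (hLF : ∀ i ∈ O, ∀ v, LF es τ i v → LF es τ' i v)
    (hO : O ⊆ O') {u v : ℕ} (h : Link es τ O u v) : Link es τ' O' u v := by
  induction h with
  | refl => exact .refl
  | tail _ h2 ih =>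
    obtain ⟨i, hi, h1, h2⟩ := h2
    exact .tail ih ⟨i, hO hi, hLF i hi _ h1, hLF i hi _ h2⟩

theorem Hard.superset {n : ℕ} {τ : ℕ → ℕ} {O O2 : Set ℕ} (h : Hard es n τ O) (hO : O ⊆ O2) :
    Hard es n τ O2 := by
  cases n with
  | zero => trivial
  | succ n =>
    obtain ⟨O', h1, h2⟩ := h
    exact ⟨O', h1.trans hO, h2⟩

theorem Hard.of_succ {n : ℕ} : ∀ {τ : ℕ → ℕ} {O : Set ℕ}, Hard es (n + 1) τ O → Hard es n τ O := by
  induction n with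
  | zero => intros; trivial
  | succ n ih =>
    rintro τ O ⟨O', h1, h2, r, h3, h4⟩
    refine ⟨O', h1, h2, r, h3, fun i hi x hx => ?_⟩
    obtain ⟨b, hb, h5⟩ := h4 i hi x hx
    exact ⟨b, hb, ih h5⟩




/-- Signs are below `2`, so freeing variables cannot satisfy a clause: live clauses stay live and
free variables stay free. -/
theorem LF.mono (hs : ∀ e ∈ es, e.2.2 < 2) {τ τ0 : ℕ → ℕ} {i : ℕ}
    (h : ∀ v, Occ es i v → τ0 v = 2 ∨ τ0 v = τ v) {v : ℕ} (hv : LF es τ i v) : LF es τ0 i v := by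
  obtain ⟨h1, h2, h3⟩ := hv
  refine ⟨fun w s hw => ?_, h2, ?_⟩
  · rcases h w ⟨s, hw⟩ with h' | h'
    · have := hs _ hw
      simp only at this
      omega
    · rw [h']; exact h1 w s hw
  · rcases h v h2 with h' | h'
    · exact h'
    · rw [h', h3]

/-- Hardness is inherited by smaller assignments. -/
theorem Hard.mono (hs : ∀ e ∈ es, e.2.2 < 2) {n : ℕ} : ∀ {τ τ0 : ℕ → ℕ} {O : Set ℕ},
    Hard es n τ O → (∀ i ∈ O, ∀ v, Occ es i v → (τ0 v = 2 ∨ τ0 v = τ v) ∧ τ v ≤ 2) →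
      Hard es n τ0 O := by
  induction n with
  | zero => intros; trivial
  | succ n ih =>
    rintro τ τ0 O h hτ
    have hsucc := h
    obtain ⟨O', h1, h2, r, h3, h4⟩ := h
    have hLF : ∀ i ∈ O', ∀ v, LF es τ i v → LF es τ0 i v := fun i hi v =>
      LF.mono hs fun v hv => (hτ i (h1 hi) v hv).1
    refine ⟨O', h1, h2, r, fun i hi => ?_, fun i hi x hx => ?_⟩
    · obtain ⟨v, hv, hl⟩ := h3 i hi
      exact ⟨v, hLF i hi v hv, hl.mono hLF subset_rfl⟩
    · by_cases hx2 : τ x = 2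
      · obtain ⟨v, hv, -⟩ := h3 i hi
        obtain ⟨b, hb, h5⟩ := h4 i hi x ⟨hv.1, hx.2.1, hx2⟩
        refine ⟨b, hb, ih h5 fun j hj v hv => ?_⟩
        have := hτ j (h1 hj) v hv
        simp only [Function.update_apply]
        split_ifs
        · exact ⟨Or.inr rfl, by omega⟩
        · exact this
      -- Here `x` is free under `τ0` only. Its value under `τ` is chosen; then nothing changes for
      -- the certificate, which merely drops one level.
      · have hxle := (hτ i (h1 hi) x hx.2.1).2
        refine ⟨τ x, by omega, ?_⟩
        have h5 : Hard es n τ O' := Hard.of_succ ⟨O', subset_rfl, h2, r, h3, h4⟩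
        refine ih h5 fun j hj v hv => ?_
        have := hτ j (h1 hj) v hv
        simp only [Function.update_apply]
        split_ifs with hvx
        · subst hvx; exact ⟨Or.inr rfl, this.2⟩
        · exact this

/-- A wide clause is hard. -/
theorem Hard.of_wide (hs : ∀ e ∈ es, e.2.2 < 2) {n : ℕ} : ∀ {τ : ℕ → ℕ} {i : ℕ} (F : Finset ℕ),
    n ≤ F.card → (∀ v s s', (i, v, s) ∈ es → (i, v, s') ∈ es → s = s') →
      (∀ v ∈ F, LF es τ i v) → Hard es n τ {i} := by
  induction n with
  | zero => intros; trivial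
  | succ n ih =>
    intro τ i F hF hp hv
    obtain ⟨v0, hv0⟩ : F.Nonempty := Finset.card_pos.mp (by omega)
    refine ⟨{i}, subset_rfl, ⟨i, rfl⟩, v0, ?_, ?_⟩
    · rintro j rfl
      exact ⟨v0, hv v0 hv0, .refl⟩
    · rintro j rfl x hx
      obtain ⟨hl, ⟨s, hxs⟩, hx2⟩ := hx
      have hs2 : s < 2 := hs _ hxs
      -- The value that falsifies the literal of `x`: the clause remains unsatisfied and loses just
      -- one free variable.
      refine ⟨1 - s, by omega, ih (F.erase x) ?_ hp ?_⟩
      · have := Finset.pred_card_le_card_erase (s := F) (a := x)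
        omega
      · intro v hvF
        obtain ⟨hvx, hvF⟩ := Finset.mem_erase.mp hvF
        obtain ⟨h1, h2, h3⟩ := hv v hvF
        refine ⟨fun w s' hw => ?_, h2, by rw [Function.update_of_ne hvx, h3]⟩
        rw [Function.update_apply]
        split_ifs with hwx
        · subst hwx
          have := hp _ _ _ hxs hw
          omega
        · exact h1 w s' hw

/-- Reachability in at most `n` steps. -/
inductive Within (es : List Ev) (τ : ℕ → ℕ) : ℕ → ℕ → ℕ → Prop
  | refl (n u : ℕ) : Within es τ n u u
  | step {n u v w : ℕ} (h : Within es τ n u v) (h' : Adj es τ Set.univ v w) :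
      Within es τ (n + 1) u w

theorem Within.succ {τ : ℕ → ℕ} {n u v : ℕ} (h : Within es τ n u v) : Within es τ (n + 1) u v := by
  induction h with
  | refl n u => exact .refl _ _
  | step h h' ih => exact .step ih h'

theorem Within.le {τ : ℕ → ℕ} {n m u v : ℕ} (h : Within es τ n u v) (hnm : n ≤ m) :
    Within es τ m u v := by
  induction hnm with
  | refl => exact h
  | step _ ih => exact ih.succ

theorem Within.trans {τ : ℕ → ℕ} {n m u v w : ℕ} (h : Within es τ n u v)
    (h' : Within es τ m v w) : Within es τ (n + m) u w := by
  induction h' with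
  | refl m v => exact h.le (by omega)
  | step h1 h2 ih => exact .step (ih h) h2

theorem Within.symm {τ : ℕ → ℕ} {n u v : ℕ} (h : Within es τ n u v) : Within es τ n v u := by
  induction h with
  | refl n u => exact .refl _ _
  | @step n u v w h h' ih =>
    have h1 : Within es τ (0 + 1) w v := .step (.refl 0 w) h'.symm
    have := h1.trans ih
    rwa [zero_add, add_comm] at this

theorem exists_within {τ : ℕ → ℕ} {u v : ℕ} (h : Link es τ Set.univ u v) :
    ∃ n, Within es τ n u v := by
  induction h with
  | refl => exact ⟨0, .refl _ _⟩
  | tail _ h' ih =>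
    obtain ⟨n, hn⟩ := ih
    exact ⟨n + 1, hn.step h'⟩

theorem Within.link {τ : ℕ → ℕ} {n u v : ℕ} (h : Within es τ n u v) : Link es τ Set.univ u v := by
  induction h with
  | refl n u => exact .refl
  | step _ h' ih => exact .tail ih h'

/-- An initial part of a shortest walk to `x` does not meet the clauses that contain `x`. -/
theorem Within.avoid {τ : ℕ → ℕ} {x b L m u w : ℕ} (hx : τ x = 2) (h : Within es τ m u w) :
    m ≤ L → ¬ Within es τ L u x → Within es (Function.update τ x b) m u w := by
  induction h with
  | refl n u => intros; exact .refl _ _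
  | @step n u v w h h' ih =>
    intro hm hn
    refine .step (ih (by omega) hn) ?_
    obtain ⟨i, -, h1, h2⟩ := h'
    -- Otherwise one more step through the clause `i` would reach `x` within `L` steps.
    have hix : ¬ Occ es i x := fun ho => hn ((h.step ⟨i, trivial, h1, h1.1, ho, hx⟩).le hm)
    have key : ∀ y, LF es τ i y → LF es (Function.update τ x b) i y := by
      rintro y ⟨k1, k2, k3⟩
      refine ⟨fun z s hz => ?_, k2, ?_⟩
      · rw [Function.update_of_ne]
        · exact k1 z s hz
        · rintro rfl; exact hix ⟨s, hz⟩
      · rw [Function.update_of_ne]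
        · exact k3
        · rintro rfl; exact hix k2
    exact ⟨i, trivial, key v h1, key w h2⟩

/-- Half of a diameter that forces depth `n`. -/
def farDist : ℕ → ℕ
  | 0 => 0
  | n + 1 => 2 * (farDist n + 1)

/-- The closed form is `2 ^ (n + 1) - 2`; this is why `2 ^ (k + 2)` rounds of propagation suffice
for `n = k + 1`. -/
theorem farDist_le (n : ℕ) : farDist n + 2 = 2 ^ (n + 1) := by
  induction n with
  | zero => rfl
  | succ n ih => rw [farDist, pow_succ, ← ih]; ring

/-- The certificate is the whole component of `u`. Given a variable `x` of it, one end `y` of the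
far pair has distance more than `farDist n + 1` from `x`. Let `z` be the last variable before `x` on
a shortest walk from `y`. The walk to `z` avoids the clauses of `x` and survives the assignment, and
no assignment creates shortcuts, so `y` and `z` are a far pair for `n`. -/
theorem Hard.of_far_part (hs' : ∀ e ∈ es, e.2.2 < 2) {n : ℕ} : ∀ {τ : ℕ → ℕ} {u v : ℕ}, Link es τ Set.univ u v →
    ¬ Within es τ (farDist n) u v →
      Hard es n τ {i | ∃ w, LF es τ i w ∧ Link es τ Set.univ u w} := by
  induction n with
  | zero => intros; trivial
  | succ n ih =>
    intro τ u v hl hf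
    set O : Set ℕ := {i | ∃ w, LF es τ i w ∧ Link es τ Set.univ u w} with hO
    have hlink : ∀ w, Link es τ Set.univ u w → Link es τ O u w := by
      intro w hw
      induction hw with
      | refl => exact .refl
      | @tail a b h1 h2 ih2 =>
        obtain ⟨i, -, h3, h4⟩ := h2
        exact .tail ih2 ⟨i, ⟨a, h3, h1⟩, h3, h4⟩
    refine ⟨O, subset_rfl, ?_, u, ?_, ?_⟩
    · rcases Relation.ReflTransGen.cases_head hl with rfl | ⟨w, ⟨i, -, h1, h2⟩, -⟩
      · exact absurd (.refl _ _) hf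
      · exact ⟨i, u, h1, .refl⟩
    · rintro i ⟨w, hw, h⟩
      exact ⟨w, hw, hlink w h⟩
    · rintro i ⟨w, hw, hwl⟩ x hx
      -- Either value would do.
      refine ⟨0, by omega, ?_⟩
      have hux : Link es τ Set.univ u x := hwl.tail ⟨i, trivial, hw, hx⟩
      -- one of the two ends is far from `x`
      obtain ⟨y, hy, hyx⟩ : ∃ y, Link es τ Set.univ u y ∧ ¬ Within es τ (farDist n + 1) y x := by
        by_contra hcon
        push Not at hcon
        apply hf
        have := (hcon u .refl).trans (hcon v hl).symm
        rw [farDist, two_mul]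
        exact this
      have hyxl : Link es τ Set.univ y x := hy.symm.trans hux
      classical
      obtain ⟨L, hL, hmin⟩ : ∃ L, Within es τ L y x ∧ ∀ m < L, ¬ Within es τ m y x :=
        ⟨Nat.find (exists_within hyxl), Nat.find_spec (exists_within hyxl),
          fun m hm => Nat.find_min (exists_within hyxl) hm⟩
      have hLf : farDist n + 1 < L := by
        by_contra hcon
        exact hyx (hL.le (by omega))
      cases hL with
      | refl => exact absurd (.refl _ _) hyx
      | @step L' _ z _ h1 h2 =>
        have hav : Within es (Function.update τ x 0) L' y z :=
          h1.avoid (L := L') hx.2.2 le_rfl (hmin L' (by omega))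
        -- An assignment makes no clause live and no variable free, so distances can only grow.
        have back : ∀ j w, LF es (Function.update τ x 0) j w → LF es τ j w := by
          rintro j w ⟨k1, k2, k3⟩
          have hwx : w ≠ x := by
            rintro rfl
            simp at k3
          refine ⟨fun a s ha => ?_, k2, by rwa [Function.update_of_ne hwx] at k3⟩
          by_cases hax : a = x
          · subst hax
            rw [hx.2.2]
            intro h
            have := hs' _ ha
            simp only at this
            omega
          · have := k1 a s ha
            rwa [Function.update_of_ne hax] at this
        have hbackW : ∀ m a b, Within es (Function.update τ x 0) m a b → Within es τ m a b := by
          intro m a b h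
          induction h with
          | refl n u => exact .refl _ _
          | step _ h' ih =>
            obtain ⟨j, -, k1, k2⟩ := h'
            exact .step ih ⟨j, trivial, back _ _ k1, back _ _ k2⟩
        refine (ih hav.link fun hcon => ?_).superset ?_
        · have := (hbackW _ _ _ hcon).step h2
          exact hmin _ (by omega) this
        · rintro j ⟨w', k1, k2⟩
          exact ⟨w', back _ _ k1, hy.trans (k2.mono (fun j _ => back j) subset_rfl)⟩

end RecBackdoor

/-! ### Certificates bound the backdoor depth from below. -/

namespace RecBackdoor

variable {es : List Ev}

/-- What is left of the clause `c` in the assignment `τ`. -/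
def resid (τ : ℕ → ℕ) (c : Clause) : Clause := c.filter fun l => τ l.1 = 2

theorem mem_vars_resid {cl : ℕ → Clause} (hcl : ∀ i v b, (i, v, Bool.toNat b) ∈ es ↔ (v, b) ∈ cl i)
    (hs : ∀ e ∈ es, e.2.2 < 2) {τ : ℕ → ℕ} {i v : ℕ} :
    v ∈ Clause.vars (resid τ (cl i)) ↔ Occ es i v ∧ τ v = 2 := by
  simp only [Clause.vars, resid, Finset.mem_image, Finset.mem_filter, Prod.exists, exists_and_right,
    exists_eq_right]
  constructor
  · rintro ⟨⟨b, h1⟩, h2⟩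
    exact ⟨⟨_, (hcl i v b).mpr h1⟩, h2⟩
  · rintro ⟨⟨s, h1⟩, h2⟩
    have := hs _ h1
    simp only at this
    interval_cases s
    · exact ⟨⟨false, (hcl i v false).mp h1⟩, h2⟩
    · exact ⟨⟨true, (hcl i v true).mp h1⟩, h2⟩

/-- A clause that the new value does not satisfy lacks the literal `(x, b)`. So it is not deleted,
and erasing the opposite literal agrees with filtering by the updated assignment. -/
theorem Live.assign {cl : ℕ → Clause} (hcl : ∀ i v b, (i, v, Bool.toNat b) ∈ es ↔ (v, b) ∈ cl i)
    {τ : ℕ → ℕ} {ψ : Formula} {i x : ℕ} {b : Bool} (hx : τ x = 2) (h : resid τ (cl i) ∈ ψ)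
    (hl : Live es (Function.update τ x b.toNat) i) :
    resid (Function.update τ x b.toNat) (cl i) ∈ Formula.assign ψ x b := by
  simp only [Formula.assign, Finset.mem_image, Finset.mem_filter]
  have hxb : (x, b) ∉ cl i := fun hm => by
    have := hl x _ ((hcl i x b).mpr hm)
    simp at this
  refine ⟨_, ⟨h, fun hm => hxb (Finset.mem_filter.mp hm).1⟩, ?_⟩
  ext ⟨y, b'⟩
  simp only [resid, Finset.mem_erase, Finset.mem_filter, Function.update_apply]
  by_cases hyx : y = x
  · subst hyx
    have hb2 : b.toNat ≠ 2 := by cases b <;> simp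
    simp only [if_true, hb2, and_false, iff_false, not_and]
    intro h1 h2
    exfalso
    by_cases hbb : b' = b
    · exact hxb (hbb ▸ h2)
    · have : b' = !b := by cases b <;> cases b' <;> simp_all
      exact h1 (by rw [this])
  · simp [hyx]

theorem resid_mem_assign {ψ : Formula} {c : Clause} {x : ℕ} {b : Bool} (h : c ∈ ψ)
    (hx : x ∉ Clause.vars c) : c ∈ Formula.assign ψ x b := by
  have hx' : ∀ b, (x, b) ∉ c := fun b hb => hx (Finset.mem_image_of_mem Prod.fst hb)
  simp only [Formula.assign, Finset.mem_image, Finset.mem_filter]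
  exact ⟨c, ⟨h, hx' b⟩, Finset.erase_eq_of_notMem (hx' _)⟩

theorem incidence_adj {ψ : Formula} {c : Clause} {x : ℕ} (hc : Formula.IsVertex ψ (Sum.inr c))
    (hx : Formula.IsVertex ψ (Sum.inl x)) (h : x ∈ Clause.vars c) :
    (Formula.incidenceGraph ψ).Adj ⟨Sum.inl x, hx⟩ ⟨Sum.inr c, hc⟩ := by
  rw [Formula.incidenceGraph, SimpleGraph.fromRel_adj]
  refine ⟨by simp, Or.inl ⟨x, c, rfl, rfl, h⟩⟩

/-- A certificate bounds the depth of every strong recursive backdoor. -/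
theorem SRB.le_depth {cl : ℕ → Clause} (hcl : ∀ i v b, (i, v, Bool.toNat b) ∈ es ↔ (v, b) ∈ cl i)
    (hs : ∀ e ∈ es, e.2.2 < 2) {ψ : Formula} (T : SRB (widthAtMost 0) ψ) :
    ∀ (n : ℕ) (τ : ℕ → ℕ) (O : Set ℕ), Hard es n τ O →
      (∀ i ∈ O, ∀ v, LF es τ i v → resid τ (cl i) ∈ ψ) → (n : ℕ∞) ≤ T.depth := by
  induction T with
  | @leaf ψ h =>
    rintro (_ | n) τ O hO hψ
    · simp
    · obtain ⟨O', h1, ⟨i, hi⟩, r, h3, h4⟩ := hO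
      -- A certificate of positive level contains a clause with a free variable, which a leaf
      -- forbids.
      obtain ⟨v, hv, -⟩ := h3 i hi
      have hm := hψ i (h1 hi) v hv
      have := h _ hm
      have hv' := (mem_vars_resid hcl hs).mpr hv.2
      rw [Nat.le_zero, Finset.card_eq_zero] at this
      rw [this] at hv'
      exact absurd hv' (by simp)
  | @branch ψ h x hx T ih =>
    rintro (_ | n) τ O hO hψ
    · simp
    · obtain ⟨O', h1, hne, r, h3, h4⟩ := hO
      rw [SRB.depth]
      -- A branching over a variable of the certificate follows its bad value and uses up one level.
      -- Any other branching leaves the residual clauses of the certificate intact, so either child,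
      -- here that for `true`, has the full depth already.
      by_cases hxO : ∃ i ∈ O', LF es τ i x
      · obtain ⟨i, hi, hix⟩ := hxO
        obtain ⟨b, hb, h5⟩ := h4 i hi x hix
        obtain ⟨b, rfl⟩ : ∃ b' : Bool, b = b'.toNat := by
          interval_cases b
          · exact ⟨false, rfl⟩
          · exact ⟨true, rfl⟩
        have := ih b n _ O' h5 fun j hj v hv => by
          obtain ⟨w, hw, -⟩ := h3 j hj
          exact Live.assign hcl hix.2.2 (hψ j (h1 hj) w hw) hv.1
        rw [Nat.cast_add, Nat.cast_one, add_comm]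
        exact add_le_add_right (this.trans (le_iSup (fun b => (T b).depth) b)) 1
      · push Not at hxO
        have := ih true (n + 1) τ O' ⟨O', subset_rfl, hne, r, h3, h4⟩ fun j hj v hv => by
          refine resid_mem_assign (hψ j (h1 hj) v hv) fun hm => ?_
          obtain ⟨k1, k2⟩ := (mem_vars_resid hcl hs).mp hm
          exact hxO j hj ⟨hv.1, k1, k2⟩
        exact this.trans ((le_iSup (fun b => (T b).depth) true).trans le_add_self)
  | @split ψ h T ih =>
    rintro (_ | n) τ O hO hψ
    · simp
    · obtain ⟨O', h1, ⟨i, hi⟩, r, h3, h4⟩ := hO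
      rw [SRB.depth]
      have hmem : ∀ j ∈ O', resid τ (cl j) ∈ ψ := fun j hj => by
        obtain ⟨v, hv, -⟩ := h3 j hj
        exact hψ j (h1 hj) v hv
      have hvar : ∀ j ∈ O', ∀ v, LF es τ j v → Formula.IsVertex ψ (Sum.inl v) := fun j hj v hv =>
        Finset.mem_biUnion.mpr ⟨_, hmem j hj, (mem_vars_resid hcl hs).mpr hv.2⟩
      have hadj : ∀ j (hj : j ∈ O') v (hv : LF es τ j v), (Formula.incidenceGraph ψ).Adj
          ⟨Sum.inl v, hvar j hj v hv⟩ ⟨Sum.inr (resid τ (cl j)), hmem j hj⟩ := fun j hj v hv =>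
        incidence_adj _ _ ((mem_vars_resid hcl hs).mpr hv.2)
      -- Links inside the certificate are paths in the incidence graph, so all its clauses lie in
      -- one component, and the child for that component inherits the certificate.
      have hlink : ∀ u v, Link es τ O' u v → ∀ (j) (hj : j ∈ O') (hu : LF es τ j u) (k)
          (hk : k ∈ O') (hv : LF es τ k v),
          (Formula.incidenceGraph ψ).Reachable ⟨Sum.inl u, hvar j hj u hu⟩
            ⟨Sum.inl v, hvar k hk v hv⟩ := by
        intro u v huv
        induction huv with
        | refl => intros; exact .refl _
        | @tail a b h5 h6 ih2 =>
          obtain ⟨l, hl, h7, h8⟩ := h6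
          intro j hj hu k hk hv
          exact (ih2 j hj hu l hl h7).trans
            ((hadj l hl a h7).reachable.trans (hadj l hl b h8).symm.reachable)
      obtain ⟨v0, hv0, hr0⟩ := h3 i hi
      set K := (Formula.incidenceGraph ψ).connectedComponentMk
        ⟨Sum.inr (resid τ (cl i)), hmem i hi⟩ with hK
      have := ih K (n + 1) τ O' ⟨O', subset_rfl, ⟨i, hi⟩, r, h3, h4⟩ fun j hj v hv => by
        classical
        unfold Formula.component
        rw [Finset.mem_filter]
        refine ⟨hmem j hj, hmem j hj, ?_⟩
        rw [hK, SimpleGraph.ConnectedComponent.eq]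
        obtain ⟨w, hw, hrw⟩ := h3 j hj
        exact (hadj j hj w hw).symm.reachable.trans ((hlink w v0 (hrw.symm.trans hr0) j hj hw i hi
          hv0).trans (hadj i hi v0 hv0).reachable)
      exact this.trans (le_iSup (fun K => (T K).depth) K)

theorem Hard.le_srbd {cl : ℕ → Clause} (hcl : ∀ i v b, (i, v, Bool.toNat b) ∈ es ↔ (v, b) ∈ cl i)
    (hs : ∀ e ∈ es, e.2.2 < 2) {φ : Formula} {n : ℕ} {O : Set ℕ}
    (h : Hard es n (fun _ => 2) O) (hφ : ∀ i ∈ O, ∀ v, Occ es i v → cl i ∈ φ) :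
    (n : ℕ∞) ≤ srbd (widthAtMost 0) φ := by
  refine le_iInf fun T => T.le_depth hcl hs n _ O h fun i hi v hv => ?_
  simpa [resid] using hφ i hi v hv.2.1

end RecBackdoor

namespace RecBackdoor

/-! ### The effect of simple passes -/

/-- The occurrences of literals in the listed clauses. -/
def events (L : List (List Literal)) : List Ev :=
  L.zipIdx.flatMap fun p => p.1.map fun l => (p.2, l.1, l.2.toNat)

theorem passSem_skip (S LM : ℕ) (L : List (List Literal)) (B : C) (σ : HS) :
    passSem S LM L .skip B σ = (events L).foldl (fun σ e => B.run S LM e σ) σ := by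
  unfold passSem events
  rw [List.foldl_flatMap]
  simp only [List.foldl_map, C.run]

/-- The expression does not read the array `a`. -/
def E.avoids (a : Fin 32) : E → Bool
  | arr b _ x => b ≠ a && x.avoids a
  | eq x y | lt x y | and x y => x.avoids a && y.avoids a
  | _ => true

@[simp] theorem HS.lev_setA (σ : HS) (a : Fin 32) (l : ℕ) (f : ℕ → ℕ) : (σ.setA a l f).lev = σ.lev :=
  rfl

@[simp] theorem HS.reg_setA (σ : HS) (a : Fin 32) (l : ℕ) (f : ℕ → ℕ) : (σ.setA a l f).reg = σ.reg :=
  rfl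

@[simp] theorem HS.lv_setA (σ : HS) (a : Fin 32) (l : ℕ) (f : ℕ → ℕ) (ch : Bool) :
    (σ.setA a l f).lv ch = σ.lv ch := rfl

theorem HS.setA_setA (σ : HS) (a : Fin 32) (l : ℕ) (f g : ℕ → ℕ) :
    (σ.setA a l f).setA a l g = σ.setA a l g := by
  simp [HS.setA]

theorem HS.setA_self (σ : HS) (a : Fin 32) (l : ℕ) : σ.setA a l (σ.arr a l) = σ := by
  simp [HS.setA]

theorem HS.setA_comm (σ : HS) {a b : Fin 32} (hab : a ≠ b) (l m : ℕ) (f g : ℕ → ℕ) :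
    (σ.setA a l f).setA b m g = (σ.setA b m g).setA a l f := by
  ext
  · rfl
  · rfl
  · simp only [HS.setA_arr]
    split_ifs with h1 h2
    · exact absurd (h2.1.symm.trans h1.1) hab
    all_goals rfl

theorem E.eval_setA {S LM : ℕ} {e : Ev} {σ : HS} {a : Fin 32} {l : ℕ} {f : ℕ → ℕ} :
    ∀ {x : E}, x.avoids a = true → x.eval S LM e (σ.setA a l f) = x.eval S LM e σ
  | .arr b ch x, h => by
      simp only [avoids, Bool.and_eq_true, decide_eq_true_eq] at h
      simp only [eval, eval_setA h.2, HS.lv_setA, HS.setA_arr, h.1, false_and, if_false]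
  | .eq x y, h | .lt x y, h | .and x y, h => by
      simp only [avoids, Bool.and_eq_true] at h
      simp only [eval, eval_setA h.1, eval_setA h.2]
  | .c _, _ | .ci, _ | .cv, _ | .cs, _ | .reg _, _ | .top, _ | .bot, _ => rfl

@[simp] theorem E.eval_and_eq_zero {S LM : ℕ} {e : Ev} {σ : HS} {x y : E} :
    (E.and x y).eval S LM e σ = 0 ↔ ¬ (x.eval S LM e σ ≠ 0 ∧ y.eval S LM e σ ≠ 0) := by
  simp only [E.eval]; split_ifs <;> simp_all

@[simp] theorem E.eval_eq_eq_zero {S LM : ℕ} {e : Ev} {σ : HS} {x y : E} :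
    (E.eq x y).eval S LM e σ = 0 ↔ ¬ x.eval S LM e σ = y.eval S LM e σ := by
  simp only [E.eval]; split_ifs <;> simp_all

@[simp] theorem E.eval_lt_eq_zero {S LM : ℕ} {e : Ev} {σ : HS} {x y : E} :
    (E.lt x y).eval S LM e σ = 0 ↔ ¬ x.eval S LM e σ < y.eval S LM e σ := by
  simp only [E.eval]; split_ifs <;> simp_all

/-- The row `f` arises from the row `old` by assigning, for all events `(i, w, s)` that satisfy `G`
and in some order, the value `V i w s` to the entry `X i w s`. -/
def Scat (es : List Ev) (G : ℕ → ℕ → ℕ → Prop) (X V : ℕ → ℕ → ℕ → ℕ) (old f : ℕ → ℕ) : Prop :=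
  ∀ y, (∃ i w s, (i, w, s) ∈ es ∧ G i w s ∧ X i w s = y ∧ f y = V i w s) ∨
    ((∀ i w s, (i, w, s) ∈ es → G i w s → X i w s ≠ y) ∧ f y = old y)

/-- The pass that writes `v` into the entry `x` of a row for all events with the property `g`. -/
def Flat.wr (g : E) (a : Fin 32) (ch : Bool) (x v : E) : Flat :=
  .pass .skip (.ite g (.put a ch x v) .skip)

/-- Guard, index and value do not read the array that is written, so they can be evaluated in the
initial state throughout the pass, whatever the order of the events. -/
theorem Flat.wr_spec {S LM : ℕ} {L : List (List Literal)} (σ : HS) (g : E) (a : Fin 32) (ch : Bool)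
    (x v : E) (G : ℕ → ℕ → ℕ → Prop) (X V : ℕ → ℕ → ℕ → ℕ)
    (ha : (g.avoids a && x.avoids a && v.avoids a) = true)
    (h : ∀ i w s, (i, w, s) ∈ events L → (g.eval S LM (i, w, s) σ ≠ 0 ↔ G i w s) ∧
      (G i w s → x.eval S LM (i, w, s) σ = X i w s ∧ X i w s < S ∧
        v.eval S LM (i, w, s) σ = V i w s)) :
    ∃ f, (Flat.wr g a ch x v).sem S LM L σ = σ.setA a (σ.lv ch) f ∧
      Scat (events L) G X V (σ.arr a (σ.lv ch)) f := by
  simp only [Bool.and_eq_true] at ha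
  obtain ⟨⟨hg, hx⟩, hv⟩ := ha
  simp only [Flat.wr, Flat.sem, passSem_skip]
  generalize events L = es at h
  have key : ∀ (es' : List Ev) (old : ℕ → ℕ), (∀ e ∈ es', e ∈ es) → ∃ f,
      es'.foldl (fun σ e => (C.ite g (.put a ch x v) .skip).run S LM e σ) (σ.setA a (σ.lv ch) old) =
        σ.setA a (σ.lv ch) f ∧ Scat es' G X V old f := by
    intro es'
    induction es' with
    | nil => exact fun old _ => ⟨old, rfl, fun y => Or.inr ⟨by simp, rfl⟩⟩
    | cons e es' ih =>
      intro old hes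
      obtain ⟨i, w, s⟩ := e
      have he := h i w s (hes _ List.mem_cons_self)
      have hes' : ∀ e ∈ es', e ∈ es := fun e h => hes e (List.mem_cons_of_mem _ h)
      rw [List.foldl_cons]
      by_cases hG : G i w s
      · obtain ⟨k1, k2, k3⟩ := he.2 hG
        obtain ⟨f, hf, hs⟩ := ih (Function.update old (X i w s) (V i w s)) hes'
        refine ⟨f, ?_, fun y => ?_⟩
        · rw [← hf]; congr 1
          simp only [C.run, E.eval_setA hg, E.eval_setA hx, E.eval_setA hv, HS.lv_setA]
          rw [if_pos (he.1.mpr hG), k1, k3, if_pos k2, HS.setA_setA, HS.setA_arr, if_pos ⟨rfl, rfl⟩]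
        · rcases hs y with ⟨i', w', s', h1, h2, h3, h4⟩ | ⟨h1, h2⟩
          · exact Or.inl ⟨i', w', s', List.mem_cons_of_mem _ h1, h2, h3, h4⟩
          · by_cases hy : X i w s = y
            · refine Or.inl ⟨i, w, s, List.mem_cons_self, hG, hy, ?_⟩
              rw [h2, hy, Function.update_self]
            · refine Or.inr ⟨fun i' w' s' hm => ?_, ?_⟩
              · rcases List.mem_cons.mp hm with heq | hm
                · obtain ⟨rfl, rfl, rfl⟩ : i' = i ∧ w' = w ∧ s' = s := by simpa using heq
                  exact fun _ => hy
                · exact h1 i' w' s' hm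
              · rw [h2, Function.update_of_ne (Ne.symm hy)]
      · obtain ⟨f, hf, hs⟩ := ih old hes'
        refine ⟨f, ?_, fun y => ?_⟩
        · rw [← hf]; congr 1
          simp only [C.run, E.eval_setA hg]
          rw [if_neg (fun hh => hG (he.1.mp hh))]
        · rcases hs y with ⟨i', w', s', h1, h2, h3, h4⟩ | ⟨h1, h2⟩
          · exact Or.inl ⟨i', w', s', List.mem_cons_of_mem _ h1, h2, h3, h4⟩
          · refine Or.inr ⟨fun i' w' s' hm => ?_, h2⟩
            rcases List.mem_cons.mp hm with heq | hm
            · obtain ⟨rfl, rfl, rfl⟩ : i' = i ∧ w' = w ∧ s' = s := by simpa using heq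
              exact fun hh => absurd hh hG
            · exact h1 i' w' s' hm
  have := key es (σ.arr a (σ.lv ch)) fun _ h => h
  rwa [HS.setA_self] at this

/-- The row `f` arises from the row `old` by taking minima with the values `V i w s`; the row `h`
records the value `U i w s` for the last event that caused a change. -/
def ScatMin (es : List Ev) (G : ℕ → ℕ → ℕ → Prop) (X V U : ℕ → ℕ → ℕ → ℕ) (old oldh f h : ℕ → ℕ) :
    Prop :=
  ∀ y, f y ≤ old y ∧ (∀ i w s, (i, w, s) ∈ es → G i w s → X i w s = y → f y ≤ V i w s) ∧
    ((f y = old y ∧ h y = oldh y) ∨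
      ∃ i w s, (i, w, s) ∈ es ∧ G i w s ∧ X i w s = y ∧ f y = V i w s ∧ f y < old y ∧ h y = U i w s)

/-- The pass that takes minima. -/
def Flat.wrMin (g : E) (a b : Fin 32) (x v u : E) : Flat :=
  .pass .skip (.ite (.and g (.lt v (.arr a false x)))
    (.seq (.put b false x u) (.put a false x v)) .skip)

/-- Only the comparison reads the changing row (`hread`); everything else keeps its initial value. A
record is written along with each strict decrease, so it finally belongs to an event that attains
the minimum. -/
theorem Flat.wrMin_spec {S LM : ℕ} {L : List (List Literal)} (σ : HS) (g : E) (a b : Fin 32)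
    (x v u : E) (G : ℕ → ℕ → ℕ → Prop) (X V U : ℕ → ℕ → ℕ → ℕ) (hab : a ≠ b)
    (ha : (g.avoids a && x.avoids a && v.avoids a && u.avoids a) = true)
    (hb : (g.avoids b && x.avoids b && v.avoids b && u.avoids b) = true)
    (h : ∀ i w s, (i, w, s) ∈ events L → (g.eval S LM (i, w, s) σ ≠ 0 ↔ G i w s) ∧
      x.eval S LM (i, w, s) σ = X i w s ∧ X i w s < S ∧ (G i w s →
        v.eval S LM (i, w, s) σ = V i w s ∧ u.eval S LM (i, w, s) σ = U i w s)) :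
    ∃ f k, (Flat.wrMin g a b x v u).sem S LM L σ = (σ.setA a σ.lev f).setA b σ.lev k ∧
      ScatMin (events L) G X V U (σ.arr a σ.lev) (σ.arr b σ.lev) f k := by
  simp only [Bool.and_eq_true] at ha hb
  obtain ⟨⟨⟨hg, hx⟩, hv⟩, hu⟩ := ha
  obtain ⟨⟨⟨hg', hx'⟩, hv'⟩, hu'⟩ := hb
  simp only [Flat.wrMin, Flat.sem, passSem_skip]
  generalize events L = es at h
  have key : ∀ (es' : List Ev) (old oldk : ℕ → ℕ), (∀ e ∈ es', e ∈ es) → ∃ f k,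
      es'.foldl (fun σ e => (C.ite (.and g (.lt v (.arr a false x)))
        (.seq (.put b false x u) (.put a false x v)) .skip).run S LM e σ)
          ((σ.setA a σ.lev old).setA b σ.lev oldk) = (σ.setA a σ.lev f).setA b σ.lev k ∧
        ScatMin es' G X V U old oldk f k := by
    intro es'
    induction es' with
    | nil => exact fun old oldk _ => ⟨old, oldk, rfl, fun y => ⟨le_rfl, by simp, Or.inl ⟨rfl, rfl⟩⟩⟩
    | cons e es' ih =>
      intro old oldk hes
      obtain ⟨i, w, s⟩ := e
      have he := h i w s (hes _ List.mem_cons_self)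
      have hes' : ∀ e ∈ es', e ∈ es := fun e h => hes e (List.mem_cons_of_mem _ h)
      rw [List.foldl_cons]
      obtain ⟨he1, k1, k2, he2⟩ := he
      have hread : (E.arr a false x).eval S LM (i, w, s) ((σ.setA a σ.lev old).setA b σ.lev oldk) =
          old (X i w s) := by
        simp only [E.eval, E.eval_setA hx', E.eval_setA hx, k1, if_pos k2, HS.setA_arr, HS.lv,
          Bool.false_eq_true, if_false, HS.lev_setA, and_true, hab, if_true]
      by_cases hG : G i w s ∧ V i w s < old (X i w s)
      · obtain ⟨k3, k4⟩ := he2 hG.1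
        obtain ⟨f, k, hf, hs⟩ := ih (Function.update old (X i w s) (V i w s))
          (Function.update oldk (X i w s) (U i w s)) hes'
        refine ⟨f, k, ?_, fun y => ?_⟩
        · rw [← hf]; congr 1
          simp only [C.run]
          rw [if_pos]
          · simp only [E.eval_setA hx, E.eval_setA hx', E.eval_setA hv, E.eval_setA hv',
              E.eval_setA hu, E.eval_setA hu', k1, k3, k4, if_pos k2, HS.lv, Bool.false_eq_true,
              if_false, HS.lev_setA]
            rw [HS.setA_setA, HS.setA_comm _ hab.symm, HS.setA_setA]
            simp [HS.setA_arr, hab]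
          · simp only [ne_eq, E.eval_and_eq_zero, not_not, E.eval_lt_eq_zero, hread,
              E.eval_setA hg, E.eval_setA hg', E.eval_setA hv, E.eval_setA hv', k3]
            exact ⟨he1.mpr hG.1, hG.2⟩
        · obtain ⟨h1, h2, h3⟩ := hs y
          have hle : Function.update old (X i w s) (V i w s) y ≤ old y := by
            rw [Function.update_apply]; split_ifs with hy
            · rw [hy]; exact hG.2.le
            · exact le_rfl
          refine ⟨h1.trans hle, ?_, ?_⟩
          · intro i' w' s' hm hG' hX'
            rcases List.mem_cons.mp hm with heq | hm
            · obtain ⟨rfl, rfl, rfl⟩ : i' = i ∧ w' = w ∧ s' = s := by simpa using heq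
              subst hX'
              simpa using h1
            · exact h2 i' w' s' hm hG' hX'
          · rcases h3 with ⟨h4, h5⟩ | ⟨i', w', s', hm, g1, g2, g3, g4, g5⟩
            · by_cases hy : X i w s = y
              · subst hy
                rw [Function.update_self] at h4 h5
                exact Or.inr ⟨i, w, s, List.mem_cons_self, hG.1, rfl, h4, by omega, h5⟩
              · rw [Function.update_of_ne (Ne.symm hy)] at h4 h5
                exact Or.inl ⟨h4, h5⟩
            · exact Or.inr ⟨i', w', s', List.mem_cons_of_mem _ hm, g1, g2, g3, by omega, g5⟩
      · obtain ⟨f, k, hf, hs⟩ := ih old oldk hes'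
        refine ⟨f, k, ?_, fun y => ?_⟩
        · rw [← hf]; congr 1
          simp only [C.run]
          rw [if_neg]
          simp only [ne_eq, E.eval_and_eq_zero, not_not, E.eval_lt_eq_zero, hread,
              E.eval_setA hg, E.eval_setA hg', E.eval_setA hv, E.eval_setA hv']
          rintro ⟨h1, h2⟩
          have h1 := he1.mp h1
          rw [(he2 h1).1] at h2
          exact hG ⟨h1, h2⟩
        · obtain ⟨h1, h2, h3⟩ := hs y
          refine ⟨h1, ?_, ?_⟩
          · intro i' w' s' hm hG' hX'
            rcases List.mem_cons.mp hm with heq | hm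
            · obtain ⟨rfl, rfl, rfl⟩ : i' = i ∧ w' = w ∧ s' = s := by simpa using heq
              subst hX'
              have : ¬ V i' w' s' < old (X i' w' s') := fun hh => hG ⟨hG', hh⟩
              omega
            · exact h2 i' w' s' hm hG' hX'
          · rcases h3 with h4 | ⟨i', w', s', hm, g1, g2, g3, g4, g5⟩
            · exact Or.inl h4
            · exact Or.inr ⟨i', w', s', List.mem_cons_of_mem _ hm, g1, g2, g3, g4, g5⟩
  have := key es (σ.arr a σ.lev) (σ.arr b σ.lev) fun _ h => h
  rwa [HS.setA_self, HS.setA_self] at this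

end RecBackdoor

namespace RecBackdoor

/-! ### The commands of the algorithm

The rows: 0 the assignment, 1 live clauses, 2 component labels, 3 parent clauses, 4 minima of
clauses, 5 a flag, 6 the status of components, 7 candidates, 8 the number of values tried,
9 failures, 10 the obstruction, 11 and 12 selected variables, 13 a flag, 14 marked variables,
15 to 18 outcomes for components, 19 empty clauses, 20 the new part of the obstruction,
21 and 22 flags, 23 the next assignment.  Register 3 is the mode, register 4 the answer. -/

/-- The current occurrence is that of a free variable in a live clause, at the level itself or
(`ch`) at the level below. -/
def lfE (ch : Bool) : E := .and (.eq (.arr 1 ch .ci) (.c 1)) (.eq (.arr 0 ch .cv) (.c 2))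

/-- All variables and clauses that occur are in the range of the rows. -/
def InRange (S : ℕ) (L : List (List Literal)) : Prop :=
  0 < S ∧ ∀ i w s, (i, w, s) ∈ events L → i < S ∧ w < S ∧ s < 2

infixr:60 " ;;; " => Flat.seq

infixr:58 " ;;;; " => Cmd.seq

/-- The row of parents is written twice, so that it holds a clause index for every occurring
variable, and a live clause whenever the variable is free in one. -/
def initF : Flat :=
  .wr (.c 1) 1 false .ci (.c 1) ;;; .wr (.eq (.arr 0 false .cv) .cs) 1 false .ci (.c 0) ;;;
  .wr (.c 1) 2 false .cv .cv ;;; .wr (.c 1) 3 false .cv .ci ;;; .wr (lfE false) 3 false .cv .ci ;;;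
  .wr (.c 1) 6 false .cv (.c 0) ;;; .wr (.c 1) 7 false .cv (.c 0) ;;;
  .wr (.c 1) 8 false .cv (.c 0) ;;; .wr (.c 1) 9 false .cv (.c 0) ;;;
  .wr (.c 1) 10 false .ci (.c 0)

/-- The row is first set to an arbitrary label of the clause, since a smaller leftover would spoil
the minimum. Row 24 only absorbs the records. -/
def cminF : Flat :=
  .wr (lfE false) 4 false .ci (.arr 2 false .cv) ;;;
  .wrMin (lfE false) 4 24 .ci (.arr 2 false .cv) .ci

/-- Labels travel by one clause per round; the clause from which a label was taken becomes the
parent. -/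
def labelF : Flat := cminF ;;; .wrMin (lfE false) 2 3 .cv (.arr 4 false .ci) .ci

def rootE : E := .and (lfE false) (.eq (.arr 2 false .cv) .cv)

/-- At level `0` everything is left open. Above it, if some clause still sees two labels after `D`
rounds, then the diameter is too large and the run halts (mode 3) with the answer 2. Otherwise the
roots become candidates and their parent clauses are marked, so that every obstruction is nonempty.
-/
def enterCmd : Cmd :=
  .flat initF ;;;;
  .ite .bot (.flat (.once (.set 3 (.c 2))))
    (.rep labelF ;;;; .flat (cminF ;;; .once (.put 5 false (.c 0) (.c 0)) ;;;
        .wr (.and (lfE false) (.lt (.arr 4 false .ci) (.arr 2 false .cv))) 5 false (.c 0) (.c 1)) ;;;;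
      .ite (.arr 5 false (.c 0)) (.flat (.once (.seq (.set 3 (.c 3)) (.set 4 (.c 2)))))
        (.flat (.wr rootE 7 false .cv (.c 1) ;;; .wr rootE 10 false (.arr 3 false .cv) (.c 1) ;;;
          .once (.set 3 (.c 1)))))

/-- The variable can be selected: it is a candidate, one of its values has not been tried, and its
component is undecided. -/
def pickE : E :=
  .and (lfE false) (.and (.eq (.arr 7 false .cv) (.c 1)) (.and (.lt (.arr 8 false .cv) (.c 2))
    (.eq (.arr 6 false (.arr 2 false .cv)) (.c 0))))

/-- For each label, row 11 keeps the pickable variable that was written last, and only this one is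
selected. Leftovers do no harm, because any pickable variable overwrites the entry of its own
component. -/
def pickF : Flat :=
  .wr pickE 11 false (.arr 2 false .cv) .cv ;;; .wr (.c 1) 12 false .cv (.c 0) ;;;
  .wr (.and pickE (.eq (.arr 11 false (.arr 2 false .cv)) .cv)) 12 false .cv (.c 1) ;;;
  .once (.put 13 false (.c 0) (.c 0)) ;;;
  .wr (.eq (.arr 12 false .cv) (.c 1)) 13 false (.c 0) (.c 1)

def closeF : Flat :=
  .wr (.and (lfE false) (.eq (.arr 10 false .ci) (.c 1))) 14 false .cv (.c 1) ;;;
  .wr (.and (lfE false) (.eq (.arr 14 false .cv) (.c 1))) 10 false (.arr 3 false .cv) (.c 1)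

/-- The count in row 8 is at the same time the next value to try: `0`, then `1`. The selected
variables of all components are assigned together, and a single call serves them all. -/
def roundCmd : Cmd :=
  .flat pickF ;;;;
  .ite (.arr 13 false (.c 0))
    (.flat (.wr (.c 1) 23 false .cv (.arr 0 false .cv) ;;;
        .wr (.eq (.arr 12 false .cv) (.c 1)) 23 false .cv (.arr 8 false .cv) ;;;
        .wr (.c 1) 0 true .cv (.arr 23 false .cv) ;;; .once (.set 3 (.c 0))) ;;;; .down)
    (.flat (.wr (.c 1) 14 false .cv (.c 0)) ;;;; .rep closeF ;;;; .flat (.once (.set 3 (.c 2))))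

/-- Seen from the calling level: the occurrence belongs to a component of the call with status `n`.
-/
def outE (n : Fin 8) : E :=
  .and (lfE true) (.eq (.arr 6 true (.arr 2 true .cv)) (.c n))

/-- A single unsatisfiable component settles the formula; failing that, an open one shows that the
depth exceeds the parameter. -/
def finishF : Flat :=
  .once (.seq (.put 21 false (.c 0) (.c 0)) (.put 22 false (.c 0) (.c 0))) ;;;
  .wr (outE 2) 21 false (.c 0) (.c 1) ;;; .wr (outE 0) 22 false (.c 0) (.c 1) ;;;
  .once (.seq (.ite (.arr 21 false (.c 0)) (.set 4 (.c 0))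
    (.ite (.arr 22 false (.c 0)) (.set 4 (.c 2)) (.set 4 (.c 1)))) (.set 3 (.c 3)))

def labE : E := .arr 2 false .cv

/-- The component has a selected variable, so that the result of the call says something new about
it. -/
def hpE : E := .eq (.arr 15 false labE) (.c 1)

def selE (u f : Fin 8) : E :=
  .and (lfE false) (.and (.eq (.arr 12 false .cv) (.c 1))
    (.and (.eq (.arr 18 false labE) (.c u)) (.eq (.arr 16 false labE) (.c f))))

/-- A component may break into several components of the call. Row 16 tells whether one of them is
open, and row 17 names one such; only its obstruction is kept (row 20), so that a round adds at most
one obstruction. A live clause without free variables (row 19) counts as an unsatisfiable part, like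
a component of status 2 (row 18). -/
def outcomeF : Flat :=
  .wr (.c 1) 15 false .cv (.c 0) ;;;
  .wr (.and (lfE false) (.eq (.arr 12 false .cv) (.c 1))) 15 false labE (.c 1) ;;;
  .wr (.c 1) 16 false .cv (.c 0) ;;; .wr (.and (lfE false) (.and hpE (outE 0))) 16 false labE (.c 1) ;;;
  .wr (.and (lfE false) (.and hpE (outE 0))) 17 false labE (.arr 2 true .cv) ;;;
  .wr (.c 1) 19 false .ci (.c 0) ;;;
  .wr (.eq (.arr 1 true .ci) (.c 1)) 19 false .ci (.c 1) ;;;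
  .wr (.eq (.arr 0 true .cv) (.c 2)) 19 false .ci (.c 0) ;;;
  .wr (.c 1) 18 false .cv (.c 0) ;;; .wr (.and (lfE false) (outE 2)) 18 false labE (.c 1) ;;;
  .wr (.and (lfE false) (.eq (.arr 19 false .ci) (.c 1))) 18 false labE (.c 1) ;;;
  .wr (.c 1) 20 false .ci (.c 0) ;;;
  .wr (.and (lfE false) (.and (lfE true) (.and hpE (.and (.eq (.arr 16 false labE) (.c 1))
    (.and (.eq (.arr 10 true .ci) (.c 1)) (.eq (.arr 2 true .cv) (.arr 17 false labE)))))))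
    20 false .ci (.c 1)

/-- An unsatisfiable part takes precedence over an open one. Only when the root itself was selected
does the new obstruction yield candidates. As the language cannot add, the count in row 8 is derived
from the value just tried. -/
def recordF : Flat :=
  .wr (.eq (.arr 20 false .ci) (.c 1)) 10 false .ci (.c 1) ;;;
  .wr (.and (lfE false) (.and (.eq (.arr 20 false .ci) (.c 1)) (.eq (.arr 12 false labE) (.c 1))))
    7 false .cv (.c 1) ;;;
  .wr (selE 0 1) 9 false .cv (.c 1) ;;; .wr (selE 0 0) 6 false labE (.c 1) ;;;
  .wr (.and (.eq (.arr 12 false .cv) (.c 1)) (.eq (.arr 0 true .cv) (.c 0))) 8 false .cv (.c 1) ;;;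
  .wr (.and (.eq (.arr 12 false .cv) (.c 1)) (.eq (.arr 0 true .cv) (.c 1))) 8 false .cv (.c 2) ;;;
  .wr (.and (lfE false) (.and (.eq (.arr 12 false .cv) (.c 1)) (.and (.eq (.arr 18 false labE) (.c 1))
    (.and (.eq (.arr 8 false .cv) (.c 2)) (.eq (.arr 9 false .cv) (.c 0)))))) 6 false labE (.c 2) ;;;
  .once (.set 3 (.c 1))

def returnCmd : Cmd :=
  .up ;;;; .ite .top (.flat finishF) (.flat (outcomeF ;;; recordF))

/-- One step of the recursion: depending on the mode, start at a level, start a round, or return to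
the level above. -/
def stepCmd : Cmd :=
  .ite (.eq (.reg 3) (.c 0)) enterCmd (.ite (.eq (.reg 3) (.c 1)) roundCmd returnCmd)

theorem lfE_eval {S LM : ℕ} {L : List (List Literal)} (hr : InRange S L) {i w s : ℕ}
    (h : (i, w, s) ∈ events L) (σ : HS) (ch : Bool) : ((lfE ch).eval S LM (i, w, s) σ = 0) ↔
      ¬ (σ.arr 1 (σ.lv ch) i = 1 ∧ σ.arr 0 (σ.lv ch) w = 2) := by
  obtain ⟨h1, h2, -⟩ := hr.2 i w s h
  simp [lfE, E.eval, h1, h2]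

theorem Scat.const {es : List Ev} {X V : ℕ → ℕ → ℕ → ℕ} {old f : ℕ → ℕ}
    (h : Scat es (fun _ _ _ => True) X V old f) {i w s : ℕ} (he : (i, w, s) ∈ es) :
    ∃ i' w' s', (i', w', s') ∈ es ∧ X i' w' s' = X i w s ∧ f (X i w s) = V i' w' s' := by
  rcases h (X i w s) with ⟨i', w', s', h1, -, h2, h3⟩ | ⟨h1, -⟩
  · exact ⟨i', w', s', h1, h2, h3⟩
  · exact absurd rfl (h1 i w s he trivial)

theorem Flat.fillV {S LM : ℕ} {L : List (List Literal)} (hr : InRange S L) (σ : HS)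
    (a : Fin 32) (n : Fin 8) {l : ℕ} (hl : σ.lev = l) :
    ∃ f, (Flat.wr (.c 1) a false .cv (.c n)).sem S LM L σ = σ.setA a l f ∧
      ∀ i w s, (i, w, s) ∈ events L → f w = n := by
  subst hl
  obtain ⟨f, e, h⟩ := Flat.wr_spec (S := S) (LM := LM) (L := L) σ (.c 1) a false .cv (.c n)
    (fun _ _ _ => True) (fun _ w _ => w) (fun _ _ _ => n) rfl (fun i w s he => by
      simp [E.eval, hr.2 i w s he])
  refine ⟨f, e, fun i w s he => ?_⟩
  obtain ⟨_, _, _, -, -, h3⟩ := h.const he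
  exact h3

theorem Flat.fillI {S LM : ℕ} {L : List (List Literal)} (hr : InRange S L) (σ : HS)
    (a : Fin 32) (n : Fin 8) {l : ℕ} (hl : σ.lev = l) :
    ∃ f, (Flat.wr (.c 1) a false .ci (.c n)).sem S LM L σ = σ.setA a l f ∧
      ∀ i w s, (i, w, s) ∈ events L → f i = n := by
  subst hl
  obtain ⟨f, e, h⟩ := Flat.wr_spec (S := S) (LM := LM) (L := L) σ (.c 1) a false .ci (.c n)
    (fun _ _ _ => True) (fun i _ _ => i) (fun _ _ _ => n) rfl (fun i w s he => by
      simp [E.eval, hr.2 i w s he])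
  refine ⟨f, e, fun i w s he => ?_⟩
  obtain ⟨_, _, _, -, -, h3⟩ := h.const he
  exact h3

theorem init_spec {S LM : ℕ} {L : List (List Literal)} (hr : InRange S L) (σ : HS) :
    ∃ f1 f2 f3 f6 f7 f8 f9 f10, initF.sem S LM L σ = ((((((((σ.setA 1 σ.lev f1).setA 2 σ.lev f2).setA
        3 σ.lev f3).setA 6 σ.lev f6).setA 7 σ.lev f7).setA 8 σ.lev f8).setA 9 σ.lev f9).setA
        10 σ.lev f10) ∧
      ∀ i w s, (i, w, s) ∈ events L → (f1 i = 1 ↔ Live (events L) (σ.arr 0 σ.lev) i) ∧ f2 w = w ∧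
        f3 w < S ∧ (LF (events L) (σ.arr 0 σ.lev) i w → LF (events L) (σ.arr 0 σ.lev) (f3 w) w) ∧
        f6 w = 0 ∧ f7 w = 0 ∧ f8 w = 0 ∧ f9 w = 0 ∧ f10 i = 0 := by
  unfold initF
  simp only [Flat.sem]
  obtain ⟨f1, e1, s1⟩ := Flat.fillI (LM := LM) hr σ 1 1 rfl
  rw [e1]
  obtain ⟨g1, e2, s2⟩ := Flat.wr_spec (S := S) (LM := LM) (L := L) (σ.setA 1 σ.lev f1)
    (.eq (.arr 0 false .cv) .cs) 1 false .ci (.c 0)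
    (fun _ w s => σ.arr 0 σ.lev w = s) (fun i _ _ => i) (fun _ _ _ => 0) rfl (fun i w s he => by
      simp [E.eval, hr.2 i w s he, HS.setA_arr, HS.lv])
  rw [e2]
  simp only [HS.lv, HS.lev_setA, Bool.false_eq_true, if_false, HS.setA_setA, HS.setA_arr, and_true,
    if_true] at s2 ⊢
  obtain ⟨f2, e3, s3⟩ := Flat.wr_spec (S := S) (LM := LM) (L := L) (σ.setA 1 σ.lev g1)
    (.c 1) 2 false .cv .cv
    (fun _ w s => True) (fun i w _ => w) (fun _ w _ => w) rfl (fun i w s he => by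
      simp [E.eval, hr.2 i w s he])
  rw [e3]
  simp only [HS.lv, HS.lev_setA, Bool.false_eq_true, if_false] at s3 ⊢
  obtain ⟨f3, e4, s4⟩ := Flat.wr_spec (S := S) (LM := LM) (L := L)
    ((σ.setA 1 σ.lev g1).setA 2 σ.lev f2) (.c 1) 3 false .cv .ci
    (fun _ w s => True) (fun i w _ => w) (fun i w _ => i) rfl (fun i w s he => by
      simp [E.eval, hr.2 i w s he])
  rw [e4]
  simp only [HS.lv, HS.lev_setA, Bool.false_eq_true, if_false] at s4 ⊢
  obtain ⟨g3, e5, s5⟩ := Flat.wr_spec (S := S) (LM := LM) (L := L)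
    (((σ.setA 1 σ.lev g1).setA 2 σ.lev f2).setA 3 σ.lev f3) (lfE false) 3 false .cv .ci
    (fun i w s => g1 i = 1 ∧ σ.arr 0 σ.lev w = 2) (fun i w _ => w) (fun i w _ => i) rfl
    (fun i w s he => by
      simp [lfE_eval hr he, E.eval, hr.2 i w s he, HS.setA_arr, HS.lv])
  rw [e5]
  simp only [HS.lv, HS.lev_setA, Bool.false_eq_true, if_false, HS.setA_setA, HS.setA_arr, and_true,
    if_true] at s5 ⊢
  obtain ⟨f6, e6, s6⟩ := Flat.fillV (LM := LM) hr
    (((σ.setA 1 σ.lev g1).setA 2 σ.lev f2).setA 3 σ.lev g3) 6 0 rfl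
  rw [e6]
  obtain ⟨f7, e7, s7⟩ := Flat.fillV (LM := LM) hr
    ((((σ.setA 1 σ.lev g1).setA 2 σ.lev f2).setA 3 σ.lev g3).setA 6 σ.lev f6) 7 0 rfl
  erw [e7]
  obtain ⟨f8, e8, s8⟩ := Flat.fillV (LM := LM) hr (((((σ.setA 1 σ.lev g1).setA 2 σ.lev f2).setA 3
    σ.lev g3).setA 6 σ.lev f6).setA 7 σ.lev f7) 8 0 rfl
  erw [e8]
  obtain ⟨f9, e9, s9⟩ := Flat.fillV (LM := LM) hr ((((((σ.setA 1 σ.lev g1).setA 2 σ.lev f2).setA 3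
    σ.lev g3).setA 6 σ.lev f6).setA 7 σ.lev f7).setA 8 σ.lev f8) 9 0 rfl
  erw [e9]
  obtain ⟨f10, e10, s10⟩ := Flat.fillI (LM := LM) hr (((((((σ.setA 1 σ.lev g1).setA 2 σ.lev
    f2).setA 3 σ.lev g3).setA 6 σ.lev f6).setA 7 σ.lev f7).setA 8 σ.lev f8).setA 9 σ.lev f9) 10 0
    rfl
  erw [e10]
  refine ⟨g1, f2, g3, f6, f7, f8, f9, f10, rfl, fun i w s he => ?_⟩
  have hlive : ∀ i w s, (i, w, s) ∈ events L →
      (g1 i = 1 ↔ Live (events L) (σ.arr 0 σ.lev) i) := by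
    intro i w s he
    have h1 := s1 i w s he
    rcases s2 i with ⟨i', w', s', k1, k2, rfl, k4⟩ | ⟨k1, k2⟩
    · simp only [k4, zero_ne_one, false_iff]
      exact fun hl => hl w' s' k1 k2
    · rw [k2, h1]
      refine ⟨fun _ w' s' k3 k4 => k1 i w' s' k3 k4 rfl, fun _ => by simp⟩
  have h6 := s6 i w s he
  have h7 := s7 i w s he
  have h8 := s8 i w s he
  have h9 := s9 i w s he
  have h10 := s10 i w s he
  refine ⟨hlive i w s he, ?_, ?_, ?_, h6, h7, h8, h9, h10⟩
  · obtain ⟨i', w', s', -, k2, k3⟩ := s3.const he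
    rw [k3]; exact k2
  · rcases s5 w with ⟨i', w', s', k1, k2, rfl, k4⟩ | ⟨k1, k2⟩
    · rw [k4]; exact (hr.2 _ _ _ k1).1
    · obtain ⟨i', w', s', k3, -, k4⟩ := s4.const he
      rw [k2, k4]; exact (hr.2 _ _ _ k3).1
  · intro hl
    rcases s5 w with ⟨i', w', s', k1, ⟨k2, k5⟩, rfl, k4⟩ | ⟨k1, k2⟩
    · rw [k4]; exact ⟨(hlive _ _ _ k1).mp k2, ⟨s', k1⟩, k5⟩
    · exact absurd rfl (k1 i w s he ⟨(hlive i w s he).mpr hl.1, hl.2.2⟩)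

end RecBackdoor

/-! ### Component labels and the forest of parent clauses. -/

namespace RecBackdoor

/-- Only the rows of level `l` of the arrays in `As` have changed. -/
structure Chg (As : List (Fin 32)) (l : ℕ) (σ σ' : HS) : Prop where
  lev : σ'.lev = σ.lev
  reg : σ'.reg = σ.reg
  arr : ∀ a m, (a ∈ As → m ≠ l) → σ'.arr a m = σ.arr a m

theorem Chg.refl (As : List (Fin 32)) (l : ℕ) (σ : HS) : Chg As l σ σ := ⟨rfl, rfl, fun _ _ _ => rfl⟩

theorem Chg.trans {As : List (Fin 32)} {l : ℕ} {σ σ' σ'' : HS} (h : Chg As l σ σ')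
    (h' : Chg As l σ' σ'') : Chg As l σ σ'' :=
  ⟨h'.lev.trans h.lev, h'.reg.trans h.reg, fun a m ha => (h'.arr a m ha).trans (h.arr a m ha)⟩

theorem Chg.setA {As : List (Fin 32)} {l : ℕ} {σ σ' : HS} (h : Chg As l σ σ') {a : Fin 32}
    (ha : a ∈ As) (f : ℕ → ℕ) : Chg As l σ (σ'.setA a l f) := by
  refine ⟨h.lev, h.reg, fun b m hb => ?_⟩
  rw [HS.setA_arr, if_neg, h.arr b m hb]
  rintro ⟨rfl, rfl⟩
  exact hb ha rfl

theorem Flat.wr_at {S LM : ℕ} {L : List (List Literal)} (σ : HS) (g : E) (a : Fin 32) (ch : Bool)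
    (x v : E) {l : ℕ} (hl : σ.lv ch = l) (G : ℕ → ℕ → ℕ → Prop) (X V : ℕ → ℕ → ℕ → ℕ)
    (ha : (g.avoids a && x.avoids a && v.avoids a) = true)
    (h : ∀ i w s, (i, w, s) ∈ events L → (g.eval S LM (i, w, s) σ ≠ 0 ↔ G i w s) ∧
      (G i w s → x.eval S LM (i, w, s) σ = X i w s ∧ X i w s < S ∧
        v.eval S LM (i, w, s) σ = V i w s)) :
    ∃ f, (Flat.wr g a ch x v).sem S LM L σ = σ.setA a l f ∧
      Scat (events L) G X V (σ.arr a l) f := by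
  subst hl
  exact Flat.wr_spec σ g a ch x v G X V ha h

theorem Flat.wrMin_at {S LM : ℕ} {L : List (List Literal)} (σ : HS) (g : E) (a b : Fin 32)
    (x v u : E) {l : ℕ} (hl : σ.lev = l) (G : ℕ → ℕ → ℕ → Prop) (X V U : ℕ → ℕ → ℕ → ℕ) (hab : a ≠ b)
    (ha : (g.avoids a && x.avoids a && v.avoids a && u.avoids a) = true)
    (hb : (g.avoids b && x.avoids b && v.avoids b && u.avoids b) = true)
    (h : ∀ i w s, (i, w, s) ∈ events L → (g.eval S LM (i, w, s) σ ≠ 0 ↔ G i w s) ∧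
      x.eval S LM (i, w, s) σ = X i w s ∧ X i w s < S ∧ (G i w s →
        v.eval S LM (i, w, s) σ = V i w s ∧ u.eval S LM (i, w, s) σ = U i w s)) :
    ∃ f k, (Flat.wrMin g a b x v u).sem S LM L σ = (σ.setA a l f).setA b l k ∧
      ScatMin (events L) G X V U (σ.arr a l) (σ.arr b l) f k := by
  subst hl
  exact Flat.wrMin_spec σ g a b x v u G X V U hab ha hb h

/-- The row 1 tells which clauses are live. -/
def LiveOK (L : List (List Literal)) (τ live : ℕ → ℕ) : Prop :=
  ∀ i w s, (i, w, s) ∈ events L → (live i = 1 ↔ Live (events L) τ i)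

theorem lfE_LF {S LM : ℕ} {L : List (List Literal)} (hr : InRange S L) {i w s : ℕ}
    (h : (i, w, s) ∈ events L) (σ : HS) (ch : Bool) {l : ℕ} (hl : σ.lv ch = l) {τ : ℕ → ℕ}
    (hτ : σ.arr 0 l = τ) (hlive : LiveOK L τ (σ.arr 1 l)) :
    ((lfE ch).eval S LM (i, w, s) σ = 0) ↔ ¬ LF (events L) τ i w := by
  subst hl hτ
  rw [lfE_eval hr h, hlive i w s h]
  simp only [LF, Occ]
  refine not_congr ⟨fun h' => ⟨h'.1, ⟨s, h⟩, h'.2⟩, fun h' => ⟨h'.1, h'.2.2⟩⟩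

theorem cmin_spec {S LM : ℕ} {L : List (List Literal)} (hr : InRange S L) (σ : HS) {l : ℕ}
    (hl : σ.lev = l) {τ : ℕ → ℕ} (hτ : σ.arr 0 l = τ) (hlive : LiveOK L τ (σ.arr 1 l)) :
    ∃ c d, cminF.sem S LM L σ = (σ.setA 4 l c).setA 24 l d ∧
      ∀ i w, LF (events L) τ i w → c i ≤ σ.arr 2 l w ∧
        ∃ u, LF (events L) τ i u ∧ c i = σ.arr 2 l u := by
  unfold cminF
  simp only [Flat.sem]
  obtain ⟨c0, e1, s1⟩ := Flat.wr_at (S := S) (LM := LM) (L := L) σ (lfE false) 4 false .ci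
    (.arr 2 false .cv) (l := l) hl (fun i w _ => LF (events L) τ i w) (fun i _ _ => i)
    (fun _ w _ => σ.arr 2 l w) rfl (fun i w s he => by
      simp [lfE_LF hr he σ false hl hτ hlive, E.eval, hr.2 i w s he, HS.lv, hl])
  rw [e1]
  obtain ⟨c, d, e2, s2⟩ := Flat.wrMin_at (S := S) (LM := LM) (L := L) (σ.setA 4 l c0) (lfE false) 4 24
    .ci (.arr 2 false .cv) .ci (l := l) hl (fun i w _ => LF (events L) τ i w) (fun i _ _ => i)
    (fun _ w _ => σ.arr 2 l w) (fun i _ _ => i) (by decide) rfl rfl (fun i w s he => by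
      have := lfE_LF (LM := LM) hr he (σ.setA 4 l c0) false (l := l) hl (by simpa [HS.setA_arr] using hτ)
        (by simpa [HS.setA_arr] using hlive)
      simp [this, E.eval, hr.2 i w s he, HS.lv, hl, HS.setA_arr])
  rw [e2, HS.setA_setA]
  refine ⟨c, d, rfl, fun i w hw => ?_⟩
  obtain ⟨s, hs⟩ := hw.2.1
  obtain ⟨h1, h2, h3⟩ := s2 i
  refine ⟨h2 i w s hs hw rfl, ?_⟩
  simp only [HS.setA_arr, and_self, if_true] at h1 h3
  rcases h3 with ⟨h4, -⟩ | ⟨i', u, s', -, k2, rfl, k4, -⟩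
  · rcases s1 i with ⟨i', u, s', -, k2, rfl, k4⟩ | ⟨k1, -⟩
    · exact ⟨u, k2, h4.trans k4⟩
    · exact absurd rfl (k1 i w s hs hw)
  · exact ⟨u, k2, k4⟩

/-- The invariant of the propagation of labels, after `t` rounds. -/
structure LabInv (L : List (List Literal)) (S : ℕ) (τ : ℕ → ℕ) (t : ℕ) (lab par : ℕ → ℕ) : Prop where
  link : ∀ i w, LF (events L) τ i w → Link (events L) τ Set.univ (lab w) w
  le : ∀ i w, Occ (events L) i w → lab w ≤ w
  within : ∀ i w u, LF (events L) τ i w → Within (events L) τ t u w → lab w ≤ u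
  -- `tm w` is the round in which the label of `w` was last changed. The label of the variable from
  -- which it came may have decreased since, hence the lexicographic comparison.
  chain : ∃ tm : ℕ → ℕ, ∀ i w, LF (events L) τ i w → tm w ≤ t ∧ LF (events L) τ (par w) w ∧
    (lab w = w ∨ ∃ u, LF (events L) τ (par w) u ∧ (lab u < lab w ∨ lab u = lab w ∧ tm u < tm w))
  par : ∀ i w, Occ (events L) i w → par w < S

theorem label_spec {S LM : ℕ} {L : List (List Literal)} (hr : InRange S L) (σ : HS) {l : ℕ}
    (hl : σ.lev = l) {τ : ℕ → ℕ} (hτ : σ.arr 0 l = τ) (hlive : LiveOK L τ (σ.arr 1 l)) {t : ℕ}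
    (hi : LabInv L S τ t (σ.arr 2 l) (σ.arr 3 l)) :
    ∃ σ', labelF.sem S LM L σ = σ' ∧ Chg [2, 3, 4, 24] l σ σ' ∧
      LabInv L S τ (t + 1) (σ'.arr 2 l) (σ'.arr 3 l) := by
  unfold labelF
  simp only [Flat.sem]
  obtain ⟨c, d, e1, s1⟩ := cmin_spec (LM := LM) hr σ hl hτ hlive
  rw [e1]
  obtain ⟨f, k, e2, s2⟩ := Flat.wrMin_at (S := S) (LM := LM) (L := L) ((σ.setA 4 l c).setA 24 l d)
    (lfE false) 2 3 .cv (.arr 4 false .ci) .ci (l := l) hl (fun i w _ => LF (events L) τ i w)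
    (fun _ w _ => w) (fun i _ _ => c i) (fun i _ _ => i) (by decide) rfl rfl (fun i w s he => by
      have := lfE_LF (LM := LM) hr he ((σ.setA 4 l c).setA 24 l d) false (l := l) hl
        (by simpa [HS.setA_arr] using hτ) (by simpa [HS.setA_arr] using hlive)
      simp [this, E.eval, hr.2 i w s he, HS.lv, hl, HS.setA_arr])
  refine ⟨_, e2, ?_, ?_⟩
  · exact ((((Chg.refl _ l σ).setA (by simp) c).setA (by simp) d).setA (by simp) f).setA (by simp) k
  simp only [HS.setA_arr] at s2 ⊢
  simp only [Fin.reduceEq, false_and, if_false, and_self, if_true] at s2 ⊢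
  set lab := σ.arr 2 l
  set par := σ.arr 3 l
  have hle : ∀ w, f w ≤ lab w := fun w => (s2 w).1
  have hstep : ∀ i u w, LF (events L) τ i u → LF (events L) τ i w → f w ≤ lab u := by
    intro i u w hu hw
    obtain ⟨s, hs⟩ := hw.2.1
    exact ((s2 w).2.1 i w s hs hw rfl).trans (s1 i u hu).1
  have hcase : ∀ w, (f w = lab w ∧ k w = par w) ∨ ∃ u, LF (events L) τ (k w) w ∧
      LF (events L) τ (k w) u ∧ f w = lab u ∧ f w < lab w := by
    intro w
    rcases (s2 w).2.2 with h | ⟨i, w, s, he, hw, rfl, k1, k2, k3⟩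
    · exact Or.inl h
    · obtain ⟨u, hu, huc⟩ := (s1 i w hw).2
      rw [k3]
      exact Or.inr ⟨u, hw, hu, k1.trans huc, k2⟩
  constructor
  · intro i w hw
    rcases hcase w with ⟨h1, -⟩ | ⟨u, h1, h2, h3, -⟩
    · rw [h1]; exact hi.link i w hw
    · rw [h3]
      exact (hi.link _ u h2).tail ⟨_, trivial, h2, h1⟩
  · exact fun i w hw => (hle w).trans (hi.le i w hw)
  · intro i w u hw h
    cases h with
    | refl => exact (hle w).trans (hi.le i w hw.2.1)
    | @step t _ v _ h1 h2 =>
      obtain ⟨i', -, h3, h4⟩ := h2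
      exact (hstep i' v w h3 h4).trans (hi.within i' v u h3 h1)
  · obtain ⟨tm, htm⟩ := hi.chain
    classical
    -- A variable whose label has just dropped gets the time stamp `t + 1`, larger than all stamps
    -- given before.
    refine ⟨fun w => if f w = lab w then tm w else t + 1, fun i w hw => ?_⟩
    obtain ⟨a1, a2, a3⟩ := htm i w hw
    rcases hcase w with ⟨h1, h2⟩ | ⟨u, h1, h2, h3, h4⟩
    · refine ⟨by simp only [h1, if_true]; omega, by rw [h2]; exact a2, ?_⟩
      rcases a3 with a3 | ⟨u, b1, b2⟩
      · exact Or.inl (h1.trans a3)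
      · refine Or.inr ⟨u, by rw [h2]; exact b1, ?_⟩
        have := hle u
        rcases b2 with b2 | ⟨b2, b3⟩
        · left; omega
        · by_cases hu : f u = lab u
          · right; simp only [h1, hu, if_true]; exact ⟨b2, b3⟩
          · left; omega
    · have hne : f w ≠ lab w := by omega
      refine ⟨by simp [hne], h1, Or.inr ⟨u, h2, ?_⟩⟩
      have := hle u
      by_cases hu : f u = lab u
      · right
        refine ⟨by rw [hu, h3], ?_⟩
        simp only [if_pos hu, if_neg hne]
        have := (htm _ u h2).1
        omega
      · left; omega
  · intro i w hw
    rcases hcase w with ⟨-, h2⟩ | ⟨u, h1, -⟩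
    · rw [h2]; exact hi.par i w hw
    · obtain ⟨s, hs⟩ := h1.2.1
      exact (hr.2 _ _ _ hs).1

theorem labels_spec {S LM : ℕ} {L : List (List Literal)} (hr : InRange S L) {l : ℕ}
    {τ : ℕ → ℕ} (t : ℕ) (σ : HS) (hl : σ.lev = l) (hτ : σ.arr 0 l = τ)
    (hlive : LiveOK L τ (σ.arr 1 l)) (hi : LabInv L S τ 0 (σ.arr 2 l) (σ.arr 3 l)) :
    ∃ σ', (labelF.sem S LM L)^[t] σ = σ' ∧ Chg [2, 3, 4, 24] l σ σ' ∧
      LabInv L S τ t (σ'.arr 2 l) (σ'.arr 3 l) := by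
  induction t with
  | zero => exact ⟨σ, rfl, .refl _ _ _, hi⟩
  | succ t ih =>
    obtain ⟨σ1, e1, h1, i1⟩ := ih
    obtain ⟨σ2, e2, h2, i2⟩ := label_spec (LM := LM) hr σ1 (h1.lev.trans hl)
      ((h1.arr 0 l (by simp)).trans hτ) (by rwa [h1.arr 1 l (by simp)]) i1
    refine ⟨σ2, ?_, h1.trans h2, i2⟩
    rw [Function.iterate_succ_apply', e1, e2]

/-- The labels are the components of the live clauses, with a forest of parent clauses of depth at
most `D`. -/
structure LabOK (L : List (List Literal)) (S : ℕ) (τ : ℕ → ℕ) (D : ℕ) (lab par : ℕ → ℕ) : Prop where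
  link : ∀ i w, LF (events L) τ i w → Link (events L) τ Set.univ (lab w) w
  le : ∀ i w, Occ (events L) i w → lab w ≤ w
  unif : ∀ i u w, LF (events L) τ i u → LF (events L) τ i w → lab u = lab w
  chain : ∃ tm : ℕ → ℕ, ∀ i w, LF (events L) τ i w → tm w ≤ D ∧ LF (events L) τ (par w) w ∧
    (lab w = w ∨ ∃ u, LF (events L) τ (par w) u ∧ tm u < tm w)
  par : ∀ i w, Occ (events L) i w → par w < S

theorem LabOK.of_link {L : List (List Literal)} {S : ℕ} {τ : ℕ → ℕ} {D : ℕ} {lab par : ℕ → ℕ}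
    (h : LabOK L S τ D lab par) {O : Set ℕ} {u v : ℕ} (hl : Link (events L) τ O u v) :
    lab u = lab v := by
  induction hl with
  | refl => rfl
  | tail _ h2 ih =>
    obtain ⟨i, -, h3, h4⟩ := h2
    exact ih.trans (h.unif i _ _ h3 h4)

theorem LabOK.root {L : List (List Literal)} {S : ℕ} {τ : ℕ → ℕ} {D : ℕ} {lab par : ℕ → ℕ}
    (h : LabOK L S τ D lab par) {i w : ℕ} (hw : LF (events L) τ i w) :
    lab (lab w) = lab w ∧ ∃ j, LF (events L) τ j (lab w) := by
  have h1 := h.link i w hw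
  refine ⟨h.of_link h1, ?_⟩
  rcases Relation.ReflTransGen.cases_head h1 with h2 | ⟨v, ⟨j, -, h2, -⟩, -⟩
  · exact ⟨i, by rwa [h2]⟩
  · exact ⟨j, h2⟩

/-- Once labels are constant on clauses, the lexicographic decrease is a decrease of the time stamp
alone, so chains of parents have length at most `D`. -/
theorem LabInv.ok {L : List (List Literal)} {S : ℕ} {τ : ℕ → ℕ} {D : ℕ} {lab par : ℕ → ℕ}
    (h : LabInv L S τ D lab par)
    (hu : ∀ i u w, LF (events L) τ i u → LF (events L) τ i w → lab u = lab w) :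
    LabOK L S τ D lab par where
  link := h.link
  le := h.le
  unif := hu
  chain := by
    obtain ⟨tm, htm⟩ := h.chain
    refine ⟨tm, fun i w hw => ?_⟩
    obtain ⟨h1, h2, h3⟩ := htm i w hw
    refine ⟨h1, h2, h3.imp_right ?_⟩
    rintro ⟨u, k1, k2⟩
    have := hu _ _ _ k1 h2
    exact ⟨u, k1, by omega⟩
  par := h.par

/-- After `D` rounds `lab w` is at most every variable within distance `D` of `w`. The smaller `lab
u` is linked to `w` through the clause `i`, so it must be farther away than `farDist n`. -/
theorem LabInv.hard {L : List (List Literal)} {S n : ℕ} {τ : ℕ → ℕ} {D : ℕ} {lab par : ℕ → ℕ}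
    (hr : InRange S L) (hD : farDist n ≤ D) (h : LabInv L S τ D lab par) {i u w : ℕ}
    (hu : LF (events L) τ i u) (hw : LF (events L) τ i w) (hlt : lab u < lab w) :
    Hard (events L) n τ Set.univ := by
  have hl : Link (events L) τ Set.univ (lab u) w := (h.link i u hu).tail ⟨i, trivial, hu, hw⟩
  refine (Hard.of_far_part (fun e he => (hr.2 e.1 e.2.1 e.2.2 he).2.2) hl fun hwi => ?_).superset
    (Set.subset_univ _)
  have := h.within i w _ hw (hwi.le hD)
  omega

end RecBackdoor

namespace RecBackdoor

/-! ### The invariants of the recursion -/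

/-- A set with at most `n` elements. -/
def Small (n : ℕ) (P : Set ℕ) : Prop := ∃ F : Finset ℕ, F.card ≤ n ∧ ∀ x ∈ P, x ∈ F

theorem Small.mono {n m : ℕ} {P Q : Set ℕ} (h : Small n P) (hnm : n ≤ m) (hQ : Q ⊆ P) :
    Small m Q := by
  obtain ⟨F, h1, h2⟩ := h
  exact ⟨F, h1.trans hnm, fun x hx => h2 x (hQ hx)⟩

theorem Small.union {n m : ℕ} {P Q : Set ℕ} (h : Small n P) (h' : Small m Q) :
    Small (n + m) (P ∪ Q) := by
  classical
  obtain ⟨F, h1, h2⟩ := h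
  obtain ⟨F', h1', h2'⟩ := h'
  refine ⟨F ∪ F', (Finset.card_union_le _ _).trans (by omega), fun x hx => ?_⟩
  rw [Finset.mem_union]
  exact hx.imp (h2 x) (h2' x)

theorem Small.bUnion {n m : ℕ} {P : Set ℕ} {Q : ℕ → Set ℕ} (h : Small n P)
    (h' : ∀ i, Small m (Q i)) : Small (m * n) {x | ∃ i ∈ P, x ∈ Q i} := by
  classical
  obtain ⟨F, h1, h2⟩ := h
  choose G g1 g2 using h'
  refine ⟨F.biUnion G, ?_, ?_⟩
  · refine (Finset.card_biUnion_le_card_mul _ _ m fun i _ => g1 i).trans ?_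
    rw [mul_comm]; exact Nat.mul_le_mul_left _ h1
  · rintro x ⟨i, hi, hx⟩
    exact Finset.mem_biUnion.mpr ⟨i, h2 i hi, g2 i x hx⟩

theorem Small.image {n : ℕ} {P : Set ℕ} (f : ℕ → ℕ) (h : Small n P) : Small n (f '' P) := by
  classical
  obtain ⟨F, h1, h2⟩ := h
  refine ⟨F.image f, Finset.card_image_le.trans h1, ?_⟩
  rintro _ ⟨x, hx, rfl⟩
  exact Finset.mem_image_of_mem _ (h2 x hx)

section

variable (es : List Ev) (S K : ℕ)

/-- The marked clauses in the component with label `R`. -/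
def comp (τ lab obs : ℕ → ℕ) (R : ℕ) : Set ℕ := {i | obs i = 1 ∧ ∃ w, LF es τ i w ∧ lab w = R}

/-- In contrast to `SatBy`, the satisfying literal has to carry the label `R` itself, since `SpecOK`
does not require labels to be constant on clauses; this is what permits gluing the assignments of
different components. -/
def CompSat (τ lab : ℕ → ℕ) (R : ℕ) : Prop :=
  ∃ α : ℕ → ℕ, ∀ i v, LF es τ i v → lab v = R →
    ∃ w s, (i, w, s) ∈ es ∧ τ w = 2 ∧ lab w = R ∧ α w = s

/-- The assignment `α` satisfies the component with label `R`. -/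
def SatBy (τ lab : ℕ → ℕ) (R : ℕ) (α : ℕ → ℕ) : Prop :=
  ∀ i v, LF es τ i v → lab v = R → ∃ w s, (i, w, s) ∈ es ∧ τ w = 2 ∧ α w = s

/-- The labels, the status and the obstructions that a call returns are correct. -/
structure SpecOK (n sz : ℕ) (τ lab stat obs : ℕ → ℕ) : Prop where
  lt : ∀ i w, Occ es i w → lab w < S
  link : ∀ i w, LF es τ i w → Link es τ Set.univ (lab w) w
  le2 : ∀ i w, LF es τ i w → stat (lab w) ≤ 2
  sat : ∀ i w, LF es τ i w → stat (lab w) = 1 → CompSat es τ lab (lab w)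
  unsat : ∀ i w, LF es τ i w → stat (lab w) = 2 →
    ∀ α : ℕ → ℕ, (∀ v, α v < 2) → ¬ SatBy es τ lab (lab w) α
  hard : ∀ i w, LF es τ i w → stat (lab w) = 0 →
    Hard es n τ (comp es τ lab obs (lab w)) ∧ Small sz (comp es τ lab obs (lab w))

/-- The variable is a candidate and one of its values has not been tried. -/
def Pickable (τ lab stat cand tried : ℕ → ℕ) (y : ℕ) : Prop :=
  (∃ i, LF es τ i y) ∧ cand y = 1 ∧ tried y < 2 ∧ stat (lab y) = 0

/-- The invariant of the rounds at a level above the level `n`, for an undecided component that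
contains the variable `w`. -/
structure Undecided (n sz ρ : ℕ) (τ lab par stat cand tried fl obs : ℕ → ℕ) (w : ℕ) : Prop where
  le : tried w ≤ 2
  mem : 0 < tried w → cand w = 1
  root : cand (lab w) = 1
  parMem : obs (par (lab w)) = 1
  -- Flag `0`: at most the value `0` has been tried, and it was refuted; a second refutation would
  -- have decided the component. Flag `1`: some value has an obstruction among the marked clauses.
  outcome : (fl w = 0 ∧ tried w ≤ 1 ∧ (tried w = 1 → ∀ α : ℕ → ℕ, (∀ v, α v < 2) → α w = 0 →
      ¬ SatBy es τ lab (lab w) α)) ∨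
    (fl w = 1 ∧ ∃ b < 2, Hard es n (Function.update τ w b) (comp es τ lab obs (lab w)))
  -- The obstruction found for the root, kept within the marked clauses whose free variables are all
  -- candidates: a variable that is not a candidate does not occur freely in them.
  rootHard : fl (lab w) = 1 → ∃ b < 2, Hard es n (Function.update τ (lab w) b)
    {i | i ∈ comp es τ lab obs (lab w) ∧ ∀ v, LF es τ i v → cand v = 1}
  obsSmall : Small (1 + ρ * sz) (comp es τ lab obs (lab w))
  candSmall : Small (1 + tried (lab w) * (K * sz))
    {y | cand y = 1 ∧ lab y = lab w ∧ ∃ i, LF es τ i y}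
  -- `F` collects the codes `2 * y + b` of the pairs of a variable and a tried value; each round has
  -- contributed one pair as long as something is left to try.
  count : (∃ y, Pickable es τ lab stat cand tried y ∧ lab y = lab w) →
    ∃ F : Finset ℕ, F.card = ρ ∧ ∀ x ∈ F, x % 2 < tried (x / 2) ∧ (∃ i, LF es τ i (x / 2)) ∧
      lab (x / 2) = lab w

/-- The rows of a level after `ρ` rounds, where the level below certifies hardness `n` by
obstructions of at most `sz` clauses. -/
structure Dyn (n sz ρ : ℕ) (τ lab par stat cand tried fl obs : ℕ → ℕ) : Prop where
  le2 : ∀ i w, LF es τ i w → stat (lab w) ≤ 2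
  sat : ∀ i w, LF es τ i w → stat (lab w) = 1 → CompSat es τ lab (lab w)
  unsat : ∀ i w, LF es τ i w → stat (lab w) = 2 →
    ∀ α : ℕ → ℕ, (∀ v, α v < 2) → ¬ SatBy es τ lab (lab w) α
  open_ : ∀ i w, LF es τ i w → stat (lab w) = 0 →
    Undecided es K n sz ρ τ lab par stat cand tried fl obs w

/-- The selection of one variable in every component with a pickable variable. -/
structure PickOK (τ lab stat cand tried pk : ℕ → ℕ) : Prop where
  pick : ∀ i w, Occ es i w → pk w = 1 → Pickable es τ lab stat cand tried w
  unique : ∀ i w i' w', Occ es i w → Occ es i' w' → pk w = 1 → pk w' = 1 → lab w = lab w' → w = w'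
  ex : ∀ w, Pickable es τ lab stat cand tried w →
    ∃ y, pk y = 1 ∧ lab y = lab w ∧ ∃ i, LF es τ i y

/-- The outcome of a round for the components. -/
structure Outcome (τ lab pk τ' lab' stat' obs' fa ch un nob : ℕ → ℕ) : Prop where
  fa1 : ∀ i w, LF es τ i w → (fa (lab w) = 1 ↔ (∃ y, pk y = 1 ∧ lab y = lab w ∧ ∃ i, LF es τ i y) ∧
    ∃ j v, LF es τ j v ∧ LF es τ' j v ∧ lab v = lab w ∧ stat' (lab' v) = 0)
  fa0 : ∀ i w, LF es τ i w → fa (lab w) = 0 ∨ fa (lab w) = 1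
  chosen : ∀ i w, LF es τ i w → fa (lab w) = 1 →
    ∃ j v, LF es τ j v ∧ LF es τ' j v ∧ lab v = lab w ∧ stat' (lab' v) = 0 ∧ ch (lab w) = lab' v
  un1 : ∀ i w, LF es τ i w → (un (lab w) = 1 ↔ ∃ j v, LF es τ j v ∧ lab v = lab w ∧
    ((LF es τ' j v ∧ stat' (lab' v) = 2) ∨ (Live es τ' j ∧ ∀ u, Occ es j u → τ' u ≠ 2)))
  un0 : ∀ i w, LF es τ i w → un (lab w) = 0 ∨ un (lab w) = 1
  new : ∀ i w, LF es τ i w → (nob i = 1 ↔ ∃ v, LF es τ i v ∧ LF es τ' i v ∧ fa (lab v) = 1 ∧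
    obs' i = 1 ∧ lab' v = ch (lab v))

/-- The update of the rows after a round. -/
structure Recorded (τ lab pk stat cand tried fl obs fa un nob stat2 cand2 tried2 fl2 obs2 : ℕ → ℕ) :
    Prop where
  obsIff : ∀ i w, LF es τ i w → (obs2 i = 1 ↔ obs i = 1 ∨ nob i = 1)
  candIff : ∀ i w, LF es τ i w →
    (cand2 w = 1 ↔ cand w = 1 ∨ ∃ j, LF es τ j w ∧ nob j = 1 ∧ pk (lab w) = 1)
  fl1 : ∀ i w, LF es τ i w → pk w = 1 → un (lab w) = 0 → fa (lab w) = 1 → fl2 w = 1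
  fl0 : ∀ i w, LF es τ i w → (¬ (pk w = 1 ∧ un (lab w) = 0 ∧ fa (lab w) = 1)) → fl2 w = fl w
  tried1 : ∀ i w, LF es τ i w → pk w = 1 → tried2 w = tried w + 1
  tried0 : ∀ i w, LF es τ i w → pk w ≠ 1 → tried2 w = tried w
  stat0 : ∀ i w, LF es τ i w → (∀ y i, LF es τ i y → lab y = lab w → pk y ≠ 1) →
    stat2 (lab w) = stat (lab w)
  statSat : ∀ i y, LF es τ i y → pk y = 1 → un (lab y) = 0 → fa (lab y) = 0 → stat2 (lab y) = 1
  statFail : ∀ i y, LF es τ i y → pk y = 1 → un (lab y) = 0 → fa (lab y) = 1 →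
    stat2 (lab y) = stat (lab y)
  statUn : ∀ i y, LF es τ i y → pk y = 1 → un (lab y) = 1 → tried2 y = 2 → fl2 y = 0 →
    stat2 (lab y) = 2
  statUn0 : ∀ i y, LF es τ i y → pk y = 1 → un (lab y) = 1 → ¬ (tried2 y = 2 ∧ fl2 y = 0) →
    stat2 (lab y) = stat (lab y)

end

/-! ### One round: what the result of the call proves. -/

section

variable {L : List (List Literal)} {S K D : ℕ} {n sz ρ : ℕ}
variable {τ lab par stat cand tried fl obs pk τ' lab' stat' obs' fa ch un nob : ℕ → ℕ}

/-- The facts about a round in which the variable `y` is selected in its component. -/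
theorem PickOK.agree (hlab : LabOK L S τ D lab par)
    (hpk : PickOK (events L) τ lab stat cand tried pk)
    (hτ' : ∀ i w, Occ (events L) i w → τ' w = if pk w = 1 then tried w else τ w)
    {i v y : ℕ} (hy : pk y = 1) (hyo : ∃ j, LF (events L) τ j y) (hi : LF (events L) τ i v)
    (hv : lab v = lab y) {w : ℕ} (hw : Occ (events L) i w) :
    τ' w = Function.update τ y (tried y) w := by
  rw [hτ' i w hw, Function.update_apply]
  by_cases hwy : w = y
  · subst hwy; simp [hy]
  · rw [if_neg hwy, if_neg]
    intro hpw
    obtain ⟨⟨j, hj⟩, -⟩ := hpk.pick i w hw hpw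
    have hiw : LF (events L) τ i w := ⟨hi.1, hw, hj.2.2⟩
    obtain ⟨k, hk⟩ := hyo
    exact hwy (hpk.unique i w k y hw hk.2.1 hpw hy ((hlab.unif i w v hiw hi).trans hv))

theorem PickOK.ext (hpk : PickOK (events L) τ lab stat cand tried pk)
    (hτ' : ∀ i w, Occ (events L) i w → τ' w = if pk w = 1 then tried w else τ w)
    {i w : ℕ} (hw : Occ (events L) i w) : τ w = 2 ∨ τ w = τ' w := by
  rw [hτ' i w hw]
  split_ifs with h
  · obtain ⟨⟨j, hj⟩, -⟩ := hpk.pick i w hw h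
    exact Or.inl hj.2.2
  · exact Or.inr rfl

theorem PickOK.lf (hr : InRange S L) (hpk : PickOK (events L) τ lab stat cand tried pk)
    (hτ' : ∀ i w, Occ (events L) i w → τ' w = if pk w = 1 then tried w else τ w)
    {i w : ℕ} (hw : LF (events L) τ' i w) : LF (events L) τ i w :=
  LF.mono (fun e he => (hr.2 e.1 e.2.1 e.2.2 he).2.2) (fun _ hv => hpk.ext hτ' hv) hw

/-- The call only assigns further variables, so its links are links at the calling level, and its
components refine those of the caller. -/
theorem lab_eq_of_child (hr : InRange S L) (hlab : LabOK L S τ D lab par)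
    (hpk : PickOK (events L) τ lab stat cand tried pk)
    (hτ' : ∀ i w, Occ (events L) i w → τ' w = if pk w = 1 then tried w else τ w)
    (hch : SpecOK (events L) S n sz τ' lab' stat' obs') {i v j w : ℕ} (hv : LF (events L) τ' i v)
    (hw : LF (events L) τ' j w) (h : lab' v = lab' w) : lab v = lab w := by
  have h1 := hch.link i v hv
  have h2 := hch.link j w hw
  rw [h] at h1
  have h3 : Link (events L) τ Set.univ v w :=
    Link.mono (fun i _ v hv => hpk.lf hr hτ' hv) subset_rfl (h1.symm.trans h2)
  exact hlab.of_link h3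

/-- If the outcome for a component is negative, then the tried value cannot be extended. -/
theorem Outcome.unsat (hr : InRange S L) (hlab : LabOK L S τ D lab par)
    (hpk : PickOK (events L) τ lab stat cand tried pk)
    (hτ' : ∀ i w, Occ (events L) i w → τ' w = if pk w = 1 then tried w else τ w)
    (hch : SpecOK (events L) S n sz τ' lab' stat' obs')
    (ho : Outcome (events L) τ lab pk τ' lab' stat' obs' fa ch un nob)
    {k y : ℕ} (hy : pk y = 1) (hyo : LF (events L) τ k y) (hun : un (lab y) = 1)
    (α : ℕ → ℕ) (hα : ∀ v, α v < 2) (hαy : α y = tried y) :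
    ¬ SatBy (events L) τ lab (lab y) α := by
  intro hsat
  -- If `α` takes the tried value at `y`, then it satisfies each clause of the component that is
  -- live in the call by a variable still free there.
  have key : ∀ j v, LF (events L) τ j v → lab v = lab y → Live (events L) τ' j →
      ∃ w s, (j, w, s) ∈ events L ∧ τ' w = 2 ∧ α w = s := by
    intro j v hv hvy hlive
    obtain ⟨w, s, h1, h2, h3⟩ := hsat j v hv hvy
    refine ⟨w, s, h1, ?_, h3⟩
    have h4 := hpk.agree hlab hτ' hy ⟨k, hyo⟩ hv hvy ⟨s, h1⟩
    rw [Function.update_apply] at h4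
    split_ifs at h4 with hwy
    · subst hwy
      exact absurd (h4.trans (hαy.symm.trans h3)) (hlive w s h1)
    · rw [h4, h2]
  obtain ⟨j, v, hv, hvy, h | ⟨h1, h2⟩⟩ := (ho.un1 k y hyo).mp hun
  · refine hch.unsat j v h.1 h.2 α hα fun j' v' hv' hvv => ?_
    have h1 := hpk.lf hr hτ' hv'
    exact key j' v' h1 ((lab_eq_of_child hr hlab hpk hτ' hch hv' h.1 hvv).trans hvy) hv'.1
  · obtain ⟨w, s, h3, h4, -⟩ := key j v hv hvy h1
    exact h2 w ⟨s, h3⟩ h4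

/-- If the outcome for a component is neither negative nor open, then the component is
satisfiable. -/
theorem Outcome.sat (hr : InRange S L) (hlab : LabOK L S τ D lab par)
    (hpk : PickOK (events L) τ lab stat cand tried pk)
    (hτ' : ∀ i w, Occ (events L) i w → τ' w = if pk w = 1 then tried w else τ w)
    (hch : SpecOK (events L) S n sz τ' lab' stat' obs')
    (ho : Outcome (events L) τ lab pk τ' lab' stat' obs' fa ch un nob)
    {k y : ℕ} (hy : pk y = 1) (hyo : LF (events L) τ k y) (hun : un (lab y) = 0)
    (hfa : fa (lab y) = 0) : CompSat (events L) τ lab (lab y) := by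
  classical
  have hpy := hpk.pick k y hyo.2.1 hy
  -- A satisfying assignment for each component of the call. Glued along the labels of the call and
  -- completed by the tried value of `y`, they satisfy the component.
  let β : ℕ → ℕ → ℕ := fun r =>
    if h : CompSat (events L) τ' lab' r then Classical.choose h else fun _ => 0
  have hone : ∀ j v, LF (events L) τ' j v → lab v = lab y → CompSat (events L) τ' lab' (lab' v) := by
    intro j v hv hvy
    have hv1 := hpk.lf hr hτ' hv
    refine hch.sat j v hv ?_
    have h1 := hch.le2 j v hv
    have h2 : stat' (lab' v) ≠ 0 := fun h => by
      have := (ho.fa1 k y hyo).mpr ⟨⟨y, hy, rfl, k, hyo⟩, j, v, hv1, hv, hvy, h⟩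
      omega
    have h3 : stat' (lab' v) ≠ 2 := fun h => by
      have := (ho.un1 k y hyo).mpr ⟨j, v, hv1, hvy, Or.inl ⟨hv, h⟩⟩
      omega
    omega
  refine ⟨fun v => if v = y then tried y else β (lab' v) v, fun i v hv hvy => ?_⟩
  by_cases hlive : Live (events L) τ' i
  · obtain ⟨u, hu, hu2⟩ : ∃ u, Occ (events L) i u ∧ τ' u = 2 := by
      by_contra hcon
      push Not at hcon
      have := (ho.un1 k y hyo).mpr ⟨i, v, hv, hvy, Or.inr ⟨hlive, hcon⟩⟩
      omega
    have hu' : LF (events L) τ' i u := ⟨hlive, hu, hu2⟩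
    have huy : lab u = lab y := (hlab.unif i u v (hpk.lf hr hτ' hu') hv).trans hvy
    have hcs := hone i u hu' huy
    obtain ⟨w, s, h1, h2, h3, h4⟩ := Classical.choose_spec hcs i u hu' rfl
    have hw : LF (events L) τ i w := hpk.lf hr hτ' ⟨hlive, ⟨s, h1⟩, h2⟩
    refine ⟨w, s, h1, hw.2.2, (hlab.unif i w v hw hv).trans hvy, ?_⟩
    have hwy : w ≠ y := by
      rintro rfl
      rw [hτ' i w ⟨s, h1⟩, if_pos hy] at h2
      have := hpy.2.2.1
      omega
    simp only [if_neg hwy, β, h3, dif_pos hcs, h4]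
  · simp only [Live, not_forall, not_not] at hlive
    obtain ⟨w, s, h1, h2⟩ := hlive
    have h3 := hpk.agree hlab hτ' hy ⟨k, hyo⟩ hv hvy ⟨s, h1⟩
    rw [Function.update_apply] at h3
    split_ifs at h3 with hwy
    · subst hwy
      exact ⟨w, s, h1, hyo.2.2, rfl, by simp only [if_true]; omega⟩
    · exact absurd (h3.symm.trans h2) (hv.1 w s h1)

end

end RecBackdoor

/-! ### One round: preservation of the invariant, and the number of rounds. -/

namespace RecBackdoor

variable {L : List (List Literal)} {S K D : ℕ} {n sz ρ : ℕ}
variable {τ lab par stat cand tried fl obs pk τ' lab' stat' obs' fa ch un nob : ℕ → ℕ}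
variable {stat2 cand2 tried2 fl2 obs2 : ℕ → ℕ}

/-- The new part of the obstruction of a component with an open outcome. -/
theorem Outcome.new_hard (hr : InRange S L) (hlab : LabOK L S τ D lab par)
    (hpk : PickOK (events L) τ lab stat cand tried pk)
    (hτ2 : ∀ i w, Occ (events L) i w → τ w ≤ 2)
    (hτ' : ∀ i w, Occ (events L) i w → τ' w = if pk w = 1 then tried w else τ w)
    (hch : SpecOK (events L) S n sz τ' lab' stat' obs')
    (ho : Outcome (events L) τ lab pk τ' lab' stat' obs' fa ch un nob)
    {k y : ℕ} (hy : pk y = 1) (hyo : LF (events L) τ k y) (hfa : fa (lab y) = 1) :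
    Hard (events L) n (Function.update τ y (tried y)) (comp (events L) τ lab nob (lab y)) ∧
      Small sz (comp (events L) τ lab nob (lab y)) := by
  obtain ⟨j0, v0, h1, h2, h3, h4, h5⟩ := ho.chosen k y hyo hfa
  obtain ⟨hh, hs⟩ := hch.hard j0 v0 h2 h4
  -- The new clauses are exactly the obstruction of the chosen component of the call, and on them
  -- the assignment of the call differs from `τ` at `y` only.
  have heq : comp (events L) τ lab nob (lab y) = comp (events L) τ' lab' obs' (lab' v0) := by
    ext i
    constructor
    · rintro ⟨k1, w, k2, k3⟩
      obtain ⟨v, k4, k5, k6, k7, k8⟩ := (ho.new i w k2).mp k1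
      have : lab v = lab y := (hlab.unif i v w k4 k2).trans k3
      rw [this, h5] at k8
      exact ⟨k7, v, k5, k8⟩
    · rintro ⟨k1, w, k2, k3⟩
      have k4 := hpk.lf hr hτ' k2
      have k5 := (lab_eq_of_child hr hlab hpk hτ' hch k2 h2 k3).trans h3
      refine ⟨(ho.new i w k4).mpr ⟨w, k4, k2, by rw [k5]; exact hfa, k1, by rw [k5, h5, k3]⟩, w, k4,
        k5⟩
  rw [heq]
  refine ⟨hh.mono (fun e he => (hr.2 e.1 e.2.1 e.2.2 he).2.2) fun i hi v hv => ?_, hs⟩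
  rw [← heq] at hi
  obtain ⟨-, w, k2, k3⟩ := hi
  have h6 := hpk.agree hlab hτ' hy ⟨k, hyo⟩ k2 k3 hv
  refine ⟨Or.inr h6.symm, ?_⟩
  have h7 := (hpk.pick k y hyo.2.1 hy).2.2.1
  have h8 := hτ2 i v hv
  rw [h6, Function.update_apply]
  split_ifs <;> omega

/-- The components are independent. Without a selected variable nothing relevant changes. With a
selected `y`, the round decides the component, or refutes one value, or adds an obstruction of at
most `sz` clauses; in any case it consumes the pair of `y` and the tried value. -/
theorem Dyn.step (hr : InRange S L) (hlab : LabOK L S τ D lab par)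
    (hK : ∀ i, Small K {v | Occ (events L) i v})
    (hpk : PickOK (events L) τ lab stat cand tried pk)
    (hτ2 : ∀ i w, Occ (events L) i w → τ w ≤ 2)
    (hτ' : ∀ i w, Occ (events L) i w → τ' w = if pk w = 1 then tried w else τ w)
    (hch : SpecOK (events L) S n sz τ' lab' stat' obs')
    (ho : Outcome (events L) τ lab pk τ' lab' stat' obs' fa ch un nob)
    (hrec : Recorded (events L) τ lab pk stat cand tried fl obs fa un nob stat2 cand2 tried2 fl2 obs2)
    (hd : Dyn (events L) K n sz ρ τ lab par stat cand tried fl obs) :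
    Dyn (events L) K n sz (ρ + 1) τ lab par stat2 cand2 tried2 fl2 obs2 := by
  -- components without a selected variable do not change
  have hno : ∀ i w, LF (events L) τ i w →
      (¬ ∃ y, pk y = 1 ∧ lab y = lab w ∧ ∃ i, LF (events L) τ i y) → stat2 (lab w) = stat (lab w) :=
    fun i w hw h => hrec.stat0 i w hw fun y j hy hl hp => h ⟨y, hp, hl, j, hy⟩
  have hyes : ∀ k y, LF (events L) τ k y → pk y = 1 →
      (stat2 (lab y) = 1 → CompSat (events L) τ lab (lab y)) ∧
      (stat2 (lab y) = 2 → ∀ α : ℕ → ℕ, (∀ v, α v < 2) → ¬ SatBy (events L) τ lab (lab y) α) ∧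
      stat2 (lab y) ≤ 2 := by
    intro k y hyo hy
    obtain ⟨-, hcy, hty, hsy⟩ := hpk.pick k y hyo.2.1 hy
    rcases ho.un0 k y hyo with hun | hun
    · rcases ho.fa0 k y hyo with hfa | hfa
      · have := hrec.statSat k y hyo hy hun hfa
        exact ⟨fun _ => ho.sat hr hlab hpk hτ' hch hy hyo hun hfa, by omega, by omega⟩
      · have := hrec.statFail k y hyo hy hun hfa
        exact ⟨by omega, by omega, by omega⟩
    · by_cases ht : tried2 y = 2 ∧ fl2 y = 0
      · have hst := hrec.statUn k y hyo hy hun ht.1 ht.2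
        refine ⟨by omega, fun _ α hα hsat => ?_, by omega⟩
        have hneg := ho.unsat hr hlab hpk hτ' hch hy hyo hun α hα
        have ht1 := hrec.tried1 k y hyo hy
        have hfl := hrec.fl0 k y hyo (by omega)
        have hu := (hd.open_ k y hyo hsy).outcome
        rcases hu with ⟨-, -, h3⟩ | ⟨h1, -⟩
        · have := hα y
          -- The value `0` was refuted in an earlier round, by the invariant, and the value `1` in
          -- this one.
          by_cases hay : α y = 0
          · exact h3 (by omega) α hα hay hsat
          · exact hneg (by omega) hsat
        · omega
      · have := hrec.statUn0 k y hyo hy hun ht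
        exact ⟨by omega, by omega, by omega⟩
  refine ⟨fun i w hw => ?_, fun i w hw hst => ?_, fun i w hw hst => ?_, fun i w hw hst => ?_⟩
  · by_cases h : ∃ y, pk y = 1 ∧ lab y = lab w ∧ ∃ i, LF (events L) τ i y
    · obtain ⟨y, h1, h2, k, h3⟩ := h
      rw [← h2]; exact (hyes k y h3 h1).2.2
    · rw [hno i w hw h]; exact hd.le2 i w hw
  · by_cases h : ∃ y, pk y = 1 ∧ lab y = lab w ∧ ∃ i, LF (events L) τ i y
    · obtain ⟨y, h1, h2, k, h3⟩ := h
      rw [← h2] at hst ⊢; exact (hyes k y h3 h1).1 hst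
    · rw [hno i w hw h] at hst; exact hd.sat i w hw hst
  · by_cases h : ∃ y, pk y = 1 ∧ lab y = lab w ∧ ∃ i, LF (events L) τ i y
    · obtain ⟨y, h1, h2, k, h3⟩ := h
      rw [← h2] at hst ⊢; exact (hyes k y h3 h1).2.1 hst
    · rw [hno i w hw h] at hst; exact hd.unsat i w hw hst
  -- undecided components
  have hs0 : stat (lab w) = 0 := by
    by_cases h : ∃ y, pk y = 1 ∧ lab y = lab w ∧ ∃ i, LF (events L) τ i y
    · obtain ⟨y, h1, h2, k, h3⟩ := h
      rw [← h2]; exact (hpk.pick k y h3.2.1 h1).2.2.2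
    · rw [hno i w hw h] at hst; exact hst
  have hu := hd.open_ i w hw hs0
  obtain ⟨hroot, j0, hj0⟩ := hlab.root hw
  have hcand : ∀ v, (∃ j, LF (events L) τ j v) → cand v = 1 → cand2 v = 1 := by
    rintro v ⟨j, hj⟩ hc
    exact (hrec.candIff j v hj).mpr (Or.inl hc)
  have hobs : comp (events L) τ lab obs (lab w) ⊆ comp (events L) τ lab obs2 (lab w) := by
    rintro j ⟨h1, v, h2, h3⟩
    exact ⟨(hrec.obsIff j v h2).mpr (Or.inl h1), v, h2, h3⟩
  have hobs2 : comp (events L) τ lab obs2 (lab w) ⊆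
      comp (events L) τ lab obs (lab w) ∪ comp (events L) τ lab nob (lab w) := by
    rintro j ⟨h1, v, h2, h3⟩
    rcases (hrec.obsIff j v h2).mp h1 with h4 | h4
    · exact Or.inl ⟨h4, v, h2, h3⟩
    · exact Or.inr ⟨h4, v, h2, h3⟩
  have hpar : obs2 (par (lab w)) = 1 := by
    obtain ⟨tm, htm⟩ := hlab.chain
    exact (hrec.obsIff _ _ (htm _ _ hj0).2.1).mpr (Or.inl hu.parMem)
  have hrootHard : ∀ {b : ℕ}, Hard (events L) n (Function.update τ (lab w) b)
      {i | i ∈ comp (events L) τ lab obs (lab w) ∧ ∀ v, LF (events L) τ i v → cand v = 1} →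
      Hard (events L) n (Function.update τ (lab w) b)
      {i | i ∈ comp (events L) τ lab obs2 (lab w) ∧ ∀ v, LF (events L) τ i v → cand2 v = 1} :=
    fun h => h.superset fun j hj => ⟨hobs hj.1, fun v hv => hcand v ⟨j, hv⟩ (hj.2 v hv)⟩
  by_cases h : ∃ y, pk y = 1 ∧ lab y = lab w ∧ ∃ i, LF (events L) τ i y
  · obtain ⟨y, hy, hyl, k, hyo⟩ := h
    obtain ⟨-, hcy, hty, hsy⟩ := hpk.pick k y hyo.2.1 hy
    have hty2 := hrec.tried1 k y hyo hy
    have huniq : ∀ v j, LF (events L) τ j v → lab v = lab w → pk v = 1 → v = y :=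
      fun v j hv hl hp => hpk.unique j v k y hv.2.1 hyo.2.1 hp hy (hl.trans hyl.symm)
    have hnew := fun hfa => ho.new_hard hr hlab hpk hτ2 hτ' hch hy hyo hfa
    rw [hyl] at hnew
    have hempty : fa (lab w) ≠ 1 → comp (events L) τ lab nob (lab w) = ∅ := by
      intro hfa
      ext j
      simp only [Set.mem_empty_iff_false, iff_false]
      rintro ⟨h1, v, h2, h3⟩
      obtain ⟨u, h4, -, h5, -⟩ := (ho.new j v h2).mp h1
      rw [hlab.unif j u v h4 h2, h3] at h5
      exact hfa h5
    have hsmall : Small sz (comp (events L) τ lab nob (lab w)) := by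
      by_cases hfa : fa (lab w) = 1
      · exact (hnew hfa).2
      · rw [hempty hfa]; exact ⟨∅, by simp, by simp⟩
    constructor
    · by_cases hp : pk w = 1
      · rw [hrec.tried1 i w hw hp, huniq w i hw rfl hp]; omega
      · rw [hrec.tried0 i w hw hp]; exact hu.le
    · intro ht
      by_cases hp : pk w = 1
      · rw [huniq w i hw rfl hp]; exact hcand y ⟨k, hyo⟩ hcy
      · rw [hrec.tried0 i w hw hp] at ht; exact hcand w ⟨i, hw⟩ (hu.mem ht)
    · exact hcand _ ⟨j0, hj0⟩ hu.root
    · exact hpar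
    · by_cases hp : pk w = 1
      · obtain rfl := huniq w i hw rfl hp
        rcases ho.un0 i w hw with hun | hun
        · rcases ho.fa0 i w hw with hfa | hfa
          · have := hrec.statSat i w hw hp hun hfa
            omega
          · exact Or.inr ⟨hrec.fl1 i w hw hp hun hfa, tried w, hty, (hnew hfa).1.superset
              fun j hj => by
                obtain ⟨h1, v, h2, h3⟩ := hj
                exact ⟨(hrec.obsIff j v h2).mpr (Or.inr h1), v, h2, h3⟩⟩
        · have hfl := hrec.fl0 i w hw (by omega)
          rcases hu.outcome with ⟨h1, h2, h3⟩ | ⟨h1, b, hb, h2⟩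
          · refine Or.inl ⟨by omega, ?_, fun ht α hα hα0 => ?_⟩
            -- Two refuted values without the flag would have set the status to `2`.
            · by_contra hcon
              have := hrec.statUn i w hw hp hun (by omega) (by omega)
              omega
            · exact ho.unsat hr hlab hpk hτ' hch hy hyo hun α hα (by omega)
          · exact Or.inr ⟨by omega, b, hb, h2.superset hobs⟩
      · rw [hrec.tried0 i w hw hp, hrec.fl0 i w hw (by tauto)]
        exact hu.outcome.imp_right fun ⟨h1, b, hb, h2⟩ => ⟨h1, b, hb, h2.superset hobs⟩
    · intro hf
      by_cases hold : fl (lab w) = 1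
      · obtain ⟨b, hb, h1⟩ := hu.rootHard hold
        exact ⟨b, hb, hrootHard h1⟩
      · have hcond : pk (lab w) = 1 ∧ un (lab (lab w)) = 0 ∧ fa (lab (lab w)) = 1 := by
          by_contra hcon
          rw [hrec.fl0 j0 _ hj0 hcon] at hf
          exact hold hf
        rw [hroot] at hcond
        obtain rfl := huniq _ j0 hj0 hroot hcond.1
        refine ⟨tried (lab w), hty, (hnew hcond.2.2).1.superset fun j hj => ?_⟩
        obtain ⟨h1, v, h2, h3⟩ := hj
        refine ⟨⟨(hrec.obsIff j v h2).mpr (Or.inr h1), v, h2, h3⟩, fun u hu => ?_⟩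
        -- All free variables of a new obstruction of the root become candidates in the same round.
        refine (hrec.candIff j u hu).mpr (Or.inr ⟨j, hu, h1, ?_⟩)
        rw [hlab.unif j u v hu h2, h3]; exact hy
    · refine (hu.obsSmall.union hsmall).mono ?_ hobs2
      rw [add_mul]; omega
    -- Candidates arise only when the root is selected, at most `K` for each clause of the new
    -- obstruction.
    · by_cases hp : pk (lab w) = 1
      · rw [hrec.tried1 j0 _ hj0 hp]
        refine (hu.candSmall.union (hsmall.bUnion hK)).mono (by rw [add_mul]; omega) ?_
        rintro v ⟨h1, h2, j, h3⟩
        rcases (hrec.candIff j v h3).mp h1 with h4 | ⟨j', h4, h5, -⟩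
        · exact Or.inl ⟨h4, h2, j, h3⟩
        · exact Or.inr ⟨j', ⟨h5, v, h4, h2⟩, h4.2.1⟩
      · rw [hrec.tried0 j0 _ hj0 hp]
        refine hu.candSmall.mono le_rfl ?_
        rintro v ⟨h1, h2, j, h3⟩
        rcases (hrec.candIff j v h3).mp h1 with h4 | ⟨j', h4, h5, h6⟩
        · exact ⟨h4, h2, j, h3⟩
        · rw [h2] at h6; exact absurd h6 hp
    · intro _
      obtain ⟨F, hF, hF2⟩ := hu.count ⟨y, ⟨⟨k, hyo⟩, hcy, hty, hsy⟩, hyl⟩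
      -- This code is new, since the codes of `y` in `F` have remainders below `tried y`.
      refine ⟨insert (2 * y + tried y) F, ?_, fun x hx => ?_⟩
      · rw [Finset.card_insert_of_notMem, hF]
        intro hx
        have := (hF2 _ hx).1
        rw [show (2 * y + tried y) / 2 = y by omega] at this
        omega
      · rcases Finset.mem_insert.mp hx with rfl | hx
        · rw [show (2 * y + tried y) / 2 = y by omega]
          exact ⟨by omega, ⟨k, hyo⟩, hyl⟩
        · obtain ⟨h1, ⟨j, h2⟩, h3⟩ := hF2 x hx
          refine ⟨?_, ⟨j, h2⟩, h3⟩
          by_cases hp : pk (x / 2) = 1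
          · rw [hrec.tried1 j _ h2 hp]; omega
          · rw [hrec.tried0 j _ h2 hp]; exact h1
  · have hpk0 : ∀ v j, LF (events L) τ j v → lab v = lab w → pk v ≠ 1 := fun v j hv hl hp =>
      h ⟨v, hp, hl, j, hv⟩
    have hfa : fa (lab w) ≠ 1 := fun hf => h ((ho.fa1 i w hw).mp hf).1
    have hnob : ∀ v j, LF (events L) τ j v → lab v = lab w → nob j ≠ 1 := by
      intro v j hv hl hn
      obtain ⟨u, h4, -, h5, -⟩ := (ho.new j v hv).mp hn
      rw [hlab.unif j u v h4 hv, hl] at h5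
      exact hfa h5
    have hobs3 : comp (events L) τ lab obs2 (lab w) = comp (events L) τ lab obs (lab w) := by
      refine Set.Subset.antisymm (hobs2.trans (Set.union_subset subset_rfl ?_)) hobs
      rintro j ⟨h1, v, h2, h3⟩
      exact absurd h1 (hnob v j h2 h3)
    have hcand3 : ∀ v j, LF (events L) τ j v → lab v = lab w → cand2 v = 1 → cand v = 1 := by
      intro v j hv hl hc
      rcases (hrec.candIff j v hv).mp hc with h4 | ⟨j', h4, h5, -⟩
      · exact h4
      · exact absurd h5 (hnob v j' h4 hl)
    have htr : ∀ v j, LF (events L) τ j v → lab v = lab w → tried2 v = tried v := fun v j hv hl =>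
      hrec.tried0 j v hv (hpk0 v j hv hl)
    have hfl : ∀ v j, LF (events L) τ j v → lab v = lab w → fl2 v = fl v := fun v j hv hl =>
      hrec.fl0 j v hv fun hc => hpk0 v j hv hl hc.1
    constructor
    · rw [htr w i hw rfl]; exact hu.le
    · rw [htr w i hw rfl]; exact fun h => hcand w ⟨i, hw⟩ (hu.mem h)
    · exact hcand _ ⟨j0, hj0⟩ hu.root
    · exact hpar
    · rw [htr w i hw rfl, hfl w i hw rfl, hobs3]; exact hu.outcome
    · rw [hfl _ j0 hj0 hroot]
      intro hf
      obtain ⟨b, hb, h1⟩ := hu.rootHard hf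
      exact ⟨b, hb, hrootHard h1⟩
    · rw [hobs3]
      exact hu.obsSmall.mono (by rw [add_mul]; omega) subset_rfl
    · rw [htr _ j0 hj0 hroot]
      refine hu.candSmall.mono le_rfl ?_
      rintro v ⟨h1, h2, j, h3⟩
      exact ⟨hcand3 v j h3 h2 h1, h2, j, h3⟩
    · rintro ⟨v, ⟨⟨j, hj⟩, h1, h2, h3⟩, hl⟩
      exfalso
      obtain ⟨y, h4, h5, h6⟩ := hpk.ex v ⟨⟨j, hj⟩, hcand3 v j hj hl h1, by rwa [htr v j hj hl] at h2,
        by rw [hl]; exact hs0⟩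
      exact h ⟨y, h4, h5.trans hl, h6⟩

/-- The number of rounds is bounded. -/
theorem Dyn.count_lt (hd : Dyn (events L) K n sz ρ τ lab par stat cand tried fl obs)
    (hlab : LabOK L S τ D lab par) {y : ℕ} (hy : Pickable (events L) τ lab stat cand tried y) :
    ρ + 1 ≤ 2 * (1 + 2 * (K * sz)) := by
  classical
  obtain ⟨⟨i, hi⟩, hc, ht, hst⟩ := hy
  have hu := hd.open_ i y hi hst
  obtain ⟨F, hF, hF2⟩ := hu.count ⟨y, ⟨⟨i, hi⟩, hc, ht, hst⟩, rfl⟩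
  obtain ⟨hroot, j0, hj0⟩ := hlab.root hi
  have hrt : tried (lab y) ≤ 2 := (hd.open_ j0 _ hj0 (by rw [hroot]; exact hst)).le
  obtain ⟨G, hG, hG2⟩ := hu.candSmall
  -- The pairs counted so far and the next one consist of a candidate and one of two values; the
  -- candidates are the root and at most `K * sz` variables for each of the two values of the root.
  have hsub : insert (2 * y + tried y) F ⊆ (G ×ˢ Finset.range 2).image fun p => 2 * p.1 + p.2 := by
    intro x hx
    rw [Finset.mem_image]
    refine ⟨(x / 2, x % 2), Finset.mem_product.mpr ⟨hG2 _ ?_, Finset.mem_range.mpr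
      (Nat.mod_lt _ (by omega))⟩, by simp only; omega⟩
    rcases Finset.mem_insert.mp hx with rfl | hx
    · rw [show (2 * y + tried y) / 2 = y by omega]
      exact ⟨hc, rfl, i, hi⟩
    · obtain ⟨h1, ⟨j, h2⟩, h3⟩ := hF2 x hx
      exact ⟨(hd.open_ j _ h2 (by rw [h3]; exact hst)).mem (by omega), h3, j, h2⟩
  have h1 : ρ + 1 = (insert (2 * y + tried y) F).card := by
    rw [Finset.card_insert_of_notMem, hF]
    intro hx
    have := (hF2 _ hx).1
    rw [show (2 * y + tried y) / 2 = y by omega] at this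
    omega
  rw [h1]
  refine (Finset.card_le_card hsub).trans (Finset.card_image_le.trans ?_)
  rw [Finset.card_product, Finset.card_range, mul_comm]
  refine Nat.mul_le_mul_left _ (hG.trans ?_)
  have := Nat.mul_le_mul_right (K * sz) hrt
  omega

end RecBackdoor

/-! ### The rounds of a level: their start, the closure of the obstructions, the result. -/

namespace RecBackdoor

variable {L : List (List Literal)} {S K D : ℕ} {n sz ρ : ℕ}
variable {τ lab par stat cand tried fl obs : ℕ → ℕ}

theorem LabOK.lf_par (hlab : LabOK L S τ D lab par) {i w : ℕ} (hw : LF (events L) τ i w) :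
    LF (events L) τ (par w) w := by
  obtain ⟨tm, htm⟩ := hlab.chain
  exact (htm i w hw).2.1

/-- The invariant of the rounds holds at the start. -/
theorem Dyn.zero (hlab : LabOK L S τ D lab par)
    (hstat : ∀ i w, LF (events L) τ i w → stat w = 0)
    (htried : ∀ i w, LF (events L) τ i w → tried w = 0)
    (hfl : ∀ i w, LF (events L) τ i w → fl w = 0)
    (hcand : ∀ i w, LF (events L) τ i w → (cand w = 1 ↔ lab w = w))
    (hobs : ∀ i w, LF (events L) τ i w → (obs i = 1 ↔ ∃ j r, LF (events L) τ j r ∧ lab r = r ∧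
      par r = i)) :
    Dyn (events L) K n sz 0 τ lab par stat cand tried fl obs := by
  have h0 : ∀ i w, LF (events L) τ i w → stat (lab w) = 0 := fun i w hw => by
    obtain ⟨-, j, hj⟩ := hlab.root hw
    exact hstat j _ hj
  refine ⟨fun i w hw => ?_, fun i w hw h => ?_, fun i w hw h => ?_, fun i w hw _ => ?_⟩
  · rw [h0 i w hw]; omega
  · rw [h0 i w hw] at h; omega
  · rw [h0 i w hw] at h; omega
  obtain ⟨hroot, j, hj⟩ := hlab.root hw
  constructor
  · rw [htried i w hw]; omega
  · rw [htried i w hw]; omega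
  · exact (hcand j _ hj).mpr hroot
  · exact (hobs _ _ (hlab.lf_par hj)).mpr ⟨j, _, hj, hroot, rfl⟩
  · left
    rw [htried i w hw, hfl i w hw]
    exact ⟨rfl, by omega, by omega⟩
  · rw [hfl j _ hj]; omega
  · refine ⟨{par (lab w)}, by simp, fun i' hi' => ?_⟩
    obtain ⟨h1, v, h2, h3⟩ := hi'
    obtain ⟨j', r, h4, h5, rfl⟩ := (hobs i' v h2).mp h1
    have := hlab.unif _ _ _ (hlab.lf_par h4) h2
    rw [h5, h3] at this
    simp [this]
  · refine ⟨{lab w}, by simp, ?_⟩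
    rintro y ⟨h1, h2, i', h3⟩
    have := (hcand i' y h3).mp h1
    simp [← h2, this]
  · exact fun _ => ⟨∅, rfl, by simp⟩

/-- One step of the closure of the obstructions under parent clauses. -/
def CloseStep (es : List Ev) (τ par obs obs' : ℕ → ℕ) : Prop :=
  ∀ i w, LF es τ i w → (obs' i = 1 ↔ obs i = 1 ∨ ∃ j v, LF es τ j v ∧ obs j = 1 ∧ par v = i)

theorem closure_mono {o : ℕ → ℕ → ℕ} {t : ℕ} (ho : ∀ s < t, CloseStep (events L) τ par (o s) (o (s + 1)))
    {i w : ℕ} (hw : LF (events L) τ i w) {s u : ℕ} (hsu : s ≤ u) (hu : u ≤ t) (h : o s i = 1) :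
    o u i = 1 := by
  induction hsu with
  | refl => exact h
  | @step u _ ih => exact (ho u (by omega) i w hw).mpr (Or.inl (ih (by omega)))

theorem closure_comp_mono {o : ℕ → ℕ → ℕ} {t : ℕ}
    (ho : ∀ s < t, CloseStep (events L) τ par (o s) (o (s + 1))) (R : ℕ) {s : ℕ} (hs : s ≤ t) :
    comp (events L) τ lab (o s) R ⊆ comp (events L) τ lab (o t) R := by
  rintro i ⟨h1, w, h2, h3⟩
  exact ⟨closure_mono ho h2 hs le_rfl h1, w, h2, h3⟩

/-- A clause has at most `K` variables, each with one parent clause, so a step multiplies the size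
by at most `K + 1`. -/
theorem closure_small (hlab : LabOK L S τ D lab par) (hK : ∀ i, Small K {v | Occ (events L) i v})
    {o : ℕ → ℕ → ℕ} {t : ℕ} (ho : ∀ s < t, CloseStep (events L) τ par (o s) (o (s + 1))) {R N : ℕ}
    (h : Small N (comp (events L) τ lab (o 0) R)) :
    Small ((K + 1) ^ t * N) (comp (events L) τ lab (o t) R) := by
  induction t with
  | zero => simpa using h
  | succ t ih =>
    have h1 := ih fun s hs => ho s (by omega)
    refine (h1.union ((h1.bUnion hK).image par)).mono (by rw [pow_succ]; apply le_of_eq; ring) ?_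
    rintro i ⟨h2, w, h3, h4⟩
    rcases (ho t (by omega) i w h3).mp h2 with h5 | ⟨j, v, h5, h6, h7⟩
    · exact Or.inl ⟨h5, w, h3, h4⟩
    · refine Or.inr ⟨v, ⟨j, ⟨h6, v, h5, ?_⟩, h5.2.1⟩, h7⟩
      have := hlab.lf_par h5
      rw [h7] at this
      exact (hlab.unif i v w this h3).trans h4

/-- After `D` steps the obstruction of a component is connected. -/
theorem closure_link (hlab : LabOK L S τ D lab par) {o : ℕ → ℕ → ℕ}
    (ho : ∀ s < D, CloseStep (events L) τ par (o s) (o (s + 1))) {R i : ℕ}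
    (hi : i ∈ comp (events L) τ lab (o D) R) :
    ∃ v, LF (events L) τ i v ∧ Link (events L) τ (comp (events L) τ lab (o D) R) R v := by
  obtain ⟨tm, htm⟩ := hlab.chain
  set O := comp (events L) τ lab (o D) R with hO
  -- A variable of a clause marked after `s` steps is linked to the root if its time stamp fits into
  -- the remaining `D - s` steps: its parent clause is marked next, and contains a variable with a
  -- smaller stamp unless the root is reached.
  have hA : ∀ m v s j, tm v = m → LF (events L) τ j v → lab v = R → o s j = 1 → m + s ≤ D →
      Link (events L) τ O R v := by
    intro m
    induction m using Nat.strong_induction_on with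
    | _ m ih =>
      intro v s j hm hj hv hs hle
      obtain ⟨-, h2, h3⟩ := htm j v hj
      rcases h3 with h3 | ⟨u, h3, h4⟩
      · rw [← hv, h3]; exact .refl
      · have hpar : o (s + 1) (par v) = 1 :=
          (ho s (by omega) (par v) v h2).mpr (Or.inr ⟨j, v, hj, hs, rfl⟩)
        have hu : lab u = R := (hlab.unif _ _ _ h3 h2).trans hv
        exact (ih (tm u) (by omega) u (s + 1) (par v) rfl h3 hu hpar (by omega)).tail
          ⟨par v, ⟨closure_mono ho h2 (by omega) le_rfl hpar, v, h2, hv⟩, h3, h2⟩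
  -- A clause marked later is linked through the clause that caused its marking, so this costs no
  -- further steps.
  have hB : ∀ s ≤ D, ∀ i ∈ comp (events L) τ lab (o s) R, ∃ v, LF (events L) τ i v ∧
      Link (events L) τ O R v := by
    intro s
    induction s with
    | zero =>
      rintro - i ⟨h1, w, h2, h3⟩
      exact ⟨w, h2, hA _ w 0 i rfl h2 h3 h1 (by have := (htm i w h2).1; omega)⟩
    | succ s ih =>
      rintro hs i ⟨h1, w, h2, h3⟩
      rcases (ho s (by omega) i w h2).mp h1 with h4 | ⟨j, v, h5, h6, h7⟩
      · exact ih (by omega) i ⟨h4, w, h2, h3⟩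
      · have h8 := hlab.lf_par h5
        rw [h7] at h8
        have hv : lab v = R := (hlab.unif i v w h8 h2).trans h3
        have hj : j ∈ comp (events L) τ lab (o s) R := ⟨h6, v, h5, hv⟩
        obtain ⟨u, hu1, hu2⟩ := ih (by omega) j hj
        exact ⟨v, h8, hu2.tail ⟨j, closure_comp_mono ho R (by omega) hj, hu1, h5⟩⟩
  exact hB D le_rfl i hi

/-- If no variable can be selected any more, then the closure of the obstructions meets the
specification. -/
theorem Dyn.spec (hr : InRange S L) (hlab : LabOK L S τ D lab par)
    (hK : ∀ i, Small K {v | Occ (events L) i v})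
    (hτ2 : ∀ i w, Occ (events L) i w → τ w ≤ 2) {o : ℕ → ℕ → ℕ}
    (hd : Dyn (events L) K n sz ρ τ lab par stat cand tried fl (o 0))
    (hno : ∀ y, ¬ Pickable (events L) τ lab stat cand tried y)
    (ho : ∀ s < D, CloseStep (events L) τ par (o s) (o (s + 1))) :
    SpecOK (events L) S (n + 1) ((K + 1) ^ D * (1 + ρ * sz)) τ lab stat (o D) := by
  refine ⟨fun i w h => ?_, hlab.link, hd.le2, hd.sat, hd.unsat, fun i w hw hst => ?_⟩
  · obtain ⟨s, hs⟩ := h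
    exact (hlab.le i w ⟨s, hs⟩).trans_lt (hr.2 _ _ _ hs).2.1
  have hu := hd.open_ i w hw hst
  refine ⟨?_, closure_small hlab hK ho hu.obsSmall⟩
  obtain ⟨hroot, j, hj⟩ := hlab.root hw
  set O := comp (events L) τ lab (o D) (lab w) with hO
  have hsub : comp (events L) τ lab (o 0) (lab w) ⊆ O := closure_comp_mono ho _ (Nat.zero_le _)
  -- A candidate that is no longer pickable has had both values tried; as the component is still
  -- undecided, one of them has an obstruction.
  have hfail : ∀ k x, LF (events L) τ k x → lab x = lab w → cand x = 1 → fl x = 1 ∧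
      ∃ b < 2, Hard (events L) n (Function.update τ x b) O := by
    intro k x hx hxw hc
    have hux := hd.open_ k x hx (by rw [hxw]; exact hst)
    have h2 : tried x = 2 := by
      have h1 := hux.le
      by_contra hcon
      exact hno x ⟨⟨k, hx⟩, hc, by omega, by rw [hxw]; exact hst⟩
    rcases hux.outcome with ⟨-, h3, -⟩ | ⟨h3, b, hb, h4⟩
    · omega
    · rw [hxw] at h4
      exact ⟨h3, b, hb, h4.superset hsub⟩
  refine ⟨O, subset_rfl, ⟨par (lab w), hsub ⟨hu.parMem, lab w, hlab.lf_par hj, hroot⟩⟩, lab w,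
    fun i hi => closure_link hlab ho hi, fun i hi x hx => ?_⟩
  obtain ⟨-, w', hw', hww⟩ := hi
  have hxw : lab x = lab w := (hlab.unif i x w' hx hw').trans hww
  by_cases hc : cand x = 1
  · exact (hfail i x hx hxw hc).2
  -- The variable `x` does not occur freely in the obstruction of the root. There the assignment `x
  -- := 0` is invisible, and freeing the root only makes the assignment smaller.
  · obtain ⟨b, hb, hh⟩ := hu.rootHard (hfail j _ hj hroot hu.root).1
    refine ⟨0, by omega, Hard.superset (hh.mono (fun e he => (hr.2 e.1 e.2.1 e.2.2 he).2.2) ?_)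
      fun k hk => hsub hk.1⟩
    rintro k ⟨⟨-, u, hu1, -⟩, hk⟩ v hv
    have hvx : v ≠ x := by
      rintro rfl
      exact hc (hk v ⟨hu1.1, hv, hx.2.2⟩)
    rw [Function.update_of_ne hvx, Function.update_apply]
    have := hτ2 k v hv
    split_ifs with hvR
    · rw [hvR]; exact ⟨Or.inl hj.2.2, by omega⟩
    · exact ⟨Or.inr rfl, this⟩

end RecBackdoor

/-! ### Semantics of the commands of a round. -/

namespace RecBackdoor

variable {S LM : ℕ} {L : List (List Literal)}

theorem lfE_setA {e : Ev} {σ : HS} {a : Fin 32} {l : ℕ} {f : ℕ → ℕ} {ch : Bool} (h0 : a ≠ 0)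
    (h1 : a ≠ 1) : (lfE ch).eval S LM e (σ.setA a l f) = (lfE ch).eval S LM e σ := by
  refine E.eval_setA ?_
  simp [lfE, E.avoids, h0.symm, h1.symm]

theorem Scat.const_iff {es : List Ev} {G : ℕ → ℕ → ℕ → Prop} {X : ℕ → ℕ → ℕ → ℕ} {n : ℕ}
    {old f : ℕ → ℕ} (h : Scat es G X (fun _ _ _ => n) old f) (y : ℕ) :
    f y = n ↔ old y = n ∨ ∃ i w s, (i, w, s) ∈ es ∧ G i w s ∧ X i w s = y := by
  rcases h y with ⟨i, w, s, h1, h2, h3, h4⟩ | ⟨h1, h2⟩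
  · exact iff_of_true h4 (Or.inr ⟨i, w, s, h1, h2, h3⟩)
  · rw [h2]
    refine ⟨Or.inl, fun h => h.resolve_right ?_⟩
    rintro ⟨i, w, s, h3, h4, h5⟩
    exact h1 i w s h3 h4 h5

theorem Scat.of_mem {es : List Ev} {G : ℕ → ℕ → ℕ → Prop} {X V : ℕ → ℕ → ℕ → ℕ}
    {old f : ℕ → ℕ} (h : Scat es G X V old f) {i w s : ℕ} (he : (i, w, s) ∈ es) (hG : G i w s) :
    ∃ i' w' s', (i', w', s') ∈ es ∧ G i' w' s' ∧ X i' w' s' = X i w s ∧ f (X i w s) = V i' w' s' := by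
  rcases h (X i w s) with h | ⟨h1, -⟩
  · exact h
  · exact absurd rfl (h1 i w s he hG)

theorem Scat.of_not {es : List Ev} {G : ℕ → ℕ → ℕ → Prop} {X V : ℕ → ℕ → ℕ → ℕ}
    {old f : ℕ → ℕ} (h : Scat es G X V old f) {y : ℕ}
    (hy : ∀ i w s, (i, w, s) ∈ es → G i w s → X i w s ≠ y) : f y = old y := by
  rcases h y with ⟨i, w, s, h1, h2, h3, -⟩ | ⟨-, h2⟩
  · exact absurd h3 (hy i w s h1 h2)
  · exact h2

/-- The state is at level `l`, with the assignment `τ`, and with its live clauses. -/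
structure Env (S : ℕ) (L : List (List Literal)) (σ : HS) (l : ℕ) (τ : ℕ → ℕ) : Prop where
  lev : σ.lev = l
  val : σ.arr 0 l = τ
  live : LiveOK L τ (σ.arr 1 l)

theorem Env.lf {σ : HS} {l : ℕ} {τ : ℕ → ℕ} (hr : InRange S L) (h : Env S L σ l τ) (LM : ℕ)
    {i w s : ℕ} (he : (i, w, s) ∈ events L) :
    (lfE false).eval S LM (i, w, s) σ = 0 ↔ ¬ LF (events L) τ i w :=
  lfE_LF hr he σ false h.lev h.val h.live

theorem Env.chg {σ σ' : HS} {l : ℕ} {τ : ℕ → ℕ} (h : Env S L σ l τ) {As : List (Fin 32)}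
    (hc : Chg As l σ σ') (h0 : 0 ∉ As) (h1 : 1 ∉ As) : Env S L σ' l τ := by
  refine ⟨hc.lev.trans h.lev, ?_, ?_⟩
  · rw [hc.arr 0 l (fun h => absurd h h0)]; exact h.val
  · rw [hc.arr 1 l (fun h => absurd h h1)]; exact h.live

theorem LF.occ {es : List Ev} {τ : ℕ → ℕ} {i w : ℕ} (h : LF es τ i w) : Occ es i w := h.2.1

theorem pick_spec (hr : InRange S L) {σ : HS} {l : ℕ} {τ : ℕ → ℕ} (he : Env S L σ l τ)
    {lab stat cand tried : ℕ → ℕ} (hlab : ∀ i w, Occ (events L) i w → lab w < S)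
    (e2 : σ.arr 2 l = lab) (e6 : σ.arr 6 l = stat) (e7 : σ.arr 7 l = cand)
    (e8 : σ.arr 8 l = tried) :
    ∃ f11 pk f13, pickF.sem S LM L σ = ((σ.setA 11 l f11).setA 12 l pk).setA 13 l f13 ∧
      PickOK (events L) τ lab stat cand tried pk ∧
      (f13 0 ≠ 0 ↔ ∃ y, Pickable (events L) τ lab stat cand tried y) := by
  have hlf := fun i w s (h : (i, w, s) ∈ events L) => he.lf hr LM h
  have hl := he.lev
  unfold pickF
  simp only [Flat.sem]
  have hpick : ∀ i w s, (i, w, s) ∈ events L → ∀ σ' : HS, ((lfE false).eval S LM (i, w, s) σ' =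
      (lfE false).eval S LM (i, w, s) σ) → σ'.lev = l → σ'.arr 2 l = lab → σ'.arr 6 l = stat →
      σ'.arr 7 l = cand → σ'.arr 8 l = tried → (pickE.eval S LM (i, w, s) σ' ≠ 0 ↔
        LF (events L) τ i w ∧ cand w = 1 ∧ tried w < 2 ∧ stat (lab w) = 0) := by
    intro i w s h σ' h0 h1 h2 h6 h7 h8
    simp only [pickE, ne_eq, E.eval_and_eq_zero, E.eval_eq_eq_zero, E.eval_lt_eq_zero, not_not]
    simp [E.eval, h0, hlf i w s h, hr.2 i w s h, HS.lv, h1, h2, h6, h7, h8, hlab i w ⟨s, h⟩]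
  obtain ⟨f11, x1, s1⟩ := Flat.wr_at (S := S) (LM := LM) (L := L) σ pickE 11 false
    (.arr 2 false .cv) .cv hl (fun i w _ => LF (events L) τ i w ∧ cand w = 1 ∧ tried w < 2 ∧
      stat (lab w) = 0) (fun _ w _ => lab w) (fun _ w _ => w) rfl (fun i w s h =>
    ⟨hpick i w s h σ rfl hl e2 e6 e7 e8, fun _ => by
      simp [E.eval, hr.2 i w s h, HS.lv, hl, e2, hlab i w ⟨s, h⟩]⟩)
  rw [x1]
  obtain ⟨f12, x2, s2⟩ := Flat.fillV (LM := LM) hr (σ.setA 11 l f11) 12 0 (l := l) hl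
  rw [x2]
  obtain ⟨pk, x3, s3⟩ := Flat.wr_at (S := S) (LM := LM) (L := L) ((σ.setA 11 l f11).setA 12 l f12)
    (.and pickE (.eq (.arr 11 false (.arr 2 false .cv)) .cv)) 12 false .cv (.c 1) (l := l) hl
    (fun i w _ => (LF (events L) τ i w ∧ cand w = 1 ∧ tried w < 2 ∧
      stat (lab w) = 0) ∧ f11 (lab w) = w) (fun _ w _ => w) (fun _ _ _ => 1) rfl (fun i w s h => by
      have := hpick i w s h ((σ.setA 11 l f11).setA 12 l f12) (by
        rw [lfE_setA (by decide) (by decide), lfE_setA (by decide) (by decide)])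
        hl (by simpa [HS.setA_arr] using e2) (by simpa [HS.setA_arr] using e6)
        (by simpa [HS.setA_arr] using e7) (by simpa [HS.setA_arr] using e8)
      simp only [ne_eq, E.eval_and_eq_zero, this]
      simp [E.eval, hr.2 i w s h, HS.lv, hl, e2, hlab i w ⟨s, h⟩, HS.setA_arr, and_assoc])
  rw [x3, HS.setA_setA]
  obtain ⟨f13, x4, s4⟩ := Flat.wr_at (S := S) (LM := LM) (L := L) (((σ.setA 11 l f11).setA 12 l
    pk).setA 13 l (Function.update (σ.arr 13 l) 0 0)) (.eq (.arr 12 false .cv) (.c 1)) 13 false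
    (.c 0) (.c 1) (l := l) hl (fun i w _ => pk w = 1) (fun _ w _ => 0) (fun _ _ _ => 1) rfl
    (fun i w s h => by
      simp [E.eval, hr.2 i w s h, HS.lv, hl, HS.setA_arr, hr.1])
  have x5 : C.run S LM (0, 0, 0) (.put 13 false (.c 0) (.c 0)) ((σ.setA 11 l f11).setA 12 l pk) =
      ((σ.setA 11 l f11).setA 12 l pk).setA 13 l (Function.update (σ.arr 13 l) 0 0) := by
    simp [C.run, E.eval, hr.1, HS.lv, hl, HS.setA_arr]
  rw [x5, x4, HS.setA_setA]
  simp only [HS.setA_arr, and_self, if_true] at s3 s4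
  have hpk : ∀ i w s, (i, w, s) ∈ events L → (pk w = 1 ↔
      (Pickable (events L) τ lab stat cand tried w ∧ f11 (lab w) = w)) := by
    intro i w s h
    rw [s3.const_iff, s2 i w s h]
    constructor
    · rintro (h1 | ⟨j, v, s', h1, h2, h3⟩)
      · simp at h1
      · subst h3
        exact ⟨⟨⟨j, h2.1.1⟩, h2.1.2⟩, h2.2⟩
    · rintro ⟨⟨⟨j, h1⟩, h2⟩, h3⟩
      obtain ⟨s', hs'⟩ := h1.2.1
      exact Or.inr ⟨j, w, s', hs', ⟨⟨h1, h2⟩, h3⟩, rfl⟩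
  have hex : ∀ w, Pickable (events L) τ lab stat cand tried w →
      ∃ y, pk y = 1 ∧ lab y = lab w ∧ ∃ i, LF (events L) τ i y := by
    rintro w ⟨⟨i, h1⟩, h2⟩
    obtain ⟨s, hs⟩ := h1.2.1
    obtain ⟨i', y, s', k1, k2, k3, k4⟩ := s1.of_mem hs ⟨h1, h2⟩
    refine ⟨y, (hpk i' y s' k1).mpr ⟨⟨⟨i', k2.1⟩, k2.2⟩, ?_⟩, k3, i', k2.1⟩
    rw [k3, k4]
  refine ⟨f11, pk, f13, rfl, ⟨fun i w ⟨s, hs⟩ hp => ((hpk i w s hs).mp hp).1, ?_, hex⟩, ?_⟩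
  · rintro i w i' w' ⟨s, hs⟩ ⟨s', hs'⟩ h1 h2 h3
    have k1 := ((hpk i w s hs).mp h1).2
    have k2 := ((hpk i' w' s' hs').mp h2).2
    rw [← k1, h3, k2]
  · have h13 : f13 0 ≠ 0 ↔ f13 0 = 1 := by
      rcases s4 0 with ⟨_, _, _, -, -, -, h⟩ | ⟨-, h⟩
      · simp [h]
      · simp [h]
    rw [h13, s4.const_iff]
    constructor
    · rintro (h | ⟨i, w, s, h1, h2, -⟩)
      · simp at h
      · exact ⟨w, ((hpk i w s h1).mp h2).1⟩
    · rintro ⟨y, hy⟩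
      obtain ⟨v, h1, h2, i, h3⟩ := hex y hy
      obtain ⟨s, hs⟩ := h3.2.1
      exact Or.inr ⟨i, v, s, hs, h1, rfl⟩

end RecBackdoor

namespace RecBackdoor

variable {S LM : ℕ} {L : List (List Literal)}

theorem next_spec (hr : InRange S L) {σ : HS} {l : ℕ} (hl : σ.lev = l + 1) {τ pk tried : ℕ → ℕ}
    (e0 : σ.arr 0 (l + 1) = τ) (e12 : σ.arr 12 (l + 1) = pk) (e8 : σ.arr 8 (l + 1) = tried) :
    ∃ f23 τ', (Flat.wr (.c 1) 23 false .cv (.arr 0 false .cv) ;;;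
        .wr (.eq (.arr 12 false .cv) (.c 1)) 23 false .cv (.arr 8 false .cv) ;;;
        .wr (.c 1) 0 true .cv (.arr 23 false .cv) ;;; .once (.set 3 (.c 0))).sem S LM L σ =
          ((σ.setA 23 (l + 1) f23).setA 0 l τ').setR 3 0 ∧
      ∀ i w, Occ (events L) i w → τ' w = if pk w = 1 then tried w else τ w := by
  simp only [Flat.sem]
  obtain ⟨g23, x1, s1⟩ := Flat.wr_at (S := S) (LM := LM) (L := L) σ (.c 1) 23 false .cv
    (.arr 0 false .cv) hl (fun _ _ _ => True) (fun _ w _ => w) (fun _ w _ => τ w) rfl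
    (fun i w s h => by simp [E.eval, hr.2 i w s h, HS.lv, hl, e0])
  rw [x1]
  obtain ⟨f23, x2, s2⟩ := Flat.wr_at (S := S) (LM := LM) (L := L) (σ.setA 23 (l + 1) g23)
    (.eq (.arr 12 false .cv) (.c 1)) 23 false .cv (.arr 8 false .cv) (l := l + 1) hl
    (fun _ w _ => pk w = 1) (fun _ w _ => w) (fun _ w _ => tried w) rfl
    (fun i w s h => by simp [E.eval, hr.2 i w s h, HS.lv, hl, e12, e8, HS.setA_arr])
  rw [x2, HS.setA_setA]
  obtain ⟨τ', x3, s3⟩ := Flat.wr_at (S := S) (LM := LM) (L := L) (σ.setA 23 (l + 1) f23)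
    (.c 1) 0 true .cv (.arr 23 false .cv) (l := l) (by simp [HS.lv, hl])
    (fun _ _ _ => True) (fun _ w _ => w) (fun _ w _ => f23 w) rfl
    (fun i w s h => by simp [E.eval, hr.2 i w s h, HS.lv, hl, HS.setA_arr])
  rw [x3]
  refine ⟨f23, τ', rfl, fun i w ⟨s, hs⟩ => ?_⟩
  obtain ⟨_, _, _, -, h1, h2⟩ := s3.const hs
  rw [h2, h1]
  simp only [HS.setA_arr, and_self, if_true] at s2
  split_ifs with h
  · obtain ⟨_, _, _, -, -, h3, h4⟩ := s2.of_mem hs h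
    rw [h4, h3]
  · rw [s2.of_not]
    · obtain ⟨_, _, _, -, h3, h4⟩ := s1.const hs
      rw [h4, h3]
    · rintro _ w' _ - h1 h2
      exact h (h2 ▸ h1)

/-- Row 14 is not cleared between the steps of the closure. Its old marks remain justified because
the obstruction only grows; `hmk` carries this along. -/
theorem close_spec (hr : InRange S L) {σ : HS} {l : ℕ} {τ : ℕ → ℕ} (he : Env S L σ l τ)
    {par : ℕ → ℕ} (hpar : ∀ i w, Occ (events L) i w → par w < S) (e3 : σ.arr 3 l = par)
    (hmk : ∀ w, (∃ i, Occ (events L) i w) → σ.arr 14 l w = 1 →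
      ∃ i, LF (events L) τ i w ∧ σ.arr 10 l i = 1) :
    ∃ σ', closeF.sem S LM L σ = σ' ∧ Chg [10, 14] l σ σ' ∧
      CloseStep (events L) τ par (σ.arr 10 l) (σ'.arr 10 l) ∧
      ∀ w, (∃ i, Occ (events L) i w) → σ'.arr 14 l w = 1 →
        ∃ i, LF (events L) τ i w ∧ σ'.arr 10 l i = 1 := by
  have hlf := fun i w s (h : (i, w, s) ∈ events L) => he.lf hr LM h
  have hl := he.lev
  unfold closeF
  simp only [Flat.sem]
  obtain ⟨mk, x1, s1⟩ := Flat.wr_at (S := S) (LM := LM) (L := L) σ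
    (.and (lfE false) (.eq (.arr 10 false .ci) (.c 1))) 14 false .cv (.c 1) hl
    (fun i w _ => LF (events L) τ i w ∧ σ.arr 10 l i = 1) (fun _ w _ => w) (fun _ _ _ => 1) rfl
    (fun i w s h => by
      simp only [ne_eq, E.eval_and_eq_zero, E.eval_eq_eq_zero, not_not]
      simp [E.eval, hlf i w s h, hr.2 i w s h, HS.lv, hl])
  rw [x1]
  obtain ⟨ob, x2, s2⟩ := Flat.wr_at (S := S) (LM := LM) (L := L) (σ.setA 14 l mk)
    (.and (lfE false) (.eq (.arr 14 false .cv) (.c 1))) 10 false (.arr 3 false .cv) (.c 1) hl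
    (fun i w _ => LF (events L) τ i w ∧ mk w = 1) (fun _ w _ => par w) (fun _ _ _ => 1) rfl
    (fun i w s h => by
      simp only [ne_eq, E.eval_and_eq_zero, E.eval_eq_eq_zero, not_not,
        lfE_setA (a := 14) (by decide) (by decide)]
      simp [E.eval, hlf i w s h, hr.2 i w s h, HS.lv, hl, HS.setA_arr, e3, hpar i w ⟨s, h⟩])
  rw [x2]
  have hm : ∀ w, (∃ i, Occ (events L) i w) → (mk w = 1 ↔
      ∃ i, LF (events L) τ i w ∧ σ.arr 10 l i = 1) := by
    intro w hw
    rw [s1.const_iff]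
    constructor
    · rintro (h | ⟨i, w, s, -, h, rfl⟩)
      · exact hmk w hw h
      · exact ⟨i, h⟩
    · rintro ⟨i, h1, h2⟩
      obtain ⟨s, hs⟩ := h1.occ
      exact Or.inr ⟨i, w, s, hs, ⟨h1, h2⟩, rfl⟩
  have hob : ∀ i, ob i = 1 ↔ σ.arr 10 l i = 1 ∨
      ∃ j v, LF (events L) τ j v ∧ σ.arr 10 l j = 1 ∧ par v = i := by
    intro i
    rw [s2.const_iff]
    simp only [HS.setA_arr, Fin.reduceEq, false_and, if_false]
    refine or_congr_right ⟨?_, ?_⟩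
    · rintro ⟨j, v, s, h1, ⟨h2, h3⟩, rfl⟩
      obtain ⟨j', h4, h5⟩ := (hm v ⟨j, h2.occ⟩).mp h3
      exact ⟨j', v, h4, h5, rfl⟩
    · rintro ⟨j, v, h1, h2, rfl⟩
      obtain ⟨s, hs⟩ := h1.occ
      exact ⟨j, v, s, hs, ⟨h1, (hm v ⟨j, h1.occ⟩).mpr ⟨j, h1, h2⟩⟩, rfl⟩
  refine ⟨_, rfl, ((Chg.refl _ l σ).setA (by simp) mk).setA (by simp) ob, ?_, ?_⟩
  · intro i w _
    simp only [HS.setA_arr, and_self, if_true]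
    exact hob i
  · simp only [HS.setA_arr, and_self, if_true, Fin.reduceEq, false_and, if_false]
    intro w hw h
    obtain ⟨i, h1, h2⟩ := (hm w hw).mp h
    exact ⟨i, h1, (hob i).mpr (Or.inl h2)⟩

theorem closes_spec (hr : InRange S L) {σ : HS} {l : ℕ} {τ : ℕ → ℕ} (he : Env S L σ l τ)
    {par : ℕ → ℕ} (hpar : ∀ i w, Occ (events L) i w → par w < S) (e3 : σ.arr 3 l = par)
    (hmk : ∀ w, (∃ i, Occ (events L) i w) → σ.arr 14 l w = 1 →
      ∃ i, LF (events L) τ i w ∧ σ.arr 10 l i = 1) (t : ℕ) :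
    ∃ o : ℕ → ℕ → ℕ, o 0 = σ.arr 10 l ∧ (∀ s < t, CloseStep (events L) τ par (o s) (o (s + 1))) ∧
      ∃ σ', (closeF.sem S LM L)^[t] σ = σ' ∧ Chg [10, 14] l σ σ' ∧ σ'.arr 10 l = o t := by
  let st : ℕ → HS := fun t => (closeF.sem S LM L)^[t] σ
  have key : ∀ t, Chg [10, 14] l σ (st t) ∧ (∀ w, (∃ i, Occ (events L) i w) →
      (st t).arr 14 l w = 1 → ∃ i, LF (events L) τ i w ∧ (st t).arr 10 l i = 1) := by
    intro t
    induction t with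
    | zero => exact ⟨.refl _ _ _, hmk⟩
    | succ t ih =>
      obtain ⟨σ', h1, h2, -, h4⟩ := close_spec (LM := LM) hr (he.chg ih.1 (by decide) (by decide))
        hpar ((ih.1.arr 3 l (by simp)).trans e3) ih.2
      have : st (t + 1) = σ' := by simp only [st, Function.iterate_succ_apply']; exact h1
      rw [this]
      exact ⟨ih.1.trans h2, h4⟩
  refine ⟨fun t => (st t).arr 10 l, rfl, fun s _ => ?_, st t, rfl, (key t).1, rfl⟩
  obtain ⟨σ', h1, -, h3, -⟩ := close_spec (LM := LM) hr (he.chg (key s).1 (by decide) (by decide))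
    hpar (((key s).1.arr 3 l (by simp)).trans e3) (key s).2
  have : st (s + 1) = σ' := by simp only [st, Function.iterate_succ_apply']; exact h1
  simp only [this]
  exact h3

theorem Cmd.sem_ite_pos {D : ℕ} {g : E} {P Q : Cmd} {σ : HS} (h : g.eval S LM (0, 0, 0) σ ≠ 0) :
    (Cmd.ite g P Q).sem S LM D L σ = P.sem S LM D L σ := if_pos h

theorem Cmd.sem_ite_neg {D : ℕ} {g : E} {P Q : Cmd} {σ : HS} (h : g.eval S LM (0, 0, 0) σ = 0) :
    (Cmd.ite g P Q).sem S LM D L σ = Q.sem S LM D L σ := if_neg (not_not.mpr h)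

theorem Cmd.sem_seq {D : ℕ} {P Q : Cmd} {σ : HS} :
    (P ;;;; Q).sem S LM D L σ = Q.sem S LM D L (P.sem S LM D L σ) := rfl

theorem Cmd.sem_flat {D : ℕ} {P : Flat} {σ : HS} :
    (Cmd.flat P).sem S LM D L σ = P.sem S LM L σ := rfl

theorem Cmd.sem_rep {D : ℕ} {P : Flat} {σ : HS} :
    (Cmd.rep P).sem S LM D L σ = (P.sem S LM L)^[D] σ := rfl

/-- The effect of a round, up to the call of the level below. -/
theorem round_spec (hr : InRange S L) {D : ℕ} {σ : HS} {l : ℕ} {τ : ℕ → ℕ}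
    (he : Env S L σ (l + 1) τ) {lab par stat cand tried : ℕ → ℕ}
    (hlab : ∀ i w, Occ (events L) i w → lab w < S) (hpar : ∀ i w, Occ (events L) i w → par w < S)
    (e2 : σ.arr 2 (l + 1) = lab) (e3 : σ.arr 3 (l + 1) = par) (e6 : σ.arr 6 (l + 1) = stat)
    (e7 : σ.arr 7 (l + 1) = cand) (e8 : σ.arr 8 (l + 1) = tried) :
    ∃ σ', roundCmd.sem S LM D L σ = σ' ∧
      (((∃ y, Pickable (events L) τ lab stat cand tried y) ∧ σ'.lev = l ∧
        σ'.reg = Function.update σ.reg 3 0 ∧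
        (∀ a m, ¬ (a ∈ [11, 12, 13, 23] ∧ m = l + 1) → ¬ (a = 0 ∧ m = l) →
          σ'.arr a m = σ.arr a m) ∧
        PickOK (events L) τ lab stat cand tried (σ'.arr 12 (l + 1)) ∧
        ∀ i w, Occ (events L) i w → σ'.arr 0 l w = if σ'.arr 12 (l + 1) w = 1 then tried w else τ w) ∨
      ((∀ y, ¬ Pickable (events L) τ lab stat cand tried y) ∧ σ'.lev = l + 1 ∧
        σ'.reg = Function.update σ.reg 3 2 ∧
        (∀ a m, ¬ (a ∈ [10, 11, 12, 13, 14] ∧ m = l + 1) → σ'.arr a m = σ.arr a m) ∧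
        ∃ o : ℕ → ℕ → ℕ, o 0 = σ.arr 10 (l + 1) ∧
          (∀ s < D, CloseStep (events L) τ par (o s) (o (s + 1))) ∧ σ'.arr 10 (l + 1) = o D)) := by
  obtain ⟨f11, pk, f13, x1, hpk, h13⟩ := pick_spec (LM := LM) hr he hlab e2 e6 e7 e8
  rw [roundCmd, Cmd.sem_seq, Cmd.sem_flat, x1]
  set σ1 := ((σ.setA 11 (l + 1) f11).setA 12 (l + 1) pk).setA 13 (l + 1) f13 with hσ1
  have hl : σ1.lev = l + 1 := he.lev
  have e13 : (E.arr 13 false (.c 0)).eval S LM (0, 0, 0) σ1 = f13 0 := by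
    simp [E.eval, hr.1, HS.lv, he.lev, hσ1, HS.setA_arr]
  have hchg : Chg [11, 12, 13] (l + 1) σ σ1 :=
    (((Chg.refl _ _ σ).setA (by simp) f11).setA (by simp) pk).setA (by simp) f13
  by_cases hp : ∃ y, Pickable (events L) τ lab stat cand tried y
  · rw [Cmd.sem_ite_pos (by rw [e13]; exact h13.mpr hp)]
    obtain ⟨f23, τ', x2, hτ'⟩ := next_spec (LM := LM) hr hl
      ((hchg.arr 0 _ (by simp)).trans he.val) (pk := pk) (by simp [hσ1, HS.setA_arr])
      ((hchg.arr 8 _ (by simp)).trans e8)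
    rw [Cmd.sem_seq, Cmd.sem_flat, x2]
    refine ⟨_, rfl, Or.inl ⟨hp, ?_⟩⟩
    simp only [Cmd.sem]
    have harr : ∀ a m, (((σ1.setA 23 (l + 1) f23).setA 0 l τ').setR 3 0).arr a m =
        if a = 0 ∧ m = l then τ' else if a = 23 ∧ m = l + 1 then f23 else σ1.arr a m := by
      intro a m
      simp only [HS.setR, HS.setA_arr]
    have h12 : σ1.arr 12 (l + 1) = pk := by simp [hσ1, HS.setA_arr]
    refine ⟨?_, rfl, fun a m h1 h2 => ?_, ?_, ?_⟩
    · simp [HS.setR, hl]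
    · simp only [harr]
      rw [if_neg h2, if_neg (fun h => h1 ⟨by simp [h.1], h.2⟩), hchg.arr a m]
      exact fun h h' => h1 ⟨by simp at h ⊢; tauto, h'⟩
    · simp only [harr]
      simpa [h12] using hpk
    · simp only [harr]
      simpa [h12] using hτ'
  · rw [Cmd.sem_ite_neg (by rw [e13]; by_contra h; exact hp (h13.mp h))]
    obtain ⟨f14, x2, s2⟩ := Flat.fillV (LM := LM) hr σ1 14 0 (l := l + 1) hl
    have hchg2 : Chg [10, 11, 12, 13, 14] (l + 1) σ (σ1.setA 14 (l + 1) f14) :=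
      ((((Chg.refl _ _ σ).setA (by simp) f11).setA (by simp) pk).setA (by simp) f13).setA
        (by simp) f14
    obtain ⟨o, o0, o1, σ3, x3, hc3, h10⟩ := closes_spec (LM := LM) hr
      (he.chg hchg2 (by decide) (by decide)) hpar ((hchg2.arr 3 _ (by simp)).trans e3) (by
        rintro w ⟨i, s, hs⟩ h
        simp only [HS.setA_arr, and_self, if_true] at h
        rw [s2 i w s hs] at h
        simp at h) D
    rw [Cmd.sem_seq, Cmd.sem_flat, x2, Cmd.sem_seq, Cmd.sem_rep, x3]
    refine ⟨_, rfl, Or.inr ⟨not_exists.mp hp, ?_⟩⟩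
    refine ⟨hc3.lev.trans hl, ?_, fun a m h => ?_, o, ?_, o1, ?_⟩
    · simp only [Cmd.sem, Flat.sem, C.run, HS.setR, hc3.reg]; rfl
    · have h1 : a ∈ [(10 : Fin 32), 14] → m ≠ l + 1 := fun h1 h2 => h ⟨by simp at h1 ⊢; tauto, h2⟩
      have h2 : a ∈ [(10 : Fin 32), 11, 12, 13, 14] → m ≠ l + 1 := fun h1 h2 => h ⟨h1, h2⟩
      exact (hc3.arr a m h1).trans (hchg2.arr a m h2)
    · rw [o0]
      simp [hσ1, HS.setA_arr]
    · exact h10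

end RecBackdoor

/-! ### Entering a level. -/

namespace RecBackdoor

variable {S LM : ℕ} {L : List (List Literal)}

/-- A clause sees two different labels exactly if one of them exceeds the minimum over the clause.
-/
theorem bad_spec (hr : InRange S L) {σ : HS} {l : ℕ} {τ : ℕ → ℕ} (he : Env S L σ l τ)
    {lab : ℕ → ℕ} (e2 : σ.arr 2 l = lab) :
    ∃ σ', (cminF ;;; .once (.put 5 false (.c 0) (.c 0)) ;;;
        .wr (.and (lfE false) (.lt (.arr 4 false .ci) (.arr 2 false .cv))) 5 false (.c 0) (.c 1)).sem
          S LM L σ = σ' ∧ Chg [4, 5, 24] l σ σ' ∧ (σ'.arr 5 l 0 ≠ 0 ↔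
            ∃ i u w, LF (events L) τ i u ∧ LF (events L) τ i w ∧ lab u < lab w) := by
  have hl := he.lev
  simp only [Flat.sem]
  obtain ⟨c, d, x1, s1⟩ := cmin_spec (LM := LM) hr σ hl he.val he.live
  rw [x1]
  have hc : Chg [4, 5, 24] l σ (((σ.setA 4 l c).setA 24 l d).setA 5 l
      (Function.update (σ.arr 5 l) 0 0)) :=
    (((Chg.refl _ _ σ).setA (by simp) c).setA (by simp) d).setA (by simp) _
  have x2 : C.run S LM (0, 0, 0) (.put 5 false (.c 0) (.c 0)) ((σ.setA 4 l c).setA 24 l d) =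
      ((σ.setA 4 l c).setA 24 l d).setA 5 l (Function.update (σ.arr 5 l) 0 0) := by
    simp [C.run, E.eval, hr.1, HS.lv, hl, HS.setA_arr]
  rw [x2]
  have he' := he.chg hc (by decide) (by decide)
  obtain ⟨f, x3, s3⟩ := Flat.wr_at (S := S) (LM := LM) (L := L) _
    (.and (lfE false) (.lt (.arr 4 false .ci) (.arr 2 false .cv))) 5 false (.c 0) (.c 1) he'.lev
    (fun i w _ => LF (events L) τ i w ∧ c i < lab w) (fun _ _ _ => 0) (fun _ _ _ => 1) rfl
    (fun i w s h => by
      simp only [ne_eq, E.eval_and_eq_zero, E.eval_lt_eq_zero, not_not]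
      simp only [he'.lf hr LM h]
      simp [E.eval, hr.2 i w s h, HS.lv, hl, HS.setA_arr, e2, hr.1])
  rw [x3, HS.setA_setA]
  refine ⟨_, rfl, (((Chg.refl _ _ σ).setA (by simp) c).setA (by simp) d).setA (by simp) _, ?_⟩
  simp only [HS.setA_arr, and_self, if_true] at s3 ⊢
  have h5 : f 0 ≠ 0 ↔ f 0 = 1 := by
    rcases s3 0 with ⟨_, _, _, -, -, -, h⟩ | ⟨-, h⟩
    · simp [h]
    · simp [h]
  rw [h5, s3.const_iff]
  constructor
  · rintro (h | ⟨i, w, s, -, ⟨h1, h2⟩, -⟩)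
    · simp at h
    · obtain ⟨-, u, h3, h4⟩ := s1 i w h1
      exact ⟨i, u, w, h3, h1, by rw [h4, e2] at h2; exact h2⟩
  · rintro ⟨i, u, w, h1, h2, h3⟩
    obtain ⟨s, hs⟩ := h2.occ
    have := (s1 i u h1).1
    rw [e2] at this
    exact Or.inr ⟨i, w, s, hs, ⟨h2, by omega⟩, rfl⟩

theorem root_spec (hr : InRange S L) {σ : HS} {l : ℕ} {τ : ℕ → ℕ} (he : Env S L σ l τ)
    {lab par : ℕ → ℕ} (hpar : ∀ i w, Occ (events L) i w → par w < S) (e2 : σ.arr 2 l = lab)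
    (e3 : σ.arr 3 l = par) :
    ∃ f g, (Flat.wr rootE 7 false .cv (.c 1) ;;; .wr rootE 10 false (.arr 3 false .cv) (.c 1) ;;;
          .once (.set 3 (.c 1))).sem S LM L σ = ((σ.setA 7 l f).setA 10 l g).setR 3 1 ∧
      (∀ w, f w = 1 ↔ σ.arr 7 l w = 1 ∨ ∃ i, LF (events L) τ i w ∧ lab w = w) ∧
      (∀ i, g i = 1 ↔ σ.arr 10 l i = 1 ∨ ∃ j r, LF (events L) τ j r ∧ lab r = r ∧ par r = i) := by
  have hl := he.lev
  simp only [Flat.sem]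
  have hroot : ∀ i w s, (i, w, s) ∈ events L → ∀ σ' : HS, Env S L σ' l τ → σ'.arr 2 l = lab →
      (rootE.eval S LM (i, w, s) σ' ≠ 0 ↔ LF (events L) τ i w ∧ lab w = w) := by
    intro i w s h σ' he' h2
    simp only [rootE, ne_eq, E.eval_and_eq_zero, E.eval_eq_eq_zero, not_not]
    simp only [he'.lf hr LM h]
    simp [E.eval, hr.2 i w s h, HS.lv, he'.lev, h2]
  obtain ⟨f, x1, s1⟩ := Flat.wr_at (S := S) (LM := LM) (L := L) σ rootE 7 false .cv (.c 1) hl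
    (fun i w _ => LF (events L) τ i w ∧ lab w = w) (fun _ w _ => w) (fun _ _ _ => 1) rfl
    (fun i w s h => ⟨hroot i w s h σ he e2, fun _ => by simp [E.eval, hr.2 i w s h]⟩)
  rw [x1]
  obtain ⟨g, x2, s2⟩ := Flat.wr_at (S := S) (LM := LM) (L := L) (σ.setA 7 l f) rootE 10 false
    (.arr 3 false .cv) (.c 1) (l := l) hl
    (fun i w _ => LF (events L) τ i w ∧ lab w = w) (fun _ w _ => par w) (fun _ _ _ => 1) rfl
    (fun i w s h => ⟨hroot i w s h _ (he.chg ((Chg.refl [7] l σ).setA (by simp) f) (by decide)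
      (by decide)) (by simpa [HS.setA_arr] using e2), fun _ => by
        simp [E.eval, hr.2 i w s h, HS.lv, hl, HS.setA_arr, e3, hpar i w ⟨s, h⟩]⟩)
  rw [x2]
  refine ⟨f, g, rfl, fun w => ?_, fun i => ?_⟩
  · rw [s1.const_iff]
    refine or_congr_right ⟨?_, ?_⟩
    · rintro ⟨i, w, s, -, h, rfl⟩
      exact ⟨i, h⟩
    · rintro ⟨i, h1, h2⟩
      obtain ⟨s, hs⟩ := h1.occ
      exact ⟨i, w, s, hs, ⟨h1, h2⟩, rfl⟩
  · rw [s2.const_iff]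
    simp only [HS.setA_arr, Fin.reduceEq, false_and, if_false]
    refine or_congr_right ⟨?_, ?_⟩
    · rintro ⟨j, w, s, -, ⟨h1, h2⟩, rfl⟩
      exact ⟨j, w, h1, h2, rfl⟩
    · rintro ⟨j, w, h1, h2, rfl⟩
      obtain ⟨s, hs⟩ := h1.occ
      exact ⟨j, w, s, hs, ⟨h1, h2⟩, rfl⟩

-- The three exits: the lowest level, a diameter that is too large, and the start of the rounds. The
-- listed rows of the one level are the only ones that change, so the data of the calling levels
-- survive.
set_option maxHeartbeats 400000 in
theorem enter_spec (hr : InRange S L) {D n : ℕ} (hD : farDist n ≤ D) {σ : HS} {l : ℕ} {τ : ℕ → ℕ}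
    (hl : σ.lev = l) (e0 : σ.arr 0 l = τ) :
    ∃ σ', enterCmd.sem S LM D L σ = σ' ∧ σ'.lev = l ∧
      (∀ a m, ¬ (a ∈ [1, 2, 3, 4, 5, 6, 7, 8, 9, 10, 24] ∧ m = l) → σ'.arr a m = σ.arr a m) ∧
      LiveOK L τ (σ'.arr 1 l) ∧
      ((l = 0 ∧ σ'.reg = Function.update σ.reg 3 2 ∧
          SpecOK (events L) S 0 0 τ (σ'.arr 2 l) (σ'.arr 6 l) (σ'.arr 10 l)) ∨
        (l ≠ 0 ∧ σ'.reg = Function.update (Function.update σ.reg 3 3) 4 2 ∧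
          Hard (events L) n τ Set.univ) ∨
        (l ≠ 0 ∧ σ'.reg = Function.update σ.reg 3 1 ∧
          LabOK L S τ D (σ'.arr 2 l) (σ'.arr 3 l) ∧ ∀ K n sz, Dyn (events L) K n sz 0 τ
            (σ'.arr 2 l) (σ'.arr 3 l) (σ'.arr 6 l) (σ'.arr 7 l) (σ'.arr 8 l) (σ'.arr 9 l)
            (σ'.arr 10 l))) := by
  obtain ⟨f1, f2, f3, f6, f7, f8, f9, f10, x1, s1⟩ := init_spec (LM := LM) hr σ
  rw [hl] at x1 s1
  rw [e0] at s1
  rw [enterCmd, Cmd.sem_seq, Cmd.sem_flat, x1]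
  set As : List (Fin 32) := [1, 2, 3, 4, 5, 6, 7, 8, 9, 10, 24] with hAs
  set σ1 := ((((((((σ.setA 1 l f1).setA 2 l f2).setA 3 l f3).setA 6 l f6).setA 7 l f7).setA 8 l
    f8).setA 9 l f9).setA 10 l f10) with hσ1
  have hc1 : Chg As l σ σ1 :=
    ((((((((Chg.refl _ _ σ).setA (by simp [hAs]) _).setA (by simp [hAs]) _).setA (by simp [hAs])
      _).setA (by simp [hAs]) _).setA (by simp [hAs]) _).setA (by simp [hAs]) _).setA
      (by simp [hAs]) _).setA (by simp [hAs]) _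
  have a1 : σ1.arr 1 l = f1 := by simp [hσ1, HS.setA_arr]
  have a2 : σ1.arr 2 l = f2 := by simp [hσ1, HS.setA_arr]
  have a3 : σ1.arr 3 l = f3 := by simp [hσ1, HS.setA_arr]
  have a6 : σ1.arr 6 l = f6 := by simp [hσ1, HS.setA_arr]
  have a7 : σ1.arr 7 l = f7 := by simp [hσ1, HS.setA_arr]
  have a8 : σ1.arr 8 l = f8 := by simp [hσ1, HS.setA_arr]
  have a9 : σ1.arr 9 l = f9 := by simp [hσ1, HS.setA_arr]
  have a10 : σ1.arr 10 l = f10 := by simp [hσ1, HS.setA_arr]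
  have h0 : σ1.arr 0 l = τ := by rw [hc1.arr 0 l (by simp [hAs]), e0]
  have hlive : LiveOK L τ (σ1.arr 1 l) := by
    intro i w s h
    rw [a1]; exact (s1 i w s h).1
  have hl1 : σ1.lev = l := hl
  clear_value σ1
  have hframe : ∀ {σ' : HS}, Chg As l σ σ' →
      ∀ a m, ¬ (a ∈ As ∧ m = l) → σ'.arr a m = σ.arr a m :=
    fun h a m ham => h.arr a m fun h1 h2 => ham ⟨h1, h2⟩
  have hz : ∀ i w, LF (events L) τ i w → f2 w = w ∧ f6 w = 0 ∧ f7 w = 0 ∧ f8 w = 0 ∧ f9 w = 0 ∧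
      f10 i = 0 := fun i w h => by
    obtain ⟨s, hs⟩ := h.occ
    obtain ⟨-, h1, -, -, h2, h3, h4, h5, h6⟩ := s1 i w s hs
    exact ⟨h1, h2, h3, h4, h5, h6⟩
  by_cases hl0 : l = 0
  -- At level `0` every component is open with an empty obstruction, as `Hard 0` demands nothing.
  · rw [Cmd.sem_ite_pos (by simp [E.eval, hl1, hl0]), Cmd.sem_flat]
    have hz0 : ∀ i w, LF (events L) τ i w → f6 (f2 w) = 0 := fun i w h => by
      rw [(hz i w h).1]; exact (hz i w h).2.1
    refine ⟨_, rfl, hl1, hframe (σ' := σ1) hc1, hlive, Or.inl ⟨hl0, by rw [← hc1.reg]; rfl, ?_⟩⟩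
    change SpecOK (events L) S 0 0 τ (σ1.arr 2 l) (σ1.arr 6 l) (σ1.arr 10 l)
    rw [a2, a6, a10]
    refine ⟨fun i w h => ?_, fun i w h => ?_, fun i w h => ?_, fun i w h h' => ?_,
      fun i w h h' => ?_, fun i w h _ => ⟨trivial, ∅, le_rfl, fun x hx => ?_⟩⟩
    · obtain ⟨s, hs⟩ := h
      rw [(s1 i w s hs).2.1]; exact (hr.2 i w s hs).2.1
    · rw [(hz i w h).1]; exact .refl
    · rw [hz0 i w h]; omega
    · rw [hz0 i w h] at h'; omega
    · rw [hz0 i w h] at h'; omega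
    · obtain ⟨h1, v, h2, -⟩ := hx
      rw [(hz x v h2).2.2.2.2.2] at h1
      omega
  rw [Cmd.sem_ite_neg (by simp [E.eval, hl1, hl0]), Cmd.sem_seq, Cmd.sem_rep]
  have hinv : LabInv L S τ 0 (σ1.arr 2 l) (σ1.arr 3 l) := by
    rw [a2, a3]
    refine ⟨fun i w h => ?_, fun i w h => ?_, fun i w u h hu => ?_, ⟨fun _ => 0, fun i w h => ?_⟩,
      fun i w h => ?_⟩
    · rw [(hz i w h).1]; exact .refl
    · obtain ⟨s, hs⟩ := h
      rw [(s1 i w s hs).2.1]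
    · cases hu
      rw [(hz i _ h).1]
    · obtain ⟨s, hs⟩ := h.occ
      exact ⟨le_rfl, (s1 i w s hs).2.2.2.1 h, Or.inl (hz i w h).1⟩
    · obtain ⟨s, hs⟩ := h
      exact (s1 i w s hs).2.2.1
  obtain ⟨σ2, x2, hc2, hinv2⟩ := labels_spec (LM := LM) hr D σ1 hl1 h0 hlive hinv
  rw [x2, Cmd.sem_seq, Cmd.sem_flat]
  have he2 : Env S L σ2 l τ := Env.chg ⟨hl1, h0, hlive⟩ hc2 (by decide) (by decide)
  obtain ⟨σ3, x3, hc3, h5⟩ := bad_spec (LM := LM) hr he2 rfl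
  rw [x3]
  have hc13 : ∀ a m, (a ∈ [(2 : Fin 32), 3, 4, 5, 24] → m ≠ l) → σ3.arr a m = σ1.arr a m := by
    have h2 : ∀ a ∈ [(2 : Fin 32), 3, 4, 24], a ∈ [(2 : Fin 32), 3, 4, 5, 24] := by decide
    have h3 : ∀ a ∈ [(4 : Fin 32), 5, 24], a ∈ [(2 : Fin 32), 3, 4, 5, 24] := by decide
    intro a m h
    rw [hc3.arr a m fun h' => h (h3 a h'), hc2.arr a m fun h' => h (h2 a h')]
  have hc : Chg As l σ σ3 := by
    have h2 : ∀ a ∈ [(2 : Fin 32), 3, 4, 5, 24], a ∈ As := by decide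
    exact ⟨hc3.lev.trans (hc2.lev.trans hc1.lev), hc3.reg.trans (hc2.reg.trans hc1.reg),
      fun a m h => (hc13 a m fun h' => h (h2 a h')).trans (hc1.arr a m h)⟩
  have he3 : Env S L σ3 l τ := he2.chg hc3 (by decide) (by decide)
  have e5 : (E.arr 5 false (.c 0)).eval S LM (0, 0, 0) σ3 = σ3.arr 5 l 0 := by
    simp [E.eval, hr.1, HS.lv, he3.lev]
  have hlab : σ3.arr 2 l = σ2.arr 2 l := hc3.arr 2 l (by simp)
  have hpar : σ3.arr 3 l = σ2.arr 3 l := hc3.arr 3 l (by simp)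
  by_cases hb : σ3.arr 5 l 0 = 0
  · rw [Cmd.sem_ite_neg (by rw [e5, hb]), Cmd.sem_flat]
    have hok : LabOK L S τ D (σ3.arr 2 l) (σ3.arr 3 l) := by
      rw [hlab, hpar]
      refine hinv2.ok fun i u w hu hw => ?_
      by_contra hne
      rcases lt_or_gt_of_ne hne with h | h
      · exact h5.mpr ⟨i, u, w, hu, hw, h⟩ hb
      · exact h5.mpr ⟨i, w, u, hw, hu, h⟩ hb
    obtain ⟨f, g, x4, hf, hg⟩ := root_spec (LM := LM) hr he3 (par := σ3.arr 3 l)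
      (fun i w h => hok.par i w h) rfl rfl
    rw [x4]
    have hc4 : Chg As l σ ((σ3.setA 7 l f).setA 10 l g) :=
      (hc.setA (by simp [hAs]) f).setA (by simp [hAs]) g
    have he4 : Env S L ((σ3.setA 7 l f).setA 10 l g) l τ :=
      he3.chg (((Chg.refl [7, 10] l σ3).setA (a := 7) (by simp) f).setA (a := 10) (by simp) g)
        (by decide) (by decide)
    refine ⟨_, rfl, he3.lev, hframe (σ' := ((σ3.setA 7 l f).setA 10 l g)) hc4, he4.live,
      Or.inr (Or.inr ⟨hl0, ?_, ?_⟩)⟩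
    · simp [HS.setR, hc.reg]
    simp only [HS.setR, HS.setA_arr, Fin.reduceEq, false_and, if_false, and_self, if_true]
    refine ⟨hok, fun K n sz => Dyn.zero hok (fun i w h => ?_) (fun i w h => ?_) (fun i w h => ?_)
      (fun i w h => ?_) (fun i w h => ?_)⟩
    · rw [hc13 6 l (by simp), a6]; exact (hz i w h).2.1
    · rw [hc13 8 l (by simp), a8]; exact (hz i w h).2.2.2.1
    · rw [hc13 9 l (by simp), a9]; exact (hz i w h).2.2.2.2.1
    · rw [hf, hc13 7 l (by simp), a7, (hz i w h).2.2.1]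
      simp only [zero_ne_one, false_or]
      exact ⟨fun ⟨_, _, h⟩ => h, fun h' => ⟨i, h, h'⟩⟩
    · rw [hg, hc13 10 l (by simp), a10, (hz i w h).2.2.2.2.2]
      simp only [zero_ne_one, false_or]
  · rw [Cmd.sem_ite_pos (by rw [e5]; exact hb), Cmd.sem_flat]
    obtain ⟨i, u, w, h1, h2, h3⟩ := h5.mp hb
    refine ⟨_, rfl, he3.lev, hframe (σ' := σ3) hc, he3.live, Or.inr (Or.inl ⟨hl0, ?_,
      hinv2.hard hr hD h1 h2 h3⟩)⟩
    rw [← hc.reg]; rfl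

end RecBackdoor

/-! ### Evaluating the result of a call. -/

namespace RecBackdoor

variable {S LM : ℕ} {L : List (List Literal)}

/-- The rows that are read when the level above evaluates the result of a call. -/
structure Env2 (S : ℕ) (L : List (List Literal)) (σ : HS) (l : ℕ)
    (τ τ' lab lab' stat' obs' pk : ℕ → ℕ) : Prop extends Env S L σ (l + 1) τ where
  val' : σ.arr 0 l = τ'
  live' : LiveOK L τ' (σ.arr 1 l)
  row2 : σ.arr 2 (l + 1) = lab
  row2' : σ.arr 2 l = lab'
  row6' : σ.arr 6 l = stat'
  row10' : σ.arr 10 l = obs'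
  row12 : σ.arr 12 (l + 1) = pk
  lab_lt : ∀ i w, Occ (events L) i w → lab w < S
  lab_lt' : ∀ i w, Occ (events L) i w → lab' w < S

section

variable {σ : HS} {l : ℕ} {τ τ' lab lab' stat' obs' pk : ℕ → ℕ}

theorem Env2.chg {σ' : HS} (h : Env2 S L σ l τ τ' lab lab' stat' obs' pk) {As : List (Fin 32)}
    (hc : Chg As (l + 1) σ σ')
    (hA : (decide (0 ∉ As) && decide (1 ∉ As) && decide (2 ∉ As) && decide (12 ∉ As)) = true) :
    Env2 S L σ' l τ τ' lab lab' stat' obs' pk := by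
  simp only [Bool.and_eq_true, decide_eq_true_eq] at hA
  obtain ⟨⟨⟨h0, h1⟩, h2⟩, h12⟩ := hA
  have hl : ∀ a, σ'.arr a l = σ.arr a l := fun a => hc.arr a l fun _ => by omega
  have hl1 : ∀ a ∉ As, σ'.arr a (l + 1) = σ.arr a (l + 1) := fun a ha =>
    hc.arr a _ fun h => absurd h ha
  exact { h.toEnv.chg hc h0 h1 with
    val' := (hl 0).trans h.val'
    live' := by rw [hl]; exact h.live'
    row2 := (hl1 2 h2).trans h.row2
    row2' := (hl 2).trans h.row2'
    row6' := (hl 6).trans h.row6'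
    row10' := (hl 10).trans h.row10'
    row12 := (hl1 12 h12).trans h.row12
    lab_lt := h.lab_lt
    lab_lt' := h.lab_lt' }

theorem Env2.setA (h : Env2 S L σ l τ τ' lab lab' stat' obs' pk) (a : Fin 32) (f : ℕ → ℕ)
    (hA : (decide (a ≠ 0) && decide (a ≠ 1) && decide (a ≠ 2) && decide (a ≠ 12)) = true) :
    Env2 S L (σ.setA a (l + 1) f) l τ τ' lab lab' stat' obs' pk := by
  refine h.chg (As := [a]) ((Chg.refl _ _ σ).setA (by simp) f) ?_
  simp only [Bool.and_eq_true, decide_eq_true_eq, List.mem_singleton] at hA ⊢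
  exact ⟨⟨⟨hA.1.1.1.symm, hA.1.1.2.symm⟩, hA.1.2.symm⟩, hA.2.symm⟩

theorem Env2.lv_true (h : Env2 S L σ l τ τ' lab lab' stat' obs' pk) : σ.lv true = l := by
  simp [HS.lv, h.lev]

theorem Env2.lv_false (h : Env2 S L σ l τ τ' lab lab' stat' obs' pk) : σ.lv false = l + 1 := by
  simp [HS.lv, h.lev]

theorem Env2.lf' (h : Env2 S L σ l τ τ' lab lab' stat' obs' pk) (hr : InRange S L) (LM : ℕ)
    {i w s : ℕ} (he : (i, w, s) ∈ events L) :
    (lfE true).eval S LM (i, w, s) σ = 0 ↔ ¬ LF (events L) τ' i w :=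
  lfE_LF hr he σ true (by simp [HS.lv, h.lev]) h.val' h.live'

theorem outE_eval (hr : InRange S L) (LM : ℕ) (hl : σ.lv true = l) (h0 : σ.arr 0 l = τ')
    (h1 : LiveOK L τ' (σ.arr 1 l)) (h2 : σ.arr 2 l = lab') (h6 : σ.arr 6 l = stat')
    (hlab : ∀ i w, Occ (events L) i w → lab' w < S) {i w s : ℕ} (he : (i, w, s) ∈ events L)
    (n : Fin 8) :
    (outE n).eval S LM (i, w, s) σ = 0 ↔ ¬ (LF (events L) τ' i w ∧ stat' (lab' w) = n) := by
  simp only [outE, ne_eq, E.eval_and_eq_zero, E.eval_eq_eq_zero, not_not]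
  simp only [lfE_LF hr he σ true hl h0 h1, not_not]
  simp [E.eval, hr.2 i w s he, hl, h2, h6, hlab i w ⟨s, he⟩]

theorem Env2.out (h : Env2 S L σ l τ τ' lab lab' stat' obs' pk) (hr : InRange S L) (LM : ℕ)
    {i w s : ℕ} (he : (i, w, s) ∈ events L) (n : Fin 8) :
    (outE n).eval S LM (i, w, s) σ = 0 ↔ ¬ (LF (events L) τ' i w ∧ stat' (lab' w) = n) :=
  outE_eval hr LM h.lv_true h.val' h.live' h.row2' h.row6' h.lab_lt' he n

theorem Env2.evalLab (h : Env2 S L σ l τ τ' lab lab' stat' obs' pk) (hr : InRange S L) (LM : ℕ)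
    {i w s : ℕ} (he : (i, w, s) ∈ events L) : labE.eval S LM (i, w, s) σ = lab w := by
  simp [labE, E.eval, hr.2 i w s he, HS.lv, h.row2, h.lev]

theorem Env2.evalPk (h : Env2 S L σ l τ τ' lab lab' stat' obs' pk) (hr : InRange S L) (LM : ℕ)
    {i w s : ℕ} (he : (i, w, s) ∈ events L) :
    (E.arr 12 false .cv).eval S LM (i, w, s) σ = pk w := by
  simp [E.eval, hr.2 i w s he, HS.lv, h.row12, h.lev]

theorem Env2.evalAt (h : Env2 S L σ l τ τ' lab lab' stat' obs' pk) (hr : InRange S L) (LM : ℕ)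
    {i w s : ℕ} (he : (i, w, s) ∈ events L) (a : Fin 32) :
    (E.arr a false labE).eval S LM (i, w, s) σ = σ.arr a (l + 1) (lab w) := by
  simp only [E.eval, h.evalLab hr LM he, if_pos (h.lab_lt i w ⟨s, he⟩), HS.lv, h.lev,
    Bool.false_eq_true, if_false]

theorem E.eval_ci (e : Ev) (σ : HS) (hr : InRange S L) (he : e ∈ events L) (a : Fin 32) (ch : Bool) :
    (E.arr a ch .ci).eval S LM e σ = σ.arr a (σ.lv ch) e.1 := by
  obtain ⟨i, w, s⟩ := e
  simp [E.eval, hr.2 i w s he]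

theorem E.eval_cv (e : Ev) (σ : HS) (hr : InRange S L) (he : e ∈ events L) (a : Fin 32) (ch : Bool) :
    (E.arr a ch .cv).eval S LM e σ = σ.arr a (σ.lv ch) e.2.1 := by
  obtain ⟨i, w, s⟩ := e
  simp [E.eval, hr.2 i w s he]

/-- Clear a row, and then mark the components that contain an event with a given property. -/
theorem markLab_spec (hr : InRange S L) (h : Env2 S L σ l τ τ' lab lab' stat' obs' pk)
    (a : Fin 32) (g : E) (G : ℕ → ℕ → ℕ → Prop)
    (hA : (decide (a ≠ 0) && decide (a ≠ 1) && decide (a ≠ 2) && decide (a ≠ 12)) = true)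
    (ha : g.avoids a = true)
    (hG : ∀ i w s, (i, w, s) ∈ events L → (g.eval S LM (i, w, s) σ ≠ 0 ↔ G i w s)) :
    ∃ f, (Flat.wr g a false labE (.c 1)).sem S LM L
        ((Flat.wr (.c 1) a false .cv (.c 0)).sem S LM L σ) = σ.setA a (l + 1) f ∧
      ∀ y, (∃ i, Occ (events L) i y) → (f y = 0 ∨ f y = 1) ∧
        (f y = 1 ↔ ∃ i w s, (i, w, s) ∈ events L ∧ G i w s ∧ lab w = y) := by
  obtain ⟨f0, x0, s0⟩ := Flat.fillV (LM := LM) hr σ a 0 h.lev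
  rw [x0]
  have h1 := h.setA a f0 hA
  simp only [Bool.and_eq_true, decide_eq_true_eq] at hA
  obtain ⟨f, x1, s1⟩ := Flat.wr_at (S := S) (LM := LM) (L := L) _ g a false labE (.c 1) h1.lev
    G (fun _ w _ => lab w) (fun _ _ _ => 1) (by
      simp [ha, labE, E.avoids, hA.1.2.symm]) (fun i w s he => ⟨by
        rw [E.eval_setA ha]; exact hG i w s he, fun _ => ⟨h1.evalLab hr LM he,
          h.lab_lt i w ⟨s, he⟩, rfl⟩⟩)
  rw [x1, HS.setA_setA]
  refine ⟨f, rfl, fun y ⟨i, s, hs⟩ => ?_⟩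
  simp only [HS.setA_arr, and_self, if_true] at s1
  have hy := s0 i y s hs
  constructor
  · rcases s1 y with ⟨_, _, _, -, -, -, h⟩ | ⟨-, h⟩
    · exact Or.inr h
    · exact Or.inl (h.trans hy)
  · rw [s1.const_iff, hy]
    simp

/-- Row 17 is never cleared. It is read only where row 16 is set, and both are written under the
same guard, so the entry then stems from this round. -/
theorem outcome_spec (hr : InRange S L) {D : ℕ} {par : ℕ → ℕ} (hlab : LabOK L S τ D lab par)
    (h : Env2 S L σ l τ τ' lab lab' stat' obs' pk) :
    ∃ σ', outcomeF.sem S LM L σ = σ' ∧ Chg [15, 16, 17, 18, 19, 20] (l + 1) σ σ' ∧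
      Outcome (events L) τ lab pk τ' lab' stat' obs' (σ'.arr 16 (l + 1)) (σ'.arr 17 (l + 1))
        (σ'.arr 18 (l + 1)) (σ'.arr 20 (l + 1)) := by
  unfold outcomeF
  simp only [Flat.sem]
  -- components with a selected variable
  obtain ⟨hp, x1, s1⟩ := markLab_spec (LM := LM) hr h 15
    (.and (lfE false) (.eq (.arr 12 false .cv) (.c 1)))
    (fun i w _ => LF (events L) τ i w ∧ pk w = 1) rfl rfl (fun i w s he => by
      simp only [ne_eq, E.eval_and_eq_zero, E.eval_eq_eq_zero, not_not, h.lf hr LM he,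
        h.evalPk hr LM he]
      simp [E.eval])
  rw [x1]
  have c1 : Chg [15, 16, 17, 18, 19, 20] (l + 1) σ (σ.setA 15 (l + 1) hp) :=
    (Chg.refl _ _ σ).setA (by simp) _
  have h1 := h.chg c1 rfl
  set σ1 := σ.setA 15 (l + 1) hp with hσ1
  have r15 : σ1.arr 15 (l + 1) = hp := by simp [hσ1, HS.setA_arr]
  clear_value σ1
  -- open components
  have ghp : ∀ i w s, (i, w, s) ∈ events L → ∀ σ' : HS, Env2 S L σ' l τ τ' lab lab' stat' obs' pk →
      σ'.arr 15 (l + 1) = hp → (E.eval S LM (i, w, s) σ' (.and (lfE false) (.and hpE (outE 0))) ≠ 0 ↔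
        LF (events L) τ i w ∧ hp (lab w) = 1 ∧ LF (events L) τ' i w ∧ stat' (lab' w) = 0) := by
    intro i w s he σ' h' h15
    simp only [ne_eq, hpE, E.eval_and_eq_zero, E.eval_eq_eq_zero, not_not, h'.lf hr LM he,
        h'.evalAt hr LM he, h'.out hr LM he, h15]
    simp [E.eval]
  obtain ⟨fa, x2, s2⟩ := markLab_spec (LM := LM) hr h1 16 (.and (lfE false) (.and hpE (outE 0)))
    (fun i w _ => LF (events L) τ i w ∧ hp (lab w) = 1 ∧ LF (events L) τ' i w ∧ stat' (lab' w) = 0)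
    rfl rfl (fun i w s he => ghp i w s he σ1 h1 r15)
  rw [x2]
  have c2 := c1.setA (a := 16) (by simp) fa
  have h2 := h1.setA 16 fa rfl
  have r15 : (σ1.setA 16 (l + 1) fa).arr 15 (l + 1) = hp := by simpa [HS.setA_arr] using r15
  have r16 : (σ1.setA 16 (l + 1) fa).arr 16 (l + 1) = fa := by simp [HS.setA_arr]
  set σ2 := σ1.setA 16 (l + 1) fa
  clear_value σ2
  obtain ⟨ch, x3, s3⟩ := Flat.wr_at (S := S) (LM := LM) (L := L) σ2
    (.and (lfE false) (.and hpE (outE 0))) 17 false labE (.arr 2 true .cv) (l := l + 1) h2.lev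
    (fun i w _ => LF (events L) τ i w ∧ hp (lab w) = 1 ∧ LF (events L) τ' i w ∧ stat' (lab' w) = 0)
    (fun _ w _ => lab w) (fun _ w _ => lab' w) rfl (fun i w s he => ⟨ghp i w s he σ2 h2 r15,
      fun _ => ⟨h2.evalLab hr LM he, h.lab_lt i w ⟨s, he⟩, by
        rw [E.eval_cv _ _ hr he]; simp [HS.lv, h2.lev, h2.row2']⟩⟩)
  rw [x3]
  have c3 := c2.setA (a := 17) (by simp) ch
  have h3 := h2.setA 17 ch rfl
  have r15 : (σ2.setA 17 (l + 1) ch).arr 15 (l + 1) = hp := by simpa [HS.setA_arr] using r15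
  have r16 : (σ2.setA 17 (l + 1) ch).arr 16 (l + 1) = fa := by simpa [HS.setA_arr] using r16
  have r17 : (σ2.setA 17 (l + 1) ch).arr 17 (l + 1) = ch := by simp [HS.setA_arr]
  set σ3 := σ2.setA 17 (l + 1) ch
  clear_value σ3
  -- falsified clauses
  obtain ⟨e0, x4, s4⟩ := Flat.fillI (LM := LM) hr σ3 19 0 (l := l + 1) h3.lev
  rw [x4]
  have h4 := h3.setA 19 e0 rfl
  obtain ⟨e1, x5, s5⟩ := Flat.wr_at (S := S) (LM := LM) (L := L) _ (.eq (.arr 1 true .ci) (.c 1)) 19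
    false .ci (.c 1) h4.lev (fun i _ _ => Live (events L) τ' i) (fun i _ _ => i) (fun _ _ _ => 1) rfl
    (fun i w s he => by
      simp only [ne_eq, E.eval_eq_eq_zero, not_not, E.eval_ci _ _ hr he, h4.lv_true]
      exact ⟨h4.live' i w s he, fun _ => by simp [E.eval, (hr.2 i w s he).1]⟩)
  rw [x5, HS.setA_setA]
  have h5 := h3.setA 19 e1 rfl
  obtain ⟨e2, x6, s6⟩ := Flat.wr_at (S := S) (LM := LM) (L := L) _ (.eq (.arr 0 true .cv) (.c 2)) 19
    false .ci (.c 0) h5.lev (fun _ w _ => τ' w = 2) (fun i _ _ => i) (fun _ _ _ => 0) rfl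
    (fun i w s he => by
      simp only [ne_eq, E.eval_eq_eq_zero, not_not, E.eval_cv _ _ hr he, h5.lv_true, h5.val']
      exact ⟨Iff.rfl, fun _ => by simp [E.eval, (hr.2 i w s he).1]⟩)
  rw [x6, HS.setA_setA]
  simp only [HS.setA_arr, and_self, if_true] at s5 s6
  have hemp : ∀ i, (∃ w, Occ (events L) i w) → (e2 i = 1 ↔ Live (events L) τ' i ∧
      ∀ u, Occ (events L) i u → τ' u ≠ 2) := by
    rintro i ⟨w, s, hs⟩
    rcases s6 i with ⟨i', w', s', k1, k2, rfl, k3⟩ | ⟨k1, k2⟩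
    · rw [k3]
      simp only [zero_ne_one, false_iff, not_and, not_forall, not_not]
      exact fun _ => ⟨w', ⟨s', k1⟩, k2⟩
    · rw [k2, s5.const_iff, s4 i w s hs]
      constructor
      · rintro (k | ⟨i', w', s', -, k3, rfl⟩)
        · simp at k
        · exact ⟨k3, fun u ⟨s, hu⟩ k4 => k1 _ _ _ hu k4 rfl⟩
      · exact fun k => Or.inr ⟨i, w, s, hs, k.1, rfl⟩
  have c4 := c3.setA (a := 19) (by simp) e2
  have h6 := h3.setA 19 e2 rfl
  have r15 : (σ3.setA 19 (l + 1) e2).arr 15 (l + 1) = hp := by simpa [HS.setA_arr] using r15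
  have r16 : (σ3.setA 19 (l + 1) e2).arr 16 (l + 1) = fa := by simpa [HS.setA_arr] using r16
  have r17 : (σ3.setA 19 (l + 1) e2).arr 17 (l + 1) = ch := by simpa [HS.setA_arr] using r17
  have r19 : (σ3.setA 19 (l + 1) e2).arr 19 (l + 1) = e2 := by simp [HS.setA_arr]
  set σ4 := σ3.setA 19 (l + 1) e2
  clear_value σ4
  -- negative components
  obtain ⟨u0, x7, s7⟩ := markLab_spec (LM := LM) hr h6 18 (.and (lfE false) (outE 2))
    (fun i w _ => LF (events L) τ i w ∧ LF (events L) τ' i w ∧ stat' (lab' w) = 2) rfl rfl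
    (fun i w s he => by
      simp only [ne_eq, E.eval_and_eq_zero, not_not, h6.lf hr LM he, h6.out hr LM he]
      simp)
  rw [x7]
  have h7 := h6.setA 18 u0 rfl
  obtain ⟨un, x8, s8⟩ := Flat.wr_at (S := S) (LM := LM) (L := L) _
    (.and (lfE false) (.eq (.arr 19 false .ci) (.c 1))) 18 false labE (.c 1) (l := l + 1) h7.lev
    (fun i w _ => LF (events L) τ i w ∧ e2 i = 1) (fun _ w _ => lab w) (fun _ _ _ => 1) rfl
    (fun i w s he => ⟨by
      simp only [ne_eq, E.eval_and_eq_zero, E.eval_eq_eq_zero, not_not, h7.lf hr LM he,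
        E.eval_ci _ _ hr he, h7.lv_false]
      simp [E.eval, HS.setA_arr, r19], fun _ => ⟨h7.evalLab hr LM he,
        h.lab_lt i w ⟨s, he⟩, rfl⟩⟩)
  rw [x8, HS.setA_setA]
  simp only [HS.setA_arr, and_self, if_true] at s8
  have c5 := c4.setA (a := 18) (by simp) un
  have h8 := h6.setA 18 un rfl
  have r15 : (σ4.setA 18 (l + 1) un).arr 15 (l + 1) = hp := by simpa [HS.setA_arr] using r15
  have r16 : (σ4.setA 18 (l + 1) un).arr 16 (l + 1) = fa := by simpa [HS.setA_arr] using r16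
  have r17 : (σ4.setA 18 (l + 1) un).arr 17 (l + 1) = ch := by simpa [HS.setA_arr] using r17
  have r18 : (σ4.setA 18 (l + 1) un).arr 18 (l + 1) = un := by simp [HS.setA_arr]
  set σ5 := σ4.setA 18 (l + 1) un
  clear_value σ5
  -- the new part of the obstruction
  obtain ⟨n0, x9, s9⟩ := Flat.fillI (LM := LM) hr σ5 20 0 (l := l + 1) h8.lev
  rw [x9]
  have h9 := h8.setA 20 n0 rfl
  obtain ⟨nob, x10, s10⟩ := Flat.wr_at (S := S) (LM := LM) (L := L) (σ5.setA 20 (l + 1) n0)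
    (.and (lfE false) (.and (lfE true) (.and hpE (.and (.eq (.arr 16 false labE) (.c 1))
    (.and (.eq (.arr 10 true .ci) (.c 1)) (.eq (.arr 2 true .cv) (.arr 17 false labE)))))))
    20 false .ci (.c 1) (l := l + 1) h9.lev
    (fun i w _ => LF (events L) τ i w ∧ LF (events L) τ' i w ∧ hp (lab w) = 1 ∧ fa (lab w) = 1 ∧
      obs' i = 1 ∧ lab' w = ch (lab w)) (fun i _ _ => i) (fun _ _ _ => 1) rfl
    (fun i w s he => ⟨by
      simp only [ne_eq, hpE, E.eval_and_eq_zero, E.eval_eq_eq_zero, not_not, h9.lf hr LM he,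
        h9.lf' hr LM he, E.eval_ci _ _ hr he, E.eval_cv _ _ hr he, h9.evalAt hr LM he,
        h9.lv_true, h9.row2', h9.row10']
      simp [E.eval, HS.setA_arr, r15, r16, r17],
      fun _ => by simp [E.eval, hr.2 i w s he]⟩)
  rw [x10, HS.setA_setA]
  simp only [HS.setA_arr, and_self, if_true] at s10
  refine ⟨_, rfl, c5.setA (a := 20) (by simp) nob, ?_⟩
  simp only [HS.setA_arr, Fin.reduceEq, false_and, if_false, and_self, if_true, r16, r17, r18]
  have hocc : ∀ i w, LF (events L) τ i w → ∃ j, Occ (events L) j (lab w) := fun i w hw =>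
    ⟨_, (hlab.root hw).2.choose_spec.occ⟩
  have hhp : ∀ i w, LF (events L) τ i w → (hp (lab w) = 1 ↔
      ∃ y, pk y = 1 ∧ lab y = lab w ∧ ∃ i, LF (events L) τ i y) := by
    intro i w hw
    rw [(s1 _ (hocc i w hw)).2]
    constructor
    · rintro ⟨j, y, s, -, ⟨k1, k2⟩, k3⟩
      exact ⟨y, k2, k3, j, k1⟩
    · rintro ⟨y, k2, k3, j, k1⟩
      obtain ⟨s, hs⟩ := k1.occ
      exact ⟨j, y, s, hs, ⟨k1, k2⟩, k3⟩
  have hfa : ∀ i w, LF (events L) τ i w → (fa (lab w) = 1 ↔ hp (lab w) = 1 ∧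
      ∃ j v, LF (events L) τ j v ∧ LF (events L) τ' j v ∧ lab v = lab w ∧ stat' (lab' v) = 0) := by
    intro i w hw
    rw [(s2 _ (hocc i w hw)).2]
    constructor
    · rintro ⟨j, v, s, -, ⟨k1, k2, k3, k4⟩, k5⟩
      exact ⟨k5 ▸ k2, j, v, k1, k3, k5, k4⟩
    · rintro ⟨k2, j, v, k1, k3, k5, k4⟩
      obtain ⟨s, hs⟩ := k1.occ
      exact ⟨j, v, s, hs, ⟨k1, by rw [k5]; exact k2, k3, k4⟩, k5⟩
  constructor
  · intro i w hw
    rw [hfa i w hw, hhp i w hw]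
  · exact fun i w hw => (s2 _ (hocc i w hw)).1
  · intro i w hw hf
    obtain ⟨k2, j, v, k1, k3, k5, k4⟩ := (hfa i w hw).mp hf
    obtain ⟨s, hs⟩ := k1.occ
    obtain ⟨j', v', s', m1, ⟨m2, m3, m4, m5⟩, m6, m7⟩ :=
      s3.of_mem hs ⟨k1, by rw [k5]; exact k2, k3, k4⟩
    rw [k5] at m6 m7
    exact ⟨j', v', m2, m4, m6, m5, m7⟩
  · intro i w hw
    rw [s8.const_iff, (s7 _ (hocc i w hw)).2]
    constructor
    · rintro (⟨j, v, s, -, ⟨k1, k2, k3⟩, k4⟩ | ⟨j, v, s, -, ⟨k1, k2⟩, k4⟩)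
      · exact ⟨j, v, k1, k4, Or.inl ⟨k2, k3⟩⟩
      · exact ⟨j, v, k1, k4, Or.inr ((hemp j ⟨v, k1.occ⟩).mp k2)⟩
    · rintro ⟨j, v, k1, k4, k | k⟩
      · obtain ⟨s, hs⟩ := k1.occ
        exact Or.inl ⟨j, v, s, hs, ⟨k1, k⟩, k4⟩
      · obtain ⟨s, hs⟩ := k1.occ
        exact Or.inr ⟨j, v, s, hs, ⟨k1, (hemp j ⟨v, k1.occ⟩).mpr k⟩, k4⟩
  · intro i w hw
    rcases s8 (lab w) with ⟨_, _, _, -, -, -, k⟩ | ⟨-, k⟩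
    · exact Or.inr k
    · rw [k]; exact (s7 _ (hocc i w hw)).1
  · intro i w hw
    obtain ⟨s, hs⟩ := hw.occ
    rw [s10.const_iff, s9 i w s hs]
    constructor
    · rintro (k | ⟨i', v, s, -, ⟨k1, k2, -, k3, k4, k5⟩, rfl⟩)
      · simp at k
      · exact ⟨v, k1, k2, k3, k4, k5⟩
    · rintro ⟨v, k1, k2, k3, k4, k5⟩
      obtain ⟨s, hs⟩ := k1.occ
      exact Or.inr ⟨i, v, s, hs, ⟨k1, k2, ((hfa i v k1).mp k3).1, k3, k4, k5⟩, rfl⟩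

end

end RecBackdoor

/-! ### Recording the outcome of a round. -/

namespace RecBackdoor

variable {S LM : ℕ} {L : List (List Literal)}
variable {σ : HS} {l : ℕ} {τ τ' lab lab' stat' obs' pk : ℕ → ℕ}

/-- The status of a component is written by its selected variable only. As there is at most one
(`PickOK.unique`), the writes to the same label cannot conflict. -/
theorem record_spec (hr : InRange S L)
    (h : Env2 S L σ l τ τ' lab lab' stat' obs' pk) {stat cand tried fl obs fa un nob : ℕ → ℕ}
    (e6 : σ.arr 6 (l + 1) = stat) (e7 : σ.arr 7 (l + 1) = cand) (e8 : σ.arr 8 (l + 1) = tried)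
    (e9 : σ.arr 9 (l + 1) = fl) (e10 : σ.arr 10 (l + 1) = obs) (e16 : σ.arr 16 (l + 1) = fa)
    (e18 : σ.arr 18 (l + 1) = un) (e20 : σ.arr 20 (l + 1) = nob)
    (hpk : PickOK (events L) τ lab stat cand tried pk)
    (hτ' : ∀ i w, Occ (events L) i w → τ' w = if pk w = 1 then tried w else τ w) :
    ∃ σ', recordF.sem S LM L σ = σ'.setR 3 1 ∧ Chg [6, 7, 8, 9, 10] (l + 1) σ σ' ∧
      Recorded (events L) τ lab pk stat cand tried fl obs fa un nob (σ'.arr 6 (l + 1))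
        (σ'.arr 7 (l + 1)) (σ'.arr 8 (l + 1)) (σ'.arr 9 (l + 1)) (σ'.arr 10 (l + 1)) := by
  unfold recordF
  simp only [Flat.sem]
  obtain ⟨obs2, x1, s1⟩ := Flat.wr_at (S := S) (LM := LM) (L := L) σ
    (.eq (.arr 20 false .ci) (.c 1)) 10 false .ci (.c 1) h.lev (fun i _ _ => nob i = 1)
    (fun i _ _ => i) (fun _ _ _ => 1) rfl (fun i w s he => by
      simp only [ne_eq, E.eval_eq_eq_zero, not_not, E.eval_ci _ _ hr he, h.lv_false, e20]
      exact ⟨Iff.rfl, fun _ => by simp [E.eval, (hr.2 i w s he).1]⟩)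
  rw [x1]
  have h1 := h.setA 10 obs2 rfl
  obtain ⟨cand2, x2, s2⟩ := Flat.wr_at (S := S) (LM := LM) (L := L) (σ.setA 10 (l + 1) obs2)
    (.and (lfE false) (.and (.eq (.arr 20 false .ci) (.c 1)) (.eq (.arr 12 false labE) (.c 1))))
    7 false .cv (.c 1) h1.lev (fun i w _ => LF (events L) τ i w ∧ nob i = 1 ∧ pk (lab w) = 1)
    (fun _ w _ => w) (fun _ _ _ => 1) rfl (fun i w s he => by
      simp only [ne_eq, E.eval_and_eq_zero, E.eval_eq_eq_zero, not_not, h1.lf hr LM he,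
        E.eval_ci _ _ hr he, h1.lv_false, h1.evalAt hr LM he]
      exact ⟨by simp [E.eval, HS.setA_arr, e20, h.row12], fun _ => by
        simp [E.eval, (hr.2 i w s he).2.1]⟩)
  rw [x2]
  have h2 := h1.setA 7 cand2 rfl
  have hsel : ∀ (u f : Fin 8) (i w s : ℕ), (i, w, s) ∈ events L → ∀ σ' : HS,
      Env2 S L σ' l τ τ' lab lab' stat' obs' pk → σ'.arr 16 (l + 1) = fa →
      σ'.arr 18 (l + 1) = un → ((selE u f).eval S LM (i, w, s) σ' ≠ 0 ↔
        LF (events L) τ i w ∧ pk w = 1 ∧ un (lab w) = u ∧ fa (lab w) = f) := by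
    intro u f i w s he σ' h' h16 h18
    simp only [ne_eq, selE, E.eval_and_eq_zero, E.eval_eq_eq_zero, not_not, h'.lf hr LM he,
      h'.evalPk hr LM he, h'.evalAt hr LM he, h16, h18]
    simp [E.eval]
  obtain ⟨fl2, x3, s3⟩ := Flat.wr_at (S := S) (LM := LM) (L := L)
    ((σ.setA 10 (l + 1) obs2).setA 7 (l + 1) cand2) (selE 0 1) 9 false .cv (.c 1) h2.lev
    (fun i w _ => LF (events L) τ i w ∧ pk w = 1 ∧ un (lab w) = 0 ∧ fa (lab w) = 1)
    (fun _ w _ => w) (fun _ _ _ => 1) rfl (fun i w s he =>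
      ⟨hsel 0 1 i w s he _ h2 (by simpa [HS.setA_arr] using e16) (by simpa [HS.setA_arr] using e18),
        fun _ => by simp [E.eval, (hr.2 i w s he).2.1]⟩)
  rw [x3]
  have h3 := h2.setA 9 fl2 rfl
  obtain ⟨st1, x4, s4⟩ := Flat.wr_at (S := S) (LM := LM) (L := L)
    (((σ.setA 10 (l + 1) obs2).setA 7 (l + 1) cand2).setA 9 (l + 1) fl2) (selE 0 0) 6 false labE
    (.c 1) h3.lev (fun i w _ => LF (events L) τ i w ∧ pk w = 1 ∧ un (lab w) = 0 ∧ fa (lab w) = 0)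
    (fun _ w _ => lab w) (fun _ _ _ => 1) rfl (fun i w s he =>
      ⟨hsel 0 0 i w s he _ h3 (by simpa [HS.setA_arr] using e16) (by simpa [HS.setA_arr] using e18),
        fun _ => ⟨h3.evalLab hr LM he, h.lab_lt i w ⟨s, he⟩, rfl⟩⟩)
  rw [x4]
  have h4 := h3.setA 6 st1 rfl
  have htv : ∀ (n : Fin 8) (i w s : ℕ), (i, w, s) ∈ events L → ∀ σ' : HS,
      Env2 S L σ' l τ τ' lab lab' stat' obs' pk → ((E.and (.eq (.arr 12 false .cv) (.c 1))
        (.eq (.arr 0 true .cv) (.c n))).eval S LM (i, w, s) σ' ≠ 0 ↔ pk w = 1 ∧ τ' w = n) := by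
    intro n i w s he σ' h'
    simp only [ne_eq, E.eval_and_eq_zero, E.eval_eq_eq_zero, not_not, h'.evalPk hr LM he,
      E.eval_cv _ _ hr he, h'.lv_true, h'.val']
    simp [E.eval]
  obtain ⟨tr1, x5, s5⟩ := Flat.wr_at (S := S) (LM := LM) (L := L)
    ((((σ.setA 10 (l + 1) obs2).setA 7 (l + 1) cand2).setA 9 (l + 1) fl2).setA 6 (l + 1) st1)
    (.and (.eq (.arr 12 false .cv) (.c 1)) (.eq (.arr 0 true .cv) (.c 0))) 8 false .cv (.c 1) h4.lev
    (fun _ w _ => pk w = 1 ∧ τ' w = 0) (fun _ w _ => w) (fun _ _ _ => 1) rfl (fun i w s he =>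
      ⟨htv 0 i w s he _ h4, fun _ => by simp [E.eval, (hr.2 i w s he).2.1]⟩)
  rw [x5]
  have h5 := h4.setA 8 tr1 rfl
  obtain ⟨tr2, x6, s6⟩ := Flat.wr_at (S := S) (LM := LM) (L := L)
    (((((σ.setA 10 (l + 1) obs2).setA 7 (l + 1) cand2).setA 9 (l + 1) fl2).setA 6 (l + 1)
      st1).setA 8 (l + 1) tr1)
    (.and (.eq (.arr 12 false .cv) (.c 1)) (.eq (.arr 0 true .cv) (.c 1))) 8 false .cv (.c 2) h5.lev
    (fun _ w _ => pk w = 1 ∧ τ' w = 1) (fun _ w _ => w) (fun _ _ _ => 2) rfl (fun i w s he =>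
      ⟨htv 1 i w s he _ h5, fun _ => by simp [E.eval, (hr.2 i w s he).2.1]⟩)
  rw [x6, HS.setA_setA]
  have h6 := h4.setA 8 tr2 rfl
  obtain ⟨st2, x7, s7⟩ := Flat.wr_at (S := S) (LM := LM) (L := L)
    (((((σ.setA 10 (l + 1) obs2).setA 7 (l + 1) cand2).setA 9 (l + 1) fl2).setA 6 (l + 1)
      st1).setA 8 (l + 1) tr2)
    (.and (lfE false) (.and (.eq (.arr 12 false .cv) (.c 1)) (.and (.eq (.arr 18 false labE) (.c 1))
    (.and (.eq (.arr 8 false .cv) (.c 2)) (.eq (.arr 9 false .cv) (.c 0)))))) 6 false labE (.c 2)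
    h6.lev (fun i w _ => LF (events L) τ i w ∧ pk w = 1 ∧ un (lab w) = 1 ∧ tr2 w = 2 ∧ fl2 w = 0)
    (fun _ w _ => lab w) (fun _ _ _ => 2) rfl (fun i w s he => by
      simp only [ne_eq, E.eval_and_eq_zero, E.eval_eq_eq_zero, not_not, h6.lf hr LM he,
        h6.evalPk hr LM he, h6.evalAt hr LM he]
      simp only [E.eval_cv _ _ hr he, h6.lv_false]
      exact ⟨by simp [E.eval, HS.setA_arr, e18], fun _ =>
        ⟨h6.evalLab hr LM he, h.lab_lt i w ⟨s, he⟩, rfl⟩⟩)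
  rw [x7]
  refine ⟨_, rfl, ((((((Chg.refl _ _ σ).setA (by simp) obs2).setA (by simp) cand2).setA (by simp)
    fl2).setA (by simp) st1).setA (by simp) tr2).setA (by simp) st2, ?_⟩
  simp only [HS.setA_arr, Fin.reduceEq, false_and, if_false, and_self, if_true, e6, e7, e8, e9,
    e10] at s1 s2 s3 s4 s5 s6 s7 ⊢
  -- The value assigned in the call is the old count, so the value `0` leads to the count `1` and
  -- the value `1` to the count `2`.
  have htr1 : ∀ i w, LF (events L) τ i w → pk w = 1 → tr2 w = tried w + 1 := by
    intro i w hw hp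
    obtain ⟨s, hs⟩ := hw.occ
    have ht := hτ' i w hw.occ
    rw [if_pos hp] at ht
    have h2 := (hpk.pick i w hw.occ hp).2.2.1
    by_cases h1 : τ' w = 1
    · obtain ⟨_, _, _, -, -, k1, k2⟩ := s6.of_mem hs ⟨hp, h1⟩
      rw [k2]; omega
    · rw [s6.of_not]
      · obtain ⟨_, _, _, -, -, k1, k2⟩ := s5.of_mem hs ⟨hp, by omega⟩
        rw [k2]; omega
      · rintro i' w' s' - ⟨-, k1⟩ rfl
        exact h1 k1
  have hst : ∀ i w, LF (events L) τ i w → pk w = 1 →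
      ∀ j v, LF (events L) τ j v → pk v = 1 → lab v = lab w → v = w := fun i w hw hp j v hv hpv hl =>
    hpk.unique j v i w hv.occ hw.occ hpv hp hl
  have hno7 : ∀ i y, LF (events L) τ i y → pk y = 1 →
      ¬ (un (lab y) = 1 ∧ tr2 y = 2 ∧ fl2 y = 0) → st2 (lab y) = st1 (lab y) := by
    intro i y hy hp hn
    refine s7.of_not ?_
    rintro j v s - ⟨k1, k2, k3⟩ k4
    obtain rfl := hst i y hy hp j v k1 k2 k4
    exact hn k3
  have hno4 : ∀ i y, LF (events L) τ i y → pk y = 1 →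
      ¬ (un (lab y) = 0 ∧ fa (lab y) = 0) → st1 (lab y) = stat (lab y) := by
    intro i y hy hp hn
    refine s4.of_not ?_
    rintro j v s - ⟨k1, k2, k3⟩ k4
    obtain rfl := hst i y hy hp j v k1 k2 k4
    exact hn k3
  constructor
  · intro i w hw
    obtain ⟨s, hs⟩ := hw.occ
    rw [s1.const_iff]
    refine or_congr_right ⟨?_, fun k => ⟨i, w, s, hs, k, rfl⟩⟩
    rintro ⟨i', w', s', -, k, rfl⟩
    exact k
  · intro i w hw
    rw [s2.const_iff]
    refine or_congr_right ⟨?_, ?_⟩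
    · rintro ⟨j, w', s', -, ⟨k1, k2, k3⟩, rfl⟩
      exact ⟨j, k1, k2, k3⟩
    · rintro ⟨j, k1, k2, k3⟩
      obtain ⟨s, hs⟩ := k1.occ
      exact ⟨j, w, s, hs, ⟨k1, k2, k3⟩, rfl⟩
  · intro i w hw k1 k2 k3
    obtain ⟨s, hs⟩ := hw.occ
    exact (s3.const_iff w).mpr (Or.inr ⟨i, w, s, hs, ⟨hw, k1, k2, k3⟩, rfl⟩)
  · intro i w hw hn
    refine s3.of_not ?_
    rintro j v s - ⟨-, k⟩ rfl
    exact hn k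
  · exact htr1
  · intro i w hw hp
    rw [s6.of_not, s5.of_not]
    · rintro j v s - ⟨k, -⟩ rfl
      exact hp k
    · rintro j v s - ⟨k, -⟩ rfl
      exact hp k
  · intro i w hw hn
    rw [s7.of_not, s4.of_not]
    · rintro j v s - ⟨k1, k2, -⟩ k3
      exact hn v j k1 k3 k2
    · rintro j v s - ⟨k1, k2, -⟩ k3
      exact hn v j k1 k3 k2
  · intro i y hy hp k1 k2
    rw [hno7 i y hy hp (by omega)]
    obtain ⟨s, hs⟩ := hy.occ
    exact (s4.const_iff _).mpr (Or.inr ⟨i, y, s, hs, ⟨hy, hp, k1, k2⟩, rfl⟩)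
  · intro i y hy hp k1 k2
    rw [hno7 i y hy hp (by omega), hno4 i y hy hp (by omega)]
  · intro i y hy hp k1 k2 k3
    obtain ⟨s, hs⟩ := hy.occ
    exact (s7.const_iff _).mpr (Or.inr ⟨i, y, s, hs, ⟨hy, hp, k1, k2, k3⟩, rfl⟩)
  · intro i y hy hp k1 k2
    rw [hno7 i y hy hp (fun k => k2 k.2), hno4 i y hy hp (by omega)]

/-- The evaluation of the result of a call, below the highest level. -/
theorem return_spec (hr : InRange S L) {D : ℕ} {par stat cand tried fl obs : ℕ → ℕ}
    (hlab : LabOK L S τ D lab par) (hlM : l + 1 < LM) (hl : σ.lev = l)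
    (h : Env2 S L { σ with lev := l + 1 } l τ τ' lab lab' stat' obs' pk)
    (e6 : σ.arr 6 (l + 1) = stat) (e7 : σ.arr 7 (l + 1) = cand) (e8 : σ.arr 8 (l + 1) = tried)
    (e9 : σ.arr 9 (l + 1) = fl) (e10 : σ.arr 10 (l + 1) = obs)
    (hpk : PickOK (events L) τ lab stat cand tried pk)
    (hτ' : ∀ i w, Occ (events L) i w → τ' w = if pk w = 1 then tried w else τ w) :
    ∃ σ', returnCmd.sem S LM D L σ = σ' ∧ σ'.lev = l + 1 ∧ σ'.reg = Function.update σ.reg 3 1 ∧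
      (∀ a m, ¬ (a ∈ [6, 7, 8, 9, 10, 15, 16, 17, 18, 19, 20] ∧ m = l + 1) →
        σ'.arr a m = σ.arr a m) ∧
      ∃ fa ch un nob, Outcome (events L) τ lab pk τ' lab' stat' obs' fa ch un nob ∧
        Recorded (events L) τ lab pk stat cand tried fl obs fa un nob (σ'.arr 6 (l + 1))
        (σ'.arr 7 (l + 1)) (σ'.arr 8 (l + 1)) (σ'.arr 9 (l + 1)) (σ'.arr 10 (l + 1)) := by
  have hup : Cmd.up.sem S LM D L σ = { σ with lev := l + 1 } := by
    simp only [Cmd.sem, hl]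
    rw [if_pos (by omega)]
  rw [returnCmd, Cmd.sem_seq, hup]
  set σ0 : HS := { σ with lev := l + 1 } with hσ0
  rw [Cmd.sem_ite_neg (by simp only [E.eval, h.lev]; rw [if_neg (by omega)]), Cmd.sem_flat]
  obtain ⟨σ1, x1, c1, o1⟩ := outcome_spec (LM := LM) hr hlab h
  simp only [Flat.sem]
  rw [x1]
  obtain ⟨σ2, x2, c2, r2⟩ := record_spec (LM := LM) hr (h.chg c1 rfl)
    ((c1.arr 6 _ (by simp)).trans e6) ((c1.arr 7 _ (by simp)).trans e7)
    ((c1.arr 8 _ (by simp)).trans e8) ((c1.arr 9 _ (by simp)).trans e9)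
    ((c1.arr 10 _ (by simp)).trans e10) rfl rfl rfl hpk hτ'
  refine ⟨_, x2, c2.lev.trans (c1.lev.trans h.lev), ?_, fun a m ham => ?_, _, _, _, _, o1, r2⟩
  · simp only [HS.setR, c2.reg, c1.reg, hσ0]
  · have k1 : ∀ a ∈ [(6 : Fin 32), 7, 8, 9, 10],
        a ∈ [(6 : Fin 32), 7, 8, 9, 10, 15, 16, 17, 18, 19, 20] := by decide
    have k2 : ∀ a ∈ [(15 : Fin 32), 16, 17, 18, 19, 20],
        a ∈ [(6 : Fin 32), 7, 8, 9, 10, 15, 16, 17, 18, 19, 20] := by decide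
    exact (c2.arr a m fun h1 h2 => ham ⟨k1 a h1, h2⟩).trans
      (c1.arr a m fun h1 h2 => ham ⟨k2 a h1, h2⟩)

end RecBackdoor

/-! ### The final answer, and correctness and length of the recursion. -/

namespace RecBackdoor

variable {S LM : ℕ} {L : List (List Literal)}

theorem flag_spec (hr : InRange S L) {σ : HS} {l : ℕ} (hl : σ.lev = l + 1)
    {τ' lab' stat' : ℕ → ℕ} (h0 : σ.arr 0 l = τ')
    (h1 : LiveOK L τ' (σ.arr 1 l)) (h2 : σ.arr 2 l = lab') (h6 : σ.arr 6 l = stat')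
    (hlab : ∀ i w, Occ (events L) i w → lab' w < S) (a : Fin 32) (n : Fin 8)
    (ha : (outE n).avoids a = true) (hz : σ.arr a (l + 1) 0 = 0) :
    ∃ f, (Flat.wr (outE n) a false (.c 0) (.c 1)).sem S LM L σ = σ.setA a (l + 1) f ∧
      (f 0 ≠ 0 ↔ ∃ i w, LF (events L) τ' i w ∧ stat' (lab' w) = n) := by
  obtain ⟨f, x1, s1⟩ := Flat.wr_at (S := S) (LM := LM) (L := L) σ (outE n) a false (.c 0) (.c 1) hl
    (fun i w _ => LF (events L) τ' i w ∧ stat' (lab' w) = n) (fun _ _ _ => 0) (fun _ _ _ => 1)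
    (by simp [ha, E.avoids]) (fun i w s he => ⟨by
      rw [ne_eq, outE_eval hr LM (by simp [HS.lv, hl]) h0 h1 h2 h6 hlab he, not_not],
      fun _ => ⟨rfl, hr.1, rfl⟩⟩)
  refine ⟨f, x1, ?_⟩
  have hf : f 0 ≠ 0 ↔ f 0 = 1 := by
    rcases s1 0 with ⟨_, _, _, -, -, -, h⟩ | ⟨-, h⟩
    · simp [h]
    · simp [h, hz]
  rw [hf, s1.const_iff, hz]
  constructor
  · rintro (h | ⟨i, w, s, -, h, -⟩)
    · simp at h
    · exact ⟨i, w, h⟩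
  · rintro ⟨i, w, h⟩
    obtain ⟨s, hs⟩ := h.1.occ
    exact Or.inr ⟨i, w, s, hs, h, rfl⟩

/-- The evaluation of the result at the highest level. -/
theorem finish_spec (hr : InRange S L) {D : ℕ} {σ : HS} {l : ℕ} (hl : σ.lev = l) (hLM : LM = l + 1)
    {τ' lab' stat' : ℕ → ℕ} (h0 : σ.arr 0 l = τ')
    (h1 : LiveOK L τ' (σ.arr 1 l)) (h2 : σ.arr 2 l = lab') (h6 : σ.arr 6 l = stat')
    (hlab : ∀ i w, Occ (events L) i w → lab' w < S) :
    ∃ σ', returnCmd.sem S LM D L σ = σ' ∧ σ'.reg 3 = 3 ∧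
      ((σ'.reg 4 = 0 ∧ ∃ i w, LF (events L) τ' i w ∧ stat' (lab' w) = 2) ∨
        (σ'.reg 4 = 2 ∧ ∃ i w, LF (events L) τ' i w ∧ stat' (lab' w) = 0) ∨
        (σ'.reg 4 = 1 ∧ ∀ i w, LF (events L) τ' i w → stat' (lab' w) ≠ 2 ∧ stat' (lab' w) ≠ 0)) := by
  have hup : Cmd.up.sem S LM D L σ = { σ with lev := l + 1 } := by
    simp only [Cmd.sem, hl]
    rw [if_pos (by omega)]
  rw [returnCmd, Cmd.sem_seq, hup]
  set σ0 : HS := { σ with lev := l + 1 } with hσ0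
  rw [Cmd.sem_ite_pos (by simp [E.eval, hσ0, hLM]), Cmd.sem_flat]
  unfold finishF
  simp only [Flat.sem]
  have x0 : C.run S LM (0, 0, 0) (.seq (.put 21 false (.c 0) (.c 0)) (.put 22 false (.c 0) (.c 0)))
      σ0 = (σ0.setA 21 (l + 1) (Function.update (σ.arr 21 (l + 1)) 0 0)).setA 22 (l + 1)
        (Function.update (σ.arr 22 (l + 1)) 0 0) := by
    simp [C.run, E.eval, hr.1, HS.lv, HS.setA_arr, hσ0]
  rw [x0]
  obtain ⟨f, x1, s1⟩ := flag_spec (LM := LM) hr (σ := (σ0.setA 21 (l + 1)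
    (Function.update (σ.arr 21 (l + 1)) 0 0)).setA 22 (l + 1)
      (Function.update (σ.arr 22 (l + 1)) 0 0)) (l := l) rfl (τ' := τ') (lab' := lab')
    (stat' := stat') (by simpa [HS.setA_arr] using h0) (by simpa [HS.setA_arr] using h1)
    (by simpa [HS.setA_arr] using h2) (by simpa [HS.setA_arr] using h6) hlab 21 2 rfl
    (by simp [HS.setA_arr])
  rw [x1]
  obtain ⟨g, x2, s2⟩ := flag_spec (LM := LM) hr (σ := ((σ0.setA 21 (l + 1)
    (Function.update (σ.arr 21 (l + 1)) 0 0)).setA 22 (l + 1)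
      (Function.update (σ.arr 22 (l + 1)) 0 0)).setA 21 (l + 1) f) (l := l) rfl (τ' := τ')
      (lab' := lab')
    (stat' := stat') (by simpa [HS.setA_arr] using h0) (by simpa [HS.setA_arr] using h1)
    (by simpa [HS.setA_arr] using h2) (by simpa [HS.setA_arr] using h6) hlab 22 0 rfl
    (by simp [HS.setA_arr])
  rw [x2]
  set σ3 := (((σ0.setA 21 (l + 1)
    (Function.update (σ.arr 21 (l + 1)) 0 0)).setA 22 (l + 1)
      (Function.update (σ.arr 22 (l + 1)) 0 0)).setA 21 (l + 1) f).setA 22 (l + 1) g with hσ3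
  have e1 : (E.arr 21 false (.c 0)).eval S LM (0, 0, 0) σ3 = f 0 := by
    simp [E.eval, hr.1, HS.lv, hσ3, HS.setA_arr, hσ0]
  have e2 : (E.arr 22 false (.c 0)).eval S LM (0, 0, 0) σ3 = g 0 := by
    simp [E.eval, hr.1, HS.lv, hσ3, HS.setA_arr, hσ0]
  refine ⟨_, rfl, by simp [C.run, HS.setR, E.eval], ?_⟩
  simp only [C.run, e1, e2]
  by_cases hf : f 0 = 0
  · by_cases hg : g 0 = 0
    · right; right
      refine ⟨by simp [hf, hg, HS.setR, E.eval], fun i w hw => ⟨fun h => ?_, fun h => ?_⟩⟩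
      · exact s1.mpr ⟨i, w, hw, h⟩ hf
      · exact s2.mpr ⟨i, w, hw, h⟩ hg
    · right; left
      exact ⟨by simp [hf, hg, HS.setR, E.eval], s2.mp hg⟩
  · left
    exact ⟨by simp [hf, HS.setR, E.eval], s1.mp hf⟩

/-- The bound on the number of rounds, if the calls return obstructions of size `s`. -/
def rounds (K s : ℕ) : ℕ := 2 * (1 + 2 * (K * s))

/-- The bound on the size of the obstructions. -/
def obsSize (K D : ℕ) : ℕ → ℕ
  | 0 => 0
  | j + 1 => (K + 1) ^ D * (1 + rounds K (obsSize K D j) * obsSize K D j)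

/-- The bound on the number of steps of a call. -/
def iters (K D : ℕ) : ℕ → ℕ
  | 0 => 1
  | j + 1 => 2 + rounds K (obsSize K D j) * (iters K D j + 2)

/-- The run from `σ` reaches `σ'` after `N` steps, and has not halted before. -/
def Steps (S LM D : ℕ) (L : List (List Literal)) (N : ℕ) (σ σ' : HS) : Prop :=
  (stepCmd.sem S LM D L)^[N] σ = σ' ∧ ∀ m < N, ((stepCmd.sem S LM D L)^[m] σ).reg 3 < 3

theorem Steps.one {D : ℕ} {σ σ' : HS} (h : σ.reg 3 < 3) (h' : stepCmd.sem S LM D L σ = σ') :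
    Steps S LM D L 1 σ σ' := by
  refine ⟨h', fun m hm => ?_⟩
  obtain rfl : m = 0 := by omega
  exact h

theorem Steps.trans {D N M : ℕ} {σ σ' σ'' : HS} (h : Steps S LM D L N σ σ')
    (h' : Steps S LM D L M σ' σ'') : Steps S LM D L (N + M) σ σ'' := by
  obtain ⟨h1, h2⟩ := h
  obtain ⟨h3, h4⟩ := h'
  refine ⟨by rw [add_comm, Function.iterate_add_apply, h1, h3], fun m hm => ?_⟩
  by_cases hmN : m < N
  · exact h2 m hmN
  · obtain ⟨k, rfl⟩ := Nat.exists_eq_add_of_le (not_lt.mp hmN)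
    rw [add_comm, Function.iterate_add_apply, h1]
    exact h4 k (by omega)

theorem step_enter {D : ℕ} {σ : HS} (h : σ.reg 3 = 0) :
    stepCmd.sem S LM D L σ = enterCmd.sem S LM D L σ := by
  rw [stepCmd, Cmd.sem_ite_pos (by simp [E.eval, h])]

theorem step_round {D : ℕ} {σ : HS} (h : σ.reg 3 = 1) :
    stepCmd.sem S LM D L σ = roundCmd.sem S LM D L σ := by
  rw [stepCmd, Cmd.sem_ite_neg (by simp [E.eval, h]), Cmd.sem_ite_pos (by simp [E.eval, h])]

theorem step_return {D : ℕ} {σ : HS} (h : σ.reg 3 = 2) :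
    stepCmd.sem S LM D L σ = returnCmd.sem S LM D L σ := by
  rw [stepCmd, Cmd.sem_ite_neg (by simp [E.eval, h]), Cmd.sem_ite_neg (by simp [E.eval, h])]

theorem SpecOK.mono {es : List Ev} {n sz sz' : ℕ} {τ lab stat obs : ℕ → ℕ}
    (h : SpecOK es S n sz τ lab stat obs) (hle : sz ≤ sz') : SpecOK es S n sz' τ lab stat obs :=
  { h with hard := fun i w hw h0 => (h.hard i w hw h0).imp_right fun h => h.mono hle subset_rfl }

/-- The state after a call at level `j`: either the run has halted, since the bound on the depth is
exceeded, or the rows of level `j` contain the result. -/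
def Result (S : ℕ) (L : List (List Literal)) (n sz j : ℕ) (τ : ℕ → ℕ) (σ σ' : HS) : Prop :=
  (σ'.reg 3 = 3 ∧ σ'.reg 4 = 2 ∧ Hard (events L) n (fun _ => 2) Set.univ) ∨
    (σ'.lev = j ∧ σ'.reg 3 = 2 ∧ (∀ a m, j < m → σ'.arr a m = σ.arr a m) ∧ σ'.arr 0 j = τ ∧
      LiveOK L τ (σ'.arr 1 j) ∧
      SpecOK (events L) S j sz τ (σ'.arr 2 j) (σ'.arr 6 j) (σ'.arr 10 j))

/-- The state at the start of a round. -/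
structure AtRound (S K D : ℕ) (L : List (List Literal)) (sz ρ l : ℕ) (τ : ℕ → ℕ) (σ : HS) : Prop
    extends Env S L σ (l + 1) τ where
  mode : σ.reg 3 = 1
  labOK : LabOK L S τ D (σ.arr 2 (l + 1)) (σ.arr 3 (l + 1))
  dyn : Dyn (events L) K l sz ρ τ (σ.arr 2 (l + 1)) (σ.arr 3 (l + 1)) (σ.arr 6 (l + 1))
    (σ.arr 7 (l + 1)) (σ.arr 8 (l + 1)) (σ.arr 9 (l + 1)) (σ.arr 10 (l + 1))

theorem LabOK.lt (hr : InRange S L) {D : ℕ} {τ lab par : ℕ → ℕ} (h : LabOK L S τ D lab par)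
    {i w : ℕ} (hw : Occ (events L) i w) : lab w < S := by
  obtain ⟨s, hs⟩ := hw
  exact (h.le i w ⟨s, hs⟩).trans_lt (hr.2 _ _ _ hs).2.1

/-- Induction on the number `d` of rounds that remain. For `d = 0` a pickable variable would
contradict `Dyn.count_lt`, so the level finishes. A round costs a step for the selection, the call,
and a step for the return. -/
theorem rounds_spec (hr : InRange S L) {K D n : ℕ} (hK : ∀ i, Small K {v | Occ (events L) i v})
    {l : ℕ} (hl : l + 1 < LM) {sz N0 : ℕ}
    (hcall : ∀ (σ : HS) (τ : ℕ → ℕ), σ.lev = l → σ.reg 3 = 0 → σ.arr 0 l = τ →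
      (∀ i w, Occ (events L) i w → τ w ≤ 2) →
      ∃ N ≤ N0, ∃ σ', Steps S LM D L N σ σ' ∧ Result S L n sz l τ σ σ') {τ : ℕ → ℕ}
    (hτ2 : ∀ i w, Occ (events L) i w → τ w ≤ 2) :
    ∀ (d ρ : ℕ) (σ : HS), ρ + d = rounds K sz → AtRound S K D L sz ρ l τ σ →
      ∃ N ≤ d * (N0 + 2) + 1, ∃ σ', Steps S LM D L N σ σ' ∧
        Result S L n ((K + 1) ^ D * (1 + rounds K sz * sz)) (l + 1) τ σ σ' := by
  intro d
  induction d with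
  | zero =>
    intro ρ σ hρ h
    obtain ⟨σ1, x1, h1⟩ := round_spec (LM := LM) (D := D) hr h.toEnv
      (fun i w hw => h.labOK.lt hr hw) h.labOK.par rfl rfl rfl rfl rfl
    rw [← step_round h.mode] at x1
    rcases h1 with ⟨⟨y, hy⟩, -⟩ | ⟨hno, hlev, hreg, harr, o, o0, ho, oD⟩
    · have := h.dyn.count_lt h.labOK hy
      simp only [rounds] at hρ
      omega
    refine ⟨1, by omega, σ1, Steps.one (by rw [h.mode]; omega) x1, Or.inr ⟨hlev, by simp [hreg],
      fun a m hm => harr a m fun h => by omega, ?_, ?_, ?_⟩⟩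
    · rw [harr 0 _ (by simp), h.val]
    · rw [harr 1 _ (by simp)]; exact h.live
    · rw [harr 2 _ (by simp), harr 6 _ (by simp), oD]
      refine (Dyn.spec hr h.labOK hK hτ2 (by rw [o0]; exact h.dyn) hno ho).mono ?_
      refine Nat.mul_le_mul_left _ (Nat.add_le_add_left (Nat.mul_le_mul_right _ ?_) _)
      omega
  | succ d ih =>
    intro ρ σ hρ h
    obtain ⟨σ1, x1, h1⟩ := round_spec (LM := LM) (D := D) hr h.toEnv
      (fun i w hw => h.labOK.lt hr hw) h.labOK.par rfl rfl rfl rfl rfl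
    rw [← step_round h.mode] at x1
    rcases h1 with ⟨-, hlev, hreg, harr, hpk, hτ'⟩ | ⟨hno, hlev, hreg, harr, o, o0, ho, oD⟩
    · have st1 := Steps.one (by rw [h.mode]; omega) x1
      obtain ⟨N, hN, σ2, st2, h2⟩ := hcall σ1 _ hlev (by simp [hreg]) rfl (fun i w hw => by
        rw [hτ' i w hw]
        split_ifs with hp
        · have := (hpk.pick i w hw hp).2.2.1
          omega
        · exact hτ2 i w hw)
      rcases h2 with h2 | ⟨k1, k2, k3, k4, k5, k6⟩
      · refine ⟨1 + N, ?_, σ2, st1.trans st2, Or.inl h2⟩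
        rw [add_mul]; omega
      -- Neither the preparation of the call nor the call itself touches the rows of the levels
      -- above that the return has to read.
      have key : ∀ a, a ∉ [(0 : Fin 32), 11, 12, 13, 23] → ∀ m, l < m →
          σ2.arr a m = σ.arr a m := by
        intro a ha m hm
        simp only [List.mem_cons, List.not_mem_nil, or_false, not_or] at ha
        rw [k3 a m hm, harr a m _ _]
        · simp only [List.mem_cons, List.not_mem_nil, or_false]; tauto
        · tauto
      have key0 : ∀ m, l < m → σ2.arr 0 m = σ.arr 0 m := fun m hm => by
        rw [k3 0 m hm, harr 0 m (by simp) (by omega)]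
      have henv2 : Env2 S L { σ2 with lev := l + 1 } l τ (σ1.arr 0 l) (σ.arr 2 (l + 1)) (σ2.arr 2 l)
          (σ2.arr 6 l) (σ2.arr 10 l) (σ1.arr 12 (l + 1)) :=
        { lev := rfl
          val := (key0 _ (by omega)).trans h.val
          live := by
            simp only [key 1 (by decide) (l + 1) (by omega)]
            exact h.live
          val' := k4
          live' := k5
          row2 := key 2 (by decide) _ (by omega)
          row2' := rfl
          row6' := rfl
          row10' := rfl
          row12 := k3 12 _ (by omega)
          lab_lt := fun i w hw => h.labOK.lt hr hw
          lab_lt' := k6.lt }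
      obtain ⟨σ3, x3, m1, m2, m3, fa, ch, un, nob, hout, hrec⟩ := return_spec (LM := LM) (D := D) hr
        h.labOK hl k1 henv2 (key 6 (by decide) _ (by omega)) (key 7 (by decide) _ (by omega))
        (key 8 (by decide) _ (by omega)) (key 9 (by decide) _ (by omega))
        (key 10 (by decide) _ (by omega)) hpk hτ'
      rw [← step_return k2] at x3
      have st3 := Steps.one (by rw [k2]; omega) x3
      have n2 : σ3.arr 2 (l + 1) = σ.arr 2 (l + 1) := by
        rw [m3 2 _ (by simp), key 2 (by decide) _ (by omega)]
      have n3 : σ3.arr 3 (l + 1) = σ.arr 3 (l + 1) := by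
        rw [m3 3 _ (by simp), key 3 (by decide) _ (by omega)]
      have n0 : σ3.arr 0 (l + 1) = τ := by
        rw [m3 0 _ (by simp), key0 _ (by omega), h.val]
      have n1 : σ3.arr 1 (l + 1) = σ.arr 1 (l + 1) := by
        rw [m3 1 _ (by simp), key 1 (by decide) _ (by omega)]
      have h3 : AtRound S K D L sz (ρ + 1) l τ σ3 :=
        { lev := m1
          val := n0
          live := by rw [n1]; exact h.live
          mode := by simp [m2]
          labOK := by rw [n2, n3]; exact h.labOK
          dyn := by
            rw [n2, n3]
            exact h.dyn.step hr h.labOK hK hpk hτ2 hτ' k6 hout hrec }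
      obtain ⟨N', hN', σ4, st4, h4⟩ := ih (ρ + 1) σ3 (by omega) h3
      refine ⟨1 + N + 1 + N', ?_, σ4, ((st1.trans st2).trans st3).trans st4, h4.imp_right ?_⟩
      · rw [add_mul]; omega
      · rintro ⟨q1, q2, q3, q4⟩
        refine ⟨q1, q2, fun a m hm => ?_, q4⟩
        rw [q3 a m hm, m3 a m (by omega), k3 a m (by omega), harr a m (by omega) (by omega)]
    · refine ⟨1, by omega, σ1, Steps.one (by rw [h.mode]; omega) x1, Or.inr ⟨hlev, by simp [hreg],
        fun a m hm => harr a m fun h => by omega, ?_, ?_, ?_⟩⟩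
      · rw [harr 0 _ (by simp), h.val]
      · rw [harr 1 _ (by simp)]; exact h.live
      · rw [harr 2 _ (by simp), harr 6 _ (by simp), oD]
        refine (Dyn.spec hr h.labOK hK hτ2 (by rw [o0]; exact h.dyn) hno ho).mono ?_
        refine Nat.mul_le_mul_left _ (Nat.add_le_add_left (Nat.mul_le_mul_right _ ?_) _)
        omega

/-- Induction on the level. An early halt is passed up unchanged: its certificate is moved at once
to the empty assignment, which is smaller than every other (`Hard.mono`). -/
theorem call_spec (hr : InRange S L) {K D n : ℕ} (hK : ∀ i, Small K {v | Occ (events L) i v})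
    (hD : farDist n ≤ D) : ∀ j, j < LM → ∀ (σ : HS) (τ : ℕ → ℕ), σ.lev = j → σ.reg 3 = 0 →
      σ.arr 0 j = τ → (∀ i w, Occ (events L) i w → τ w ≤ 2) →
      ∃ N ≤ iters K D j, ∃ σ', Steps S LM D L N σ σ' ∧ Result S L n (obsSize K D j) j τ σ σ' := by
  intro j
  induction j with
  | zero =>
    intro hj σ τ hl hm h0 hτ2
    obtain ⟨σ1, x1, h1, h2, h3, h4⟩ := enter_spec (LM := LM) hr hD hl h0
    rw [← step_enter hm] at x1
    refine ⟨1, le_rfl, σ1, Steps.one (by rw [hm]; omega) x1, ?_⟩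
    rcases h4 with ⟨-, h4, h5⟩ | ⟨h4, -⟩ | ⟨h4, -⟩
    · refine Or.inr ⟨h1, by simp [h4], fun a m hm => h2 a m (by omega), ?_, h3, h5⟩
      rw [h2 0 0 (by simp), h0]
    · exact absurd rfl h4
    · exact absurd rfl h4
  | succ j ih =>
    intro hj σ τ hl hm h0 hτ2
    obtain ⟨σ1, x1, h1, h2, h3, h4⟩ := enter_spec (LM := LM) hr hD hl h0
    rw [← step_enter hm] at x1
    have st1 := Steps.one (by rw [hm]; omega) x1
    rcases h4 with ⟨h4, -⟩ | ⟨-, h4, h5⟩ | ⟨-, h4, h5, h6⟩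
    · omega
    · refine ⟨1, by simp only [iters]; omega, σ1, st1, Or.inl ⟨by simp [h4], by simp [h4], ?_⟩⟩
      exact h5.mono (fun e he => (hr.2 e.1 e.2.1 e.2.2 he).2.2)
        fun i _ v hv => ⟨Or.inl rfl, hτ2 i v hv⟩
    · have hat : AtRound S K D L (obsSize K D j) 0 j τ σ1 :=
        { lev := h1
          val := by rw [h2 0 _ (by simp), h0]
          live := h3
          mode := by simp [h4]
          labOK := h5
          dyn := h6 _ _ _ }
      obtain ⟨N, hN, σ2, st2, h7⟩ := rounds_spec (LM := LM) (n := n) hr hK hj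
        (ih (by omega)) hτ2 _ 0 σ1 (zero_add _) hat
      refine ⟨1 + N, ?_, σ2, st1.trans st2, ?_⟩
      · simp only [iters]; omega
      · refine h7.imp_right ?_
        rintro ⟨q1, q2, q3, q4⟩
        refine ⟨q1, q2, fun a m hm => ?_, q4⟩
        rw [q3 a m hm, h2 a m (by omega)]

end RecBackdoor

namespace RecBackdoor

/-! ### The first pass over the input and the result of a run -/

theorem mem_events {L : List (List Literal)} {i v s : ℕ} :
    (i, v, s) ∈ events L ↔ ∃ C, L[i]? = some C ∧ ∃ b : Bool, (v, b) ∈ C ∧ b.toNat = s := by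
  simp only [events, List.mem_flatMap, List.mem_map, Prod.exists, List.mem_zipIdx_iff_getElem?,
    Prod.mk.injEq]
  constructor
  · rintro ⟨C, j, hj, v', b, hm, rfl, rfl, hb⟩
    exact ⟨C, hj, b, hm, hb⟩
  · rintro ⟨C, hC, b, hm, hb⟩
    exact ⟨C, i, hC, v, b, hm, rfl, rfl, hb⟩

/-- Detect empty clauses (register 5) and clauses wider than register 6 (register 7). -/
def scanClause : C :=
  .seq (.ite (.eq .cv (.c 0)) (.set 5 (.c 1)) .skip)
    (.ite (.lt (.reg 6) .cv) (.set 7 (.c 1)) .skip)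

/-- Compute the largest variable (register 8). -/
def scanLiteral : C := .ite (.lt (.reg 8) .cv) (.set 8 .cv) .skip

/-- The effect of the first pass. -/
structure Scanned (L : List (List Literal)) (σ σ' : HS) : Prop where
  lev : σ'.lev = σ.lev
  arr : σ'.arr = σ.arr
  reg : ∀ r, r ≠ 5 → r ≠ 7 → r ≠ 8 → σ'.reg r = σ.reg r
  empty : σ'.reg 5 ≠ 0 ↔ σ.reg 5 ≠ 0 ∨ [] ∈ L
  wide : σ'.reg 7 ≠ 0 ↔ σ.reg 7 ≠ 0 ∨ ∃ C ∈ L, σ.reg 6 < C.length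
  le : σ.reg 8 ≤ σ'.reg 8
  var_le : ∀ C ∈ L, ∀ l ∈ C, l.1 ≤ σ'.reg 8
  le_max : ∀ M, σ.reg 8 ≤ M → (∀ C ∈ L, ∀ l ∈ C, l.1 ≤ M) → σ'.reg 8 ≤ M

theorem scanClause_spec (S LM i n : ℕ) (σ : HS) :
    let σ' := scanClause.run S LM (i, n, 0) σ
    σ'.lev = σ.lev ∧ σ'.arr = σ.arr ∧ (∀ r, r ≠ 5 → r ≠ 7 → σ'.reg r = σ.reg r) ∧
      (σ'.reg 5 ≠ 0 ↔ σ.reg 5 ≠ 0 ∨ n = 0) ∧ (σ'.reg 7 ≠ 0 ↔ σ.reg 7 ≠ 0 ∨ σ.reg 6 < n) := by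
  simp only [scanClause, C.run, E.eval, HS.setR]
  by_cases h1 : n = 0 <;> by_cases h2 : σ.reg 6 < n <;> simp [h1, h2, Function.update_apply]
  all_goals try omega

theorem scanLiteral_spec (S LM i : ℕ) (c : List Literal) : ∀ (σ : HS),
    let σ' := c.foldl (fun σ l => scanLiteral.run S LM (i, l.1, l.2.toNat) σ) σ
    σ'.lev = σ.lev ∧ σ'.arr = σ.arr ∧ (∀ r, r ≠ 8 → σ'.reg r = σ.reg r) ∧
      σ.reg 8 ≤ σ'.reg 8 ∧ (∀ l ∈ c, l.1 ≤ σ'.reg 8) ∧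
      ∀ M, σ.reg 8 ≤ M → (∀ l ∈ c, l.1 ≤ M) → σ'.reg 8 ≤ M := by
  induction c with
  | nil => intro σ; simp
  | cons l c ih =>
    intro σ
    rw [List.foldl_cons]
    obtain ⟨h1, h2, h3, h4, h5, h6⟩ := ih (scanLiteral.run S LM (i, l.1, l.2.toNat) σ)
    have k : (scanLiteral.run S LM (i, l.1, l.2.toNat) σ) =
        if σ.reg 8 < l.1 then σ.setR 8 l.1 else σ := by
      simp only [scanLiteral, C.run, ne_eq, E.eval_lt_eq_zero, not_not]
      rfl
    rw [k] at h1 h2 h3 h4 h5 h6 ⊢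
    split_ifs at * with h
    · have e8 : (σ.setR 8 l.1).reg 8 = l.1 := by simp [HS.setR]
      rw [e8] at h4 h6
      refine ⟨h1, h2, fun r hr => (h3 r hr).trans (Function.update_of_ne hr _ _), by omega, ?_,
        ?_⟩
      · intro l' hl'
        rcases List.mem_cons.mp hl' with rfl | hl'
        · exact h4
        · exact h5 l' hl'
      · exact fun M hM hC => h6 M (hC l List.mem_cons_self)
          fun l' hl' => hC l' (List.mem_cons_of_mem _ hl')
    · refine ⟨h1, h2, h3, h4, ?_, ?_⟩
      · intro l' hl'
        rcases List.mem_cons.mp hl' with rfl | hl'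
        · omega
        · exact h5 l' hl'
      · exact fun M hM hC => h6 M hM fun l' hl' => hC l' (List.mem_cons_of_mem _ hl')

theorem scan_spec (S LM : ℕ) (L : List (List Literal)) (σ : HS) :
    Scanned L σ (passSem S LM L scanClause scanLiteral σ) := by
  suffices h : ∀ n, Scanned L σ ((L.zipIdx n).foldl (fun σ p => p.1.foldl
      (fun σ l => scanLiteral.run S LM (p.2, l.1, l.2.toNat) σ)
      (scanClause.run S LM (p.2, p.1.length, 0) σ)) σ) from h 0
  intro n
  induction L generalizing n σ with
  | nil =>
    simp only [List.zipIdx_nil, List.foldl_nil]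
    constructor <;> simp
  | cons c L ih =>
    simp only [List.zipIdx_cons, List.foldl_cons]
    obtain ⟨a1, a2, a3, a4, a5⟩ := scanClause_spec S LM n c.length σ
    obtain ⟨b1, b2, b3, b4, b5, b6⟩ :=
      scanLiteral_spec S LM n c (scanClause.run S LM (n, c.length, 0) σ)
    generalize scanClause.run S LM (n, c.length, 0) σ = σ1 at *
    generalize c.foldl (fun σ l => scanLiteral.run S LM (n, l.1, l.2.toNat) σ) σ1 = σ2 at *
    suffices key : ∀ σ3, Scanned L σ2 σ3 → Scanned (c :: L) σ σ3 from
      key _ (ih _ _)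
    intro σ3 h
    have e8 := a3 8 (by omega) (by omega)
    have e6 : σ2.reg 6 = σ.reg 6 := (b3 6 (by omega)).trans (a3 6 (by omega) (by omega))
    constructor
    · rw [h.lev, b1, a1]
    · rw [h.arr, b2, a2]
    · intro r h5 h7 h8
      rw [h.reg r h5 h7 h8, b3 r h8, a3 r h5 h7]
    · rw [h.empty, b3 5 (by omega), a4, List.mem_cons, or_assoc, List.length_eq_zero_iff, eq_comm]
    · rw [h.wide, b3 7 (by omega), a5, e6]
      simp [or_assoc]
    · have := h.le; omega
    · intro C' hC' l hl
      rcases List.mem_cons.mp hC' with rfl | hC'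
      · exact (b5 l hl).trans h.le
      · exact h.var_le C' hC' l hl
    · intro M hM hC
      exact h.le_max M (b6 M (by omega) (hC c List.mem_cons_self))
        fun C' hC' => hC C' (List.mem_cons_of_mem _ hC')

/-- Some truth assignment satisfies all listed clauses. -/
def ListSat (L : List (List Literal)) : Prop := ∃ α : ℕ → Bool, ∀ C ∈ L, ∃ l ∈ C, α l.1 = l.2

variable {S LM : ℕ} {L : List (List Literal)}

/-- The initialization of the assignment. -/
def startF : Flat := .wr (.c 1) 0 false .cv (.c 2)

theorem not_listSat_of_unsat {n sz : ℕ} {τ lab stat obs : ℕ → ℕ}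
    (h : SpecOK (events L) S n sz τ lab stat obs) (hτ : ∀ i w, Occ (events L) i w → τ w = 2)
    {i w : ℕ} (hw : LF (events L) τ i w) (h2 : stat (lab w) = 2) : ¬ ListSat L := by
  rintro ⟨α, hα⟩
  refine h.unsat i w hw h2 (fun v => (α v).toNat) (fun v => Bool.toNat_lt _) fun j v hj _ => ?_
  obtain ⟨s, hs⟩ := hj.2.1
  obtain ⟨C, hC, -⟩ := mem_events.mp hs
  obtain ⟨l, hl, hl2⟩ := hα C (List.mem_of_getElem? hC)
  have he : (j, l.1, l.2.toNat) ∈ events L := mem_events.mpr ⟨C, hC, l.2, hl, rfl⟩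
  exact ⟨l.1, l.2.toNat, he, hτ j l.1 ⟨_, he⟩, congrArg _ hl2⟩

/-- Every nonempty clause belongs to a component and is satisfied there by a variable with the label
of that component; hence the assignments can be chosen label by label. -/
theorem listSat_of_sat {n sz : ℕ} {τ lab stat obs : ℕ → ℕ}
    (h : SpecOK (events L) S n sz τ lab stat obs) (hτ : ∀ i w, Occ (events L) i w → τ w = 2)
    (hne : [] ∉ L) (h1 : ∀ i w, LF (events L) τ i w → stat (lab w) = 1) : ListSat L := by
  classical
  let A : ℕ → ℕ → ℕ := fun R => if h : CompSat (events L) τ lab R then h.choose else fun _ => 0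
  refine ⟨fun v => decide (A (lab v) v = 1), fun C hC => ?_⟩
  obtain ⟨i, hi⟩ := List.mem_iff_getElem?.mp hC
  obtain ⟨⟨v, b⟩, hv⟩ := List.exists_mem_of_ne_nil C fun h => hne (h ▸ hC)
  have he : (i, v, b.toNat) ∈ events L := mem_events.mpr ⟨C, hi, b, hv, rfl⟩
  have hLF : LF (events L) τ i v := by
    refine ⟨fun w s hw => ?_, ⟨_, he⟩, hτ i v ⟨_, he⟩⟩
    obtain ⟨-, -, c, -, rfl⟩ := mem_events.mp hw
    rw [hτ i w ⟨_, hw⟩]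
    have := Bool.toNat_lt c
    omega
  have hs := h.sat i v hLF (h1 i v hLF)
  obtain ⟨w, s, hw, -, hl, hA⟩ := hs.choose_spec i v hLF rfl
  obtain ⟨C', hC', c, hc, rfl⟩ := mem_events.mp hw
  obtain rfl : C = C' := by rw [hi] at hC'; simpa using hC'
  refine ⟨(w, c), hc, ?_⟩
  have hA' : A (lab w) w = c.toNat := by
    rw [hl]
    simp only [A, dif_pos hs]
    exact hA
  simp only [hA']
  cases c <;> rfl

/-- The recursion starts at level `k + 1`, so that an open component certifies depth at least `k +
1`. The bound on the widths of the clauses supplies the constant `K = k`. -/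
theorem run_spec (hr : InRange S L) {k D : ℕ} (hne : [] ∉ L) (hk : ∀ C ∈ L, C.length ≤ k)
    (hD : farDist (k + 1) ≤ D) (hLM : LM = k + 2) {σ : HS} (hlev : σ.lev = k + 1)
    (hmode : σ.reg 3 = 0) :
    ∃ N ≤ iters k D (k + 1) + 1, ∃ σ', Steps S LM D L N (startF.sem S LM L σ) σ' ∧ σ'.reg 3 = 3 ∧
      ((σ'.reg 4 = 0 ∧ ¬ ListSat L) ∨ (σ'.reg 4 = 1 ∧ ListSat L) ∨
        (σ'.reg 4 = 2 ∧ Hard (events L) (k + 1) (fun _ => 2) Set.univ)) := by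
  obtain ⟨f, x1, s1⟩ := Flat.fillV (LM := LM) hr σ 0 2 hlev
  rw [startF, x1]
  set σ1 := σ.setA 0 (k + 1) f with hσ1
  have hf : ∀ i w, Occ (events L) i w → σ1.arr 0 (k + 1) w = 2 := by
    rintro i w ⟨s, hs⟩
    simpa [hσ1, HS.setA_arr] using s1 i w s hs
  have hlev1 : σ1.lev = k + 1 := hlev
  have hmode1 : σ1.reg 3 = 0 := hmode
  have hK : ∀ i, Small k {v | Occ (events L) i v} := by
    intro i
    by_cases hi : i < L.length
    · refine ⟨(L[i].map Prod.fst).toFinset, (List.toFinset_card_le _).trans ?_, ?_⟩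
      · rw [List.length_map]; exact hk _ (List.getElem_mem hi)
      · rintro v ⟨s, hs⟩
        obtain ⟨C, hC, b, hb, -⟩ := mem_events.mp hs
        rw [List.getElem?_eq_getElem hi, Option.some.injEq] at hC
        subst hC
        exact List.mem_toFinset.mpr (List.mem_map.mpr ⟨_, hb, rfl⟩)
    · refine ⟨∅, by simp, ?_⟩
      rintro v ⟨s, hs⟩
      obtain ⟨C, hC, -⟩ := mem_events.mp hs
      rw [List.getElem?_eq_none (by omega)] at hC
      simp at hC
  obtain ⟨N, hN, σ2, st, h⟩ := call_spec (LM := LM) hr hK hD (k + 1) (by omega) σ1 _ hlev1 hmode1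
    rfl (fun i w hw => (hf i w hw).le)
  rcases h with ⟨h3, h4, h5⟩ | ⟨h1, h2, -, h4, h5, h6⟩
  · exact ⟨N, by omega, σ2, st, h3, Or.inr (Or.inr ⟨h4, h5⟩)⟩
  · obtain ⟨σ3, x3, m3, hres⟩ := finish_spec (D := D) hr h1 hLM h4 h5 rfl rfl h6.lt
    rw [← step_return h2] at x3
    refine ⟨N + 1, by omega, σ3, st.trans (Steps.one (by omega) x3), m3, ?_⟩
    rcases hres with ⟨r4, i, w, hw, h0⟩ | ⟨r4, i, w, hw, h0⟩ | ⟨r4, h0⟩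
    · exact Or.inl ⟨r4, not_listSat_of_unsat h6 hf hw h0⟩
    · refine Or.inr (Or.inr ⟨r4, ?_⟩)
      refine ((h6.hard i w hw h0).1.superset (Set.subset_univ _)).mono
        (fun e he => (hr.2 e.1 e.2.1 e.2.2 he).2.2) fun i _ v hv => ⟨Or.inl rfl, (hf i v hv).le⟩
    · refine Or.inr (Or.inl ⟨r4, listSat_of_sat h6 hf hne fun i w hw => ?_⟩)
      have := h6.le2 i w hw
      have := h0 i w hw
      omega

end RecBackdoor

namespace RecBackdoor

/-! ### The program -/

/-- The program does not write into the memory. -/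
def Program.noStore : Program → Bool
  | .store _ _ => false
  | .seq P Q => P.noStore && Q.noStore
  | .cond _ P Q => P.noStore && Q.noStore
  | .loop _ P => P.noStore
  | _ => true

/-- Scanning and setup work in registers only, so the memory behind the input is still zero when the
rows are laid out there, and no initialization is needed. -/
theorem Exec.mem_eq {W : ℕ} {P : Program} {s s' : State} {t : ℕ} (h : Exec W P s s' t)
    (hP : P.noStore = true) : s'.mem = s.mem := by
  induction h with
  | store => simp [Program.noStore] at hP
  | seq _ _ ih1 ih2 =>
    simp only [Program.noStore, Bool.and_eq_true] at hP
    exact (ih2 hP.2).trans (ih1 hP.1)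
  | condTrue _ _ ih =>
    simp only [Program.noStore, Bool.and_eq_true] at hP
    exact ih hP.1
  | condFalse _ _ ih =>
    simp only [Program.noStore, Bool.and_eq_true] at hP
    exact ih hP.2
  | loopStep _ _ _ ih1 ih2 => exact (ih2 hP).trans (ih1 hP)
  | _ => rfl

/-- Compute the parameters of the layout of the memory from `k` (register 52), the length of the
input (register 14) and the largest variable (register 56). -/
def setupCode : Program :=
  .copy 2 14 ;; .add 4 14 56 ;; .add 4 4 20 ;; .const 22 4 ;; .copy 10 20 ;; .copy 6 4 ;;
    .copy 16 52 ;;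
    .loop (.lt 26 16)
      (.add 22 22 22 ;; .copy 8 6 ;; .add 6 6 4 ;; .add 10 10 20 ;; .sub 16 16 20) ;;
    .add 28 10 20

/-- Repeat the steps until the mode is 3. -/
def runCode : Program :=
  .const 0 3 ;; .loop (.lt 46 0) (stepCmd.code ;; .const 0 3) ;; .copy 0 48

def mainProgram : Program :=
  .const 20 1 ;; .load 12 20 ;; .load 52 26 ;; passCode scanClause scanLiteral ;;
    .cond (.lt 26 50) (.const 0 0)
      (.cond (.lt 26 54) (.const 0 2) (setupCode ;; startF.code ;; runCode))

/-- One loop of `k` turns produces the power of two, the level and the multiples of `S` by doubling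
and adding. -/
theorem exec_setup_loop {W S : ℕ} : ∀ (d j : ℕ) (s : State), s.reg 26 = 0 → s.reg 20 = 1 →
    s.reg 4 = S → s.reg 16 = d → s.reg 22 = 4 * 2 ^ j → s.reg 10 = j + 1 →
    s.reg 6 = (j + 1) * S → s.reg 8 = j * S → (j + d + 1) * S ≤ W → 4 * 2 ^ (j + d) ≤ W →
    j + d + 1 ≤ W → ∃ s' t, Exec W (.loop (.lt 26 16)
      (.add 22 22 22 ;; .copy 8 6 ;; .add 6 6 4 ;; .add 10 10 20 ;; .sub 16 16 20)) s s' t ∧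
      t ≤ 6 * d + 1 ∧ s'.reg 22 = 4 * 2 ^ (j + d) ∧ s'.reg 10 = j + d + 1 ∧
      s'.reg 6 = (j + d + 1) * S ∧ s'.reg 8 = (j + d) * S ∧
      ∀ r, r ≠ 22 → r ≠ 10 → r ≠ 6 → r ≠ 8 → r ≠ 16 → s'.reg r = s.reg r := by
  intro d
  induction d with
  | zero =>
    intro j s h26 h20 h4 h16 h22 h10 h6 h8 _ _ _
    exact ⟨s, 1, .loopDone (by simp [Test.Holds, h26, h16]), by omega, h22, h10, h6, h8,
      fun _ _ _ _ _ _ => rfl⟩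
  | succ d ih =>
    intro j s h26 h20 h4 h16 h22 h10 h6 h8 hS hD hj
    have e : j + 1 + d = j + (d + 1) := by ring
    have x1 := Exec.add (W := W) s 22 22 22 (by
      rw [h22]
      have : 2 ^ (j + 1) ≤ 2 ^ (j + (d + 1)) := Nat.pow_le_pow_right (by norm_num) (by omega)
      rw [pow_succ] at this
      omega)
    set s1 := s.setReg 22 (s.reg 22 + s.reg 22) with hs1
    have x2 := Exec.copy (W := W) s1 8 6
    set s2 := s1.setReg 8 (s1.reg 6) with hs2
    have hadd : s.reg 6 + s.reg 4 = (j + 1 + 1) * S := by rw [h6, h4]; ring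
    have x3 := Exec.add (W := W) s2 6 6 4 (by
      have : (j + 1 + 1) * S ≤ (j + (d + 1) + 1) * S := Nat.mul_le_mul_right _ (by omega)
      simp only [hs2, hs1, State.reg_setReg]
      simp
      omega)
    set s3 := s2.setReg 6 (s2.reg 6 + s2.reg 4) with hs3
    have x4 := Exec.add (W := W) s3 10 10 20 (by
      simp [hs3, hs2, hs1, h10, h20]; omega)
    set s4 := s3.setReg 10 (s3.reg 10 + s3.reg 20) with hs4
    have x5 := Exec.sub (W := W) s4 16 16 20
    set s5 := s4.setReg 16 (s4.reg 16 - s4.reg 20) with hs5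
    obtain ⟨s', t, x, ht, k22, k10, k6, k8, kr⟩ := ih (j + 1) s5
      (by simp [hs5, hs4, hs3, hs2, hs1, h26]) (by simp [hs5, hs4, hs3, hs2, hs1, h20])
      (by simp [hs5, hs4, hs3, hs2, hs1, h4]) (by simp [hs5, hs4, hs3, hs2, hs1, h16, h20])
      (by simp [hs5, hs4, hs3, hs2, hs1, h22, pow_succ]; ring)
      (by simp [hs5, hs4, hs3, hs2, hs1, h10, h20])
      (by simp [hs5, hs4, hs3, hs2, hs1]; exact hadd)
      (by simp [hs5, hs4, hs3, hs2, hs1, h6])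
      (by rwa [e]) (by rwa [e]) (by omega)
    rw [e] at k22 k10 k6 k8
    refine ⟨s', _, .loopStep (by simp [Test.Holds, h26, h16])
      (x1.seq (x2.seq (x3.seq (x4.seq x5)))) x, by omega, k22, k10, k6, k8, ?_⟩
    intro r a1 a2 a3 a4 a5
    rw [kr r a1 a2 a3 a4 a5]
    simp [hs5, hs4, hs3, hs2, hs1, a1, a2, a3, a4, a5]

theorem exec_setup {W k n m : ℕ} (s : State) (h26 : s.reg 26 = 0) (h20 : s.reg 20 = 1)
    (h8 : s.reg 8 = 0) (h52 : s.reg 52 = k) (h14 : s.reg 14 = n) (h56 : s.reg 56 = m)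
    (hS : (k + 3) * (n + m + 1) ≤ W) (hD : 2 ^ (k + 2) ≤ W) :
    ∃ s' t, Exec W setupCode s s' t ∧ t ≤ 6 * k + 9 ∧ s'.mem = s.mem ∧ s'.reg 2 = n ∧
      s'.reg 4 = n + m + 1 ∧ s'.reg 6 = (k + 1) * (n + m + 1) ∧ s'.reg 8 = k * (n + m + 1) ∧
      s'.reg 10 = k + 1 ∧ s'.reg 22 = 2 ^ (k + 2) ∧ s'.reg 28 = k + 2 ∧
      ∀ r, 10 < r → r ≠ 22 → r ≠ 16 → r ≠ 28 → s'.reg r = s.reg r := by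
  have hSW : n + m + 1 ≤ W := le_trans (Nat.le_mul_of_pos_left _ (by omega)) hS
  have hkW : k + 3 ≤ W := le_trans (Nat.le_mul_of_pos_right _ (by omega)) hS
  have h4W : 4 ≤ W := le_trans (by
    have := Nat.one_le_two_pow (n := k)
    rw [pow_add]; omega) hD
  have x1 := Exec.copy (W := W) s 2 14
  set s1 := s.setReg 2 (s.reg 14) with hs1
  have x2 := Exec.add (W := W) s1 4 14 56 (by simp [hs1, h14, h56]; omega)
  set s2 := s1.setReg 4 (s1.reg 14 + s1.reg 56) with hs2
  have x3 := Exec.add (W := W) s2 4 4 20 (by simp [hs2, hs1, h14, h56, h20]; omega)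
  set s3 := s2.setReg 4 (s2.reg 4 + s2.reg 20) with hs3
  have x4 := Exec.const (W := W) s3 22 4 h4W
  set s4 := s3.setReg 22 4 with hs4
  have x5 := Exec.copy (W := W) s4 10 20
  set s5 := s4.setReg 10 (s4.reg 20) with hs5
  have x6 := Exec.copy (W := W) s5 6 4
  set s6 := s5.setReg 6 (s5.reg 4) with hs6
  have x7 := Exec.copy (W := W) s6 16 52
  set s7 := s6.setReg 16 (s6.reg 52) with hs7
  have v4 : s7.reg 4 = n + m + 1 := by simp [hs7, hs6, hs5, hs4, hs3, hs2, hs1, h14, h56, h20]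
  obtain ⟨s', t, x, ht, k22, k10, k6, k8, kr⟩ := exec_setup_loop (W := W) (S := n + m + 1) k 0 s7
    (by simp [hs7, hs6, hs5, hs4, hs3, hs2, hs1, h26])
    (by simp [hs7, hs6, hs5, hs4, hs3, hs2, hs1, h20]) v4
    (by simp [hs7, hs6, hs5, hs4, hs3, hs2, hs1, h52])
    (by simp [hs7, hs6, hs5, hs4])
    (by simp [hs7, hs6, hs5, hs4, hs3, hs2, hs1, h20])
    (by simp [hs7, hs6, hs5, hs4, hs3, hs2, hs1, h14, h56, h20])
    (by simp [hs7, hs6, hs5, hs4, hs3, hs2, hs1, h8])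
    (le_trans (Nat.mul_le_mul_right _ (by omega)) hS)
    (by rw [zero_add]; rw [pow_add] at hD; omega) (by omega)
  simp only [zero_add] at k22 k10 k6 k8
  have r20 : s'.reg 20 = 1 := by
    rw [kr 20 (by omega) (by omega) (by omega) (by omega) (by omega)]
    simp [hs7, hs6, hs5, hs4, hs3, hs2, hs1, h20]
  have x8 := Exec.add (W := W) s' 28 10 20 (by rw [k10, r20]; omega)
  have hx := x1.seq (x2.seq (x3.seq (x4.seq (x5.seq (x6.seq (x7.seq (x.seq x8)))))))
  refine ⟨_, _, hx, by omega, hx.mem_eq rfl, ?_, ?_, ?_, ?_, ?_, ?_, ?_, ?_⟩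
  · rw [State.reg_setReg, if_neg (by omega), kr 2 (by omega) (by omega) (by omega) (by omega)
      (by omega)]
    simp [hs7, hs6, hs5, hs4, hs3, hs2, hs1, h14]
  · rw [State.reg_setReg, if_neg (by omega), kr 4 (by omega) (by omega) (by omega) (by omega)
      (by omega), v4]
  · rw [State.reg_setReg, if_neg (by omega), k6]
  · rw [State.reg_setReg, if_neg (by omega), k8]
  · rw [State.reg_setReg, if_neg (by omega), k10]
  · rw [State.reg_setReg, if_neg (by omega), k22, pow_add]; ring
  · rw [State.reg_setReg, if_pos rfl, k10, r20]
  · intro r a1 a2 a3 a4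
    rw [State.reg_setReg, if_neg a4, kr r a2 (by omega) (by omega) (by omega) a3]
    simp [hs7, hs6, hs5, hs4, hs3, hs2, hs1, a2, a3, show r ≠ 2 by omega, show r ≠ 4 by omega,
      show r ≠ 6 by omega, show r ≠ 10 by omega]

/-- Register `0` holds the sentinel `3` but is not part of the representation, so it is set again
after every step. -/
theorem exec_run_loop (X : Layout) (k : ℕ) (L : List (List Literal)) (hw : X.w = inputWords k L) :
    ∀ (N : ℕ) (σ σ' : HS) (s : State), Rep X σ s → s.reg 0 = 3 →
      Steps X.S X.LM X.D L N σ σ' → σ'.reg 3 = 3 →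
      ∃ s' t, Exec X.W (.loop (.lt 46 0) (stepCmd.code ;; .const 0 3)) s s' t ∧
        t ≤ N * (stepCmd.cost (inputSize L) X.D + 2) + 1 ∧ Rep X σ' s' := by
  intro N
  induction N with
  | zero =>
    intro σ σ' s hs h0 hst h3
    obtain rfl : σ = σ' := hst.1
    exact ⟨s, 1, .loopDone (by
      have : s.reg 46 = _ := hs.reg 3
      simp only [Test.Holds, this, h3, h0]; omega), by omega, hs⟩
  | succ N ih =>
    intro σ σ' s hs h0 hst h3
    obtain ⟨s1, t1, x1, l1, h1, -⟩ := stepCmd.sim X k L hw σ s hs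
    have hW := X.hW
    obtain ⟨s2, t2, x2, l2, h2⟩ := ih _ σ' (s1.setReg 0 3) (h1.setReg (by simp [Spare]) 3) (by simp)
      ⟨hst.1, fun m hm => hst.2 (m + 1) (by omega)⟩ h3
    refine ⟨s2, _, .loopStep ?_ (x1.seq (.const s1 0 3 (by have := X.hB; omega))) x2, ?_, h2⟩
    · have : s.reg 46 = _ := hs.reg 3
      have h4 : σ.reg 3 < 3 := hst.2 0 (by omega)
      simp only [Test.Holds, this, h0]; exact h4
    · rw [add_mul, one_mul]; omega

theorem length_le_inputWords (k : ℕ) (L : List (List Literal)) :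
    L.length + 2 ≤ (inputWords k L).length := by
  have : L.length ≤
      (L.flatMap (fun C => C.length :: C.flatMap (fun l => [l.1, l.2.toNat]))).length := by
    induction L with
    | nil => simp
    | cons c L ih =>
      rw [List.flatMap_cons, List.length_append, List.length_cons, List.length_cons]
      omega
  simp only [inputWords, List.length_cons]
  omega

/-- The number of steps of the program, if the run of the array language has at most `N` steps. -/
def timeBound (k N n : ℕ) : ℕ :=
  n * (scanClause.cost + scanLiteral.cost + 10) + 6 * k + 30 + startF.cost n +
    N * (stepCmd.cost n (2 ^ (k + 2)) + 2)

/-- The scan answers for formulas with an empty clause or a clause wider than `k`; the remaining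
ones meet the hypotheses of the recursion. -/
theorem exec_mainProgram {k B W M : ℕ} {L : List (List Literal)} (hB : 8 ≤ B)
    (hW : (inputWords k L).length + 32 * B + 32 ≤ W)
    (hS : (k + 3) * ((inputWords k L).length + M + 1) ≤ B) (hw : ∀ x ∈ inputWords k L, x ≤ B)
    (hD : 2 ^ (k + 2) ≤ W) (hM : ∀ C ∈ L, ∀ l ∈ C, l.1 ≤ M) :
    ∃ s t, Exec W mainProgram (initialState (inputWords k L)) s t ∧
      t ≤ timeBound k (iters k (2 ^ (k + 2)) (k + 1) + 1) (inputSize L) ∧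
      ((s.reg 0 = 0 ∧ ¬ ListSat L) ∨ (s.reg 0 = 1 ∧ ListSat L) ∨
        (s.reg 0 = 2 ∧ ((∃ C ∈ L, k < C.length) ∨
          Hard (events L) (k + 1) (fun _ => 2) Set.univ))) := by
  set w := inputWords k L with hwd
  have hwl := length_le_inputWords k L
  -- During the scan the size of the rows is not yet known. With empty rows the simulation of passes
  -- applies all the same.
  let X0 : Layout :=
    { w := w, N0 := 0, S := 0, B := B, D := 0, LM := 0, W := W, hB := hB, hW := by omega,
      hS := by omega, hN := Or.inl rfl, hw := hw, hlen := by omega, hLM := by omega }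
  have x1 := Exec.const (W := W) (initialState w) 20 1 (by omega)
  set s1 := (initialState w).setReg 20 1 with hs1
  have x2 := Exec.load (W := W) s1 12 20
  set s2 := s1.setReg 12 (s1.mem (s1.reg 20)) with hs2
  have x3 := Exec.load (W := W) s2 52 26
  set s3 := s2.setReg 52 (s2.mem (s2.reg 26)) with hs3
  have hkB : k ≤ B := hw k (by simp [hwd, inputWords])
  have h3 : ∀ r, r ≠ 20 → r ≠ 12 → r ≠ 52 → s3.reg r = 0 := by
    intro r h20 h12 h52
    simp [hs3, hs2, hs1, h20, h12, h52, initialState]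
  set σ0 : HS := ⟨0, fun r => if r = 6 then k else 0, fun _ _ _ => 0⟩ with hσ0
  have hrep : Rep X0 σ0 s3 := by
    constructor
    · exact h3 2 (by omega) (by omega) (by omega)
    · exact h3 4 (by omega) (by omega) (by omega)
    · rw [h3 6 (by omega) (by omega) (by omega)]; simp [hσ0]
    · rw [h3 8 (by omega) (by omega) (by omega)]; simp [hσ0]
    · exact h3 10 (by omega) (by omega) (by omega)
    · simp [hs3, hs2, hs1, initialState, X0]
    · simp [hs3, hs2, hs1]
    · exact h3 22 (by omega) (by omega) (by omega)
    · exact h3 26 (by omega) (by omega) (by omega)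
    · exact h3 28 (by omega) (by omega) (by omega)
    · intro r
      by_cases hr : r = 6
      · subst hr
        simp [hs3, hs2, hs1, initialState, hσ0, hwd, inputWords]
      · rw [h3 _ (by omega) (by omega) (by omega)]
        simp [hσ0, hr]
    · intro i _
      rfl
    · intro a l x hx
      exact absurd hx (Nat.not_lt_zero _)
    · exact le_rfl
    · intro r
      simp only [hσ0]
      split_ifs
      · exact hkB
      · exact Nat.zero_le _
    · intro a l x hx
      exact absurd hx (Nat.not_lt_zero _)
  obtain ⟨s4, t4, x4, l4, r4, len4, -⟩ := exec_pass X0 scanClause scanLiteral k L rfl σ0 s3 hrep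
  have hsc := scan_spec X0.S X0.LM L σ0
  set σ4 := passSem X0.S X0.LM L scanClause scanLiteral σ0 with hσ4
  have mem4 : s4.mem = (initialState w).mem := x4.mem_eq rfl
  have e50 : s4.reg 50 = σ4.reg 5 := r4.reg 5
  have e52 : s4.reg 52 = σ4.reg 6 := r4.reg 6
  have e54 : s4.reg 54 = σ4.reg 7 := r4.reg 7
  have e56 : s4.reg 56 = σ4.reg 8 := r4.reg 8
  have e26 := r4.zero
  have hW1 : 1 ≤ W := by omega
  suffices hsuf : ∃ s t, Exec W (.cond (.lt 26 50) (.const 0 0)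
      (.cond (.lt 26 54) (.const 0 2) (setupCode ;; startF.code ;; runCode))) s4 s t ∧
      t + inputSize L * (scanClause.cost + scanLiteral.cost + 10) + 6 ≤
        timeBound k (iters k (2 ^ (k + 2)) (k + 1) + 1) (inputSize L) ∧
      ((s.reg 0 = 0 ∧ ¬ ListSat L) ∨ (s.reg 0 = 1 ∧ ListSat L) ∨
        (s.reg 0 = 2 ∧ ((∃ C ∈ L, k < C.length) ∨
          Hard (events L) (k + 1) (fun _ => 2) Set.univ))) by
    obtain ⟨s, t, x, ht, hres⟩ := hsuf
    exact ⟨s, _, x1.seq (x2.seq (x3.seq (x4.seq x))), by omega, hres⟩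
  by_cases h5 : σ4.reg 5 = 0
  swap
  · refine ⟨_, _, .condTrue (by simp only [Test.Holds, e26, e50]; omega)
      (.const _ _ _ (by omega)), by unfold timeBound; omega, Or.inl ⟨by simp, ?_⟩⟩
    have hmem : [] ∈ L := (hsc.empty.mp h5).resolve_left (by simp [hσ0])
    rintro ⟨α, hα⟩
    obtain ⟨l, hl, -⟩ := hα _ hmem
    simp at hl
  by_cases h7 : σ4.reg 7 = 0
  swap
  · refine ⟨_, _, .condFalse (by simp only [Test.Holds, e26, e50]; omega)
      (.condTrue (by simp only [Test.Holds, e26, e54]; omega)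
      (.const _ _ _ (by omega))), by unfold timeBound; omega, Or.inr (Or.inr ⟨by simp, ?_⟩)⟩
    left
    simpa [hσ0] using hsc.wide.mp h7
  have hne : [] ∉ L := fun h => hsc.empty.mpr (Or.inr h) h5
  have hlen : ∀ C ∈ L, C.length ≤ k := by
    intro C hC
    by_contra hcon
    exact hsc.wide.mpr (Or.inr ⟨C, hC, by simpa [hσ0] using hcon⟩) h7
  set m := σ4.reg 8 with hm
  have hmM : m ≤ M := hsc.le_max M (by simp [hσ0]) hM
  have e6 : σ4.reg 6 = k := by rw [hsc.reg 6 (by omega) (by omega) (by omega)]; simp [hσ0]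
  have e3 : σ4.reg 3 = 0 := by rw [hsc.reg 3 (by omega) (by omega) (by omega)]; simp [hσ0]
  have hSB : (k + 3) * (w.length + m + 1) ≤ B :=
    le_trans (Nat.mul_le_mul_left _ (by omega)) hS
  -- The pointer of the scan has stopped at the end of the input, which is where the rows begin.
  have hlen4 : s4.reg 14 = w.length := len4
  obtain ⟨s5, t5, x5, l5, m5, v2, v4, v6, v8, v10, v22, v28, vr⟩ := exec_setup (W := W) s4 e26 r4.one
    (by rw [r4.chi]; simp [X0]) (e52.trans e6) hlen4 e56 (by omega) hD
  let X : Layout :=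
    { w := w, N0 := w.length, S := w.length + m + 1, B := B, D := 2 ^ (k + 2), LM := k + 2, W := W,
      hB := hB, hW := hW, hS := hSB, hN := Or.inr le_rfl, hw := hw, hlen := by omega,
      hLM := le_trans (by omega) (le_trans (Nat.le_mul_of_pos_right (k + 3)
        (Nat.succ_pos (w.length + m))) hSB) }
  set σ5 : HS := ⟨k + 1, σ4.reg, fun _ _ _ => 0⟩ with hσ5
  have hrep5 : Rep X σ5 s5 := by
    constructor
    · exact v2
    · exact v4
    · exact v6
    · exact v8
    · exact v10
    · rw [vr 12 (by omega) (by omega) (by omega) (by omega)]; exact r4.num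
    · rw [vr 20 (by omega) (by omega) (by omega) (by omega)]; exact r4.one
    · exact v22
    · rw [vr 26 (by omega) (by omega) (by omega) (by omega)]; exact r4.zero
    · exact v28
    · intro r
      rw [vr _ (by omega) (by omega) (by omega) (by omega)]
      exact r4.reg r
    · intro i _
      rw [m5, mem4]
      rfl
    · intro a l x _
      rw [m5, mem4]
      exact List.getD_eq_default _ _ (Nat.le_add_right _ _)
    · exact Nat.le_succ _
    · exact r4.regle
    · intro _ _ _ _
      exact Nat.zero_le _
  have hr : InRange X.S L := by
    refine ⟨Nat.succ_pos _, fun i v s he => ?_⟩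
    obtain ⟨C, hC, b, hb, rfl⟩ := mem_events.mp he
    have h1 := (List.getElem?_eq_some_iff.mp hC).1
    have h2 := hsc.var_le C (List.mem_of_getElem? hC) _ hb
    have h3 := Bool.toNat_lt b
    have h2' : v ≤ m := h2
    have hwl' : L.length + 2 ≤ w.length := hwl
    change i < w.length + m + 1 ∧ v < w.length + m + 1 ∧ _
    exact ⟨by omega, by omega, h3⟩
  have hfar : farDist (k + 1) ≤ X.D := by
    have := farDist_le (k + 1)
    change farDist (k + 1) ≤ 2 ^ (k + 2)
    rw [← this]
    omega
  obtain ⟨N, hN, σ7, hst, h3', hres⟩ := run_spec (LM := X.LM) (k := k) hr hne hlen hfar rfl (σ := σ5)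
    rfl e3
  obtain ⟨s6, t6, x6, l6, h6, -⟩ := startF.sim X k L rfl σ5 s5 hrep5
  have y7 := Exec.const (W := W) s6 0 3 (by omega)
  obtain ⟨s8, t8, x8, l8, h8⟩ := exec_run_loop X k L rfl N _ σ7 (s6.setReg 0 3)
    (h6.setReg (by simp [Spare]) 3) (by simp) hst h3'
  have x9 := Exec.copy (W := W) s8 0 48
  have e48 : s8.reg 48 = σ7.reg 4 := h8.reg 4
  refine ⟨_, _, .condFalse (by simp only [Test.Holds, e26, e50]; omega)
      (.condFalse (by simp only [Test.Holds, e26, e54]; omega)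
      (x5.seq (x6.seq (y7.seq (x8.seq x9))))), ?_, ?_⟩
  · have l8' : t8 ≤ (iters k (2 ^ (k + 2)) (k + 1) + 1) *
        (stepCmd.cost (inputSize L) (2 ^ (k + 2)) + 2) + 1 :=
      l8.trans (Nat.add_le_add_right (Nat.mul_le_mul_right _ hN) _)
    unfold timeBound
    omega
  · simp only [State.reg_setReg, if_true, e48]
    rcases hres with h | h | ⟨h, h'⟩
    · exact Or.inl h
    · exact Or.inr (Or.inl h)
    · exact Or.inr (Or.inr ⟨h, Or.inr h'⟩)

end RecBackdoor

namespace RecBackdoor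

/-! ### Doubly exponential bounds -/

/-- The function is bounded by `2 ^ 2 ^ O(k)`. -/
def DExp (f : ℕ → ℕ) : Prop := ∃ C, ∀ k, f k ≤ 2 ^ 2 ^ (C * (k + 1))

theorem DExp.mono {f g : ℕ → ℕ} (hg : DExp g) (h : ∀ k, f k ≤ g k) : DExp f := by
  obtain ⟨C, hC⟩ := hg
  exact ⟨C, fun k => (h k).trans (hC k)⟩

theorem dexp_two_pow {e : ℕ → ℕ} (C : ℕ) (h : ∀ k, e k ≤ 2 ^ (C * (k + 1))) :
    DExp fun k => 2 ^ e k := ⟨C, fun k => Nat.pow_le_pow_right (by norm_num) (h k)⟩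

theorem dexp_const (c : ℕ) : DExp fun _ => c := by
  refine ⟨c, fun k => ?_⟩
  have h1 : c ≤ c * (k + 1) := Nat.le_mul_of_pos_right _ (by omega)
  have h2 := (Nat.lt_two_pow_self (n := c * (k + 1)))
  have h3 := (Nat.lt_two_pow_self (n := 2 ^ (c * (k + 1))))
  exact h1.trans (h2.le.trans h3.le)

theorem dexp_linear : DExp fun k => k + 1 := by
  refine ⟨1, fun k => ?_⟩
  have h2 := (Nat.lt_two_pow_self (n := 1 * (k + 1)))
  have h3 := (Nat.lt_two_pow_self (n := 2 ^ (1 * (k + 1))))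
  exact (one_mul (k + 1)).ge.trans (h2.le.trans h3.le)

theorem DExp.mul {f g : ℕ → ℕ} (hf : DExp f) (hg : DExp g) : DExp fun k => f k * g k := by
  obtain ⟨C, hC⟩ := hf
  obtain ⟨C', hC'⟩ := hg
  refine ⟨C + C' + 1, fun k => (Nat.mul_le_mul (hC k) (hC' k)).trans ?_⟩
  rw [← pow_add]
  refine Nat.pow_le_pow_right (by norm_num) ?_
  have h1 : 2 ^ (C * (k + 1)) ≤ 2 ^ (C * (k + 1) + C' * (k + 1)) :=
    Nat.pow_le_pow_right (by norm_num) (by omega)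
  have h2 : 2 ^ (C' * (k + 1)) ≤ 2 ^ (C * (k + 1) + C' * (k + 1)) :=
    Nat.pow_le_pow_right (by norm_num) (by omega)
  have h3 : 2 ^ (C * (k + 1) + C' * (k + 1) + 1) ≤ 2 ^ ((C + C' + 1) * (k + 1)) :=
    Nat.pow_le_pow_right (by norm_num) (by nlinarith)
  rw [pow_succ] at h3
  omega

theorem DExp.add {f g : ℕ → ℕ} (hf : DExp f) (hg : DExp g) : DExp fun k => f k + g k := by
  obtain ⟨C, hC⟩ := hf
  obtain ⟨C', hC'⟩ := hg
  refine DExp.mono (DExp.mul ⟨C, fun _ => le_rfl⟩ ⟨C', fun _ => le_rfl⟩) fun k =>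
    (Nat.add_le_add (hC k) (hC' k)).trans ?_
  have h : ∀ n : ℕ, 2 ≤ 2 ^ 2 ^ n := fun n => by
    calc 2 = 2 ^ 1 := rfl
      _ ≤ _ := Nat.pow_le_pow_right (by norm_num) Nat.one_le_two_pow
  exact Nat.add_le_mul (h _) (h _)

/-- The upper exponent absorbs the factor `2 ^ (k + 2)`: since `k + 2 ≤ 2 * (k + 1)`, the constant
grows by `2`. -/
theorem DExp.pow {f : ℕ → ℕ} (hf : DExp f) : DExp fun k => f k ^ 2 ^ (k + 2) := by
  obtain ⟨C, hC⟩ := hf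
  refine ⟨C + 2, fun k => (Nat.pow_le_pow_left (hC k) _).trans ?_⟩
  rw [← pow_mul, ← pow_add]
  refine Nat.pow_le_pow_right (by norm_num) (Nat.pow_le_pow_right (by norm_num) ?_)
  nlinarith

/-- With `A = 4 * ((K + 1) ^ D * (K + 1))`, the quantity `A * (obsSize + 1)` at most squares from
one level to the next; the factor `4 * (K + 1)` pays for the number of rounds and the lower order
terms. -/
theorem obsSize_le (K D : ℕ) (j : ℕ) :
    4 * ((K + 1) ^ D * (K + 1)) * (obsSize K D j + 1) ≤ (4 * ((K + 1) ^ D * (K + 1))) ^ 2 ^ j := by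
  induction j with
  | zero => simp [obsSize]
  | succ j ih =>
    have hP : 1 ≤ (K + 1) ^ D := Nat.one_le_pow _ _ (by omega)
    simp only [obsSize, rounds]
    generalize (K + 1) ^ D = P at *
    generalize obsSize K D j = s at *
    rw [pow_succ 2 j, pow_mul]
    refine le_trans ?_ (Nat.pow_le_pow_left ih 2)
    have h : P * (1 + 2 * (1 + 2 * (K * s)) * s) + 1 ≤ 4 * (P * (K + 1)) * (s + 1) ^ 2 := by
      calc P * (1 + 2 * (1 + 2 * (K * s)) * s) + 1 ≤ P * (1 + 2 * (1 + 2 * (K * s)) * s) + P := by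
            omega
        _ ≤ _ := by
          have : 1 + 2 * (1 + 2 * (K * s)) * s + 1 ≤ 4 * (K + 1) * (s + 1) ^ 2 := by
            nlinarith [Nat.zero_le (K * s), Nat.zero_le (s * s), Nat.zero_le (K * (s * s))]
          nlinarith [Nat.mul_le_mul_left P this]
    calc _ ≤ 4 * (P * (K + 1)) * (4 * (P * (K + 1)) * (s + 1) ^ 2) := Nat.mul_le_mul_left _ h
      _ = _ := by ring

/-- For `T = iters + 2` the recursion reads `T' ≤ 4 + R * T`, which is at most `(R + 4) * T`; the
initial value is `3`. -/
theorem iters_le (K D R : ℕ) (m : ℕ) (hR : ∀ j < m, rounds K (obsSize K D j) ≤ R) :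
    ∀ j ≤ m, iters K D j + 2 ≤ 3 * (R + 4) ^ j := by
  intro j
  induction j with
  | zero => intro _; simp [iters]
  | succ j ih =>
    intro hj
    have h1 := ih (by omega)
    have h2 := hR j (by omega)
    simp only [iters]
    rw [pow_succ]
    have h3 := Nat.mul_le_mul h2 (le_refl (iters K D j + 2))
    nlinarith

/-- Three applications of `DExp.pow` suffice: to `k + 1` for the closure, to `A` for the size of the
obstructions, and to the bound on the rounds for the nesting of the levels. -/
theorem dexp_iters : DExp fun k => iters k (2 ^ (k + 2)) (k + 1) := by
  have hA : DExp fun k => 4 * ((k + 1) ^ 2 ^ (k + 2) * (k + 1)) :=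
    (dexp_const 4).mul (dexp_linear.pow.mul dexp_linear)
  have hS := hA.pow
  have hR : DExp fun k => 2 * (1 + 2 * ((k + 1) *
      (4 * ((k + 1) ^ 2 ^ (k + 2) * (k + 1))) ^ 2 ^ (k + 2))) :=
    (dexp_const 2).mul ((dexp_const 1).add ((dexp_const 2).mul (dexp_linear.mul hS)))
  refine ((dexp_const 3).mul (hR.add (dexp_const 4)).pow).mono fun k => ?_
  have h := iters_le k (2 ^ (k + 2)) (2 * (1 + 2 * ((k + 1) *
      (4 * ((k + 1) ^ 2 ^ (k + 2) * (k + 1))) ^ 2 ^ (k + 2)))) (k + 1) (fun j hj => by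
    have h1 := obsSize_le k (2 ^ (k + 2)) j
    have hP : 1 ≤ (k + 1) ^ 2 ^ (k + 2) * (k + 1) :=
      Nat.mul_pos (Nat.pow_pos (by omega)) (by omega)
    have h2 : obsSize k (2 ^ (k + 2)) j ≤ (4 * ((k + 1) ^ 2 ^ (k + 2) * (k + 1))) ^ 2 ^ (k + 2) := by
      have : (4 * ((k + 1) ^ 2 ^ (k + 2) * (k + 1))) ^ 2 ^ j ≤
          (4 * ((k + 1) ^ 2 ^ (k + 2) * (k + 1))) ^ 2 ^ (k + 2) :=
        Nat.pow_le_pow_right (by omega) (Nat.pow_le_pow_right (by norm_num) (by omega))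
      refine le_trans ?_ (h1.trans this)
      nlinarith
    unfold rounds
    refine Nat.mul_le_mul_left _ (Nat.add_le_add_left (Nat.mul_le_mul_left _ ?_) _)
    exact Nat.mul_le_mul (by omega) h2) (k + 1) le_rfl
  have h3 : k + 1 ≤ 2 ^ (k + 2) := by
    have := Nat.lt_two_pow_self (n := k + 2)
    omega
  have h4 := Nat.pow_le_pow_right (n := 2 * (1 + 2 * ((k + 1) *
      (4 * ((k + 1) ^ 2 ^ (k + 2) * (k + 1))) ^ 2 ^ (k + 2))) + 4) (by omega) h3
  have h5 := Nat.mul_le_mul_left 3 h4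
  exact le_trans (by omega) (h.trans h5)

theorem exists_timeBound_le : ∃ f, DExp f ∧ ∀ k n,
    timeBound k (iters k (2 ^ (k + 2)) (k + 1) + 1) n ≤ f k * (n + 1) := by
  obtain ⟨c0, h0⟩ := startF.cost_le
  obtain ⟨c, hc⟩ := stepCmd.cost_le
  refine ⟨fun k => (scanClause.cost + scanLiteral.cost + 40 + c0) + (6 * (k + 1) +
    (iters k (2 ^ (k + 2)) (k + 1) + 1) * (c * (2 ^ (k + 2) + 1) + 2)), ?_, fun k n => ?_⟩
  · refine (dexp_const _).add (((dexp_const 6).mul dexp_linear).add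
      ((dexp_iters.add (dexp_const 1)).mul (((dexp_const c).mul
        (DExp.add (dexp_two_pow 2 fun k => ?_) (dexp_const 1))).add (dexp_const 2))))
    have := Nat.lt_two_pow_self (n := 2 * (k + 1))
    omega
  · unfold timeBound
    beta_reduce
    have h1 := h0 n
    generalize iters k (2 ^ (k + 2)) (k + 1) + 1 = N
    have h2 : N * (stepCmd.cost n (2 ^ (k + 2)) + 2) ≤
        N * ((c * (2 ^ (k + 2) + 1) + 2) * (n + 1)) := by
      refine Nat.mul_le_mul_left _ ?_
      nlinarith [hc n (2 ^ (k + 2))]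
    rw [← mul_assoc] at h2
    generalize N * (c * (2 ^ (k + 2) + 1) + 2) = R at *
    nlinarith [Nat.zero_le (k * n), Nat.zero_le (R * n)]

end RecBackdoor

namespace RecBackdoor

/-! ### Listed formulas -/

variable {L : List (List Literal)} {φ : Formula} {k : ℕ}

theorem Lists.mem (h : Lists L φ) {c : List Literal} (hc : c ∈ L) : c.toFinset ∈ φ := by
  rw [← h.2.2, List.mem_toFinset]
  exact List.mem_map.mpr ⟨c, hc, rfl⟩

theorem Lists.exists_of_mem (h : Lists L φ) {d : Clause} (hd : d ∈ φ) :
    ∃ c ∈ L, c.toFinset = d := by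
  rw [← h.2.2, List.mem_toFinset] at hd
  exact List.mem_map.mp hd

theorem Lists.listSat_iff (h : Lists L φ) : ListSat L ↔ Formula.Satisfiable φ := by
  refine exists_congr fun α => ⟨fun hα d hd => ?_, fun hα c hc => ?_⟩
  · obtain ⟨c, hc, rfl⟩ := h.exists_of_mem hd
    obtain ⟨l, hl, h1⟩ := hα c hc
    exact ⟨l, List.mem_toFinset.mpr hl, h1⟩
  · obtain ⟨l, hl, h1⟩ := hα _ (h.mem hc)
    exact ⟨l, List.mem_toFinset.mp hl, h1⟩

/-- Without complementary pairs, the distinct literals of a clause have distinct variables. -/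
theorem Lists.card_vars (h : Lists L φ) (hp : Formula.Proper φ) {c : List Literal} (hc : c ∈ L) :
    (Clause.vars c.toFinset).card = c.length := by
  rw [← List.toFinset_card_of_nodup (h.1 c hc), Clause.vars]
  refine Finset.card_image_of_injOn ?_
  rintro ⟨v, a⟩ hv ⟨w, b⟩ hw heq
  obtain rfl : v = w := heq
  have hv' : (v, a) ∈ c.toFinset := hv
  have hw' : (v, b) ∈ c.toFinset := hw
  have := hp _ (h.mem hc) v
  cases a <;> cases b <;> simp_all

theorem Lists.length_eq (h : Lists L φ) (hp : Formula.Proper φ) :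
    Formula.length φ = (L.map List.length).sum := by
  unfold Formula.length
  rw [← h.2.2, List.sum_toFinset _ h.2.1, List.map_map]
  exact congrArg List.sum (List.map_congr_left fun c hc => h.card_vars hp hc)

theorem Lists.card (h : Lists L φ) : L.length = φ.card := by
  rw [← h.2.2, List.toFinset_card_of_nodup h.2.1, List.length_map]

/-- Only one clause can be empty, and every other contributes to the length. Hence the size of the
input is linear in `|φ| + 1`, although the length does not see the empty clause. -/
theorem Formula.card_le (φ : Formula) : φ.card ≤ Formula.length φ + 1 := by
  have h1 : (φ.erase ∅).card ≤ Formula.length φ := by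
    refine le_trans ?_ (Finset.sum_le_sum_of_subset (Finset.erase_subset ∅ φ))
    rw [Finset.card_eq_sum_ones]
    refine Finset.sum_le_sum fun c hc => ?_
    rw [Nat.one_le_iff_ne_zero, Finset.card_ne_zero, Clause.vars, Finset.image_nonempty]
    exact Finset.nonempty_iff_ne_empty.mpr (Finset.ne_of_mem_erase hc)
  have := Finset.pred_card_le_card_erase (s := φ) (a := ∅)
  omega

theorem inputSize_eq (L : List (List Literal)) :
    inputSize L = (L.map List.length).sum + L.length := by
  unfold inputSize
  induction L with
  | nil => rfl
  | cons c L ih => simp only [List.map_cons, List.sum_cons, List.length_cons, ih]; ring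

theorem length_inputWords (k : ℕ) (L : List (List Literal)) :
    (inputWords k L).length = 2 + L.length + 2 * (L.map List.length).sum := by
  have h2 : ∀ c : List Literal, (c.flatMap fun l => [l.1, l.2.toNat]).length = 2 * c.length := by
    intro c
    induction c with
    | nil => rfl
    | cons l c ih => simp only [List.flatMap_cons, List.length_append, ih, List.length_cons,
        List.length_nil]; ring
  have h : (L.flatMap (fun C => C.length :: C.flatMap (fun l => [l.1, l.2.toNat]))).length =
      L.length + 2 * (L.map List.length).sum := by
    induction L with
    | nil => rfl
    | cons c L ih =>
      simp only [List.flatMap_cons, List.length_append, List.length_cons, h2, ih, List.map_cons,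
        List.sum_cons]
      ring
  simp only [inputWords, List.length_cons, h]
  ring

theorem Lists.var_le (h : Lists L φ) {c : List Literal} (hc : c ∈ L) {l : Literal} (hl : l ∈ c) :
    l.1 ≤ Formula.maxVar φ := by
  refine Finset.le_sup (f := id) ?_
  exact Finset.mem_biUnion.mpr ⟨_, h.mem hc, Finset.mem_image_of_mem _ (List.mem_toFinset.mpr hl)⟩

theorem Lists.word_le (h : Lists L φ) (hp : Formula.Proper φ) {v : ℕ} (hv : v ∈ inputWords k L) :
    v ≤ k + Formula.length φ + Formula.maxVar φ + 1 := by
  simp only [inputWords, List.mem_cons, List.mem_flatMap, List.not_mem_nil, or_false] at hv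
  rcases hv with rfl | rfl | ⟨c, hc, rfl | ⟨l, hl, rfl | rfl⟩⟩
  · omega
  · have := Formula.card_le φ
    rw [h.card]; omega
  · have : c.length ≤ (L.map List.length).sum :=
      List.single_le_sum (by simp) _ (List.mem_map.mpr ⟨c, hc, rfl⟩)
    rw [h.length_eq hp]; omega
  · have := h.var_le hc hl; omega
  · have := Bool.toNat_lt l.2; omega

theorem events_lt_two (L : List (List Literal)) : ∀ e ∈ events L, e.2.2 < 2 := by
  rintro ⟨i, v, s⟩ he
  obtain ⟨-, -, b, -, rfl⟩ := mem_events.mp he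
  exact Bool.toNat_lt b

theorem Lists.le_srbd (h : Lists L φ) {n : ℕ} {O : Set ℕ}
    (hh : Hard (events L) n (fun _ => 2) O) : (n : ℕ∞) ≤ srbd (widthAtMost 0) φ := by
  refine hh.le_srbd (cl := fun i => (L.getD i []).toFinset) (fun i v b => ?_) (events_lt_two L)
    fun i _ v hv => ?_
  · rw [mem_events, List.mem_toFinset, List.getD_eq_getElem?_getD]
    constructor
    · rintro ⟨c, hc, b', hb, he⟩
      obtain rfl : b' = b := by cases b <;> cases b' <;> simp_all
      rw [hc]; exact hb
    · intro hb
      cases hc : L[i]? with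
      | none => rw [hc] at hb; simp at hb
      | some c => rw [hc] at hb; exact ⟨c, rfl, b, hb, rfl⟩
  · obtain ⟨s, hs⟩ := hv
    obtain ⟨c, hc, -⟩ := mem_events.mp hs
    simp only [List.getD_eq_getElem?_getD, hc, Option.getD_some]
    exact h.mem (List.mem_of_getElem? hc)

theorem Lists.hard_of_wide (h : Lists L φ) (hp : Formula.Proper φ) {c : List Literal} (hc : c ∈ L) :
    ∃ O, Hard (events L) c.length (fun _ => 2) O := by
  obtain ⟨i, hi⟩ := List.mem_iff_getElem?.mp hc
  refine ⟨{i}, Hard.of_wide (events_lt_two L) (Clause.vars c.toFinset) (h.card_vars hp hc).ge ?_ ?_⟩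
  · intro v s s' hs hs'
    obtain ⟨d, hd, b, hb, rfl⟩ := mem_events.mp hs
    obtain ⟨d', hd', b', hb', rfl⟩ := mem_events.mp hs'
    rw [hi, Option.some.injEq] at hd hd'
    subst hd hd'
    rw [← List.mem_toFinset] at hb hb'
    have := hp _ (h.mem hc) v
    cases b <;> cases b' <;> simp_all
  · intro v hv
    obtain ⟨⟨v', b⟩, hb, rfl⟩ := Finset.mem_image.mp hv
    refine ⟨fun w s hs => ?_, ⟨b.toNat, mem_events.mpr
      ⟨c, hi, b, List.mem_toFinset.mp hb, rfl⟩⟩, rfl⟩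
    have := events_lt_two L _ hs
    simp only at this ⊢
    omega

theorem Lists.lt_srbd (h : Lists L φ) (hp : Formula.Proper φ) (hh : (∃ C ∈ L, k < C.length) ∨
    Hard (events L) (k + 1) (fun _ => 2) Set.univ) : (k : ℕ∞) < srbd (widthAtMost 0) φ := by
  obtain ⟨n, hn, O, hO⟩ : ∃ n, k < n ∧ ∃ O, Hard (events L) n (fun _ => 2) O := by
    rcases hh with ⟨c, hc, hk⟩ | hh
    · exact ⟨_, hk, h.hard_of_wide hp hc⟩
    · exact ⟨_, Nat.lt_succ_self k, _, hh⟩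
  exact lt_of_lt_of_le (Nat.cast_lt.mpr hn) (h.le_srbd hO)

/-- The constant `C` has to cover twice the time factor, as the size of the input plus one is at
most `2 * (n + 1)`, and the words. All values and row offsets are bounded by `B = 4 * ((k + 8) * (n
+ M + 1))`; the layout needs `32 * B` plus the input, which fits into `200 * (k + 8) * (n + M + 1)`,
and `2 ^ (k + 2)` is the number of repetitions. -/
theorem exists_solvesPermissive : ∃ C, SolvesPermissive mainProgram (srbd (widthAtMost 0))
    (fun φ k => 2 ^ 2 ^ (C * (k + 1)) * (Formula.length φ + 1))
    (fun φ k => 2 ^ 2 ^ (C * (k + 1)) * (Formula.length φ + Formula.maxVar φ + 1)) := by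
  obtain ⟨f, hf, hT⟩ := exists_timeBound_le
  have hw : DExp fun k => 200 * (k + 8) + 2 ^ (k + 2) := by
    refine DExp.add ((dexp_const 200).mul ((dexp_linear.add (dexp_const 7)).mono fun k => by omega))
      (dexp_two_pow 2 fun k => ?_)
    have := Nat.lt_two_pow_self (n := 2 * (k + 1))
    omega
  obtain ⟨C, hC⟩ := (hf.mul (dexp_const 2)).add hw
  refine ⟨C, fun φ k L hp hL => ?_⟩
  have hC := hC k
  beta_reduce at hC ⊢
  generalize 2 ^ 2 ^ (C * (k + 1)) = F at hC ⊢
  have hcard := Formula.card_le φ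
  have hlen := length_inputWords k L
  have hsize := inputSize_eq L
  rw [← hL.length_eq hp, hL.card] at hlen hsize
  have hword := fun v (hv : v ∈ inputWords k L) => hL.word_le hp hv
  have hvar := fun c hc l hl => hL.var_le (c := c) hc (l := l) hl
  set n := Formula.length φ
  set M := Formula.maxVar φ
  have hk1 : (k + 8) * 1 ≤ (k + 8) * (n + M + 1) := Nat.mul_le_mul_left _ (by omega)
  have hk2 : 8 * (n + M + 1) ≤ (k + 8) * (n + M + 1) := Nat.mul_le_mul_right _ (by omega)
  have hW : (200 * (k + 8) + 2 ^ (k + 2)) * (n + M + 1) ≤ F * (n + M + 1) :=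
    Nat.mul_le_mul_right _ (by omega)
  rw [add_mul, mul_assoc] at hW
  have hW2 : 2 ^ (k + 2) ≤ 2 ^ (k + 2) * (n + M + 1) := Nat.le_mul_of_pos_right _ (by omega)
  refine ⟨fun v hv => (hword v hv).trans (by omega), ?_⟩
  have hW3 : (inputWords k L).length + 32 * (4 * ((k + 8) * (n + M + 1))) + 32 ≤
      F * (n + M + 1) := by
    generalize (k + 8) * (n + M + 1) = Y at *
    generalize F * (n + M + 1) = Z at *
    have := Nat.zero_le (2 ^ (k + 2) * (n + M + 1))
    have := Nat.zero_le n
    have := Nat.zero_le M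
    linarith
  obtain ⟨s, t, x, ht, hres⟩ := exec_mainProgram (k := k) (B := 4 * ((k + 8) * (n + M + 1)))
    (W := F * (n + M + 1)) (M := M) (L := L) (by omega) hW3 (by
      have h1 : (inputWords k L).length + M + 1 ≤ 4 * (n + M + 1) := by omega
      calc _ ≤ (k + 8) * (4 * (n + M + 1)) := Nat.mul_le_mul (by omega) h1
        _ = _ := by ring) (fun v hv => (hword v hv).trans (by omega)) (by omega) hvar
  have htime : t ≤ F * (n + 1) := by
    refine ht.trans ((hT k _).trans ?_)
    have h1 : inputSize L + 1 ≤ 2 * (n + 1) := by omega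
    calc f k * (inputSize L + 1) ≤ f k * (2 * (n + 1)) := Nat.mul_le_mul_left _ h1
      _ = f k * 2 * (n + 1) := by ring
      _ ≤ _ := Nat.mul_le_mul_right _ (le_trans (Nat.le_add_right _ _) hC)
  rcases hres with ⟨h0, h⟩ | ⟨h0, h⟩ | ⟨h0, h⟩
  · exact ⟨s, t, .unsat, x, htime, h0, fun hs => h (hL.listSat_iff.mpr hs)⟩
  · exact ⟨s, t, .sat, x, htime, h0, hL.listSat_iff.mp h⟩
  · exact ⟨s, t, .exceeds, x, htime, h0, hL.lt_srbd hp h⟩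

theorem computable_bound (C : ℕ) : Computable fun k : ℕ => 2 ^ 2 ^ (C * (k + 1)) := by
  have hpow : Primrec₂ ((· ^ ·) : ℕ → ℕ → ℕ) := by
    refine Primrec₂.unpaired'.mp Nat.Primrec.pow
  refine Primrec.to_comp ?_
  exact hpow.comp (Primrec.const 2) (hpow.comp (Primrec.const 2)
    (Primrec.nat_mul.comp (Primrec.const C) Primrec.succ))

end RecBackdoor

theorem corollary5p11 :
    (∃ (P : RecBackdoor.Program) (g : ℕ → ℕ),
      (fun k : ℕ => (g k : ℝ)) =O[Filter.atTop] (fun k : ℕ => (k : ℝ)) ∧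
      RecBackdoor.SolvesPermissive P (RecBackdoor.srbd (RecBackdoor.widthAtMost 0))
        (fun φ k => 2 ^ 2 ^ g k * (RecBackdoor.Formula.length φ + 1))
        (fun φ k => 2 ^ 2 ^ g k *
          (RecBackdoor.Formula.length φ + RecBackdoor.Formula.maxVar φ + 1))) ∧
    RecBackdoor.PermissiveIsFPT (RecBackdoor.srbd (RecBackdoor.widthAtMost 0)) := by
  obtain ⟨C, hC⟩ := RecBackdoor.exists_solvesPermissive
  -- The same program serves both claims, with `c = 1` in the second. For `k ≥ 1` the exponent `C *
  -- (k + 1)` is at most `2 * C * k`.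
  refine ⟨⟨_, fun k => C * (k + 1), ?_, hC⟩,
    ⟨fun k => 2 ^ 2 ^ (C * (k + 1)), 1, _, RecBackdoor.computable_bound C, by simpa using hC⟩⟩
  refine Asymptotics.IsBigO.of_bound (2 * C) (Filter.eventually_atTop.mpr ⟨1, fun k hk => ?_⟩)
  have hk' : (1 : ℝ) ≤ k := by exact_mod_cast hk
  have hC0 : (0 : ℝ) ≤ C := Nat.cast_nonneg C
  rw [Real.norm_of_nonneg (Nat.cast_nonneg _), Real.norm_of_nonneg (Nat.cast_nonneg _)]
  push_cast
  nlinarith
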